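/- **Conventions.** In the *nonsymmetric case* "operad" means nonsymmetric operad in graded $\mathbb Z$-modules; in the *symmetric case* it means symmetric operad in graded vector spaces over a field $\mathbb K$ of characteristic zero. A dg operad is an operad with a square-zero derivation $d$ of (homological) degree $-1$. Operads are assumed to be non-zero (the identity operation is not $0$). *The curved operads.* $\mathrm{cA}_\infty$ is the nonsymmetric dg operad freely generated, as a graded operad, by operations $\mu_n$ ($n\ge 0$) of arity $n$ and degree $-1$, with $$d\mu_n=-\sum_{p+q+r=n}\mu_{p+1+r}\circ_{p+1}\mu_q .$$ $\mathrm{cL}_\infty$ is the symmetric dg operad freely generated, as a graded operad, by symmetric operations $\ell_n$ ($n\ge 0$) of arity $n$ and degree $-1$, with $$d\ell_n=-\sum_{p+q=n}\ \sum_{\sigma\ (q,p)\text{-shuffle}}(\ell_{p+1}\circ_1\ell_q)^{\sigma^{-1}} .$$ *The category $\mathrm{Curv}$.* For an operad $\mathrm P$ let $\mathrm P\vee[\kappa]$ be its coproduct with the free operad on one operation $\kappa$ of arity $0$ and degree $-1$, graded by the number of $\kappa$ (the weight). Objects of $\mathrm{Curv}$ are quadruples $(\mathrm Q,d,\kappa,\mathrm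 Q_0)$, where $(\mathrm Q,d)$ is a dg operad, $\mathrm Q_0\subset \mathrm Q$ is a suboperad of the underlying graded operad and $\kappa\in\mathrm Q\setminus\mathrm Q_0$ has arity $0$ and degree $-1$, such that (1) the natural morphism $\mathrm Q_0\vee[\kappa]\to\mathrm Q$ is an isomorphism; (2) for the resulting weight grading $\mathrm Q=\bigoplus_{k\ge0}\mathrm Q_k$ one has $d=d_0+d_1$ with $d_i(\mathrm Q_k)\subset\mathrm Q_{k+i}$; (3) $d_1\kappa=0$. Morphisms are the morphisms of dg operads that preserve $\kappa$ and map $\mathrm Q_0$ to $\mathrm Q_0$. In the nonsymmetric case this is $\mathrm{Curv}$, in the symmetric case $\mathrm{Curv}^\Sigma$. *Completed coproduct.* Let $\mathrm T$ be the dg operad freely generated by arity $0$ operations $\kappa$ of degree $-1$ and $\alpha$ of degree $0$, with $d_{\mathrm T}\alpha=\kappa$, $d_{\mathrm T}\kappa=0$. The coproduct $\mathrm P\vee\mathrm T$ of graded operads is bigraded by the numbers of $\kappa$ and of $\alpha$. Let $\mathrm P\,\hat\vee\,\mathrm T$ be its completion with respect to the number of $\alpha$, taken in each $\kappa$-weight: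 in each arity and degree it is the direct sum over the number of $\kappa$ of the product over the number of $\alpha$ of the bigraded pieces. It carries the differential $d_{\mathrm P}+d_{\mathrm T}$. Let $\mathrm P\,\hat\vee\,[\alpha]$ be its suboperad of elements without $\kappa$. **Statement.** (a) *Nonsymmetric case.* $c\mathcal A_\infty:=(\mathrm{cA}_\infty,d,\mu_0,\langle\mu_i\rangle_{i>0})$ is an initial object of $\mathrm{Curv}$. The resulting functor $\mathcal L:\mathrm{Curv}\to(\mathrm{cA}_\infty\downarrow\mathrm{dg\text{-}Op})$, which sends $(\mathrm Q,d,\kappa,\mathrm Q_0)$ to the dg operad $(\mathrm Q,d)$ with the morphism underlying the unique morphism from $c\mathcal A_\infty$, is left adjoint to the functor $\mathcal R$ given on objects by $$\mathrm P\mapsto\Bigl(\mathrm P\,\hat\vee\,\mathrm T,\ d_{\mathrm P}+d_{\mathrm T},\ \kappa+\sum_{k\ge0}\mu_k(\alpha,\dots,\alpha),\ \mathrm P\,\hat\vee\,[\alpha]\Bigr)$$ (where $\mu_k$ also denotes its image in $\mathrm P$; these quadruples do lie in $\mathrm{Curv}$) and on morphisms by $f\mapsto f\vee 1_{\mathrm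 T}$, with counit $1_{\mathrm P}\vee0:\mathrm P\,\hat\vee\,\mathrm T\to\mathrm P$. The unit of this adjunction at $c\mathcal A_\infty$ is, as a morphism of dg operads, the morphism $\eta:\mathrm{cA}_\infty\to\mathrm{cA}_\infty\,\hat\vee\,\mathrm T$ with $$\mu_0\mapsto\kappa+\sum_{k\ge0}\mu_k(\alpha,\dots,\alpha),\qquad \mu_n\mapsto\sum_{i_1,\dots,i_{n+1}\ge0}\mu_{n+\sum_k i_k}(\alpha^{i_1},-,\alpha^{i_2},-,\dots,-,\alpha^{i_{n+1}})\quad(n\ge1).$$ (b) *Symmetric case.* For every field $\mathbb K$ of characteristic zero, $c\mathcal L_\infty:=(\mathrm{cL}_\infty,d,\ell_0,\langle\ell_i\rangle_{i>0})$ is an initial object of $\mathrm{Curv}^\Sigma$. The resulting functor $\mathcal L^\Sigma:\mathrm{Curv}^\Sigma\to(\mathrm{cL}_\infty\downarrow\mathrm{dg\text{-}Op})$ is left adjoint to the functor $\mathcal R^\Sigma$ given on objects by $$\mathrm P\mapsto\Bigl(\mathrm P\,\hat\vee\,\mathrm T,\ d_{\mathrm P}+d_{\mathrm T},\ \kappa+\sum_{k\ge0}\tfrac1{k!}\ell_k(\alpha,\dots,\alpha),\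 \mathrm P\,\hat\vee\,[\alpha]\Bigr)$$ and on morphisms by $f\mapsto f\vee 1_{\mathrm T}$, with counit $1_{\mathrm P}\vee0$. The unit of this adjunction at $c\mathcal L_\infty$ is, as a morphism of dg operads, the morphism $\eta:\mathrm{cL}_\infty\to\mathrm{cL}_\infty\,\hat\vee\,\mathrm T$ with $$\ell_0\mapsto\kappa+\sum_{k\ge0}\tfrac1{k!}\ell_k(\alpha^k),\qquad \ell_n\mapsto\sum_{k\ge0}\tfrac1{k!}\ell_{k+n}(\alpha^k,-)\quad(n\ge1).$$ -/

import Mathlib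

open CategoryTheory

universe v w w'

namespace TwistOperad

noncomputable section

/-- The Koszul sign `(-1) ^ n`, as a scalar. -/
def sgn (R : Type v) [CommRing R] (n : ℤ) : R := ((Int.negOnePow n : ℤ) : R)

theorem sgn_zero (R : Type v) [CommRing R] : sgn R 0 = 1 := by simp [sgn]

theorem sgn_add (R : Type v) [CommRing R] (m n : ℤ) : sgn R (m + n) = sgn R m * sgn R n := by
  simp [sgn, Int.negOnePow_add]

theorem sgn_congr (R : Type v) [CommRing R] {m n : ℤ} (h : ∃ k, m = n + 2 * k) :
    sgn R m = sgn R n := by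
  obtain ⟨k, rfl⟩ := h
  simp [sgn, Int.negOnePow_add, Int.negOnePow_two_mul]

/-- The place among the inputs of `p ∘ₐ q` of the `j`-th input of `p` (`j ≠ a`), where `q` has
arity `n` (places are counted from `0`). -/
def outerPlace (a n j : ℕ) : ℕ := if j < a then j else j + n - 1

/-- `ρ` is the block permutation of the inputs of a partial composition at the place `a`
that is induced by `σ` on the inputs of the outer and by `τ` on those of the inner operation. -/
def IsBlockPerm {m n l : ℕ} (a : Fin m) (σ : Equiv.Perm (Fin m)) (τ : Equiv.Perm (Fin n))
    (ρ : Equiv.Perm (Fin l)) : Prop :=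
  (∀ (j : Fin m) (x : Fin l), j ≠ a → (x : ℕ) = outerPlace a n j →
    (ρ x : ℕ) = outerPlace (σ a) n (σ j)) ∧
  (∀ (k : Fin n) (x : Fin l), (x : ℕ) = a + k → (ρ x : ℕ) = σ a + τ k)

/-- Operads in `ι`-graded `R`-modules, presented by partial compositions; `deg` is the homological
degree that enters the Koszul signs.  If `S` holds these are the symmetric operads (with right
actions of the symmetric groups); if `S` is false then `act` and its laws are void, and these are
the nonsymmetric operads.  Arities and degrees of a composite are tied by equations, so
that no transport between equal arities or degrees is needed. -/
structure Op (R : Type v) [CommRing R] (S : Prop) (ι : Type) [AddCommMonoid ι]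
    (deg : ι →+ ℤ) where
  X : ℕ → ι → Type w
  [grp : ∀ n i, AddCommGroup (X n i)]
  [mod : ∀ n i, Module R (X n i)]
  one : ∀ {i : ι}, i = 0 → X 1 i
  comp : ∀ {m n l : ℕ} {i j k : ι} (_ : Fin m) (_ : l + 1 = m + n) (_ : i + j = k),
    X m i →ₗ[R] X n j →ₗ[R] X l k
  act : ∀ {n : ℕ} {i : ι} (_ : S) (_ : Equiv.Perm (Fin n)), X n i →ₗ[R] X n i
  one_comp : ∀ {n : ℕ} {i e : ι} (a : Fin 1) (hl : n + 1 = 1 + n) (he : e = 0) (hk : e + i = i)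
    (p : X n i), comp a hl hk (one he) p = p
  comp_one : ∀ {n : ℕ} {i e : ι} (a : Fin n) (hl : n + 1 = n + 1) (he : e = 0) (hk : i + e = i)
    (p : X n i), comp a hl hk p (one he) = p
  comp_seq : ∀ {m n r l l' t : ℕ} {i j k ij jk ijk : ι} (a : Fin m) (b : Fin n) (c : Fin l)
    (_ : (c : ℕ) = a + b) (h1 : l + 1 = m + n) (h2 : t + 1 = l + r) (h3 : l' + 1 = n + r)
    (h4 : t + 1 = m + l') (k1 : i + j = ij) (k2 : ij + k = ijk) (k3 : j + k = jk)
    (k4 : i + jk = ijk) (p : X m i) (q : X n j) (s : X r k),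
    comp c h2 k2 (comp a h1 k1 p q) s = comp a h4 k4 p (comp b h3 k3 q s)
  comp_par : ∀ {m n r l l' t : ℕ} {i j k ij ik ijk : ι} (a b : Fin m) (c : Fin l) (a' : Fin l')
    (_ : a < b) (_ : (c : ℕ) + 1 = b + n) (_ : (a' : ℕ) = a)
    (h1 : l + 1 = m + n) (h2 : t + 1 = l + r) (h3 : l' + 1 = m + r) (h4 : t + 1 = l' + n)
    (k1 : i + j = ij) (k2 : ij + k = ijk) (k3 : i + k = ik) (k4 : ik + j = ijk)
    (p : X m i) (q : X n j) (s : X r k),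
    comp c h2 k2 (comp a h1 k1 p q) s =
      sgn R (deg j * deg k) • comp a' h4 k4 (comp b h3 k3 p s) q
  act_one : ∀ {n : ℕ} {i : ι} (hS : S) (p : X n i), act hS 1 p = p
  act_mul : ∀ {n : ℕ} {i : ι} (hS : S) (σ τ : Equiv.Perm (Fin n)) (p : X n i),
    act hS τ (act hS σ p) = act hS (σ * τ) p
  comp_act : ∀ {m n l : ℕ} {i j k : ι} (hS : S) (a : Fin m) (hl : l + 1 = m + n) (hk : i + j = k)
    (σ : Equiv.Perm (Fin m)) (τ : Equiv.Perm (Fin n)) (ρ : Equiv.Perm (Fin l))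
    (_ : IsBlockPerm a σ τ ρ) (p : X m i) (q : X n j),
    comp a hl hk (act hS σ p) (act hS τ q) = act hS ρ (comp (σ a) hl hk p q)

attribute [instance] Op.grp Op.mod

section Presented

variable (R : Type v) [CommRing R] (S : Prop) {ι : Type} [AddCommMonoid ι] (deg : ι →+ ℤ)

/-- Formal operadic expressions in generators `G n i` of arity `n` and degree `i`. -/
inductive Tm (G : ℕ → ι → Type w) : ℕ → ι → Type (max v w)
  | gen {n : ℕ} {i : ι} (g : G n i) : Tm G n i
  | one {i : ι} (h : i = 0) : Tm G 1 i
  | comp {m n l : ℕ} {i j k : ι} (a : Fin m) (hl : l + 1 = m + n) (hk : i + j = k)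
      (p : Tm G m i) (q : Tm G n j) : Tm G l k
  | act {n : ℕ} {i : ι} (hS : S) (σ : Equiv.Perm (Fin n)) (p : Tm G n i) : Tm G n i
  | zero {n : ℕ} {i : ι} : Tm G n i
  | add {n : ℕ} {i : ι} (p q : Tm G n i) : Tm G n i
  | smul {n : ℕ} {i : ι} (r : R) (p : Tm G n i) : Tm G n i

variable {R S} {G : ℕ → ι → Type w}

/-- The congruence on formal expressions generated by the laws of an operad in graded modules
and by the relations `E`. -/
inductive Rel (E : ∀ (n : ℕ) (i : ι), Tm R S G n i → Tm R S G n i → Prop) :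
    ∀ {n : ℕ} {i : ι}, Tm R S G n i → Tm R S G n i → Prop
  | of {n : ℕ} {i : ι} {p q : Tm R S G n i} : E n i p q → Rel E p q
  | refl {n : ℕ} {i : ι} (p : Tm R S G n i) : Rel E p p
  | symm {n : ℕ} {i : ι} {p q : Tm R S G n i} : Rel E p q → Rel E q p
  | trans {n : ℕ} {i : ι} {p q s : Tm R S G n i} : Rel E p q → Rel E q s → Rel E p s
  | comp_congr {m n l : ℕ} {i j k : ι} (a : Fin m) (hl : l + 1 = m + n) (hk : i + j = k)
      {p p' : Tm R S G m i} {q q' : Tm R S G n j} : Rel E p p' → Rel E q q' →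
      Rel E (.comp a hl hk p q) (.comp a hl hk p' q')
  | act_congr {n : ℕ} {i : ι} (hS : S) (σ : Equiv.Perm (Fin n)) {p q : Tm R S G n i} :
      Rel E p q → Rel E (.act hS σ p) (.act hS σ q)
  | add_congr {n : ℕ} {i : ι} {p p' q q' : Tm R S G n i} : Rel E p p' → Rel E q q' →
      Rel E (.add p q) (.add p' q')
  | smul_congr {n : ℕ} {i : ι} (r : R) {p q : Tm R S G n i} :
      Rel E p q → Rel E (.smul r p) (.smul r q)
  | add_assoc {n : ℕ} {i : ι} (p q s : Tm R S G n i) :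
      Rel E (.add (.add p q) s) (.add p (.add q s))
  | add_comm {n : ℕ} {i : ι} (p q : Tm R S G n i) : Rel E (.add p q) (.add q p)
  | zero_add {n : ℕ} {i : ι} (p : Tm R S G n i) : Rel E (.add .zero p) p
  | zero_smul {n : ℕ} {i : ι} (p : Tm R S G n i) : Rel E (.smul 0 p) .zero
  | one_smul {n : ℕ} {i : ι} (p : Tm R S G n i) : Rel E (.smul 1 p) p
  | mul_smul {n : ℕ} {i : ι} (r s : R) (p : Tm R S G n i) :
      Rel E (.smul (r * s) p) (.smul r (.smul s p))
  | add_smul {n : ℕ} {i : ι} (r s : R) (p : Tm R S G n i) :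
      Rel E (.smul (r + s) p) (.add (.smul r p) (.smul s p))
  | smul_add {n : ℕ} {i : ι} (r : R) (p q : Tm R S G n i) :
      Rel E (.smul r (.add p q)) (.add (.smul r p) (.smul r q))
  | add_comp {m n l : ℕ} {i j k : ι} (a : Fin m) (hl : l + 1 = m + n) (hk : i + j = k)
      (p p' : Tm R S G m i) (q : Tm R S G n j) :
      Rel E (.comp a hl hk (.add p p') q) (.add (.comp a hl hk p q) (.comp a hl hk p' q))
  | comp_add {m n l : ℕ} {i j k : ι} (a : Fin m) (hl : l + 1 = m + n) (hk : i + j = k)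
      (p : Tm R S G m i) (q q' : Tm R S G n j) :
      Rel E (.comp a hl hk p (.add q q')) (.add (.comp a hl hk p q) (.comp a hl hk p q'))
  | smul_comp {m n l : ℕ} {i j k : ι} (a : Fin m) (hl : l + 1 = m + n) (hk : i + j = k)
      (r : R) (p : Tm R S G m i) (q : Tm R S G n j) :
      Rel E (.comp a hl hk (.smul r p) q) (.smul r (.comp a hl hk p q))
  | comp_smul {m n l : ℕ} {i j k : ι} (a : Fin m) (hl : l + 1 = m + n) (hk : i + j = k)
      (r : R) (p : Tm R S G m i) (q : Tm R S G n j) :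
      Rel E (.comp a hl hk p (.smul r q)) (.smul r (.comp a hl hk p q))
  | act_add {n : ℕ} {i : ι} (hS : S) (σ : Equiv.Perm (Fin n)) (p q : Tm R S G n i) :
      Rel E (.act hS σ (.add p q)) (.add (.act hS σ p) (.act hS σ q))
  | act_smul {n : ℕ} {i : ι} (hS : S) (σ : Equiv.Perm (Fin n)) (r : R) (p : Tm R S G n i) :
      Rel E (.act hS σ (.smul r p)) (.smul r (.act hS σ p))
  | one_comp {n : ℕ} {i e : ι} (a : Fin 1) (hl : n + 1 = 1 + n) (he : e = 0) (hk : e + i = i)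
      (p : Tm R S G n i) : Rel E (.comp a hl hk (.one he) p) p
  | comp_one {n : ℕ} {i e : ι} (a : Fin n) (hl : n + 1 = n + 1) (he : e = 0) (hk : i + e = i)
      (p : Tm R S G n i) : Rel E (.comp a hl hk p (.one he)) p
  | comp_seq {m n r l l' t : ℕ} {i j k ij jk ijk : ι} (a : Fin m) (b : Fin n) (c : Fin l)
      (hc : (c : ℕ) = a + b) (h1 : l + 1 = m + n) (h2 : t + 1 = l + r) (h3 : l' + 1 = n + r)
      (h4 : t + 1 = m + l') (k1 : i + j = ij) (k2 : ij + k = ijk) (k3 : j + k = jk)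
      (k4 : i + jk = ijk) (p : Tm R S G m i) (q : Tm R S G n j) (s : Tm R S G r k) :
      Rel E (.comp c h2 k2 (.comp a h1 k1 p q) s) (.comp a h4 k4 p (.comp b h3 k3 q s))
  | comp_par {m n r l l' t : ℕ} {i j k ij ik ijk : ι} (a b : Fin m) (c : Fin l) (a' : Fin l')
      (hab : a < b) (hc : (c : ℕ) + 1 = b + n) (ha : (a' : ℕ) = a)
      (h1 : l + 1 = m + n) (h2 : t + 1 = l + r) (h3 : l' + 1 = m + r) (h4 : t + 1 = l' + n)
      (k1 : i + j = ij) (k2 : ij + k = ijk) (k3 : i + k = ik) (k4 : ik + j = ijk)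
      (p : Tm R S G m i) (q : Tm R S G n j) (s : Tm R S G r k) :
      Rel E (.comp c h2 k2 (.comp a h1 k1 p q) s)
        (.smul (sgn R (deg j * deg k)) (.comp a' h4 k4 (.comp b h3 k3 p s) q))
  | act_one {n : ℕ} {i : ι} (hS : S) (p : Tm R S G n i) : Rel E (.act hS 1 p) p
  | act_mul {n : ℕ} {i : ι} (hS : S) (σ τ : Equiv.Perm (Fin n)) (p : Tm R S G n i) :
      Rel E (.act hS τ (.act hS σ p)) (.act hS (σ * τ) p)
  | comp_act {m n l : ℕ} {i j k : ι} (hS : S) (a : Fin m) (hl : l + 1 = m + n) (hk : i + j = k)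
      (σ : Equiv.Perm (Fin m)) (τ : Equiv.Perm (Fin n)) (ρ : Equiv.Perm (Fin l))
      (hρ : IsBlockPerm a σ τ ρ) (p : Tm R S G m i) (q : Tm R S G n j) :
      Rel E (.comp a hl hk (.act hS σ p) (.act hS τ q)) (.act hS ρ (.comp (σ a) hl hk p q))

variable (E : ∀ (n : ℕ) (i : ι), Tm R S G n i → Tm R S G n i → Prop)

/-- Formal expressions modulo the relations. -/
def Pres (n : ℕ) (i : ι) : Type (max v w) :=
  Quot (Rel deg E (n := n) (i := i))

namespace Pres

variable {deg E}

/-- The class of a formal expression. -/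
def mk {n : ℕ} {i : ι} (p : Tm R S G n i) : Pres deg E n i := Quot.mk _ p

instance (n : ℕ) (i : ι) : Add (Pres deg E n i) where
  add := Quot.map₂ Tm.add (fun p _ _ h => Rel.add_congr (.refl p) h)
    (fun _ _ q h => Rel.add_congr h (.refl q))

instance (n : ℕ) (i : ι) : Zero (Pres deg E n i) where
  zero := mk .zero

instance (n : ℕ) (i : ι) : Neg (Pres deg E n i) where
  neg := Quot.map (Tm.smul (-1)) fun _ _ h => Rel.smul_congr _ h

instance (n : ℕ) (i : ι) : AddCommGroup (Pres deg E n i) where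
  nsmul := nsmulRec
  zsmul := zsmulRec
  add_assoc := by
    rintro ⟨p⟩ ⟨q⟩ ⟨s⟩
    exact Quot.sound (.add_assoc p q s)
  add_comm := by
    rintro ⟨p⟩ ⟨q⟩
    exact Quot.sound (.add_comm p q)
  zero_add := by
    rintro ⟨p⟩
    exact Quot.sound (.zero_add p)
  add_zero := by
    rintro ⟨p⟩
    exact Quot.sound ((Rel.add_comm _ _).trans (.zero_add p))
  neg_add_cancel := by
    rintro ⟨p⟩
    refine Quot.sound (((Rel.add_congr (.refl _) (Rel.one_smul p).symm).trans
      (Rel.add_smul (-1) 1 p).symm).trans ?_)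
    rw [neg_add_cancel]
    exact .zero_smul p

instance (n : ℕ) (i : ι) : Module R (Pres deg E n i) where
  smul r := Quot.map (Tm.smul r) fun _ _ h => Rel.smul_congr _ h
  one_smul := by
    rintro ⟨p⟩
    exact Quot.sound (.one_smul p)
  mul_smul := by
    rintro r s ⟨p⟩
    exact Quot.sound (.mul_smul r s p)
  smul_zero := by
    intro r
    refine Quot.sound ((Rel.smul_congr r (Rel.zero_smul .zero).symm).trans
      ((Rel.mul_smul r 0 .zero).symm.trans ?_))
    rw [mul_zero]
    exact .zero_smul _
  smul_add := by
    rintro r ⟨p⟩ ⟨q⟩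
    exact Quot.sound (.smul_add r p q)
  add_smul := by
    rintro r s ⟨p⟩
    exact Quot.sound (.add_smul r s p)
  zero_smul := by
    rintro ⟨p⟩
    exact Quot.sound (.zero_smul p)

end Pres

/-- The operad presented by the generators `G` and the relations `E`. -/
def presOp : Op.{v, max v w} R S ι deg where
  X := Pres deg E
  one h := Pres.mk (.one h)
  comp a hl hk := LinearMap.mk₂ R
    (Quot.map₂ (Tm.comp a hl hk) (fun p _ _ h => Rel.comp_congr _ _ _ (.refl p) h)
      (fun _ _ q h => Rel.comp_congr _ _ _ h (.refl q)))
    (by rintro ⟨p⟩ ⟨p'⟩ ⟨q⟩; exact Quot.sound (.add_comp a hl hk p p' q))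
    (by rintro r ⟨p⟩ ⟨q⟩; exact Quot.sound (.smul_comp a hl hk r p q))
    (by rintro ⟨p⟩ ⟨q⟩ ⟨q'⟩; exact Quot.sound (.comp_add a hl hk p q q'))
    (by rintro r ⟨p⟩ ⟨q⟩; exact Quot.sound (.comp_smul a hl hk r p q))
  act hS σ :=
    { toFun := Quot.map (Tm.act hS σ) fun _ _ h => Rel.act_congr hS σ h
      map_add' := by rintro ⟨p⟩ ⟨q⟩; exact Quot.sound (.act_add hS σ p q)
      map_smul' := by rintro r ⟨p⟩; exact Quot.sound (.act_smul hS σ r p) }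
  one_comp := by
    rintro n i e a hl he hk ⟨p⟩
    exact Quot.sound (.one_comp a hl he hk p)
  comp_one := by
    rintro n i e a hl he hk ⟨p⟩
    exact Quot.sound (.comp_one a hl he hk p)
  comp_seq := by
    rintro m n r l l' t i j k ij jk ijk a b c hc h1 h2 h3 h4 k1 k2 k3 k4 ⟨p⟩ ⟨q⟩ ⟨s⟩
    exact Quot.sound (.comp_seq a b c hc h1 h2 h3 h4 k1 k2 k3 k4 p q s)
  comp_par := by
    rintro m n r l l' t i j k ij jk ijk a b c a' hab hc ha h1 h2 h3 h4 k1 k2 k3 k4 ⟨p⟩ ⟨q⟩ ⟨s⟩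
    exact Quot.sound (.comp_par a b c a' hab hc ha h1 h2 h3 h4 k1 k2 k3 k4 p q s)
  act_one := by
    rintro n i hS ⟨p⟩
    exact Quot.sound (.act_one hS p)
  act_mul := by
    rintro n i hS σ τ ⟨p⟩
    exact Quot.sound (.act_mul hS σ τ p)
  comp_act := by
    rintro m n l i j k hS a hl hk σ τ ρ hρ ⟨p⟩ ⟨q⟩
    exact Quot.sound (.comp_act hS a hl hk σ τ ρ hρ p q)

namespace Pres

variable {deg E}

/-- The class of a formal expression, as an element of the presented operad. -/
def cl {n : ℕ} {i : ι} (p : Tm R S G n i) : (presOp deg E).X n i := mk p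

theorem cl_eq {n : ℕ} {i : ι} {p q : Tm R S G n i} (h : Rel deg E p q) :
    (cl p : (presOp deg E).X n i) = cl q := Quot.sound h

theorem cl_one {i : ι} (h : i = 0) : (cl (.one h) : (presOp deg E).X 1 i) = (presOp deg E).one h :=
  rfl

theorem cl_comp {m n l : ℕ} {i j k : ι} (a : Fin m) (hl : l + 1 = m + n) (hk : i + j = k)
    (p : Tm R S G m i) (q : Tm R S G n j) :
    (cl (.comp a hl hk p q) : (presOp deg E).X l k) =
      (presOp deg E).comp a hl hk (cl p) (cl q) := rfl

theorem cl_act {n : ℕ} {i : ι} (hS : S) (σ : Equiv.Perm (Fin n)) (p : Tm R S G n i) :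
    (cl (.act hS σ p) : (presOp deg E).X n i) = (presOp deg E).act hS σ (cl p) := rfl

theorem cl_add {n : ℕ} {i : ι} (p q : Tm R S G n i) :
    (cl (.add p q) : (presOp deg E).X n i) = cl p + cl q := rfl

theorem cl_smul {n : ℕ} {i : ι} (r : R) (p : Tm R S G n i) :
    (cl (.smul r p) : (presOp deg E).X n i) = r • cl p := rfl

theorem cl_zero {n : ℕ} {i : ι} : (cl (.zero) : (presOp deg E).X n i) = 0 := rfl

theorem cl_ind {n : ℕ} {i : ι} {C : (presOp deg E).X n i → Prop} (h : ∀ p, C (cl p)) (x) : C x :=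
  Quot.ind h x

/-! Evaluation of formal expressions in an operad, and derivations on a presented operad. -/

section Eval

variable {ι' : Type} [AddCommMonoid ι'] {deg' : ι' →+ ℤ} (φ : ι →+ ι') (M : Op.{v, w'} R S ι' deg')
  (f : ∀ (n : ℕ) (i : ι), G n i → M.X n (φ i))

/-- The value of a formal expression in `M`, where `f` gives the values of the generators and
`φ` changes the grading. -/
def evalTm : ∀ {n : ℕ} {i : ι}, Tm R S G n i → M.X n (φ i)
  | _, _, .gen g => f _ _ g
  | _, _, .one h => M.one (by rw [h, map_zero])
  | _, _, .comp a hl hk p q => M.comp a hl (by rw [← hk, map_add]) (evalTm p) (evalTm q)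
  | _, _, .act hS σ p => M.act hS σ (evalTm p)
  | _, _, .zero => 0
  | _, _, .add p q => evalTm p + evalTm q
  | _, _, .smul r p => r • evalTm p

theorem evalTm_rel (hφ : ∀ i, deg' (φ i) = deg i)
    (hE : ∀ (n : ℕ) (i : ι) (p q : Tm R S G n i), E n i p q → evalTm φ M f p = evalTm φ M f q)
    {n : ℕ} {i : ι} {p q : Tm R S G n i} (h : Rel deg E p q) :
    evalTm φ M f p = evalTm φ M f q := by
  induction h with
  | of h => exact hE _ _ _ _ h
  | refl => rfl
  | symm _ ih => exact ih.symm
  | trans _ _ ih1 ih2 => exact ih1.trans ih2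
  | comp_congr a hl hk _ _ ih1 ih2 => simp only [evalTm, ih1, ih2]
  | act_congr hS σ _ ih => simp only [evalTm, ih]
  | add_congr _ _ ih1 ih2 => simp only [evalTm, ih1, ih2]
  | smul_congr r _ ih => simp only [evalTm, ih]
  | add_assoc => simp only [evalTm]; abel
  | add_comm => simp only [evalTm]; abel
  | zero_add => simp only [evalTm, _root_.zero_add]
  | zero_smul => simp only [evalTm, _root_.zero_smul]
  | one_smul => simp only [evalTm, _root_.one_smul]
  | mul_smul => simp only [evalTm, SemigroupAction.mul_smul]
  | add_smul => simp only [evalTm, _root_.add_smul]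
  | smul_add => simp only [evalTm, _root_.smul_add]
  | add_comp => simp only [evalTm, map_add, LinearMap.add_apply]
  | comp_add => simp only [evalTm, map_add]
  | smul_comp => simp only [evalTm, map_smul, LinearMap.smul_apply]
  | comp_smul => simp only [evalTm, map_smul]
  | act_add => simp only [evalTm, map_add]
  | act_smul => simp only [evalTm, map_smul]
  | one_comp => simp only [evalTm]; exact M.one_comp _ _ _ _ _
  | comp_one => simp only [evalTm]; exact M.comp_one _ _ _ _ _
  | comp_seq a b c hc => simp only [evalTm]; exact M.comp_seq a b c hc _ _ _ _ _ _ _ _ _ _ _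
  | comp_par a b c a' hab hc ha =>
    simp only [evalTm, ← hφ]
    exact M.comp_par a b c a' hab hc ha _ _ _ _ _ _ _ _ _ _ _
  | act_one => simp only [evalTm]; exact M.act_one _ _
  | act_mul => simp only [evalTm]; exact M.act_mul _ _ _ _
  | comp_act hS a hl hk σ τ ρ hρ => simp only [evalTm]; exact M.comp_act hS a hl _ σ τ ρ hρ _ _

/-- The map out of a presented operad with given values on generators. -/
def eval (hφ : ∀ i, deg' (φ i) = deg i)
    (hE : ∀ (n : ℕ) (i : ι) (p q : Tm R S G n i), E n i p q → evalTm φ M f p = evalTm φ M f q)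
    {n : ℕ} {i : ι} : (presOp deg E).X n i →ₗ[R] M.X n (φ i) where
  toFun := Quot.lift (evalTm φ M f) fun _ _ h => evalTm_rel φ M f hφ hE h
  map_add' := by rintro ⟨p⟩ ⟨q⟩; rfl
  map_smul' := by rintro r ⟨p⟩; rfl

end Eval

theorem sgn_of_zero (deg : ι →+ ℤ) {e : ι} (he : e = 0) : sgn R (deg e) = 1 := by
  rw [he, map_zero, sgn_zero]

section Der

variable (δ : ι)
  (D : ∀ (n : ℕ) (i j : ι), i + δ = j → G n i → (presOp deg E).X n j)

/-- The value on a formal expression of the derivation of degree `δ` (of odd homological degree)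
that has the values `D` on generators. -/
def derTm : ∀ {n : ℕ} {i j : ι}, i + δ = j → Tm R S G n i → (presOp deg E).X n j
  | _, _, _, h, .gen g => D _ _ _ h g
  | _, _, _, _, .one _ => 0
  | _, _, _, h, .comp (i := i) a hl hk p q =>
      (presOp deg E).comp a hl (by rw [← h, ← hk, add_right_comm]) (derTm rfl p) (cl q) +
      sgn R (deg i) •
        (presOp deg E).comp a hl (by rw [← h, ← hk, add_assoc]) (cl p) (derTm rfl q)
  | _, _, _, h, .act hS σ p => (presOp deg E).act hS σ (derTm h p)
  | _, _, _, _, .zero => 0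
  | _, _, _, h, .add p q => derTm h p + derTm h q
  | _, _, _, h, .smul r p => r • derTm h p

/-- Compatibility with the given relations is all that a derivation needs. -/
theorem derTm_rel (hδ : deg δ = -1)
    (hE : ∀ (n : ℕ) (i j : ι) (h : i + δ = j) (p q : Tm R S G n i), E n i p q →
      derTm δ D h p = derTm δ D h q)
    {n : ℕ} {i : ι} {p q : Tm R S G n i} (h : Rel deg E p q) :
    ∀ {j : ι} (hj : i + δ = j), derTm δ D hj p = derTm δ D hj q := by
  induction h with
  | of h => intro j hj; exact hE _ _ _ hj _ _ h
  | refl => intro j hj; rfl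
  | symm _ ih => intro j hj; exact (ih hj).symm
  | trans _ _ ih1 ih2 => intro j hj; exact (ih1 hj).trans (ih2 hj)
  | comp_congr a hl hk h1 h2 ih1 ih2 =>
    intro j hj; simp only [derTm, ih1, ih2, cl_eq h1, cl_eq h2]
  | act_congr hS σ _ ih => intro j hj; simp only [derTm, ih]
  | add_congr _ _ ih1 ih2 => intro j hj; simp only [derTm, ih1, ih2]
  | smul_congr r _ ih => intro j hj; simp only [derTm, ih]
  | add_assoc => intro j hj; simp only [derTm]; abel
  | add_comm => intro j hj; simp only [derTm]; abel
  | zero_add => intro j hj; simp only [derTm, _root_.zero_add]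
  | zero_smul => intro j hj; simp only [derTm, _root_.zero_smul]
  | one_smul => intro j hj; simp only [derTm, _root_.one_smul]
  | mul_smul => intro j hj; simp only [derTm, SemigroupAction.mul_smul]
  | add_smul => intro j hj; simp only [derTm, _root_.add_smul]
  | smul_add => intro j hj; simp only [derTm, _root_.smul_add]
  | add_comp =>
    intro j hj
    simp only [derTm, cl_add, map_add, LinearMap.add_apply, _root_.smul_add]; abel
  | comp_add =>
    intro j hj
    simp only [derTm, cl_add, map_add, _root_.smul_add]; abel
  | smul_comp a hl hk r =>
    intro j hj
    simp only [derTm, cl_smul, map_smul, LinearMap.smul_apply, _root_.smul_add, smul_comm r]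
  | comp_smul a hl hk r =>
    intro j hj
    simp only [derTm, cl_smul, map_smul, _root_.smul_add, smul_comm r]
  | act_add => intro j hj; simp only [derTm, map_add]
  | act_smul => intro j hj; simp only [derTm, map_smul]
  | one_comp a hl he hk p =>
    intro j hj
    subst hj
    simp only [derTm, cl_one, map_zero, LinearMap.zero_apply, _root_.zero_add, sgn_of_zero deg he,
      _root_.one_smul]
    exact (presOp deg E).one_comp _ _ _ _ _
  | comp_one a hl he hk p =>
    intro j hj
    subst hj he
    simp only [derTm, cl_one, map_zero, smul_zero, _root_.add_zero]
    have h : ∀ (y : ι) (hy : y = _) (h' : y + 0 = _),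
        ((presOp deg E).comp a hl h') (derTm δ D hy.symm p) ((presOp deg E).one rfl) =
          derTm δ D rfl p := by
      intro y hy h'
      subst hy
      exact (presOp deg E).comp_one _ _ _ _ _
    exact h _ rfl _
  | comp_seq a b c hc h1 h2 h3 h4 k1 k2 k3 k4 =>
    intro j hj
    simp only [derTm, cl_comp, map_add, map_smul, LinearMap.add_apply, LinearMap.smul_apply,
      _root_.smul_add, smul_smul, ← k1, sgn_add]
    rw [← _root_.add_assoc]
    congr 1
    · congr 1
      · exact (presOp deg E).comp_seq a b c hc _ _ _ _ _ _ _ _ _ _ _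
      · congr 1
        exact (presOp deg E).comp_seq a b c hc _ _ _ _ _ _ _ _ _ _ _
    · congr 1
      exact (presOp deg E).comp_seq a b c hc _ _ _ _ _ _ _ _ _ _ _
  | @comp_par m n r l l' t i j k ij ik ijk a b c a' hab hc ha h1 h2 h3 h4 k1 k2 k3 k4 p q s =>
    intro x hx
    have e1 : sgn R (deg i) * sgn R (deg (j + δ) * deg k) =
        sgn R (deg j * deg k) * sgn R (deg ik) := by
      rw [← sgn_add, ← sgn_add, ← k3, map_add, map_add, hδ]
      apply sgn_congr
      exact ⟨-deg k, by ring⟩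
    have e2 : sgn R (deg ij) * sgn R (deg j * deg (k + δ)) =
        sgn R (deg j * deg k) * sgn R (deg i) := by
      rw [← sgn_add, ← sgn_add, ← k1, map_add, map_add, hδ]
      apply sgn_congr
      exact ⟨0, by ring⟩
    simp only [derTm, cl_comp, map_add, map_smul, LinearMap.add_apply, LinearMap.smul_apply,
      _root_.smul_add, smul_smul]
    rw [(presOp deg E).comp_par a b c a' hab hc ha h1 h2 h3 h4 _ _
        (show (i + δ) + k = ik + δ by rw [← k3, _root_.add_right_comm]) (by rw [← hx, ← k4, ← k3]; abel) (derTm δ D rfl p) (cl q) (cl s),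
      (presOp deg E).comp_par a b c a' hab hc ha h1 h2 h3 h4 _ _
        k3 (by rw [← hx, ← k4]; abel) (cl p) (derTm δ D rfl q) (cl s),
      (presOp deg E).comp_par a b c a' hab hc ha h1 h2 h3 h4 _ _
        (show i + (k + δ) = ik + δ by rw [← k3, _root_.add_assoc]) (by rw [← hx, ← k4, ← k3]; abel) (cl p) (cl q)
        (derTm δ D rfl s), smul_smul, smul_smul, e1, e2]
    abel
  | act_one => intro j hj; simp only [derTm]; exact (presOp deg E).act_one _ _
  | act_mul => intro j hj; simp only [derTm]; exact (presOp deg E).act_mul _ _ _ _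
  | comp_act hS a hl hk σ τ ρ hρ p q =>
    intro j hj
    simp only [derTm, cl_act, map_add, map_smul]
    rw [(presOp deg E).comp_act hS a hl _ σ τ ρ hρ, (presOp deg E).comp_act hS a hl _ σ τ ρ hρ]

/-- The derivation of a presented operad with given values on generators. -/
def der (hδ : deg δ = -1)
    (hE : ∀ (n : ℕ) (i j : ι) (h : i + δ = j) (p q : Tm R S G n i), E n i p q →
      derTm δ D h p = derTm δ D h q)
    {n : ℕ} {i j : ι} (h : i + δ = j) : (presOp deg E).X n i →ₗ[R] (presOp deg E).X n j where
  toFun := Quot.lift (derTm δ D h) fun _ _ hr => derTm_rel δ D hδ hE hr h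
  map_add' := by rintro ⟨p⟩ ⟨q⟩; rfl
  map_smul' := by rintro r ⟨p⟩; rfl

end Der
end Pres
end Presented

/-! Completion of operads with two additional gradings. -/

/-- Degrees: homological degree, number of `κ`, number of `α`. -/
abbrev Tri : Type := ℤ × ℤ × ℤ

/-- The homological degree. -/
abbrev triDeg : Tri →+ ℤ := AddMonoidHom.fst ℤ (ℤ × ℤ)

/-- Operads in graded modules. -/
abbrev ZOp (R : Type v) [CommRing R] (S : Prop) := Op.{v, w} R S ℤ (AddMonoidHom.id ℤ)

/-- The ways to write a pair of natural numbers as a sum. -/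
def splits (c : ℕ × ℕ) : Finset ((ℕ × ℕ) × (ℕ × ℕ)) :=
  (Finset.HasAntidiagonal.antidiagonal c.1 ×ˢ Finset.HasAntidiagonal.antidiagonal c.2).image
    fun x => ((x.1.1, x.2.1), (x.1.2, x.2.2))

theorem mem_splits {c : ℕ × ℕ} {x : (ℕ × ℕ) × (ℕ × ℕ)} : x ∈ splits c ↔ x.1 + x.2 = c := by
  obtain ⟨⟨a, b⟩, ⟨a', b'⟩⟩ := x
  obtain ⟨c, c'⟩ := c
  simp [splits]

theorem sum_splits_assoc {M : Type w} [AddCommMonoid M] (F : ℕ × ℕ → ℕ × ℕ → ℕ × ℕ → M)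
    (c : ℕ × ℕ) :
    ∑ x ∈ splits c, ∑ y ∈ splits x.1, F y.1 y.2 x.2 =
      ∑ x ∈ splits c, ∑ y ∈ splits x.2, F x.1 y.1 y.2 := by
  rw [Finset.sum_sigma', Finset.sum_sigma']
  refine Finset.sum_nbij' (fun z => ⟨(z.2.1, z.2.2 + z.1.2), (z.2.2, z.1.2)⟩)
    (fun z => ⟨(z.1.1 + z.2.1, z.2.2), (z.1.1, z.2.1)⟩) ?_ ?_ ?_ ?_ ?_
  · rintro ⟨⟨x, x'⟩, ⟨y, y'⟩⟩ h
    simp only [Finset.mem_sigma, mem_splits] at h ⊢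
    rw [← h.1, ← h.2, add_assoc]
    simp
  · rintro ⟨⟨x, x'⟩, ⟨y, y'⟩⟩ h
    simp only [Finset.mem_sigma, mem_splits] at h ⊢
    rw [← h.1, ← h.2, add_assoc]
    simp
  · rintro ⟨⟨x, x'⟩, ⟨y, y'⟩⟩ h
    simp only [Finset.mem_sigma, mem_splits] at h
    simp [h.2]
  · rintro ⟨⟨x, x'⟩, ⟨y, y'⟩⟩ h
    simp only [Finset.mem_sigma, mem_splits] at h
    simp [h.2]
  · rintro ⟨⟨x, x'⟩, ⟨y, y'⟩⟩ h
    rfl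

theorem sum_splits_swap {M : Type w} [AddCommMonoid M] (F : ℕ × ℕ → ℕ × ℕ → M) (c : ℕ × ℕ) :
    ∑ x ∈ splits c, F x.1 x.2 = ∑ x ∈ splits c, F x.2 x.1 := by
  refine Finset.sum_nbij' Prod.swap Prod.swap ?_ ?_ ?_ ?_ ?_
  all_goals simp [mem_splits, add_comm]

section Completion

variable {R : Type v} [CommRing R] {S : Prop}

/-- Partial composition, extended by zero to target degrees that do not match. -/
def Op.tcomp {ι : Type} [AddCommMonoid ι] [DecidableEq ι] {deg : ι →+ ℤ} (A : Op R S ι deg)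
    {m n l : ℕ} {i j k : ι} (a : Fin m) (hl : l + 1 = m + n) :
    A.X m i →ₗ[R] A.X n j →ₗ[R] A.X l k :=
  if h : i + j = k then A.comp a hl h else 0

theorem Op.tcomp_eq {ι : Type} [AddCommMonoid ι] [DecidableEq ι] {deg : ι →+ ℤ}
    (A : Op R S ι deg) {m n l : ℕ} {i j k : ι} (a : Fin m) (hl : l + 1 = m + n) (h : i + j = k) :
    (A.tcomp a hl : A.X m i →ₗ[R] A.X n j →ₗ[R] A.X l k) = A.comp a hl h :=
  dif_pos h

variable (A : Op.{v, w} R S Tri triDeg)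

theorem idx_add {i j k : ℤ} (h : i + j = k) {x y c : ℕ × ℕ} (hc : x + y = c) :
    ((i, (x.1 : ℤ), (x.2 : ℤ)) : Tri) + (j, (y.1 : ℤ), (y.2 : ℤ)) = (k, (c.1 : ℤ), (c.2 : ℤ)) := by
  subst h hc
  simp

/-- The completion with respect to the number of `α`: its elements of arity `n` and degree `d` are
families of elements indexed by the number `c.1` of `κ` and the number `c.2` of `α`, that is,
formal infinite sums, where the number of `κ` is bounded. -/
def complX (n : ℕ) (d : ℤ) : Submodule R (∀ c : ℕ × ℕ, A.X n (d, (c.1 : ℤ), (c.2 : ℤ))) where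
  carrier := {f | ∃ W : ℕ, ∀ c : ℕ × ℕ, W ≤ c.1 → f c = 0}
  add_mem' := by
    rintro f g ⟨W, hW⟩ ⟨W', hW'⟩
    refine ⟨max W W', fun c hc => ?_⟩
    rw [Pi.add_apply, hW c (le_trans (le_max_left _ _) hc),
      hW' c (le_trans (le_max_right _ _) hc), add_zero]
  zero_mem' := ⟨0, fun _ _ => rfl⟩
  smul_mem' := by
    rintro r f ⟨W, hW⟩
    exact ⟨W, fun c hc => by rw [Pi.smul_apply, hW c hc, smul_zero]⟩

variable {A}

theorem mem_complX {n : ℕ} {d : ℤ} {f : ∀ c : ℕ × ℕ, A.X n (d, (c.1 : ℤ), (c.2 : ℤ))} :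
    f ∈ complX A n d ↔ ∃ W : ℕ, ∀ c : ℕ × ℕ, W ≤ c.1 → f c = 0 := Iff.rfl

theorem complX_ext {n : ℕ} {d : ℤ} {f g : complX A n d} (h : ∀ c, f.1 c = g.1 c) : f = g :=
  Subtype.ext (funext h)

/-- Partial composition of formal infinite sums. -/
def complComp {m n l : ℕ} {i j k : ℤ} (a : Fin m) (hl : l + 1 = m + n) (_ : i + j = k) :
    complX A m i →ₗ[R] complX A n j →ₗ[R] complX A l k :=
  LinearMap.mk₂ R
    (fun f g => ⟨fun c => ∑ x ∈ splits c, A.tcomp a hl (f.1 x.1) (g.1 x.2), by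
      obtain ⟨W, hW⟩ := mem_complX.1 f.2
      obtain ⟨W', hW'⟩ := mem_complX.1 g.2
      refine mem_complX.2 ⟨W + W', fun c hc => Finset.sum_eq_zero fun x hx => ?_⟩
      rw [mem_splits] at hx
      subst hx
      rw [Prod.fst_add] at hc
      rcases le_or_gt W x.1.1 with h | h
      · rw [hW _ h, map_zero, LinearMap.zero_apply]
      · rw [hW' _ (by omega), map_zero]⟩)
    (by
      intro f f' g
      refine complX_ext fun c => ?_
      simp [Finset.sum_add_distrib])
    (by
      intro r f g
      refine complX_ext fun c => ?_
      simp [Finset.smul_sum])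
    (by
      intro f g g'
      refine complX_ext fun c => ?_
      simp [Finset.sum_add_distrib])
    (by
      intro r f g
      refine complX_ext fun c => ?_
      simp [Finset.smul_sum])

theorem complComp_apply {m n l : ℕ} {i j k : ℤ} (a : Fin m) (hl : l + 1 = m + n) (hk : i + j = k)
    (f : complX A m i) (g : complX A n j) (c : ℕ × ℕ) :
    (complComp a hl hk f g).1 c = ∑ x ∈ splits c, A.tcomp a hl (f.1 x.1) (g.1 x.2) := rfl

theorem complComp_left {m n r l t : ℕ} {i j k ij ijk : ℤ} (a : Fin m) (c : Fin l)
    (h1 : l + 1 = m + n) (h2 : t + 1 = l + r) (k1 : i + j = ij) (k2 : ij + k = ijk)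
    (p : complX A m i) (q : complX A n j) (s : complX A r k) (u : ℕ × ℕ) :
    (complComp c h2 k2 (complComp a h1 k1 p q) s).1 u =
      ∑ x ∈ splits u, ∑ y ∈ splits x.1,
        A.tcomp c h2 (A.tcomp a h1 (k := (ij, ((y.1 + y.2).1 : ℤ), ((y.1 + y.2).2 : ℤ)))
          (p.1 y.1) (q.1 y.2)) (s.1 x.2) := by
  rw [complComp_apply]
  refine Finset.sum_congr rfl fun x _ => ?_
  rw [complComp_apply, map_sum, LinearMap.sum_apply]
  refine Finset.sum_congr rfl fun y hy => ?_
  rw [mem_splits] at hy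
  obtain ⟨x, x'⟩ := x
  subst hy
  rfl

theorem complComp_right {m n r l' t : ℕ} {i j k jk ijk : ℤ} (a : Fin m) (b : Fin n)
    (h3 : l' + 1 = n + r) (h4 : t + 1 = m + l') (k3 : j + k = jk) (k4 : i + jk = ijk)
    (p : complX A m i) (q : complX A n j) (s : complX A r k) (u : ℕ × ℕ) :
    (complComp a h4 k4 p (complComp b h3 k3 q s)).1 u =
      ∑ x ∈ splits u, ∑ y ∈ splits x.2,
        A.tcomp a h4 (p.1 x.1) (A.tcomp b h3 (k := (jk, ((y.1 + y.2).1 : ℤ), ((y.1 + y.2).2 : ℤ)))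
          (q.1 y.1) (s.1 y.2)) := by
  rw [complComp_apply]
  refine Finset.sum_congr rfl fun x _ => ?_
  rw [complComp_apply, map_sum]
  refine Finset.sum_congr rfl fun y hy => ?_
  rw [mem_splits] at hy
  obtain ⟨x, x'⟩ := x
  subst hy
  rfl

variable (A)

/-- The identity operation, as a formal infinite sum. -/
def complOne {i : ℤ} (h : i = 0) : complX A 1 i :=
  ⟨fun
    | (0, 0) => A.one (by rw [h]; rfl)
    | (0, _ + 1) => 0
    | (_ + 1, _) => 0,
    mem_complX.2 ⟨1, by rintro ⟨_ | w, k⟩ hc <;> simp at hc ⊢⟩⟩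

theorem complOne_zero {i : ℤ} (h : i = 0) :
    (complOne A h).1 0 = A.one (by rw [h]; rfl) := rfl

theorem complOne_ne {i : ℤ} (h : i = 0) {c : ℕ × ℕ} (hc : c ≠ 0) : (complOne A h).1 c = 0 := by
  obtain ⟨_ | w, _ | k⟩ := c
  · exact (hc rfl).elim
  all_goals rfl

set_option maxHeartbeats 2000000 in
/-- The completed operad. -/
def compl : ZOp.{v, w} R S where
  X n d := complX A n d
  one := complOne A
  comp a hl hk := complComp a hl hk
  act hS σ :=
    { toFun := fun f => ⟨fun c => A.act hS σ (f.1 c), by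
        obtain ⟨W, hW⟩ := mem_complX.1 f.2
        exact mem_complX.2 ⟨W, fun c hc => by rw [hW c hc, map_zero]⟩⟩
      map_add' := fun f g => complX_ext fun c => by simp
      map_smul' := fun r f => complX_ext fun c => by simp }
  one_comp := by
    intro n i e a hl he hk p
    refine complX_ext fun c => ?_
    rw [complComp_apply, Finset.sum_eq_single ((0 : ℕ × ℕ), c)]
    · rw [complOne_zero, A.tcomp_eq a hl (idx_add hk (zero_add c))]
      exact A.one_comp _ _ _ _ _
    · rintro ⟨x, y⟩ hx hne
      rw [mem_splits] at hx
      rw [complOne_ne, map_zero, LinearMap.zero_apply]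
      rintro rfl
      exact hne (by rw [← hx]; simp)
    · intro h
      exact (h (mem_splits.2 (zero_add c))).elim
  comp_one := by
    intro n i e a hl he hk p
    refine complX_ext fun c => ?_
    rw [complComp_apply, Finset.sum_eq_single (c, (0 : ℕ × ℕ))]
    · rw [complOne_zero, A.tcomp_eq a hl (idx_add hk (add_zero c))]
      exact A.comp_one _ _ _ _ _
    · rintro ⟨x, y⟩ hx hne
      rw [mem_splits] at hx
      rw [complOne_ne, map_zero]
      rintro rfl
      exact hne (by rw [← hx]; simp)
    · intro h
      exact (h (mem_splits.2 (add_zero c))).elim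
  comp_seq := by
    intro m n r l l' t i j k ij jk ijk a b c hc h1 h2 h3 h4 k1 k2 k3 k4 p q s
    refine complX_ext fun u => ?_
    rw [complComp_left, complComp_right, sum_splits_assoc (fun x y z =>
      A.tcomp c h2 (A.tcomp a h1 (k := (ij, ((x + y).1 : ℤ), ((x + y).2 : ℤ)))
          (p.1 x) (q.1 y)) (s.1 z))]
    refine Finset.sum_congr rfl fun x hx => Finset.sum_congr rfl fun y hy => ?_
    rw [mem_splits] at hx hy
    rw [A.tcomp_eq a h1 (idx_add k1 rfl),
      A.tcomp_eq c h2 (idx_add k2 (by rw [← hx, ← hy, add_assoc])),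
      A.tcomp_eq b h3 (idx_add k3 rfl), A.tcomp_eq a h4 (idx_add k4 (by rw [← hx, ← hy]))]
    exact A.comp_seq a b c hc _ _ _ _ _ _ _ _ _ _ _
  comp_par := by
    intro m n r l l' t i j k ij ik ijk a b c a' hab hc ha h1 h2 h3 h4 k1 k2 k3 k4 p q s
    refine complX_ext fun u => ?_
    rw [Submodule.coe_smul, Pi.smul_apply, complComp_left, complComp_left,
      sum_splits_assoc (fun x y z =>
        A.tcomp c h2 (A.tcomp a h1 (k := (ij, ((x + y).1 : ℤ), ((x + y).2 : ℤ)))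
          (p.1 x) (q.1 y)) (s.1 z)),
      sum_splits_assoc (fun x y z =>
        A.tcomp a' h4 (A.tcomp b h3 (k := (ik, ((x + y).1 : ℤ), ((x + y).2 : ℤ)))
          (p.1 x) (s.1 y)) (q.1 z)), Finset.smul_sum]
    refine Finset.sum_congr rfl fun x hx => ?_
    rw [sum_splits_swap (fun y z => A.tcomp c h2
        (A.tcomp a h1 (k := (ij, ((x.1 + y).1 : ℤ), ((x.1 + y).2 : ℤ)))
          (p.1 x.1) (q.1 y)) (s.1 z)), Finset.smul_sum]
    refine Finset.sum_congr rfl fun y hy => ?_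
    rw [mem_splits] at hx hy
    rw [A.tcomp_eq a h1 (idx_add k1 rfl),
      A.tcomp_eq c h2 (idx_add k2 (by rw [← hx, ← hy, add_assoc, add_comm y.1])),
      A.tcomp_eq b h3 (idx_add k3 rfl),
      A.tcomp_eq a' h4 (idx_add k4 (by rw [← hx, ← hy, add_assoc]))]
    exact A.comp_par a b c a' hab hc ha _ _ _ _ _ _ _ _ _ _ _
  act_one := fun hS p => complX_ext fun c => A.act_one hS _
  act_mul := fun hS σ τ p => complX_ext fun c => A.act_mul hS σ τ _
  comp_act := by
    intro m n l i j k hS a hl hk σ τ ρ hρ p q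
    refine complX_ext fun u => ?_
    change (complComp a hl hk _ _).1 u = A.act hS ρ ((complComp (σ a) hl hk _ _).1 u)
    rw [complComp_apply, complComp_apply, map_sum]
    refine Finset.sum_congr rfl fun x hx => ?_
    rw [mem_splits] at hx
    rw [A.tcomp_eq a hl (idx_add hk hx), A.tcomp_eq (σ a) hl (idx_add hk hx)]
    exact A.comp_act hS a hl _ σ τ ρ hρ _ _

end Completion

/-! Morphisms, dg operads, and the category of dg operads. -/

section Morphisms

variable {R : Type v} [CommRing R] {S : Prop}

/-- Morphisms of operads. -/
structure Op.Hom {ι : Type} [AddCommMonoid ι] {deg : ι →+ ℤ} (A : Op.{v, w} R S ι deg)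
    (B : Op.{v, w'} R S ι deg) where
  f : ∀ (n : ℕ) (i : ι), A.X n i →ₗ[R] B.X n i
  map_one : ∀ {i : ι} (h : i = 0), f 1 i (A.one h) = B.one h
  map_comp : ∀ {m n l : ℕ} {i j k : ι} (a : Fin m) (hl : l + 1 = m + n) (hk : i + j = k)
    (p : A.X m i) (q : A.X n j), f l k (A.comp a hl hk p q) = B.comp a hl hk (f m i p) (f n j q)
  map_act : ∀ {n : ℕ} {i : ι} (hS : S) (σ : Equiv.Perm (Fin n)) (p : A.X n i),
    f n i (A.act hS σ p) = B.act hS σ (f n i p)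

/-- The data of a dg operad: a graded operad with an operation of degree `-1`. -/
structure PreDG (R : Type v) [CommRing R] (S : Prop) where
  op : ZOp.{v, w} R S
  d : ∀ {n : ℕ} {i j : ℤ} (_ : i + -1 = j), op.X n i →ₗ[R] op.X n j

/-- The laws of a dg operad: `d` is a derivation of square zero, compatible with the symmetric
group actions if these are present; the zero operad is excluded. -/
structure IsDG (P : PreDG.{v, w} R S) : Prop where
  one_ne : P.op.one (rfl : (0 : ℤ) = 0) ≠ 0
  leibniz : ∀ {m n l : ℕ} {i j k i' j' k' : ℤ} (a : Fin m) (hl : l + 1 = m + n) (hk : i + j = k)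
    (hi : i + -1 = i') (hj : j + -1 = j') (hk' : k + -1 = k') (p : P.op.X m i) (q : P.op.X n j),
    P.d hk' (P.op.comp a hl hk p q) =
      P.op.comp a hl (by rw [← hk', ← hk, ← hi]; ring) (P.d hi p) q +
      sgn R i • P.op.comp a hl (by rw [← hk', ← hk, ← hj]; ring) p (P.d hj q)
  d_act : ∀ {n : ℕ} {i j : ℤ} (hS : S) (σ : Equiv.Perm (Fin n)) (h : i + -1 = j)
    (p : P.op.X n i), P.d h (P.op.act hS σ p) = P.op.act hS σ (P.d h p)
  d_d : ∀ {n : ℕ} {i j k : ℤ} (h : i + -1 = j) (h' : j + -1 = k) (p : P.op.X n i),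
    P.d h' (P.d h p) = 0

/-- Morphisms of dg operads. -/
structure PreDG.Hom (P Q : PreDG.{v, w} R S) where
  toHom : Op.Hom P.op Q.op
  map_d : ∀ {n : ℕ} {i j : ℤ} (h : i + -1 = j) (p : P.op.X n i),
    toHom.f n j (P.d h p) = Q.d h (toHom.f n i p)

theorem Op.Hom.ext' {ι : Type} [AddCommMonoid ι] {deg : ι →+ ℤ} {A : Op.{v, w} R S ι deg}
    {B : Op.{v, w'} R S ι deg} {F F' : Op.Hom A B} (h : ∀ n i p, F.f n i p = F'.f n i p) :
    F = F' := by
  obtain ⟨f, _, _, _⟩ := F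
  obtain ⟨f', _, _, _⟩ := F'
  have : f = f' := by
    funext n i
    exact LinearMap.ext (h n i)
  subst this
  rfl

/-- The identity morphism. -/
def Op.Hom.id {ι : Type} [AddCommMonoid ι] {deg : ι →+ ℤ} (A : Op.{v, w} R S ι deg) :
    Op.Hom A A where
  f _ _ := LinearMap.id
  map_one _ := rfl
  map_comp _ _ _ _ _ := rfl
  map_act _ _ _ := rfl

/-- Composition of morphisms. -/
def Op.Hom.trans {ι : Type} [AddCommMonoid ι] {deg : ι →+ ℤ} {A B C : Op.{v, w} R S ι deg}
    (F : Op.Hom A B) (F' : Op.Hom B C) : Op.Hom A C where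
  f n i := (F'.f n i).comp (F.f n i)
  map_one h := by simp [F.map_one, F'.map_one]
  map_comp a hl hk p q := by simp [F.map_comp, F'.map_comp]
  map_act hS σ p := by simp [F.map_act, F'.map_act]

theorem PreDG.Hom.ext' {P Q : PreDG.{v, w} R S} {F F' : PreDG.Hom P Q}
    (h : ∀ n i p, F.toHom.f n i p = F'.toHom.f n i p) : F = F' := by
  obtain ⟨f, _⟩ := F
  obtain ⟨f', _⟩ := F'
  have : f = f' := Op.Hom.ext' h
  subst this
  rfl

instance : Category (PreDG.{v, w} R S) where
  Hom := PreDG.Hom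
  id P := ⟨Op.Hom.id P.op, fun _ _ => rfl⟩
  comp F F' := ⟨F.toHom.trans F'.toHom, fun h p => by
    simp [Op.Hom.trans, F.map_d, F'.map_d]⟩

/-- The category of (non-zero) dg operads. -/
abbrev DGOp (R : Type v) [CommRing R] (S : Prop) :=
  ObjectProperty.FullSubcategory (fun P : PreDG.{v, w} R S => IsDG P)

/-- The value of a morphism of dg operads on an element. -/
def DGOp.ev {P Q : DGOp.{v, w} R S} (F : P ⟶ Q) {n : ℕ} {i : ℤ} (p : P.obj.op.X n i) :
    Q.obj.op.X n i := F.hom.toHom.f n i p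

/-- Suboperads (of the underlying graded operad). -/
structure SubOp (P : ZOp.{v, w} R S) where
  carrier : ∀ (n : ℕ) (i : ℤ), Submodule R (P.X n i)
  one_mem : ∀ {i : ℤ} (h : i = 0), P.one h ∈ carrier 1 i
  comp_mem : ∀ {m n l : ℕ} {i j k : ℤ} (a : Fin m) (hl : l + 1 = m + n) (hk : i + j = k)
    {p : P.X m i} {q : P.X n j}, p ∈ carrier m i → q ∈ carrier n j →
    P.comp a hl hk p q ∈ carrier l k
  act_mem : ∀ {n : ℕ} {i : ℤ} (hS : S) (σ : Equiv.Perm (Fin n)) {p : P.X n i},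
    p ∈ carrier n i → P.act hS σ p ∈ carrier n i

/-- A suboperad as an operad. -/
def SubOp.toOp {P : ZOp.{v, w} R S} (Q : SubOp P) : ZOp.{v, w} R S where
  X n i := Q.carrier n i
  one h := ⟨P.one h, Q.one_mem h⟩
  comp a hl hk := LinearMap.mk₂ R
    (fun p q => ⟨P.comp a hl hk p.1 q.1, Q.comp_mem a hl hk p.2 q.2⟩)
    (fun p p' q => Subtype.ext (by simp)) (fun r p q => Subtype.ext (by simp))
    (fun p q q' => Subtype.ext (by simp)) (fun r p q => Subtype.ext (by simp))
  act hS σ :=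
    { toFun := fun p => ⟨P.act hS σ p.1, Q.act_mem hS σ p.2⟩
      map_add' := fun p q => Subtype.ext (by simp)
      map_smul' := fun r p => Subtype.ext (by simp) }
  one_comp _ _ _ _ _ := Subtype.ext (P.one_comp _ _ _ _ _)
  comp_one _ _ _ _ _ := Subtype.ext (P.comp_one _ _ _ _ _)
  comp_seq _ _ _ h _ _ _ _ _ _ _ _ _ _ _ :=
    Subtype.ext (P.comp_seq _ _ _ h _ _ _ _ _ _ _ _ _ _ _)
  comp_par _ _ _ _ h h' h'' _ _ _ _ _ _ _ _ _ _ _ :=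
    Subtype.ext (P.comp_par _ _ _ _ h h' h'' _ _ _ _ _ _ _ _ _ _ _)
  act_one _ _ := Subtype.ext (P.act_one _ _)
  act_mul _ _ _ _ := Subtype.ext (P.act_mul _ _ _ _)
  comp_act _ _ _ _ _ _ _ h _ _ := Subtype.ext (P.comp_act _ _ _ _ _ _ _ h _ _)

/-- The suboperad generated by a set of elements. -/
def SubOp.generated (P : ZOp.{v, w} R S) (T : ∀ (n : ℕ) (i : ℤ), Set (P.X n i)) : SubOp P where
  carrier n i := ⨅ Q : {Q : SubOp P // ∀ n i, T n i ⊆ Q.carrier n i}, Q.1.carrier n i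
  one_mem h := by
    rw [Submodule.mem_iInf]
    exact fun Q => Q.1.one_mem h
  comp_mem := by
    intro m n l i j k a hl hk p q hp hq
    rw [Submodule.mem_iInf] at hp hq ⊢
    exact fun Q => Q.1.comp_mem a hl hk (hp Q) (hq Q)
  act_mem := by
    intro n i hS σ p hp
    rw [Submodule.mem_iInf] at hp ⊢
    exact fun Q => Q.1.act_mem hS σ (hp Q)

end Morphisms

/-! The coproduct of an operad with a free operad on operations of arity zero. -/

section Adjoin

variable {R : Type v} [CommRing R] {S : Prop}

/-- Generators of the coproduct of `P` with the free operad on operations `x : Z` of arity zero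
and of degree `z x`: the elements of `P`, and the new operations. -/
inductive AdjGen (P : ZOp.{v, w} R S) {Z : Type} (z : Z → Tri) : ℕ → Tri → Type w
  | old {n : ℕ} {d : ℤ} {i : Tri} (h : ((d, 0, 0) : Tri) = i) (p : P.X n d) : AdjGen P z n i
  | new {i : Tri} (x : Z) (h : z x = i) : AdjGen P z 0 i

/-- Relations of the coproduct: all those that hold in `P`. -/
inductive AdjRel (P : ZOp.{v, w} R S) {Z : Type} (z : Z → Tri) :
    ∀ (n : ℕ) (i : Tri), Tm R S (AdjGen P z) n i → Tm R S (AdjGen P z) n i → Prop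
  | one {d : ℤ} {i : Tri} (hd : d = 0) (h : ((d, 0, 0) : Tri) = i) (hi : i = 0) :
      AdjRel P z 1 i (.gen (.old h (P.one hd))) (.one hi)
  | comp {m n l : ℕ} {d e f : ℤ} {i j k : Tri} (a : Fin m) (hl : l + 1 = m + n)
      (hf : d + e = f) (hi : ((d, 0, 0) : Tri) = i) (hj : ((e, 0, 0) : Tri) = j)
      (hk : ((f, 0, 0) : Tri) = k) (hijk : i + j = k) (p : P.X m d) (q : P.X n e) :
      AdjRel P z l k (.gen (.old hk (P.comp a hl hf p q)))
        (.comp a hl hijk (.gen (.old hi p)) (.gen (.old hj q)))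
  | act {n : ℕ} {d : ℤ} {i : Tri} (hS : S) (σ : Equiv.Perm (Fin n))
      (hi : ((d, 0, 0) : Tri) = i) (p : P.X n d) :
      AdjRel P z n i (.gen (.old hi (P.act hS σ p))) (.act hS σ (.gen (.old hi p)))
  | add {n : ℕ} {d : ℤ} {i : Tri} (hi : ((d, 0, 0) : Tri) = i) (p q : P.X n d) :
      AdjRel P z n i (.gen (.old hi (p + q))) (.add (.gen (.old hi p)) (.gen (.old hi q)))
  | smul {n : ℕ} {d : ℤ} {i : Tri} (hi : ((d, 0, 0) : Tri) = i) (r : R) (p : P.X n d) :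
      AdjRel P z n i (.gen (.old hi (r • p))) (.smul r (.gen (.old hi p)))

/-- The coproduct of `P` with the free operad on operations of arity zero. -/
abbrev adjoin (P : ZOp.{v, w} R S) {Z : Type} (z : Z → Tri) : Op.{v, max v w} R S Tri triDeg :=
  presOp triDeg (AdjRel P z)

/-- The class in the coproduct of an element of `P`. -/
def inOld (P : ZOp.{v, w} R S) {Z : Type} (z : Z → Tri) {n : ℕ} {d : ℤ} {i : Tri}
    (h : ((d, 0, 0) : Tri) = i) : P.X n d →ₗ[R] (adjoin P z).X n i where
  toFun p := Pres.cl (.gen (.old h p))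
  map_add' p q := Pres.cl_eq (.of (.add h p q))
  map_smul' r p := Pres.cl_eq (.of (.smul h r p))

theorem inOld_one (P : ZOp.{v, w} R S) {Z : Type} (z : Z → Tri) {d : ℤ} {i : Tri} (hd : d = 0)
    (h : ((d, 0, 0) : Tri) = i) (hi : i = 0) :
    inOld P z h (P.one hd) = (adjoin P z).one hi := Pres.cl_eq (.of (.one hd h hi))

theorem inOld_comp (P : ZOp.{v, w} R S) {Z : Type} (z : Z → Tri) {m n l : ℕ} {d e f : ℤ}
    {i j k : Tri} (a : Fin m) (hl : l + 1 = m + n)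
    (hf : d + e = f) (hi : ((d, 0, 0) : Tri) = i) (hj : ((e, 0, 0) : Tri) = j)
    (hk : ((f, 0, 0) : Tri) = k) (hijk : i + j = k) (p : P.X m d) (q : P.X n e) :
    inOld P z hk (P.comp a hl hf p q) =
      (adjoin P z).comp a hl hijk (inOld P z hi p) (inOld P z hj q) :=
  Pres.cl_eq (.of (.comp a hl hf hi hj hk hijk p q))

theorem inOld_act (P : ZOp.{v, w} R S) {Z : Type} (z : Z → Tri) {n : ℕ} {d : ℤ} {i : Tri}
    (hS : S) (σ : Equiv.Perm (Fin n)) (hi : ((d, 0, 0) : Tri) = i) (p : P.X n d) :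
    inOld P z hi (P.act hS σ p) = (adjoin P z).act hS σ (inOld P z hi p) :=
  Pres.cl_eq (.of (.act hS σ hi p))

/-- A new operation, as an element of the coproduct. -/
def inNew (P : ZOp.{v, w} R S) {Z : Type} (z : Z → Tri) {i : Tri} (x : Z) (h : z x = i) :
    (adjoin P z).X 0 i :=
  Pres.cl (.gen (.new x h))

/-- Values on the generators of the coproduct of a morphism that is given on `P` by `F` and on
the new operations by `y`. -/
def adjEvalGen {P : ZOp.{v, w} R S} {M : ZOp.{v, w} R S} (F : Op.Hom P M) {Z : Type} (z : Z → Tri)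
    (y : ∀ x, M.X 0 (z x).1) : ∀ (n : ℕ) (i : Tri), AdjGen P z n i → M.X n (triDeg i)
  | n, _, .old rfl p => F.f n _ p
  | _, _, .new x rfl => y x

/-- The morphism from the coproduct that is given on `P` by `F` and on the new operations
by `y`, restricted to elements of a given tridegree. -/
def adjEval {P : ZOp.{v, w} R S} {M : ZOp.{v, w} R S} (F : Op.Hom P M) {Z : Type} (z : Z → Tri)
    (y : ∀ x, M.X 0 (z x).1) {n : ℕ} {i : Tri} : (adjoin P z).X n i →ₗ[R] M.X n i.1 :=
  Pres.eval triDeg M (adjEvalGen F z y) (fun _ => rfl) (by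
    intro n i p q h
    cases h with
    | one hd h hi => subst h; exact F.map_one hd
    | comp a hl hf hi hj hk hijk p q => subst hi hj hk; exact F.map_comp a hl hf p q
    | act hS σ hi p => subst hi; exact F.map_act hS σ p
    | add hi p q => subst hi; exact map_add _ p q
    | smul hi r p => subst hi; exact map_smul _ r p)

/-- The map of coproducts induced by a morphism of operads. -/
def adjMap {P : ZOp.{v, w} R S} {P' : ZOp.{v, w'} R S} (F : Op.Hom P P') {Z : Type}
    (z : Z → Tri) : Op.Hom (adjoin P z) (adjoin P' z) where
  f n i := Pres.eval (AddMonoidHom.id Tri) (adjoin P' z)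
    (fun n i g => match n, i, g with
      | n, _, .old h p => inOld P' z h (F.f n _ p)
      | _, _, .new x h => inNew P' z x h) (fun _ => rfl) (by
    intro n i p q h
    cases h with
    | one hd h hi =>
      change inOld P' z _ _ = _
      rw [F.map_one hd]
      exact inOld_one P' z hd h hi
    | comp a hl hf hi hj hk hijk p q =>
      change inOld P' z _ _ = _
      rw [F.map_comp a hl hf]
      exact inOld_comp P' z a hl hf hi hj hk hijk _ _
    | act hS σ hi p =>
      change inOld P' z _ _ = _
      rw [F.map_act hS σ]
      exact inOld_act P' z hS σ hi _
    | add hi p q =>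
      change inOld P' z _ _ = _
      rw [map_add, map_add]
      rfl
    | smul hi r p =>
      change inOld P' z _ _ = _
      rw [map_smul, map_smul]
      rfl)
  map_one h := rfl
  map_comp := by
    intro m n l i j k a hl hk p q
    induction p using Pres.cl_ind with | h p => ?_
    induction q using Pres.cl_ind with | h q => ?_
    rfl
  map_act := by
    intro n i hS σ p
    induction p using Pres.cl_ind with | h p => ?_
    rfl

end Adjoin

/-! Derivations on the coproduct and on its completion. -/

section Twist

variable {R : Type v} [CommRing R] {S : Prop}

theorem IsDG.d_one {P : PreDG.{v, w} R S} (hP : IsDG P) {i j : ℤ} (hi : i = 0) (h : i + -1 = j) :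
    P.d h (P.op.one hi) = 0 := by
  subst hi
  have h1 := hP.leibniz (0 : Fin 1) rfl (add_zero 0) h h h (P.op.one rfl) (P.op.one rfl)
  rw [P.op.comp_one, P.op.comp_one, P.op.one_comp, sgn_zero, one_smul] at h1
  exact left_eq_add.1 h1

/-- On generators: the differential of `P`. -/
def dOldGen (P : PreDG.{v, w} R S) {Z : Type} (z : Z → Tri) : ∀ (n : ℕ) (i j : Tri),
    i + ((-1, 0, 0) : Tri) = j → AdjGen P.op z n i → (adjoin P.op z).X n j
  | _, _, _, h, .old hi p => inOld P.op z (by rw [← h, ← hi]; simp) (P.d rfl p)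
  | _, _, _, _, .new _ _ => 0

/-- The derivation that extends the differential of `P` by zero on the new operations. -/
def dOld {P : PreDG.{v, w} R S} (hP : IsDG P) {Z : Type} (z : Z → Tri) {n : ℕ} {i j : Tri}
    (h : i + ((-1, 0, 0) : Tri) = j) : (adjoin P.op z).X n i →ₗ[R] (adjoin P.op z).X n j :=
  Pres.der (deg := triDeg) ((-1, 0, 0) : Tri) (dOldGen P z) rfl (by
    intro n i j h p q hr
    cases hr with
    | one hd hi h0 =>
      change inOld P.op z _ _ = 0
      rw [hP.d_one hd, map_zero]
    | @comp m n l d e f i j' k a hl hf hi hj hk hijk p q =>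
      subst hi
      change inOld P.op z _ _ = (adjoin P.op z).comp a hl _ (inOld P.op z _ _) (inOld P.op z hj q) +
        sgn R d • (adjoin P.op z).comp a hl _ (inOld P.op z rfl p) (inOld P.op z _ _)
      rw [hP.leibniz a hl hf rfl rfl rfl p q, map_add, map_smul]
      congr 1
      · exact inOld_comp P.op z a hl _ _ _ _ _ _ _
      · congr 1
        exact inOld_comp P.op z a hl _ _ _ _ _ _ _
    | act hS σ hi p =>
      change inOld P.op z _ _ = _
      rw [hP.d_act hS σ]
      exact inOld_act P.op z hS σ _ _
    | add hi p q =>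
      change inOld P.op z _ _ = _
      rw [map_add, map_add]
      rfl
    | smul hi r p =>
      change inOld P.op z _ _ = _
      rw [map_smul, map_smul]
      rfl) h

/-- The generators `κ` and `α` of the operad `T`. -/
inductive TGen : Type
  | kappa
  | alpha

/-- `κ` has degree `-1` and `α` has degree `0`. -/
def tDeg : TGen → Tri
  | .kappa => (-1, 1, 0)
  | .alpha => (0, 0, 1)

/-- The coproduct of `P` and `T`, without completion. -/
abbrev withT (P : ZOp.{v, w} R S) : Op.{v, max v w} R S Tri triDeg := adjoin P tDeg

/-- On generators: the differential of `T`, which sends `α` to `κ`. -/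
def dTGen (P : ZOp.{v, w} R S) : ∀ (n : ℕ) (i j : Tri),
    i + ((-1, 1, -1) : Tri) = j → AdjGen P tDeg n i → (withT P).X n j
  | _, _, _, _, .old _ _ => 0
  | _, _, _, _, .new .kappa _ => 0
  | _, _, _, h, .new .alpha hi => inNew P tDeg .kappa (by rw [← h, ← hi]; rfl)

/-- The derivation that is zero on `P` and sends `α` to `κ` and `κ` to zero. -/
def dT (P : ZOp.{v, w} R S) {n : ℕ} {i j : Tri} (h : i + ((-1, 1, -1) : Tri) = j) :
    (withT P).X n i →ₗ[R] (withT P).X n j :=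
  Pres.der (deg := triDeg) ((-1, 1, -1) : Tri) (dTGen P) rfl (by
    intro n i j h p q hr
    cases hr with
    | one hd hi h0 => rfl
    | comp a hl hf hi hj hk hijk p q =>
      change (0 : (withT P).X _ _) = (withT P).comp a hl _ 0 _ + _ • (withT P).comp a hl _ _ 0
      rw [map_zero, map_zero, LinearMap.zero_apply, smul_zero, add_zero]
    | act hS σ hi p =>
      change (0 : (withT P).X _ _) = (withT P).act hS σ 0
      rw [map_zero]
    | add hi p q =>
      change (0 : (withT P).X _ _) = 0 + 0
      rw [add_zero]
    | smul hi r p =>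
      change (0 : (withT P).X _ _) = r • 0
      rw [smul_zero]) h

/-- The differential `d_P + d_T` of a formal infinite sum. -/
def twistDiff {P : PreDG.{v, w} R S} (hP : IsDG P) {n : ℕ} {i j : ℤ} (h : i + -1 = j) :
    complX (withT P.op) n i →ₗ[R] complX (withT P.op) n j where
  toFun f := ⟨fun
    | (0, k) => dOld hP tDeg (by rw [← h]; simp) (f.1 (0, k))
    | (w + 1, k) => dOld hP tDeg (by rw [← h]; simp) (f.1 (w + 1, k)) +
        dT P.op (by rw [← h]; simp) (f.1 (w, k + 1)), by
    obtain ⟨W, hW⟩ := mem_complX.1 f.2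
    refine mem_complX.2 ⟨W + 1, ?_⟩
    rintro ⟨_ | w, k⟩ hc
    · simp at hc
    · change dOld hP tDeg _ (f.1 (w + 1, k)) + dT P.op _ (f.1 (w, k + 1)) = 0
      rw [hW (w + 1, k) (by simp at hc ⊢; omega), hW (w, k + 1) (by simp at hc ⊢; omega),
        map_zero, map_zero, add_zero]⟩
  map_add' f g := complX_ext (by
    rintro ⟨_ | w, k⟩
    · simp
    · simp only [Submodule.coe_add, Pi.add_apply, map_add]
      abel)
  map_smul' r f := complX_ext (by
    rintro ⟨_ | w, k⟩
    · simp
    · simp only [Submodule.coe_smul, Pi.smul_apply, map_smul, RingHom.id_apply, smul_add])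

/-- The completed coproduct of `P` and `T` with the differential `d_P + d_T`. -/
def twistDG {P : PreDG.{v, w} R S} (hP : IsDG P) : PreDG.{v, max v w} R S where
  op := compl (withT P.op)
  d := twistDiff hP

/-- The element `κ` of the completed coproduct. -/
def kappa (P : ZOp.{v, w} R S) : (compl (withT P)).X 0 (-1) :=
  ⟨fun
    | (0, _) => 0
    | (1, 0) => inNew P tDeg .kappa rfl
    | (1, _ + 1) => 0
    | (_ + 2, _) => 0, mem_complX.2 ⟨2, by
    rintro ⟨_ | _ | w, k⟩ hc
    · simp at hc
    · simp at hc
    · rfl⟩⟩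

/-- The series of elements `y k` without `κ`, where `y k` contains `α` exactly `k` times. -/
def series (P : ZOp.{v, w} R S) {n : ℕ} {d : ℤ}
    (y : ∀ k : ℕ, (withT P).X n (d, ((0 : ℕ) : ℤ), (k : ℤ))) : (compl (withT P)).X n d :=
  ⟨fun
    | (0, k) => y k
    | (_ + 1, _) => 0, mem_complX.2 ⟨1, by
    rintro ⟨_ | w, k⟩ hc
    · simp at hc
    · rfl⟩⟩

end Twist

/-! Plugging operations of arity zero into an operation. -/

section Fill

variable {R : Type v} [CommRing R] {S : Prop} {ι : Type} [AddCommMonoid ι] {deg : ι →+ ℤ}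

/-- The identity, along equations of arities and degrees. -/
def Op.cast (A : Op.{v, w} R S ι deg) {m l : ℕ} {i j : ι} (hm : m = l) (hi : i = j) :
    A.X m i →ₗ[R] A.X l j :=
  match m, i, hm, hi with
  | _, _, rfl, rfl => LinearMap.id

/-- `A.fill x k b` plugs `k` copies of the arity zero operation `x` into the consecutive inputs
`b, …, b + k - 1` of an operation (inputs are counted from `0`). -/
def Op.fill (A : Op.{v, w} R S ι deg) {e : ι} (x : A.X 0 e) : ∀ (k : ℕ) {m l : ℕ} {i j : ι} (b : ℕ)
    (_ : b ≤ l) (_ : m = l + k) (_ : i + k • e = j), A.X m i →ₗ[R] A.X l j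
  | 0, _, _, _, _, _, _, hm, h => A.cast hm (by simpa using h)
  | k + 1, m, l, i, _, b, hb, hm, h =>
      (Op.fill A x k (m := l + k) (i := i + e) b hb rfl
        (by rw [← h, succ_nsmul, add_assoc, add_comm e])).comp
        ((A.comp (⟨b, by omega⟩ : Fin m) (by omega) rfl).flip x)

/-- `A.fills x [k₀, …, kᵣ] b` plugs copies of the arity zero operation `x` into inputs:
after the first `b` inputs, which are left free, come `k₀` copies of `x`, then one free input, then
`k₁` copies of `x`, one free input, and so on. -/
def Op.fills (A : Op.{v, w} R S ι deg) {e : ι} (x : A.X 0 e) : ∀ (L : List ℕ) {m l : ℕ} {i j : ι}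
    (b : ℕ) (_ : b + L.length ≤ l + 1) (_ : m = l + L.sum) (_ : i + L.sum • e = j),
    A.X m i →ₗ[R] A.X l j
  | [], _, _, _, _, _, _, hm, h => A.cast (by simpa using hm) (by simpa using h)
  | k :: L, m, l, i, _, b, hb, hm, h =>
      (Op.fills A x L (m := l + L.sum) (i := i + k • e) (b + 1)
        (by simp at hb; omega) rfl (by rw [← h, List.sum_cons, add_nsmul, add_assoc])).comp
        (A.fill x k b (by simp at hb; omega) (by simp at hm; omega) rfl)

end Fill

/-! Quadruples, the category of curved operads, and the two functors. -/

section Curv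

variable {R : Type v} [CommRing R] {S : Prop}

/-- Quadruples: a dg operad, an operation `κ` of arity zero and degree `-1`, and a
suboperad of the underlying graded operad. -/
structure Quad (R : Type v) [CommRing R] (S : Prop) where
  dg : PreDG.{v, w} R S
  κ : dg.op.X 0 (-1)
  sub : SubOp dg.op

/-- Morphisms of quadruples. -/
structure Quad.Hom (P Q : Quad.{v, w} R S) where
  toDG : P.dg ⟶ Q.dg
  map_κ : (PreDG.Hom.toHom toDG).f 0 (-1) P.κ = Q.κ
  map_sub : ∀ {n : ℕ} {i : ℤ} {p : P.dg.op.X n i}, p ∈ P.sub.carrier n i →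
    (PreDG.Hom.toHom toDG).f n i p ∈ Q.sub.carrier n i

theorem Quad.Hom.ext' {P Q : Quad.{v, w} R S} {F F' : Quad.Hom P Q} (h : F.toDG = F'.toDG) :
    F = F' := by
  obtain ⟨f, _, _⟩ := F
  obtain ⟨f', _, _⟩ := F'
  obtain rfl : f = f' := h
  rfl

instance : Category (Quad.{v, w} R S) where
  Hom := Quad.Hom
  id P := ⟨𝟙 P.dg, rfl, fun h => h⟩
  comp F F' := ⟨F.toDG ≫ F'.toDG,
    (congrArg _ F.map_κ).trans F'.map_κ, fun h => F'.map_sub (F.map_sub h)⟩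

/-- The degree of a freely adjoined operation `κ`. -/
def kDeg : Unit → Tri := fun _ => (-1, 1, 0)

/-- The natural morphism from the coproduct `Q₀ ∨ [κ]` to `Q`, on the part of weight `k`. -/
def Quad.naturalWt (Q : Quad.{v, w} R S) (n : ℕ) (d : ℤ) (k : ℕ) :
    (adjoin Q.sub.toOp kDeg).X n (d, (k : ℤ), 0) →ₗ[R] Q.dg.op.X n d :=
  adjEval (P := Q.sub.toOp) (M := Q.dg.op)
    { f := fun n i => (Q.sub.carrier n i).subtype
      map_one := fun _ => rfl
      map_comp := fun _ _ _ _ _ => rfl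
      map_act := fun _ _ _ => rfl } kDeg (fun _ => Q.κ)

/-- The natural morphism from the coproduct `Q₀ ∨ [κ] = ⨁ₖ (Q₀ ∨ [κ])ₖ` to `Q`. -/
def Quad.natural (Q : Quad.{v, w} R S) (n : ℕ) (d : ℤ) :
    (DirectSum ℕ fun k => (adjoin Q.sub.toOp kDeg).X n (d, (k : ℤ), 0)) →ₗ[R] Q.dg.op.X n d :=
  DirectSum.toModule R ℕ _ (Q.naturalWt n d)

/-- The part of weight `k` of `Q`. -/
def Quad.wt (Q : Quad.{v, w} R S) (n : ℕ) (d : ℤ) (k : ℕ) : Submodule R (Q.dg.op.X n d) :=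
  LinearMap.range (Q.naturalWt n d k)

/-- The conditions on a quadruple `(Q, d, κ, Q₀)`: the natural morphism `Q₀ ∨ [κ] ⟶ Q` is an
isomorphism; the components `dᵢ` of `d` of weight `i` vanish for `i ≠ 0, 1`; and `d₁ κ = 0`,
that is, `d κ = d₀ κ` has weight one like `κ`. -/
structure IsCurv (Q : Quad.{v, w} R S) : Prop where
  isDG : IsDG Q.dg
  not_mem : Q.κ ∉ Q.sub.carrier 0 (-1)
  bijective : ∀ (n : ℕ) (d : ℤ), Function.Bijective (Q.natural n d)
  mixed : ∀ {n : ℕ} {i j : ℤ} (h : i + -1 = j) (k : ℕ) (p : Q.dg.op.X n i),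
    p ∈ Q.wt n i k → Q.dg.d h p ∈ Q.wt n j k ⊔ Q.wt n j (k + 1)
  d_one : Q.dg.d (rfl : -1 + -1 = -1 + -1) Q.κ ∈ Q.wt 0 (-1 + -1) 1

/-- The category `Curv`. -/
abbrev Curv (R : Type v) [CommRing R] (S : Prop) :=
  ObjectProperty.FullSubcategory (fun Q : Quad.{v, w} R S => IsCurv Q)

/-- The underlying dg operad. -/
def Curv.forget (R : Type v) [CommRing R] (S : Prop) : Curv.{v, w} R S ⥤ DGOp.{v, w} R S where
  obj Q := ⟨Q.obj.dg, Q.property.isDG⟩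
  map F := ObjectProperty.homMk (Quad.Hom.toDG F.hom)

/-- The functor `(Q, d, κ, Q₀) ↦ (Q, d)` from `Curv` to the dg operads under the initial
object of `Curv`. -/
def leftFunctor {C : Curv.{v, w} R S} (hC : Limits.IsInitial C) :
    Curv.{v, w} R S ⥤ Under ((Curv.forget R S).obj C) where
  obj Q := Under.mk ((Curv.forget R S).map (hC.to Q))
  map F := Under.homMk ((Curv.forget R S).map F) (by
    simp only [Under.mk_hom]
    rw [← Functor.map_comp, hC.hom_ext (hC.to _ ≫ F) (hC.to _)])

theorem tcomp_map {A B : Op.{v, w} R S Tri triDeg} (F : Op.Hom A B) {m n l : ℕ} {i j k : Tri}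
    (a : Fin m) (hl : l + 1 = m + n) (p : A.X m i) (q : A.X n j) :
    F.f l k (A.tcomp a hl p q) = B.tcomp a hl (F.f m i p) (F.f n j q) := by
  unfold Op.tcomp
  split_ifs with h
  · exact F.map_comp a hl h p q
  · simp

/-- The map of completions induced by a morphism. -/
def complMap {A B : Op.{v, w} R S Tri triDeg} (F : Op.Hom A B) :
    Op.Hom (compl A) (compl B) where
  f n d :=
    { toFun := fun x => ⟨fun c => F.f n _ (x.1 c), by
        obtain ⟨W, hW⟩ := mem_complX.1 x.2
        exact mem_complX.2 ⟨W, fun c hc => by rw [hW c hc, map_zero]⟩⟩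
      map_add' := fun x y => complX_ext fun c => map_add (F.f n _) (x.1 c) (y.1 c)
      map_smul' := fun r x => complX_ext fun c => map_smul (F.f n _) r (x.1 c) }
  map_one {i} h := complX_ext (by
    rintro ⟨_ | w, _ | k⟩
    · exact F.map_one _
    all_goals exact map_zero _)
  map_comp := by
    intro m n l i j k a hl hk p q
    refine complX_ext fun c => ?_
    refine (congrArg (F.f l _) (complComp_apply a hl hk p q c)).trans ?_
    rw [map_sum]
    exact Finset.sum_congr rfl fun x _ => tcomp_map F a hl _ _
  map_act hS σ p := complX_ext fun c => F.map_act hS σ _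

theorem adjMap_new {P P' : ZOp.{v, w} R S} (F : Op.Hom P P') {Z : Type} (z : Z → Tri)
    {i : Tri} (x : Z) (h : z x = i) :
    (adjMap F z).f 0 i (inNew P z x h) = inNew P' z x h := rfl

theorem adjMap_old {P P' : ZOp.{v, w} R S} (F : Op.Hom P P') {Z : Type} (z : Z → Tri)
    {n : ℕ} {d : ℤ} {i : Tri} (h : ((d, 0, 0) : Tri) = i) (p : P.X n d) :
    (adjMap F z).f n i (inOld P z h p) = inOld P' z h (F.f n d p) := rfl

/-- Morphisms out of a coproduct are determined by their values on generators. -/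
theorem pres_hom_ext {ι : Type} [AddCommMonoid ι] {deg : ι →+ ℤ} {G : ℕ → ι → Type w}
    {E : ∀ (n : ℕ) (i : ι), Tm R S G n i → Tm R S G n i → Prop} {M : Op.{v, w'} R S ι deg}
    (F F' : Op.Hom (presOp deg E) M)
    (h : ∀ n i (g : G n i), F.f n i (Pres.cl (.gen g)) = F'.f n i (Pres.cl (.gen g)))
    {n : ℕ} {i : ι} (x : (presOp deg E).X n i) : F.f n i x = F'.f n i x := by
  induction x using Pres.cl_ind with | h p => ?_
  induction p with
  | gen g => exact h _ _ g
  | one hi => rw [Pres.cl_one, F.map_one, F'.map_one]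
  | comp a hl hk p q ih ih' => rw [Pres.cl_comp, F.map_comp, F'.map_comp, ih, ih']
  | act hS σ p ih => rw [Pres.cl_act, F.map_act, F'.map_act, ih]
  | zero => rw [Pres.cl_zero, map_zero, map_zero]
  | add p q ih ih' => rw [Pres.cl_add, map_add, map_add, ih, ih']
  | smul r p ih => rw [Pres.cl_smul, map_smul, map_smul, ih]

/-- A morphism of presented operads that commutes with derivations on generators does so
everywhere. -/
theorem pres_der_comm {ι : Type} [AddCommMonoid ι] {deg : ι →+ ℤ} {G G' : ℕ → ι → Type w}
    {E : ∀ (n : ℕ) (i : ι), Tm R S G n i → Tm R S G n i → Prop}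
    {E' : ∀ (n : ℕ) (i : ι), Tm R S G' n i → Tm R S G' n i → Prop}
    (F : Op.Hom (presOp deg E) (presOp deg E')) {δ : ι}
    {D : ∀ (n : ℕ) (i j : ι), i + δ = j → G n i → (presOp deg E).X n j}
    {D' : ∀ (n : ℕ) (i j : ι), i + δ = j → G' n i → (presOp deg E').X n j}
    (hδ : deg δ = -1) (hE) (hE')
    (h : ∀ n i j (hj : i + δ = j) (g : G n i), F.f n j (Pres.der δ D hδ hE hj (Pres.cl (.gen g))) =
      Pres.der δ D' hδ hE' hj (F.f n i (Pres.cl (.gen g))))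
    {n : ℕ} {i j : ι} (hj : i + δ = j) (x : (presOp deg E).X n i) :
    F.f n j (Pres.der δ D hδ hE hj x) = Pres.der δ D' hδ hE' hj (F.f n i x) := by
  have key : ∀ {m n l : ℕ} {i j k t : ι} (a : Fin m) (hl : l + 1 = m + n) (hk : i + j = k)
      (ht : k + δ = t) (p : (presOp deg E').X m i) (q : (presOp deg E').X n j),
      Pres.der δ D' hδ hE' ht ((presOp deg E').comp a hl hk p q) =
        (presOp deg E').comp a hl (by rw [← ht, ← hk, add_right_comm])
          (Pres.der δ D' hδ hE' rfl p) q +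
        sgn R (deg i) • (presOp deg E').comp a hl (by rw [← ht, ← hk, add_assoc]) p
          (Pres.der δ D' hδ hE' rfl q) := by
    intro m n l i j k t a hl hk ht p q
    induction p using Pres.cl_ind with | h p => ?_
    induction q using Pres.cl_ind with | h q => ?_
    rfl
  have key' : ∀ {n : ℕ} {i t : ι} (hS : S) (σ : Equiv.Perm (Fin n)) (ht : i + δ = t)
      (p : (presOp deg E').X n i), Pres.der δ D' hδ hE' ht ((presOp deg E').act hS σ p) =
        (presOp deg E').act hS σ (Pres.der δ D' hδ hE' ht p) := by
    intro n i t hS σ ht p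
    induction p using Pres.cl_ind with | h p => ?_
    rfl
  induction x using Pres.cl_ind with | h p => ?_
  induction p generalizing j with
  | gen g => exact h _ _ _ hj g
  | one hi =>
    rw [Pres.cl_one, F.map_one]
    change F.f _ _ 0 = 0
    exact map_zero _
  | comp a hl hk p q ih ih' =>
    rw [Pres.cl_comp, F.map_comp, key, ← ih, ← ih', ← F.map_comp, ← F.map_comp, ← map_smul,
      ← map_add]
    rfl
  | act hS σ p ih =>
    rw [Pres.cl_act, F.map_act, key', ← ih, ← F.map_act]
    rfl
  | zero => rw [Pres.cl_zero, map_zero, map_zero, map_zero, map_zero]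
  | add p q ih ih' => rw [Pres.cl_add, map_add, map_add, map_add, map_add, ih, ih']
  | smul r p ih => rw [Pres.cl_smul, map_smul, map_smul, map_smul, map_smul, ih]

/-- The morphism `f ∨ 1` of completed coproducts induced by a morphism of dg operads. -/
def twistMap {P P' : PreDG.{v, w} R S} (hP : IsDG P) (hP' : IsDG P') (F : P ⟶ P') :
    twistDG hP ⟶ twistDG hP' where
  toHom := complMap (adjMap (PreDG.Hom.toHom F) tDeg)
  map_d := by
    intro n i j h p
    have h1 : ∀ {n : ℕ} {i j : Tri} (hj : i + ((-1, 0, 0) : Tri) = j) (x : (withT P.op).X n i),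
        (adjMap (PreDG.Hom.toHom F) tDeg).f n j (dOld hP tDeg hj x) =
          dOld hP' tDeg hj ((adjMap (PreDG.Hom.toHom F) tDeg).f n i x) := by
      intro n i j hj x
      refine pres_der_comm (adjMap (PreDG.Hom.toHom F) tDeg) _ _ _ ?_ hj x
      intro n i j hj g
      cases g with
      | old hi p =>
        change (adjMap _ tDeg).f n j (inOld P.op tDeg _ (P.d rfl p)) =
          inOld P'.op tDeg _ (P'.d rfl _)
        rw [adjMap_old, PreDG.Hom.map_d]
      | new x hx => exact map_zero _
    have h2 : ∀ {n : ℕ} {i j : Tri} (hj : i + ((-1, 1, -1) : Tri) = j) (x : (withT P.op).X n i),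
        (adjMap (PreDG.Hom.toHom F) tDeg).f n j (dT P.op hj x) =
          dT P'.op hj ((adjMap (PreDG.Hom.toHom F) tDeg).f n i x) := by
      intro n i j hj x
      refine pres_der_comm (adjMap (PreDG.Hom.toHom F) tDeg) _ _ _ ?_ hj x
      intro n i j hj g
      cases g with
      | old hi p => exact map_zero _
      | new x hx => cases x with
        | kappa => exact map_zero _
        | alpha => rfl
    refine complX_ext ?_
    rintro ⟨_ | w, k⟩
    · exact h1 _ _
    · change (adjMap _ tDeg).f n _ (_ + _) = _
      rw [map_add, h1, h2]
      rfl

theorem cast_map {A B : Op.{v, w} R S Tri triDeg} (F : Op.Hom A B) {m l : ℕ} {i j : Tri}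
    (hm : m = l) (hi : i = j) (p : A.X m i) :
    F.f l j (A.cast hm hi p) = B.cast hm hi (F.f m i p) := by
  subst hm hi
  rfl

theorem fill_map {A B : Op.{v, w} R S Tri triDeg} (F : Op.Hom A B) {e : Tri} (x : A.X 0 e) :
    ∀ (k : ℕ) {m l : ℕ} {i j : Tri} (b : ℕ) (hb : b ≤ l) (hm : m = l + k) (h : i + k • e = j)
      (p : A.X m i),
      F.f l j (A.fill x k b hb hm h p) = B.fill (F.f 0 e x) k b hb hm h (F.f m i p)
  | 0, _, _, _, _, _, _, hm, h, p => cast_map F hm _ p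
  | k + 1, _, _, _, _, b, hb, hm, h, p => by
    refine (fill_map F x k b hb rfl _ _).trans ?_
    rw [LinearMap.flip_apply, F.map_comp]
    rfl

theorem idx_nsmul (d : ℤ) (k : ℕ) :
    ((d, 0, 0) : Tri) + k • ((0, 0, 1) : Tri) = (d, ((0 : ℕ) : ℤ), (k : ℤ)) := by
  simp

/-- The element `α` of the coproduct. -/
def alpha (P : ZOp.{v, w} R S) : (withT P).X 0 ((0, 0, 1) : Tri) := inNew P tDeg .alpha rfl

/-- The element `κ + ∑ₖ cₖ mₖ(α, …, α)` of the completed coproduct. -/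
def twistedKappa (c : ℕ → R) (P : ZOp.{v, w} R S) (m : ∀ n : ℕ, P.X n (-1)) :
    (compl (withT P)).X 0 (-1) :=
  kappa P + series P fun k =>
    c k • (withT P).fill (alpha P) k 0 le_rfl (zero_add k).symm (idx_nsmul (-1) k)
      (inOld P tDeg rfl (m k))

theorem twistedKappa_map {P P' : ZOp.{v, w} R S} (F : Op.Hom P P') (c : ℕ → R)
    (m : ∀ n : ℕ, P.X n (-1)) :
    (complMap (adjMap F tDeg)).f 0 (-1) (twistedKappa c P m) =
      twistedKappa c P' fun n => F.f n (-1) (m n) := by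
  refine complX_ext ?_
  rintro ⟨_ | _ | w, k⟩
  · change (adjMap F tDeg).f 0 _ (0 + c k • _) = 0 + c k • _
    rw [map_add, map_zero, map_smul, fill_map, adjMap_old]
    rfl
  · cases k with
    | zero =>
      change (adjMap F tDeg).f 0 _ (inNew P tDeg .kappa _ + 0) = inNew P' tDeg .kappa _ + 0
      rw [map_add, map_zero]
      rfl
    | succ k =>
      change (adjMap F tDeg).f 0 _ (0 + 0) = 0 + 0
      rw [map_add, map_zero]
  · change (adjMap F tDeg).f 0 _ (0 + 0) = 0 + 0
    rw [map_add, map_zero]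

/-- The suboperad of the elements of the completed coproduct without `κ`, that is, the completed
coproduct of `P` and `[α]`. -/
def kappaFree (P : ZOp.{v, w} R S) : SubOp (compl (withT P)) where
  carrier n i :=
    { carrier := {x : complX (withT P) n i | ∀ u : ℕ × ℕ, u.1 ≠ 0 → x.1 u = 0}
      add_mem' := fun {x y} hx hy u hu => by
        change x.1 u + y.1 u = 0
        rw [hx u hu, hy u hu, add_zero]
      zero_mem' := fun _ _ => rfl
      smul_mem' := fun r x hx u hu => by
        change r • x.1 u = 0
        rw [hx u hu, smul_zero] }
  one_mem := by
    rintro i h ⟨_ | w, k⟩ hu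
    · simp at hu
    · rfl
  comp_mem := by
    intro m n l i j k a hl hk p q hp hq u hu
    refine (complComp_apply a hl hk p q u).trans (Finset.sum_eq_zero fun x hx => ?_)
    rw [mem_splits] at hx
    by_cases h : x.1.1 = 0
    · rw [hq x.2 (by
        intro h'
        apply hu
        rw [← hx, Prod.fst_add, h, h']), map_zero]
    · rw [hp x.1 h, map_zero, LinearMap.zero_apply]
  act_mem := by
    intro n i hS σ p hp u hu
    change (withT P).act hS σ (p.1 u) = 0
    rw [hp u hu, map_zero]

/-- The quadruple of the completed coproduct with `T`, its differential `d_P + d_T`,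
the element `κ + ∑ₖ cₖ mₖ(α, …, α)`, and the completed coproduct of `P` and `[α]`. -/
def twistQuad (c : ℕ → R) (P : DGOp.{v, w} R S) (m : ∀ n : ℕ, P.obj.op.X n (-1)) :
    Quad.{v, max v w} R S where
  dg := twistDG P.property
  κ := twistedKappa c P.obj.op m
  sub := kappaFree P.obj.op

/-- The functor to quadruples from the dg operads under `B`, where `B` has chosen elements
`mₙ` of arity `n` and degree `-1`; on morphisms it is `f ↦ f ∨ 1`. -/
def twistFunctor (c : ℕ → R) (B : DGOp.{v, w} R S) (m : ∀ n : ℕ, B.obj.op.X n (-1)) :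
    Under B ⥤ Quad.{v, max v w} R S where
  obj P := twistQuad c P.right fun n => DGOp.ev P.hom (m n)
  map {P P'} F :=
    { toDG := twistMap P.right.property P'.right.property F.right.hom
      map_κ := by
        have hm : (fun n => DGOp.ev F.right (DGOp.ev P.hom (m n))) =
            fun n => DGOp.ev P'.hom (m n) := by
          rw [← Under.w F]
          rfl
        refine (twistedKappa_map (PreDG.Hom.toHom F.right.hom) c _).trans ?_
        exact congrArg (twistedKappa c P'.right.obj.op) hm
      map_sub := fun {n i x} hx u hu => by
        change (adjMap _ tDeg).f n _ (x.1 u) = 0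
        rw [hx u hu, map_zero] }
  map_id P := Quad.Hom.ext' (PreDG.Hom.ext' fun n i x => complX_ext fun u =>
    pres_hom_ext (adjMap _ tDeg) (Op.Hom.id _) (fun n i g => by cases g <;> rfl) (x.1 u))
  map_comp F F' := Quad.Hom.ext' (PreDG.Hom.ext' fun n i x => complX_ext fun u =>
    pres_hom_ext (adjMap _ tDeg) ((adjMap _ tDeg).trans (adjMap _ tDeg))
      (fun n i g => by cases g <;> rfl) (x.1 u))

/-- The map `1_P ∨ 0` from the completed coproduct of `P` and `T` to `P`. -/
def epsilon (P : ZOp.{v, w} R S) {n : ℕ} {d : ℤ} (x : (compl (withT P)).X n d) : P.X n d :=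
  adjEval (Op.Hom.id P) tDeg (fun _ => 0) (x.1 (0, 0))

end Curv

/-! The operads `cA∞` and `cL∞`. -/

section CurvedInfinity

/-- The generators: one of arity `n` and degree `-1` for each `n ≥ 0`. -/
inductive MuGen : ℕ → ℤ → Type w
  | mu (n : ℕ) : MuGen n (-1)

variable (R : Type v) [CommRing R] (S : Prop)

/-- In the symmetric case, the generators are invariant under the symmetric groups. -/
inductive MuRel : ∀ (n : ℕ) (i : ℤ), Tm R S MuGen.{w} n i → Tm R S MuGen.{w} n i → Prop
  | inv (n : ℕ) (hS : S) (σ : Equiv.Perm (Fin n)) :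
      MuRel n (-1) (.act hS σ (.gen (.mu n))) (.gen (.mu n))

/-- The free operad on the generators. -/
abbrev muOp : ZOp.{v, max v w} R S := presOp (AddMonoidHom.id ℤ) (MuRel.{v, w} R S)

/-- The generator of arity `n`. -/
def mu (n : ℕ) : (muOp.{v, w} R S).X n (-1) := Pres.cl (.gen (.mu n))

theorem act_mu (hS : S) {n : ℕ} (σ : Equiv.Perm (Fin n)) :
    (muOp.{v, w} R S).act hS σ (mu R S n) = mu R S n :=
  Pres.cl_eq (.of (.inv n hS σ))

variable {R S} in
/-- The free operad on the generators, with the derivation that sends the `n`-th generator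
to `D n`. -/
def muDG (D : ∀ n : ℕ, (muOp.{v, w} R S).X n (-1 + -1))
    (hD : ∀ (hS : S) (n : ℕ) (σ : Equiv.Perm (Fin n)), (muOp R S).act hS σ (D n) = D n) :
    PreDG.{v, max v w} R S where
  op := muOp R S
  d h := Pres.der (deg := AddMonoidHom.id ℤ) (-1 : ℤ)
    (fun n i j h g => match n, i, h, g with
      | n, _, h, .mu _ => (muOp R S).cast rfl h (D n)) rfl (by
    intro n i j h p q hr
    cases hr with
    | inv hS σ =>
      subst h
      exact hD hS _ σ) h

variable {R S} in
/-- The quadruple of this operad, its generator of arity zero, and the suboperad generated by the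
generators of positive arity. -/
def muQuad (D : ∀ n : ℕ, (muOp.{v, w} R S).X n (-1 + -1))
    (hD : ∀ (hS : S) (n : ℕ) (σ : Equiv.Perm (Fin n)), (muOp R S).act hS σ (D n) = D n) :
    Quad.{v, max v w} R S where
  dg := muDG D hD
  κ := mu R S 0
  sub := SubOp.generated (muOp R S) fun n i =>
    {x | 0 < n ∧ ∃ g : MuGen n i, x = Pres.cl (.gen g)}

/-- The differential of `cA∞` on generators: `μₙ ↦ - ∑ μ_{p+1+r} ∘_{p+1} μ_q`, the sum over
`p + q + r = n`. -/
def dMu (n : ℕ) : (muOp.{v, w} R S).X n (-1 + -1) :=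
  -∑ p : Fin (n + 1), ∑ q : Fin (n + 1 - p),
    (muOp R S).comp (⟨p, by omega⟩ : Fin (p + 1 + (n - p - q))) (n := q) (by omega) rfl
      (mu R S (p + 1 + (n - p - q))) (mu R S q)

/-- The inverse of `σ` is a shuffle of the first `q` and the remaining places. -/
def IsInvShuffle {n : ℕ} (q : ℕ) (σ : Equiv.Perm (Fin n)) : Prop :=
  ∀ i j : Fin n, i < j → ((j : ℕ) < q ∨ q ≤ (i : ℕ)) → σ⁻¹ i < σ⁻¹ j

open Classical in
/-- The differential of `cL∞` on generators: `ℓₙ ↦ - ∑ (ℓ_{p+1} ∘₁ ℓ_q)^σ`, the sum over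
`p + q = n` and the inverse shuffles `σ`. -/
def dEll (n : ℕ) : (muOp.{v, w} R True).X n (-1 + -1) :=
  -∑ q : Fin (n + 1), ∑ σ : Equiv.Perm (Fin n) with IsInvShuffle q σ,
    (muOp R True).act trivial σ ((muOp R True).comp (0 : Fin (n - q + 1)) (n := q) (by omega) rfl
      (mu R True (n - q + 1)) (mu R True q))

theorem perm_apply_inv {n : ℕ} (π : Equiv.Perm (Fin n)) (x : Fin n) : π (π⁻¹ x) = x :=
  Equiv.apply_symm_apply π x

/-- `π` preserves the set of the first `q` places. -/
def Preserves {n : ℕ} (q : ℕ) (π : Equiv.Perm (Fin n)) : Prop :=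
  ∀ x : Fin n, (π x : ℕ) < q ↔ (x : ℕ) < q

theorem invShuffle_unique {n q : ℕ} {σ π : Equiv.Perm (Fin n)} (hσ : IsInvShuffle q σ)
    (hπ : Preserves q π) (h : IsInvShuffle q (π * σ)) : π = 1 := by
  have hmono : StrictMono (π⁻¹ : Equiv.Perm (Fin n)) := by
    intro i j hij
    have hi := hπ (π⁻¹ i)
    have hj := hπ (π⁻¹ j)
    rw [perm_apply_inv] at hi hj
    have hij' : (i : ℕ) < j := hij
    by_cases hb : (j : ℕ) < q ∨ q ≤ (i : ℕ)
    · have h1 := h i j hij hb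
      rw [mul_inv_rev, Equiv.Perm.mul_apply, Equiv.Perm.mul_apply] at h1
      by_contra hlt
      rcases eq_or_lt_of_le (not_lt.1 hlt) with h2 | h2
      · rw [h2] at h1
        exact lt_irrefl _ h1
      · exact lt_asymm h1 (hσ _ _ h2 (by omega))
    · show ((π⁻¹ i : Fin n) : ℕ) < (π⁻¹ j : Fin n)
      omega
  have : (π⁻¹ : Equiv.Perm (Fin n)) = 1 := by
    have h1 : (hmono.orderIsoOfSurjective _ (π⁻¹ : Equiv.Perm (Fin n)).surjective) =
        OrderIso.refl _ := Subsingleton.elim _ _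
    ext i
    exact congrArg Fin.val (DFunLike.congr_fun h1 i)
  rwa [inv_eq_one] at this

theorem invShuffle_exists {n q : ℕ} (hq : q ≤ n) (ρ : Equiv.Perm (Fin n)) :
    ∃ π : Equiv.Perm (Fin n), Preserves q π ∧ IsInvShuffle q (π * ρ) := by
  obtain ⟨p, rfl⟩ := Nat.exists_eq_add_of_le hq
  set A : Finset (Fin (q + p)) := Finset.univ.filter fun x => (ρ x : ℕ) < q with hA
  have hc : A.card = q := by
    have : A = (Finset.univ.image (Fin.castAdd p : Fin q → Fin (q + p))).image (ρ⁻¹ : Equiv.Perm (Fin (q + p))) := by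
      ext x
      simp only [hA, Finset.mem_filter, Finset.mem_univ, true_and, Finset.mem_image,
        exists_exists_eq_and]
      constructor
      · intro hx
        exact ⟨⟨ρ x, hx⟩, by rw [Equiv.Perm.inv_eq_iff_eq]; rfl⟩
      · rintro ⟨y, rfl⟩
        rw [perm_apply_inv]
        exact y.2
    rw [this, Finset.card_image_of_injective _ (ρ⁻¹ : Equiv.Perm _).injective,
      Finset.card_image_of_injective _ (Fin.castAdd_injective q p), Finset.card_univ,
      Fintype.card_fin]
  have hc' : Aᶜ.card = p := by
    rw [Finset.card_compl, hc, Fintype.card_fin]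
    omega
  let s : Equiv.Perm (Fin (q + p)) := finSumFinEquiv.symm.trans (finSumEquivOfFinset hc hc')
  have sl : ∀ x : Fin q, s (Fin.castAdd p x) = A.orderEmbOfFin hc x := by
    intro x
    simp [s]
  have sr : ∀ x : Fin p, s (Fin.natAdd q x) = Aᶜ.orderEmbOfFin hc' x := by
    intro x
    simp [s]
  have smem : ∀ x : Fin (q + p), (ρ (s x) : ℕ) < q ↔ (x : ℕ) < q := by
    intro x
    have : s x ∈ A ↔ (x : ℕ) < q := by
      refine Fin.addCases (fun x => ?_) (fun x => ?_) x
      · rw [sl]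
        simp [Finset.orderEmbOfFin_mem]
      · rw [sr]
        have := Aᶜ.orderEmbOfFin_mem hc' x
        rw [Finset.mem_compl] at this
        simp [this]
    rw [← this, hA, Finset.mem_filter]
    simp
  refine ⟨s⁻¹ * ρ⁻¹, fun x => ?_, ?_⟩
  · have := smem (s⁻¹ (ρ⁻¹ x))
    rw [perm_apply_inv, perm_apply_inv] at this
    rw [Equiv.Perm.mul_apply]
    exact this.symm
  · intro i j hij hb
    rw [inv_mul_cancel_right, inv_inv]
    have hij' : (i : ℕ) < j := hij
    rcases hb with hb | hb
    · have h1 := sl ⟨i, by omega⟩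
      have h2 := sl ⟨j, hb⟩
      change s i = _ at h1
      change s j = _ at h2
      rw [h1, h2]
      exact (A.orderEmbOfFin hc).strictMono hij
    · have h1 := sr ⟨i - q, by omega⟩
      have h2 := sr ⟨j - q, by omega⟩
      rw [show Fin.natAdd q ⟨(i : ℕ) - q, _⟩ = i from Fin.ext (by simp; omega)] at h1
      rw [show Fin.natAdd q ⟨(j : ℕ) - q, _⟩ = j from Fin.ext (by simp; omega)] at h2
      rw [h1, h2]
      refine (Aᶜ.orderEmbOfFin hc').strictMono ?_
      show (i : ℕ) - q < j - q
      omega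

variable {R S}

theorem Preserves.mul {n q : ℕ} {π π' : Equiv.Perm (Fin n)} (h : Preserves q π)
    (h' : Preserves q π') : Preserves q (π * π') := fun x => (h _).trans (h' x)

theorem Preserves.inv {n q : ℕ} {π : Equiv.Perm (Fin n)} (h : Preserves q π) :
    Preserves q π⁻¹ := fun x => by
  have := h (π⁻¹ x)
  rw [perm_apply_inv] at this
  exact this.symm

open Classical in
/-- A sum over inverse shuffles of translates of a block-invariant element is invariant. -/
theorem act_sum_invShuffle {P : ZOp.{v, w} R S} (hS : S) {n q : ℕ} (hq : q ≤ n) {i : ℤ}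
    (x : P.X n i) (hx : ∀ π, Preserves q π → P.act hS π x = x) (τ : Equiv.Perm (Fin n)) :
    P.act hS τ (∑ σ : Equiv.Perm (Fin n) with IsInvShuffle q σ, P.act hS σ x) =
      ∑ σ : Equiv.Perm (Fin n) with IsInvShuffle q σ, P.act hS σ x := by
  choose r hr hr' using fun ρ => invShuffle_exists (n := n) hq ρ
  rw [map_sum]
  have key : ∀ σ τ, IsInvShuffle q σ → r (r (σ * τ) * (σ * τ) * τ⁻¹) *
      (r (σ * τ) * (σ * τ) * τ⁻¹) = σ := by
    intro σ τ hσ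
    have h1 := hr' (r (σ * τ) * (σ * τ) * τ⁻¹)
    have h2 : r (r (σ * τ) * (σ * τ) * τ⁻¹) * (r (σ * τ) * (σ * τ) * τ⁻¹) =
        (r (r (σ * τ) * (σ * τ) * τ⁻¹) * r (σ * τ)) * σ := by
      group
    rw [h2] at h1 ⊢
    rw [invShuffle_unique hσ ((hr _).mul (hr _)) h1, one_mul]
  refine Finset.sum_nbij' (fun σ => r (σ * τ) * (σ * τ)) (fun σ => r (σ * τ⁻¹) * (σ * τ⁻¹))
    ?_ ?_ ?_ ?_ ?_
  · intro σ _
    simpa using hr' _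
  · intro σ _
    simpa using hr' _
  · intro σ hσ
    exact key σ τ (by simpa using hσ)
  · intro σ hσ
    have := key σ τ⁻¹ (by simpa using hσ)
    rwa [inv_inv] at this
  · intro σ _
    rw [P.act_mul, ← P.act_mul hS (r (σ * τ)), hx _ (hr _)]

/-- The composite at the first place of two invariant operations is block-invariant. -/
theorem act_comp_invariant {P : ZOp.{v, w} R S} (hS : S) {n p q : ℕ} {i j k : ℤ}
    (hl : n + 1 = (p + 1) + q) (hk : i + j = k) (x : P.X (p + 1) i) (y : P.X q j)
    (hx : ∀ σ, P.act hS σ x = x) (hy : ∀ σ, P.act hS σ y = y)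
    (π : Equiv.Perm (Fin n)) (hπ : Preserves q π) :
    P.act hS π (P.comp 0 hl hk x y) = P.comp 0 hl hk x y := by
  have hn : n = p + q := by omega
  have hτ : Function.Injective fun k : Fin q =>
      (⟨π ⟨k, by omega⟩, (hπ _).2 k.2⟩ : Fin q) := by
    intro a b hab
    simp only [Fin.mk.injEq, ← Fin.ext_iff] at hab
    have := π.injective hab
    simpa [Fin.ext_iff] using this
  let τ : Equiv.Perm (Fin q) := Equiv.ofBijective _ (Finite.injective_iff_bijective.1 hτ)
  have hge : ∀ x : Fin n, q ≤ (x : ℕ) → q ≤ (π x : ℕ) := fun x h => by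
    have := hπ x
    omega
  let f : Fin (p + 1) → Fin (p + 1) := fun j =>
    if h : (j : ℕ) = 0 then j else ⟨π ⟨j + q - 1, by omega⟩ - q + 1, by
      have := hge ⟨j + q - 1, by omega⟩ (by simp; omega)
      omega⟩
  have hf0 : ∀ j : Fin (p + 1), (j : ℕ) = 0 → (f j : ℕ) = 0 := fun j hj => by
    simp only [f, dif_pos hj, hj]
  have hf1 : ∀ (j : Fin (p + 1)) (_ : (j : ℕ) ≠ 0),
      (f j : ℕ) = π ⟨j + q - 1, by omega⟩ - q + 1 := fun j hj => by
    simp only [f, dif_neg hj]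
  have hσ : Function.Injective f := by
    intro a b hab
    have hab' : (f a : ℕ) = f b := congrArg Fin.val hab
    by_cases ha : (a : ℕ) = 0
    · by_cases hb : (b : ℕ) = 0
      · exact Fin.ext (ha.trans hb.symm)
      · rw [hf0 a ha, hf1 b hb] at hab'
        omega
    · by_cases hb : (b : ℕ) = 0
      · rw [hf0 b hb, hf1 a ha] at hab'
        omega
      · rw [hf1 a ha, hf1 b hb] at hab'
        have h1 := hge ⟨a + q - 1, by omega⟩ (by simp; omega)
        have h2 := hge ⟨b + q - 1, by omega⟩ (by simp; omega)
        have h3 : π ⟨a + q - 1, by omega⟩ = π ⟨b + q - 1, by omega⟩ := Fin.ext (by omega)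
        have h4 := π.injective h3
        simp only [Fin.mk.injEq] at h4
        exact Fin.ext (by omega)
  let σ : Equiv.Perm (Fin (p + 1)) := Equiv.ofBijective f (Finite.injective_iff_bijective.1 hσ)
  have h0 : σ 0 = 0 := Fin.ext (hf0 0 rfl)
  have hb : IsBlockPerm (0 : Fin (p + 1)) σ τ π := by
    constructor
    · intro j x hj hx
      have hj0 : (j : ℕ) ≠ 0 := fun h => hj (Fin.ext (by simpa using h))
      have hx' : x = ⟨j + q - 1, by omega⟩ := Fin.ext (by simpa [outerPlace] using hx)
      have h1 := hge x (by rw [hx']; simp; omega)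
      have h2 : (σ j : ℕ) = π x - q + 1 := by
        rw [hx']
        exact hf1 j hj0
      rw [h0]
      simp only [outerPlace, h2, Fin.val_zero]
      simp
      omega
    · intro k x hx
      have hx' : x = ⟨k, by omega⟩ := Fin.ext (by simpa using hx)
      rw [h0, hx']
      simp [τ]
  have h := P.comp_act hS 0 hl hk σ τ π hb x y
  rw [hx, hy, h0] at h
  exact h.symm

theorem act_dEll (n : ℕ) (τ : Equiv.Perm (Fin n)) :
    (muOp.{v, w} R True).act trivial τ (dEll R n) = dEll R n := by
  rw [dEll, map_neg, map_sum]
  refine congrArg Neg.neg (Finset.sum_congr rfl fun q _ => ?_)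
  refine act_sum_invShuffle trivial (by omega) _ (fun π hπ => ?_) τ
  exact act_comp_invariant trivial _ _ _ _ (fun σ => act_mu R True trivial σ)
    (fun σ => act_mu R True trivial σ) π hπ

variable (R)

/-- The quadruple of `cA∞`: the free nonsymmetric operad with its differential, `μ₀`, and the
suboperad generated by the `μᵢ` with `i > 0`. -/
def cAinf : Quad.{v, max v w} R False := muQuad.{v, w} (dMu R False) fun h => h.elim

/-- The quadruple of `cL∞`. -/
def cLinf : Quad.{v, max v w} R True := muQuad.{v, w} (dEll R) fun _ n τ => act_dEll n τ

end CurvedInfinity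

/-! The twisting formulas. -/

section Formulas

variable {R : Type v} [CommRing R]

/-- `∑ μ_{n+i₀+…+iₙ}(α^{i₀}, -, α^{i₁}, -, …, -, α^{iₙ})`, the sum over all `i₀, …, iₙ ≥ 0`. -/
def twistedMu {S : Prop} (P : ZOp.{v, w} R S) (m : ∀ n : ℕ, P.X n (-1)) (n : ℕ) :
    (compl (withT P)).X n (-1) :=
  series P fun k => ∑ s : {s : Fin (n + 1) → ℕ // s ∈ Finset.Nat.antidiagonalTuple (n + 1) k},
    have hs : (List.ofFn s.1).sum = k := by
      rw [List.sum_ofFn]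
      exact Finset.Nat.mem_antidiagonalTuple.1 s.2
    (withT P).fills (alpha P) (List.ofFn s.1) 0 (by simp) (by rw [hs])
      (by rw [hs]; exact idx_nsmul (-1) k) (inOld P tDeg rfl (m (n + k)))

/-- `∑ₖ 1 / k! ℓ_{k+n}(αᵏ, -)`. -/
def twistedEll {K : Type v} [Field K] {S : Prop} (P : ZOp.{v, w} K S) (m : ∀ n : ℕ, P.X n (-1))
    (n : ℕ) : (compl (withT P)).X n (-1) :=
  series P fun k => (1 / (k.factorial : K)) •
    (withT P).fill (alpha P) k 0 (Nat.zero_le n) rfl (idx_nsmul (-1) k)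
      (inOld P tDeg rfl (m (n + k)))

end Formulas
end
end TwistOperad

open TwistOperad

universe w₁ w₂ w₃

namespace TwistOperad

noncomputable section

section ShiftDerivations

variable {R : Type v} [CommRing R] {S : Prop} {ι : Type} [AddCommMonoid ι] {deg : ι →+ ℤ}

/-- The permutation that fixes the first place and acts by `σ` on the others. -/
def up {n : ℕ} (σ : Equiv.Perm (Fin n)) : Equiv.Perm (Fin (n + 1)) where
  toFun := Fin.cases 0 fun x => (σ x).succ
  invFun := Fin.cases 0 fun x => (σ⁻¹ x).succ
  left_inv x := by refine Fin.cases ?_ (fun x => ?_) x <;> simp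
  right_inv x := by refine Fin.cases ?_ (fun x => ?_) x <;> simp

@[simp] theorem up_zero {n : ℕ} (σ : Equiv.Perm (Fin n)) : up σ 0 = 0 := rfl

@[simp] theorem up_succ {n : ℕ} (σ : Equiv.Perm (Fin n)) (x : Fin n) :
    up σ x.succ = (σ x).succ := rfl

theorem up_one {n : ℕ} : up (1 : Equiv.Perm (Fin n)) = 1 := by
  ext x; refine Fin.cases ?_ (fun x => ?_) x <;> simp

theorem up_mul {n : ℕ} (σ τ : Equiv.Perm (Fin n)) : up (σ * τ) = up σ * up τ := by
  ext x; refine Fin.cases ?_ (fun x => ?_) x <;> simp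

/-- The cyclic permutation `0 ↦ a ↦ a - 1 ↦ ⋯ ↦ 0`. -/
def cyc {n : ℕ} (a : Fin (n + 1)) : Equiv.Perm (Fin (n + 1)) where
  toFun x := ⟨if (x : ℕ) = 0 then a else if (x : ℕ) ≤ a then x - 1 else x, by
    split_ifs <;> omega⟩
  invFun x := ⟨if (x : ℕ) < a then x + 1 else if (x : ℕ) = a then 0 else x, by
    have := a.2
    split_ifs <;> omega⟩
  left_inv x := by ext; grind
  right_inv x := by ext; grind

theorem cyc_val {n : ℕ} (a x : Fin (n + 1)) :
    (cyc a x : ℕ) = if (x : ℕ) = 0 then (a : ℕ) else if (x : ℕ) ≤ a then x - 1 else x := rfl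

theorem cyc_inv_val {n : ℕ} (a x : Fin (n + 1)) :
    ((cyc a)⁻¹ x : ℕ) = if (x : ℕ) < a then (x : ℕ) + 1 else if (x : ℕ) = a then 0 else x := rfl

theorem cyc_zero {n : ℕ} (a : Fin (n + 1)) (ha : (a : ℕ) = 0) : cyc a = 1 := by
  ext x
  rw [cyc_val, ha, Equiv.Perm.one_apply]
  split_ifs <;> omega

/-- The slots in which a new input can be placed: any position among `n` inputs in the
nonsymmetric case, and the first position in the symmetric case. -/
def Slot (S : Prop) (s n : ℕ) : Prop := s ≤ n ∧ (S → s = 0)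

theorem slot_zero (S : Prop) (n : ℕ) : Slot S 0 n := ⟨Nat.zero_le n, fun _ => rfl⟩

open Classical in
/-- The part of a shift derivation of a composite that comes from the outer operation. -/
def Op.outer (B : Op.{v, w} R S ι deg) {m n l : ℕ} {i j k : ι} (a : Fin m)
    (hl : l + 1 = m + 1 + n) (hk : i + j = k) (s : ℕ) (u : ℕ → B.X (m + 1) i) (y : B.X n j) :
    B.X l k :=
  if S then B.comp a.succ hl hk (u 0) y else
    (if s ≤ a then B.comp a.succ hl hk (u s) y else 0) +
      if a + n ≤ s then B.comp a.castSucc hl hk (u (s + 1 - n)) y else 0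

open Classical in
/-- The part of a shift derivation of a composite that comes from the inner operation. -/
def Op.inner (B : Op.{v, w} R S ι deg) {m n l : ℕ} {i j k : ι} (a : Fin m)
    (hl : l + 1 + 1 = m + (n + 1)) (hk : i + j = k) (s : ℕ) (x : B.X m i)
    (v : ℕ → B.X (n + 1) j) : B.X (l + 1) k :=
  if hS : S then B.act hS (cyc ⟨a, by omega⟩) (B.comp a hl hk x (v 0)) else
    if a ≤ s ∧ s ≤ a + n then B.comp a hl hk x (v (s - a)) else 0

namespace Op

variable (B : Op.{v, w} R S ι deg)

theorem outer_sym (hS : S) {m n l : ℕ} {i j k : ι} (a : Fin m)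
    (hl : l + 1 = m + 1 + n) (hk : i + j = k) (s : ℕ) (u : ℕ → B.X (m + 1) i) (y : B.X n j) :
    B.outer a hl hk s u y = B.comp a.succ hl hk (u 0) y := if_pos hS

theorem outer_ns (hS : ¬S) {m n l : ℕ} {i j k : ι} (a : Fin m)
    (hl : l + 1 = m + 1 + n) (hk : i + j = k) (s : ℕ) (u : ℕ → B.X (m + 1) i) (y : B.X n j) :
    B.outer a hl hk s u y = (if s ≤ a then B.comp a.succ hl hk (u s) y else 0) +
      if a + n ≤ s then B.comp a.castSucc hl hk (u (s + 1 - n)) y else 0 := by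
  rw [outer, if_neg hS]

theorem inner_sym (hS : S) {m n l : ℕ} {i j k : ι} (a : Fin m)
    (hl : l + 1 + 1 = m + (n + 1)) (hk : i + j = k) (s : ℕ) (x : B.X m i)
    (v : ℕ → B.X (n + 1) j) :
    B.inner a hl hk s x v = B.act hS (cyc ⟨a, by omega⟩) (B.comp a hl hk x (v 0)) := dif_pos hS

theorem inner_ns (hS : ¬S) {m n l : ℕ} {i j k : ι} (a : Fin m)
    (hl : l + 1 + 1 = m + (n + 1)) (hk : i + j = k) (s : ℕ) (x : B.X m i)
    (v : ℕ → B.X (n + 1) j) :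
    B.inner a hl hk s x v =
      if a ≤ s ∧ s ≤ a + n then B.comp a hl hk x (v (s - a)) else 0 := by
  rw [inner, dif_neg hS]

theorem comp_act_left {m n l : ℕ} {i j k : ι} (hS : S) (a : Fin m) (hl : l + 1 = m + n)
    (hk : i + j = k) (σ : Equiv.Perm (Fin m)) (ρ : Equiv.Perm (Fin l))
    (h : IsBlockPerm a σ (1 : Equiv.Perm (Fin n)) ρ) (p : B.X m i) (q : B.X n j) :
    B.comp a hl hk (B.act hS σ p) q = B.act hS ρ (B.comp (σ a) hl hk p q) := by
  have := B.comp_act hS a hl hk σ 1 ρ h p q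
  rwa [B.act_one] at this

theorem comp_act_right {m n l : ℕ} {i j k : ι} (hS : S) (a : Fin m) (hl : l + 1 = m + n)
    (hk : i + j = k) (τ : Equiv.Perm (Fin n)) (ρ : Equiv.Perm (Fin l))
    (h : IsBlockPerm a 1 τ ρ) (p : B.X m i) (q : B.X n j) :
    B.comp a hl hk p (B.act hS τ q) = B.act hS ρ (B.comp a hl hk p q) := by
  have := B.comp_act hS a hl hk 1 τ ρ h p q
  rwa [B.act_one] at this

variable {B}

theorem comp_eq {m n l : ℕ} {i j k : ι} {a b : Fin m} (h : (a : ℕ) = b) (hl : l + 1 = m + n)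
    (hk : i + j = k) (p : B.X m i) (q : B.X n j) :
    B.comp a hl hk p q = B.comp b hl hk p q := by
  rw [Fin.ext h]

section Linear

variable {m n l : ℕ} {i j k : ι} (a : Fin m)

theorem outer_congr (hl : l + 1 + 1 = m + 1 + n) (hk : i + j = k) {s : ℕ} (hs : Slot S s l)
    {u u' : ℕ → B.X (m + 1) i} (h : ∀ t, Slot S t m → u t = u' t) (y : B.X n j) :
    B.outer a hl hk s u y = B.outer a hl hk s u' y := by
  by_cases hS : S
  · rw [outer_sym B hS, outer_sym B hS, h 0 (slot_zero S m)]
  · rw [outer_ns B hS, outer_ns B hS]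
    have h1 := hs.1
    congr 1
    · split_ifs
      · rw [h _ ⟨by omega, fun h => (hS h).elim⟩]
      · rfl
    · split_ifs
      · rw [h _ ⟨by omega, fun h => (hS h).elim⟩]
      · rfl

theorem inner_congr (hl : l + 1 + 1 = m + (n + 1)) (hk : i + j = k) (s : ℕ) (x : B.X m i)
    {v v' : ℕ → B.X (n + 1) j} (h : ∀ t, Slot S t n → v t = v' t) :
    B.inner a hl hk s x v = B.inner a hl hk s x v' := by
  by_cases hS : S
  · rw [inner_sym B hS, inner_sym B hS, h 0 (slot_zero S n)]
  · rw [inner_ns B hS, inner_ns B hS]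
    split_ifs
    · rw [h _ ⟨by omega, fun h => (hS h).elim⟩]
    · rfl

variable (hl : l + 1 = m + 1 + n) (hl' : l + 1 + 1 = m + (n + 1)) (hk : i + j = k) (s : ℕ)

theorem outer_add_left (u u' : ℕ → B.X (m + 1) i) (y : B.X n j) :
    B.outer a hl hk s (fun t => u t + u' t) y =
      B.outer a hl hk s u y + B.outer a hl hk s u' y := by
  unfold outer
  split_ifs <;> simp <;> abel

theorem outer_smul_left (r : R) (u : ℕ → B.X (m + 1) i) (y : B.X n j) :
    B.outer a hl hk s (fun t => r • u t) y = r • B.outer a hl hk s u y := by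
  unfold outer
  split_ifs <;> simp

theorem outer_zero_left (y : B.X n j) :
    B.outer a hl hk s (fun _ => (0 : B.X (m + 1) i)) y = 0 := by
  unfold outer
  split_ifs <;> simp

theorem outer_add_right (u : ℕ → B.X (m + 1) i) (y y' : B.X n j) :
    B.outer a hl hk s u (y + y') = B.outer a hl hk s u y + B.outer a hl hk s u y' := by
  unfold outer
  split_ifs <;> simp <;> abel

theorem outer_smul_right (r : R) (u : ℕ → B.X (m + 1) i) (y : B.X n j) :
    B.outer a hl hk s u (r • y) = r • B.outer a hl hk s u y := by
  unfold outer
  split_ifs <;> simp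

theorem outer_zero_right (u : ℕ → B.X (m + 1) i) :
    B.outer a hl hk s u (0 : B.X n j) = 0 := by
  unfold outer
  split_ifs <;> simp

theorem inner_add_left (x x' : B.X m i) (v : ℕ → B.X (n + 1) j) :
    B.inner a hl' hk s (x + x') v = B.inner a hl' hk s x v + B.inner a hl' hk s x' v := by
  unfold inner
  split_ifs <;> simp

theorem inner_smul_left (r : R) (x : B.X m i) (v : ℕ → B.X (n + 1) j) :
    B.inner a hl' hk s (r • x) v = r • B.inner a hl' hk s x v := by
  unfold inner
  split_ifs <;> simp

theorem inner_zero_left (v : ℕ → B.X (n + 1) j) :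
    B.inner a hl' hk s (0 : B.X m i) v = 0 := by
  unfold inner
  split_ifs <;> simp

theorem inner_add_right (x : B.X m i) (v v' : ℕ → B.X (n + 1) j) :
    B.inner a hl' hk s x (fun t => v t + v' t) =
      B.inner a hl' hk s x v + B.inner a hl' hk s x v' := by
  unfold inner
  split_ifs <;> simp

theorem inner_smul_right (r : R) (x : B.X m i) (v : ℕ → B.X (n + 1) j) :
    B.inner a hl' hk s x (fun t => r • v t) = r • B.inner a hl' hk s x v := by
  unfold inner
  split_ifs <;> simp

theorem inner_zero_right (x : B.X m i) :
    B.inner a hl' hk s x (fun _ => (0 : B.X (n + 1) j)) = 0 := by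
  unfold inner
  split_ifs <;> simp

end Linear

theorem ite_add_ite {M : Type w} [AddCommMonoid M] (P Q Q' : Prop) [Decidable P] [Decidable Q]
    [Decidable Q'] (x y : M) :
    (if P then (if Q then x else 0) + (if Q' then y else 0) else 0) =
      (if P ∧ Q then x else 0) + (if P ∧ Q' then y else 0) := by
  by_cases h : P <;> simp [h]

theorem comp_ite_left (P : Prop) [Decidable P] {m n l : ℕ} {i j k : ι} (a : Fin m)
    (hl : l + 1 = m + n) (hk : i + j = k) (x : B.X m i) (y : B.X n j) :
    B.comp a hl hk (if P then x else 0) y = if P then B.comp a hl hk x y else 0 := by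
  split_ifs <;> simp

theorem comp_ite_right (P : Prop) [Decidable P] {m n l : ℕ} {i j k : ι} (a : Fin m)
    (hl : l + 1 = m + n) (hk : i + j = k) (x : B.X m i) (y : B.X n j) :
    B.comp a hl hk x (if P then y else 0) = if P then B.comp a hl hk x y else 0 := by
  split_ifs <;> simp

section Seq

variable {m n r l l' t : ℕ} {i j k ij jk ijk : ι} (a : Fin m) (b : Fin n) (c : Fin l)
  (hc : (c : ℕ) = a + b) (k1 : i + j = ij) (k2 : ij + k = ijk) (k3 : j + k = jk)
  (k4 : i + jk = ijk) {s : ℕ}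

include hc in
theorem outer_outer_seq (h1 : l + 1 + 1 = m + 1 + n) (h2 : t + 1 = l + 1 + r) (h3 : l' + 1 = n + r)
    (h4 : t + 1 = m + 1 + l') (u : ℕ → B.X (m + 1) i) (y : B.X n j)
    (z : B.X r k) :
    B.outer c h2 k2 s (fun s => B.outer a h1 k1 s u y) z =
      B.outer a h4 k4 s u (B.comp b h3 k3 y z) := by
  have hb := b.2
  by_cases hS : S
  · simp only [outer_sym B hS]
    exact B.comp_seq _ _ _ (by (try simp) <;> omega) _ _ _ _ _ _ _ _ _ _ _
  · simp only [outer_ns B hS, map_add, LinearMap.add_apply, comp_ite_left]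
    split_ifs
    all_goals first
      | (exfalso; omega)
      | (simp only [add_zero, zero_add]; done)
      | (simp only [add_zero, zero_add]
         first
          | (exact B.comp_seq _ _ _ (by (try simp) <;> omega) _ _ _ _ _ _ _ _ _ _ _)
          | (rw [show s + 1 - r + 1 - n = s + 1 - l' by omega]
             congr 1 <;> exact B.comp_seq _ _ _ (by (try simp) <;> omega) _ _ _ _ _ _ _ _ _ _ _)
          | (rw [show s + 1 - r + 1 - n = s + 1 - l' by omega]
             exact B.comp_seq _ _ _ (by (try simp) <;> omega) _ _ _ _ _ _ _ _ _ _ _))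

include hc in
theorem outer_inner_seq (h1 : l + 1 + 1 = m + (n + 1)) (h2 : t + 1 + 1 = l + 1 + r)
    (h3 : l' + 1 + 1 = n + 1 + r)
    (h4 : t + 1 + 1 = m + (l' + 1)) (x : B.X m i)
    (v : ℕ → B.X (n + 1) j) (z : B.X r k) :
    B.outer c h2 k2 s (fun s => B.inner a h1 k1 s x v) z =
      B.inner a h4 k4 s x (fun s => B.outer b h3 k3 s v z) := by
  have hb := b.2
  by_cases hS : S
  · simp only [outer_sym B hS, inner_sym B hS]
    rw [B.comp_act_left hS _ _ _ _ (cyc ⟨a, by omega⟩)]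
    · congr 1
      exact B.comp_seq _ _ _ (by rw [cyc_val]; grind)
        _ _ _ _ _ _ _ _ _ _ _
    · constructor
      · intro x y hx hy
        have hx' : (x : ℕ) ≠ c + 1 := fun h => hx (Fin.ext (by simpa using h))
        simp only [outerPlace, Fin.val_succ, cyc_val] at hy ⊢
        grind
      · intro x y hy
        simp only [Fin.val_succ, cyc_val, Equiv.Perm.one_apply] at hy ⊢
        grind
  · simp only [outer_ns B hS, inner_ns B hS, map_add, comp_ite_left, comp_ite_right]
    split_ifs
    all_goals first
      | (exfalso; omega)
      | (simp only [add_zero, zero_add]; done)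
      | (try simp only [add_zero, zero_add]
         try rw [show s + 1 - r - a = s - a + 1 - r by omega]
         first
          | (exact B.comp_seq _ _ _ (by (try simp) <;> omega) _ _ _ _ _ _ _ _ _ _ _)
          | (congr 1 <;> exact B.comp_seq _ _ _ (by (try simp) <;> omega) _ _ _ _ _ _ _ _ _ _ _))

include hc in
theorem inner_comp_seq (h1 : l + 1 = m + n) (h2 : t + 1 + 1 = l + (r + 1))
    (h3 : l' + 1 + 1 = n + (r + 1)) (h4 : t + 1 + 1 = m + (l' + 1)) (x : B.X m i) (y : B.X n j)
    (w : ℕ → B.X (r + 1) k) :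
    B.inner c h2 k2 s (B.comp a h1 k1 x y) w =
      B.inner a h4 k4 s x (fun s => B.inner b h3 k3 s y w) := by
  have hb := b.2
  by_cases hS : S
  · simp only [inner_sym B hS]
    rw [B.comp_act_right hS _ _ _ _ (cyc ⟨c, by omega⟩ * (cyc ⟨a, by omega⟩)⁻¹), B.act_mul,
      inv_mul_cancel_right]
    · congr 1
      exact B.comp_seq _ _ _ hc _ _ _ _ _ _ _ _ _ _ _
    · constructor
      · intro x y hx hy
        have hx' : (x : ℕ) ≠ a := fun h => hx (Fin.ext h)
        simp only [outerPlace, Equiv.Perm.mul_apply, cyc_val, cyc_inv_val,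
          Equiv.Perm.one_apply] at hy ⊢
        grind
      · intro x y hy
        simp only [Equiv.Perm.mul_apply, cyc_val, cyc_inv_val, Equiv.Perm.one_apply] at hy ⊢
        grind
  · simp only [inner_ns B hS, comp_ite_right]
    split_ifs
    all_goals first
      | (exfalso; omega)
      | rfl
      | (rw [show s - c = s - a - b by omega]
         exact B.comp_seq _ _ _ hc _ _ _ _ _ _ _ _ _ _ _)

end Seq

section Par

variable {m n r l l' t : ℕ} {i j k ij ik ijk : ι} (a b : Fin m) (c : Fin l) (a' : Fin l')
    (hab : a < b) (hc : (c : ℕ) + 1 = b + n) (ha : (a' : ℕ) = a)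
    (k1 : i + j = ij) (k2 : ij + k = ijk) (k3 : i + k = ik) (k4 : ik + j = ijk) {s : ℕ}

include hab hc ha

theorem outer_outer_par (h1 : l + 1 + 1 = m + 1 + n) {r' : ℕ} (h2 : t + 1 = l + 1 + r')
    (h3 : l' + 1 + 1 = m + 1 + r') (h4 : t + 1 = l' + 1 + n) (u : ℕ → B.X (m + 1) i) (y : B.X n j)
    (z : B.X r' k) :
    B.outer c h2 k2 s (fun s => B.outer a h1 k1 s u y) z =
      sgn R (deg j * deg k) •
        B.outer a' h4 k4 s (fun s => B.outer b h3 k3 s u z) y := by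
  have hab' : (a : ℕ) < b := hab
  by_cases hS : S
  · simp only [outer_sym B hS]
    exact B.comp_par _ _ _ _ (by simpa using hab) (by (try simp) <;> omega) (by simpa using ha)
      _ _ _ _ _ _ _ _ _ _ _
  · have key := fun a b c a' q1 q2 q3 u =>
      B.comp_par a b c a' q1 q2 q3 h1 h2 h3 h4 k1 k2 k3 k4 u y z
    generalize sgn R (deg j * deg k) = r at key ⊢
    have e1 : ∀ (s : ℕ) (c : Fin (l + 1)), B.comp c h2 k2 (B.outer a h1 k1 s u y) z =
        (if s ≤ a then B.comp c h2 k2 (B.comp a.succ h1 k1 (u s) y) z else 0) +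
        if a + n ≤ s then B.comp c h2 k2 (B.comp a.castSucc h1 k1 (u (s + 1 - n)) y) z else 0 := by
      intro s c
      rw [outer_ns B hS, LinearMap.map_add, LinearMap.add_apply, comp_ite_left, comp_ite_left]
    have e2 : ∀ (s : ℕ) (c : Fin (l' + 1)), B.comp c h4 k4 (B.outer b h3 k3 s u z) y =
        (if s ≤ b then B.comp c h4 k4 (B.comp b.succ h3 k3 (u s) z) y else 0) +
        if b + r' ≤ s then B.comp c h4 k4 (B.comp b.castSucc h3 k3 (u (s + 1 - r')) z) y else 0 := by
      intro s c
      rw [outer_ns B hS, LinearMap.map_add, LinearMap.add_apply, comp_ite_left, comp_ite_left]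
    rw [outer_ns B hS c, outer_ns B hS a', e1, e1, e2, e2]
    clear e1 e2
    rw [ite_add_ite, ite_add_ite, ite_add_ite, ite_add_ite,
      if_neg (show ¬(c + r' ≤ s ∧ s + 1 - r' ≤ a) by omega),
      if_neg (show ¬(s ≤ a' ∧ b + r' ≤ s) by omega), zero_add, add_zero, smul_add, smul_add,
      smul_ite, smul_ite, smul_ite, smul_zero, add_assoc]
    congr 1
    · refine if_congr (by omega) ?_ rfl
      exact key a.succ b.succ c.succ a'.succ (show (a : ℕ) + 1 < b + 1 by omega)
        (show (c : ℕ) + 1 + 1 = b + 1 + n by omega) (show (a' : ℕ) + 1 = a + 1 by omega) _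
    · congr 1
      · refine if_congr (by omega) ?_ rfl
        exact key a.castSucc b.succ c.succ a'.castSucc (show (a : ℕ) < b + 1 by omega)
          (show (c : ℕ) + 1 + 1 = b + 1 + n by omega) ha _
      · refine if_ctx_congr (by omega) (fun _ => ?_) fun _ => rfl
        rw [show s + 1 - r' + 1 - n = s + 1 - n + 1 - r' by omega]
        exact key a.castSucc b.castSucc c.castSucc a'.castSucc hab hc ha _

theorem outer_inner_par (h1 : l + 1 + 1 = m + (n + 1)) (h2 : t + 1 + 1 = l + 1 + r)
    (h3 : l' + 1 = m + r) (h4 : t + 1 + 1 = l' + (n + 1)) (x : B.X m i)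
    (v : ℕ → B.X (n + 1) j) (z : B.X r k) :
    B.outer c h2 k2 s (fun s => B.inner a h1 k1 s x v) z =
      sgn R (deg j * deg k) • B.inner a' h4 k4 s (B.comp b h3 k3 x z) v := by
  have hab' : (a : ℕ) < b := hab
  by_cases hS : S
  · simp only [outer_sym B hS, inner_sym B hS]
    rw [B.comp_act_left hS _ _ _ _ (cyc ⟨a, by omega⟩)]
    · simp only [ha]
      rw [← map_smul]
      congr 1
      exact B.comp_par _ _ _ _ hab (by rw [cyc_val]; grind) ha _ _ _ _ _ _ _ _ _ _ _
    · constructor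
      · intro x y hx hy
        have hx' : (x : ℕ) ≠ c + 1 := fun h => hx (Fin.ext (by simpa using h))
        simp only [outerPlace, Fin.val_succ, cyc_val] at hy ⊢
        grind
      · intro x y hy
        simp only [Fin.val_succ, cyc_val, Equiv.Perm.one_apply] at hy ⊢
        grind
  · simp only [outer_ns B hS, inner_ns B hS, comp_ite_left, ha]
    split_ifs
    all_goals first
      | (exfalso; omega)
      | (simp only [add_zero, smul_zero]; done)
      | (simp only [add_zero, zero_add]
         exact B.comp_par _ _ _ _ hab (by (try simp) <;> omega) ha _ _ _ _ _ _ _ _ _ _ _)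

theorem inner_comp_par (h1 : l + 1 = m + n) (h2 : t + 1 + 1 = l + (r + 1))
    (h3 : l' + 1 + 1 = m + (r + 1)) (h4 : t + 1 + 1 = l' + 1 + n) (x : B.X m i) (y : B.X n j)
    (w : ℕ → B.X (r + 1) k) :
    B.inner c h2 k2 s (B.comp a h1 k1 x y) w =
      sgn R (deg j * deg k) •
        B.outer a' h4 k4 s (fun s => B.inner b h3 k3 s x w) y := by
  have hab' : (a : ℕ) < b := hab
  by_cases hS : S
  · simp only [outer_sym B hS, inner_sym B hS]
    rw [B.comp_act_left hS _ _ _ _ (cyc ⟨c, by omega⟩), ← map_smul]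
    · congr 1
      exact B.comp_par _ _ _ _ hab (by omega) (by rw [cyc_val]; grind) _ _ _ _ _ _ _ _ _ _ _
    · constructor
      · intro x y hx hy
        have hx' : (x : ℕ) ≠ a' + 1 := fun h => hx (Fin.ext (by simpa using h))
        simp only [outerPlace, Fin.val_succ, cyc_val] at hy ⊢
        grind
      · intro x y hy
        simp only [Fin.val_succ, cyc_val, Equiv.Perm.one_apply] at hy ⊢
        grind
  · simp only [outer_ns B hS, inner_ns B hS, comp_ite_left, ha]
    split_ifs
    all_goals first
      | (exfalso; omega)
      | (simp only [add_zero, smul_zero]; done)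
      | (simp only [zero_add]
         rw [show s + 1 - n - b = s - c by omega]
         exact B.comp_par _ _ _ _ hab (by omega) (by simpa using ha) _ _ _ _ _ _ _ _ _ _ _)

end Par
end Op
end ShiftDerivations
end
end TwistOperad

namespace TwistOperad

noncomputable section

section ShiftDer

variable {R : Type v} [CommRing R] {S : Prop} {ι : Type} [AddCommMonoid ι] {deg : ι →+ ℤ}

/-- Families of linear maps of degree `δ` that add one input, indexed by slots. -/
abbrev ShiftMap (A : Op.{v, w} R S ι deg) (B : Op.{v, w'} R S ι deg) (δ : ι) :=
  ∀ (_ : ℕ) {n : ℕ} {i j : ι}, i + δ = j → A.X n i →ₗ[R] B.X (n + 1) j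

/-- Shift derivations along a morphism of operads: they replace, in all possible ways, one
occurrence of some operation of arity zero by a new input that is placed in the given slot. -/
structure IsShiftDer {A : Op.{v, w} R S ι deg} {B : Op.{v, w'} R S ι deg} (F : Op.Hom A B) (δ : ι)
    (D : ShiftMap A B δ) : Prop where
  one : ∀ {s : ℕ} {i j : ι} (h : i = 0) (hj : i + δ = j), Slot S s 1 → D s hj (A.one h) = 0
  comp : ∀ {s m n l : ℕ} {i j k k' : ι} (a : Fin m) (hl : l + 1 = m + n) (hk : i + j = k)
    (hk' : k + δ = k') (p : A.X m i) (q : A.X n j), Slot S s l →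
    D s hk' (A.comp a hl hk p q) =
      B.outer a (by omega) (by rw [← hk', ← hk, add_right_comm]) s (fun t => D t rfl p)
        (F.f n j q) +
      sgn R (deg δ * deg i) •
        B.inner a (by omega) (by rw [← hk', ← hk, add_assoc]) s (F.f m i p) (fun t => D t rfl q)
  act : ∀ {n : ℕ} {i j : ι} (hS : S) (σ : Equiv.Perm (Fin n)) (hj : i + δ = j) (p : A.X n i),
    D 0 hj (A.act hS σ p) = B.act hS (up σ) (D 0 hj p)

namespace Pres

variable {G : ℕ → ι → Type w} {E : ∀ (n : ℕ) (i : ι), Tm R S G n i → Tm R S G n i → Prop} (δ : ι)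
  (D : ∀ (_ n : ℕ) (i j : ι), i + δ = j → G n i → (presOp deg E).X (n + 1) j)

/-- The value on a formal expression of the shift derivation that has the values `D` on
generators. -/
def shiftTm (s : ℕ) : ∀ {n : ℕ} {i j : ι}, i + δ = j → Tm R S G n i → (presOp deg E).X (n + 1) j
  | _, _, _, h, .gen g => D s _ _ _ h g
  | _, _, _, _, .one _ => 0
  | _, _, _, h, .comp (i := i) a hl hk p q =>
      (presOp deg E).outer a (by omega) (by rw [← h, ← hk, add_right_comm]) s
        (fun t => shiftTm t rfl p) (cl q) +
      sgn R (deg δ * deg i) •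
        (presOp deg E).inner a (by omega) (by rw [← h, ← hk, add_assoc]) s (cl p)
          (fun t => shiftTm t rfl q)
  | _, _, _, h, .act hS σ p => (presOp deg E).act hS (up σ) (shiftTm s h p)
  | _, _, _, _, .zero => 0
  | _, _, _, h, .add p q => shiftTm s h p + shiftTm s h q
  | _, _, _, h, .smul r p => r • shiftTm s h p

end Pres

theorem sgn_mul_congr (R : Type v) [CommRing R] {a b c d : ℤ} (h : ∃ k, a + b = c + d + 2 * k) :
    sgn R a * sgn R b = sgn R c * sgn R d := by
  rw [← sgn_add, ← sgn_add]
  exact sgn_congr R h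

theorem isBlockPerm_up_left {m n l : ℕ} {a : Fin m} {σ : Equiv.Perm (Fin m)}
    {τ : Equiv.Perm (Fin n)} {ρ : Equiv.Perm (Fin l)}
    (h : IsBlockPerm a σ τ ρ) : IsBlockPerm a.succ (up σ) τ (up ρ) := by
  constructor
  · intro j x hj hx
    induction j using Fin.cases with
    | zero =>
      have : x = 0 := by
        ext
        rw [hx]
        simp [outerPlace]
      subst this
      simp [outerPlace]
    | succ j =>
      have hj' : j ≠ a := fun h => hj (by rw [h])
      have hj'' : (j : ℕ) ≠ a := fun h => hj' (Fin.ext h)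
      have hj3 : (σ j : ℕ) ≠ σ a := fun h => hj' (σ.injective (Fin.ext h))
      induction x using Fin.cases with
      | zero => 
        simp only [outerPlace, Fin.val_succ, Fin.val_zero] at hx
        split_ifs at hx <;> omega
      | succ x =>
        have := h.1 j x hj' (by
          simp only [outerPlace, Fin.val_succ] at hx ⊢
          split_ifs at hx ⊢ <;> omega)
        rw [up_succ, up_succ, up_succ, Fin.val_succ, this]
        simp only [outerPlace, Fin.val_succ]
        split_ifs <;> omega
  · intro k x hx
    induction x using Fin.cases with
    | zero => simp at hx; omega
    | succ x =>
      have := h.2 k x (by simp at hx; omega)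
      simp [this]
      omega

theorem isBlockPerm_up_right {m n l : ℕ} {a : Fin m} {σ : Equiv.Perm (Fin m)}
    {τ : Equiv.Perm (Fin n)} {ρ : Equiv.Perm (Fin l)} (hl : l + 1 = m + n)
    (h : IsBlockPerm a σ τ ρ) (a' b' : Fin (l + 1)) (ha : (a' : ℕ) = a) (hb : (b' : ℕ) = σ a) :
    IsBlockPerm a σ (up τ) (cyc b' * up ρ * (cyc a')⁻¹) := by
  have val : ∀ (x : Fin l), (up ρ x.succ : ℕ) = ρ x + 1 := fun x => by simp
  constructor
  · intro j x hj hx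
    have hj' : (j : ℕ) ≠ a := fun h => hj (Fin.ext h)
    have hj3 : (σ j : ℕ) ≠ σ a := fun h => hj (σ.injective (Fin.ext h))
    have hy := h.1 j ⟨outerPlace a n j, by simp only [outerPlace]; split_ifs <;> omega⟩ hj rfl
    have e : (cyc a')⁻¹ x = (⟨outerPlace a n j, by
        simp only [outerPlace]; split_ifs <;> omega⟩ : Fin l).succ := by
      ext
      rw [cyc_inv_val]
      simp only [outerPlace, Fin.val_succ] at hx ⊢
      grind
    rw [Equiv.Perm.mul_apply, Equiv.Perm.mul_apply, e, cyc_val, val, hy]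
    simp only [outerPlace]
    grind
  · intro k x hx
    induction k using Fin.cases with
    | zero =>
      have e : (cyc a')⁻¹ x = 0 := by
        ext
        have hx' : (x : ℕ) = a := by simpa using hx
        rw [cyc_inv_val, if_neg (by omega), if_pos (by omega)]
        rfl
      rw [Equiv.Perm.mul_apply, Equiv.Perm.mul_apply, e, up_zero, cyc_val]
      simp [hb]
    | succ k =>
      have hy := h.2 k ⟨a + k, by omega⟩ rfl
      have e : (cyc a')⁻¹ x = (⟨a + k, by omega⟩ : Fin l).succ := by
        ext
        rw [cyc_inv_val]
        simp only [Fin.val_succ] at hx ⊢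
        grind
      rw [Equiv.Perm.mul_apply, Equiv.Perm.mul_apply, e, cyc_val, val, hy]
      simp only [up_succ, Fin.val_succ]
      grind

namespace Pres

variable {G : ℕ → ι → Type w} {E : ∀ (n : ℕ) (i : ι), Tm R S G n i → Tm R S G n i → Prop} (δ : ι)
  (D : ∀ (_ n : ℕ) (i j : ι), i + δ = j → G n i → (presOp deg E).X (n + 1) j)

theorem shiftTm_rel
    (hE : ∀ (s n : ℕ) (i j : ι) (h : i + δ = j) (p q : Tm R S G n i), E n i p q → Slot S s n →
      shiftTm δ D s h p = shiftTm δ D s h q)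
    {n : ℕ} {i : ι} {p q : Tm R S G n i} (h : Rel deg E p q) :
    ∀ {s : ℕ} {j : ι} (hj : i + δ = j), Slot S s n → shiftTm δ D s hj p = shiftTm δ D s hj q := by
  induction h with
  | of h => intro s j hj hs; exact hE _ _ _ _ hj _ _ h hs
  | refl => intro s j hj hs; rfl
  | symm _ ih => intro s j hj hs; exact (ih hj hs).symm
  | trans _ _ ih1 ih2 => intro s j hj hs; exact (ih1 hj hs).trans (ih2 hj hs)
  | comp_congr a hl hk h1 h2 ih1 ih2 =>
    intro s j hj hs
    simp only [shiftTm, cl_eq h1, cl_eq h2]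
    rw [Op.outer_congr a _ _ hs fun t ht => ih1 rfl ht, Op.inner_congr a _ _ _ _ fun t ht => ih2 rfl ht]
  | act_congr hS σ _ ih => intro s j hj hs; simp only [shiftTm, ih hj hs]
  | add_congr _ _ ih1 ih2 => intro s j hj hs; simp only [shiftTm, ih1 hj hs, ih2 hj hs]
  | smul_congr r _ ih => intro s j hj hs; simp only [shiftTm, ih hj hs]
  | add_assoc => intro s j hj hs; simp only [shiftTm]; abel
  | add_comm => intro s j hj hs; simp only [shiftTm]; abel
  | zero_add => intro s j hj hs; simp only [shiftTm, _root_.zero_add]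
  | zero_smul => intro s j hj hs; simp only [shiftTm, _root_.zero_smul]
  | one_smul => intro s j hj hs; simp only [shiftTm, _root_.one_smul]
  | mul_smul => intro s j hj hs; simp only [shiftTm, SemigroupAction.mul_smul]
  | add_smul => intro s j hj hs; simp only [shiftTm, _root_.add_smul]
  | smul_add => intro s j hj hs; simp only [shiftTm, _root_.smul_add]
  | add_comp =>
    intro s j hj hs
    simp only [shiftTm, cl_add, Op.outer_add_left, Op.inner_add_left, _root_.smul_add]; abel
  | comp_add =>
    intro s j hj hs
    simp only [shiftTm, cl_add, Op.outer_add_right, Op.inner_add_right, _root_.smul_add]; abel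
  | smul_comp a hl hk r =>
    intro s j hj hs
    simp only [shiftTm, cl_smul, Op.outer_smul_left, Op.inner_smul_left, _root_.smul_add,
      smul_comm r]
  | comp_smul a hl hk r =>
    intro s j hj hs
    simp only [shiftTm, cl_smul, Op.outer_smul_right, Op.inner_smul_right, _root_.smul_add,
      smul_comm r]
  | act_add => intro s j hj hs; simp only [shiftTm, map_add]
  | act_smul => intro s j hj hs; simp only [shiftTm, map_smul]
  | @one_comp n i e a hl he hk p =>
    intro s j hj hs
    subst hj
    have ha : (a : ℕ) = 0 := by omega
    simp only [shiftTm, cl_one, Op.outer_zero_left, _root_.zero_add, he, map_zero, mul_zero,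
      sgn_zero, _root_.one_smul]
    by_cases hS : S
    · rw [Op.inner_sym _ hS, cyc_zero _ (by simp), Op.act_one, hs.2 hS]
      exact (presOp deg E).one_comp _ _ _ _ _
    · have := hs.1
      rw [Op.inner_ns _ hS, if_pos (by omega), ha, Nat.sub_zero]
      exact (presOp deg E).one_comp _ _ _ _ _
  | @comp_one n i e a hl he hk p =>
    intro s j hj hs
    subst hj he
    simp only [shiftTm, cl_one, Op.inner_zero_right, smul_zero, _root_.add_zero]
    have h : ∀ (y : ι) (hy : y = i + δ) (h' : y + 0 = i + δ) (s : ℕ) (b : Fin (n + 1)) (hl),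
        ((presOp deg E).comp b hl h') (shiftTm δ D s hy.symm p) ((presOp deg E).one rfl) =
          shiftTm δ D s rfl p := by
      intro y hy h' s b hl
      subst hy
      exact (presOp deg E).comp_one _ _ _ _ _
    by_cases hS : S
    · rw [Op.outer_sym _ hS, hs.2 hS]
      exact h _ rfl _ _ _ _
    · rw [Op.outer_ns _ hS, Nat.add_sub_cancel, h _ rfl, h _ rfl]
      split_ifs <;> first | omega | simp
  | comp_seq a b c hc h1 h2 h3 h4 k1 k2 k3 k4 p q z =>
    intro s j hj hs
    simp only [shiftTm, cl_comp, Op.outer_add_left, Op.outer_smul_left, Op.inner_add_right,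
      Op.inner_smul_right, _root_.smul_add, smul_smul, ← k1, map_add, mul_add, sgn_add]
    rw [← _root_.add_assoc]
    congr 1
    · congr 1
      · exact Op.outer_outer_seq a b c hc _ _ _ _ _ _ _ _ _ _ _
      · congr 1
        exact Op.outer_inner_seq a b c hc _ _ _ _ _ _ _ _ _ _ _
    · congr 1
      exact Op.inner_comp_seq a b c hc _ _ _ _ _ _ _ _ _ _ _
  | @comp_par m n r l l' t i j k ij ik ijk a b c a' hab hc ha h1 h2 h3 h4 k1 k2 k3 k4 p q z =>
    intro s x hx hs
    have e1 : sgn R (deg δ * deg i) * sgn R (deg (j + δ) * deg k) =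
        sgn R (deg j * deg k) * sgn R (deg δ * deg ik) := by
      rw [← k3, map_add, map_add]
      exact sgn_mul_congr R ⟨0, by ring⟩
    have e2 : sgn R (deg δ * deg ij) * sgn R (deg j * deg (k + δ)) =
        sgn R (deg j * deg k) * sgn R (deg δ * deg i) := by
      rw [← k1, map_add, map_add]
      exact sgn_mul_congr R ⟨deg δ * deg j, by ring⟩
    simp only [shiftTm, cl_comp, Op.outer_add_left, Op.outer_smul_left, _root_.smul_add, smul_smul]
    rw [Op.outer_outer_par a b c a' hab hc ha _ _ (show i + δ + k = ik + δ by
          rw [← k3, _root_.add_right_comm]) (by rw [← hx, ← k4, _root_.add_right_comm])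
          (by omega) (by omega) (by omega) (by omega),
      Op.outer_inner_par a b c a' hab hc ha _ _ k3 (by rw [← hx, ← k4, _root_.add_assoc])
          (by omega) (by omega) (by omega) (by omega),
      Op.inner_comp_par a b c a' hab hc ha _ _ (show i + (k + δ) = ik + δ by
          rw [← k3, _root_.add_assoc]) (by rw [← hx, ← k4, _root_.add_right_comm])
          (by omega) (by omega) (by omega) (by omega), smul_smul, smul_smul, e1, e2]
    abel
  | act_one =>
    intro s j hj hs
    simp only [shiftTm, up_one]
    exact (presOp deg E).act_one _ _
  | act_mul =>
    intro s j hj hs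
    simp only [shiftTm, up_mul]
    exact (presOp deg E).act_mul _ _ _ _
  | comp_act hS a hl hk σ τ ρ hρ p q =>
    intro s j hj hs
    simp only [shiftTm, cl_act, Op.outer_sym _ hS, Op.inner_sym _ hS, map_add, map_smul]
    rw [(presOp deg E).comp_act hS _ _ _ _ _ _ (isBlockPerm_up_left hρ),
      (presOp deg E).comp_act hS _ _ _ _ _ _ (isBlockPerm_up_right hl hρ ⟨a, by omega⟩
        ⟨σ a, by omega⟩ rfl rfl), Op.act_mul, Op.act_mul, inv_mul_cancel_right]
    rfl

open Classical in
/-- The shift derivation of a presented operad with given values on generators. -/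
def shift
    (hE : ∀ (s n : ℕ) (i j : ι) (h : i + δ = j) (p q : Tm R S G n i), E n i p q → Slot S s n →
      shiftTm δ D s h p = shiftTm δ D s h q) : ShiftMap (presOp deg E) (presOp deg E) δ :=
  fun s n _ _ h => if hs : Slot S s n then
    { toFun := Quot.lift (shiftTm δ D s h) fun _ _ hr => shiftTm_rel δ D hE hr h hs
      map_add' := by rintro ⟨p⟩ ⟨q⟩; rfl
      map_smul' := by rintro r ⟨p⟩; rfl } else 0

variable {δ D}

theorem shift_cl {hE} {s n : ℕ} {i j : ι} (h : i + δ = j) (hs : Slot S s n) (p : Tm R S G n i) :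
    shift (deg := deg) δ D hE s h (cl p) = shiftTm δ D s h p := by
  rw [shift, dif_pos hs]
  rfl

theorem isShiftDer_shift (hE) :
    IsShiftDer (Op.Hom.id _) δ (shift (deg := deg) δ D hE) where
  one h hj hs := shift_cl hj hs (.one h)
  comp := by
    intro s m n l i j k k' a hl hk hk' p q hs
    induction p using cl_ind with | h p => ?_
    induction q using cl_ind with | h q => ?_
    refine (shift_cl hk' hs (.comp a hl hk p q)).trans ?_
    rw [Op.outer_congr a _ _ hs fun t ht => shift_cl rfl ht p,
      Op.inner_congr a _ _ _ _ fun t ht => shift_cl rfl ht q]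
    rfl
  act := by
    intro n i j hS σ hj p
    induction p using cl_ind with | h p => ?_
    rw [shift_cl hj (slot_zero S n)]
    exact shift_cl hj (slot_zero S n) (.act hS σ p)

end Pres
end ShiftDer
end
end TwistOperad

namespace TwistOperad

noncomputable section

section Brackets

variable {R : Type v} [CommRing R] {S : Prop} {ι : Type} [AddCommMonoid ι] {deg : ι →+ ℤ}

theorem Op.Hom.map_outer {A : Op.{v, w} R S ι deg} {B : Op.{v, w'} R S ι deg} (F : Op.Hom A B)
    {m n l : ℕ} {i j k : ι} (a : Fin m) (hl : l + 1 = m + 1 + n) (hk : i + j = k) (s : ℕ)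
    (u : ℕ → A.X (m + 1) i) (y : A.X n j) :
    F.f l k (A.outer a hl hk s u y) = B.outer a hl hk s (fun t => F.f _ _ (u t)) (F.f _ _ y) := by
  unfold Op.outer
  split_ifs <;> simp [F.map_comp]

theorem Op.Hom.map_inner {A : Op.{v, w} R S ι deg} {B : Op.{v, w'} R S ι deg} (F : Op.Hom A B)
    {m n l : ℕ} {i j k : ι} (a : Fin m) (hl : l + 1 + 1 = m + (n + 1)) (hk : i + j = k) (s : ℕ)
    (x : A.X m i) (v : ℕ → A.X (n + 1) j) :
    F.f _ k (A.inner a hl hk s x v) = B.inner a hl hk s (F.f _ _ x) (fun t => F.f _ _ (v t)) := by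
  unfold Op.inner
  split_ifs <;> simp [F.map_comp, F.map_act]

/-- A shift derivation followed by a morphism. -/
theorem IsShiftDer.hom_comp {A : Op.{v, w₁} R S ι deg} {A' : Op.{v, w₂} R S ι deg}
    {B : Op.{v, w₃} R S ι deg}
    {F : Op.Hom A A'} {δ : ι} {D : ShiftMap A A' δ} (h : IsShiftDer F δ D) (F' : Op.Hom A' B)
    (G : Op.Hom A B) (hG : ∀ n i p, G.f n i p = F'.f n i (F.f n i p)) :
    IsShiftDer G δ
      ((fun s _ _ _ hj => (F'.f _ _).comp (D s hj)) : ShiftMap A B δ) where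
  one hi hj hs := by simp [h.one hi hj hs]
  comp a hl hk hk' p q hs := by
    simp only [LinearMap.comp_apply, h.comp a hl hk hk' p q hs, LinearMap.map_add,
      LinearMap.map_smul, F'.map_outer, F'.map_inner, hG]
  act hS σ hj p := by simp [h.act hS σ hj p, F'.map_act]

/-- A morphism followed by a shift derivation. -/
theorem IsShiftDer.comp_hom {A : Op.{v, w₁} R S ι deg} {A' : Op.{v, w₂} R S ι deg}
    {B : Op.{v, w₃} R S ι deg}
    {F' : Op.Hom A' B} {δ : ι} {D : ShiftMap A' B δ} (h : IsShiftDer F' δ D) (F : Op.Hom A A')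
    (G : Op.Hom A B) (hG : ∀ n i p, G.f n i p = F'.f n i (F.f n i p)) :
    IsShiftDer G δ
      ((fun s _ _ _ hj => (D s hj).comp (F.f _ _)) : ShiftMap A B δ) where
  one hi hj hs := by simp [h.one hi hj hs, F.map_one]
  comp a hl hk hk' p q hs := by
    simp only [LinearMap.comp_apply, F.map_comp, h.comp a hl hk hk' _ _ hs, hG]
  act hS σ hj p := by simp [h.act hS σ hj, F.map_act]

section Ext

variable {A : Op.{v, w} R S ι deg} {B : Op.{v, w'} R S ι deg} {F : Op.Hom A B} {δ : ι}
  {D D' : ShiftMap A B δ}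

/-- Two shift maps agree on an element, in all slots. -/
def ShiftAgree (D D' : ShiftMap A B δ) {n : ℕ} {i : ι} (p : A.X n i) : Prop :=
  ∀ (s : ℕ) (j : ι) (hj : i + δ = j), Slot S s n → D s hj p = D' s hj p

theorem ShiftAgree.one (h : IsShiftDer F δ D) (h' : IsShiftDer F δ D') {i : ι} (hi : i = 0) :
    ShiftAgree D D' (A.one hi) := fun s j hj hs => by
  rw [h.one hi hj hs, h'.one hi hj hs]

theorem ShiftAgree.comp (h : IsShiftDer F δ D) (h' : IsShiftDer F δ D') {m n l : ℕ} {i j k : ι}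
    (a : Fin m) (hl : l + 1 = m + n) (hk : i + j = k) {p : A.X m i} {q : A.X n j}
    (hp : ShiftAgree D D' p) (hq : ShiftAgree D D' q) :
    ShiftAgree D D' (A.comp a hl hk p q) := fun s j' hj hs => by
  rw [h.comp a hl hk hj p q hs, h'.comp a hl hk hj p q hs,
    Op.outer_congr a _ _ hs fun t ht => hp t _ rfl ht,
    Op.inner_congr a _ _ _ _ fun t ht => hq t _ rfl ht]

theorem ShiftAgree.act (h : IsShiftDer F δ D) (h' : IsShiftDer F δ D') {n : ℕ} {i : ι} (hS : S)
    (σ : Equiv.Perm (Fin n)) {p : A.X n i} (hp : ShiftAgree D D' p) :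
    ShiftAgree D D' (A.act hS σ p) := fun s j hj hs => by
  rw [hs.2 hS, h.act, h'.act, hp 0 j hj (slot_zero S n)]

theorem ShiftAgree.zero {n : ℕ} {i : ι} : ShiftAgree D D' (0 : A.X n i) := fun s j hj hs => by
  rw [map_zero, map_zero]

theorem ShiftAgree.add {n : ℕ} {i : ι} {p q : A.X n i} (hp : ShiftAgree D D' p)
    (hq : ShiftAgree D D' q) : ShiftAgree D D' (p + q) := fun s j hj hs => by
  rw [map_add, map_add, hp s j hj hs, hq s j hj hs]

theorem ShiftAgree.smul {n : ℕ} {i : ι} (r : R) {p : A.X n i} (hp : ShiftAgree D D' p) :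
    ShiftAgree D D' (r • p) := fun s j hj hs => by
  rw [map_smul, map_smul, hp s j hj hs]

/-- Shift derivations on a presented operad are determined by their values on generators. -/
theorem shiftAgree_pres {G : ℕ → ι → Type w} {E : ∀ (n : ℕ) (i : ι), Tm R S G n i →
    Tm R S G n i → Prop} {F : Op.Hom (presOp deg E) B} {D D' : ShiftMap (presOp deg E) B δ}
    (h : IsShiftDer F δ D) (h' : IsShiftDer F δ D')
    (hg : ∀ {n i} (g : G n i), ShiftAgree D D' (Pres.cl (.gen g) : (presOp deg E).X n i))
    {n : ℕ} {i : ι} (x : (presOp deg E).X n i) : ShiftAgree D D' x := by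
  induction x using Pres.cl_ind with | h p => ?_
  induction p with
  | gen g => exact hg g
  | one hi => exact .one h h' hi
  | comp a hl hk p q ih ih' => exact .comp h h' a hl hk ih ih'
  | act hS σ p ih => exact .act h h' hS σ ih
  | zero => exact .zero
  | add p q ih ih' => exact .add ih ih'
  | smul r p ih => exact .smul r ih

end Ext

/-- The zero map is a shift derivation. -/
theorem isShiftDer_zero {A : Op.{v, w} R S ι deg} {B : Op.{v, w'} R S ι deg} (F : Op.Hom A B)
    (δ : ι) : IsShiftDer F δ (fun _ _ _ _ _ => 0) where
  one _ _ _ := rfl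
  comp a hl hk hk' p q hs := by
    simp [Op.outer_zero_left, Op.inner_zero_right]
  act hS σ hj p := by simp

/-- Derivations of odd degree of an operad. -/
structure IsDer (A : Op.{v, w} R S ι deg) (δ : ι)
    (d : ∀ {n : ℕ} {i j : ι}, i + δ = j → A.X n i →ₗ[R] A.X n j) : Prop where
  odd : deg δ = -1
  one : ∀ {i j : ι} (h : i = 0) (hj : i + δ = j), d hj (A.one h) = 0
  comp : ∀ {m n l : ℕ} {i j k k' : ι} (a : Fin m) (hl : l + 1 = m + n) (hk : i + j = k)
    (hk' : k + δ = k') (p : A.X m i) (q : A.X n j),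
    d hk' (A.comp a hl hk p q) =
      A.comp a hl (by rw [← hk', ← hk, add_right_comm]) (d rfl p) q +
      sgn R (deg i) • A.comp a hl (by rw [← hk', ← hk, add_assoc]) p (d rfl q)
  act : ∀ {n : ℕ} {i j : ι} (hS : S) (σ : Equiv.Perm (Fin n)) (h : i + δ = j) (p : A.X n i),
    d h (A.act hS σ p) = A.act hS σ (d h p)

theorem isDer_der {G : ℕ → ι → Type w} {E : ∀ (n : ℕ) (i : ι), Tm R S G n i → Tm R S G n i → Prop}
    {δ : ι} {D : ∀ (n : ℕ) (i j : ι), i + δ = j → G n i → (presOp deg E).X n j}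
    (hδ : deg δ = -1) (hE) : IsDer (presOp deg E) δ (Pres.der δ D hδ hE) where
  odd := hδ
  one _ _ := rfl
  comp := by
    intro m n l i j k t a hl hk ht p q
    induction p using Pres.cl_ind with | h p => ?_
    induction q using Pres.cl_ind with | h q => ?_
    rfl
  act := by
    intro n i t hS σ ht p
    induction p using Pres.cl_ind with | h p => ?_
    rfl

theorem IsDG.isDer {P : PreDG.{v, w} R S} (hP : IsDG P) : IsDer P.op (-1) P.d where
  odd := rfl
  one := hP.d_one
  comp a hl hk hk' p q := hP.leibniz a hl hk rfl rfl hk' p q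
  act := hP.d_act

namespace IsDer

variable {A : Op.{v, w} R S ι deg} {δ' : ι}
  {d : ∀ {n : ℕ} {i j : ι}, i + δ' = j → A.X n i →ₗ[R] A.X n j} (hd : IsDer A δ' d)

include hd

theorem outer {m n l : ℕ} {i j k k' : ι} (a : Fin m) (hl : l + 1 = m + 1 + n) (hk : i + j = k)
    (hk' : k + δ' = k') (s : ℕ) (u : ℕ → A.X (m + 1) i) (y : A.X n j) :
    d hk' (A.outer a hl hk s u y) =
      A.outer a hl (by rw [← hk', ← hk, add_right_comm]) s (fun t => d rfl (u t)) y +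
      sgn R (deg i) • A.outer a hl (by rw [← hk', ← hk, add_assoc]) s u (d rfl y) := by
  unfold Op.outer
  split_ifs <;> simp [hd.comp] <;> abel

theorem inner {m n l : ℕ} {i j k k' : ι} (a : Fin m) (hl : l + 1 + 1 = m + (n + 1))
    (hk : i + j = k)
    (hk' : k + δ' = k') (s : ℕ) (x : A.X m i) (v : ℕ → A.X (n + 1) j) :
    d hk' (A.inner a hl hk s x v) =
      A.inner a hl (by rw [← hk', ← hk, add_right_comm]) s (d rfl x) v +
      sgn R (deg i) • A.inner a hl (by rw [← hk', ← hk, add_assoc]) s x (fun t => d rfl (v t)) := by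
  unfold Op.inner
  split_ifs <;> simp [hd.comp, hd.act]

end IsDer

section Index

variable {B : Op.{v, w} R S ι deg} {m n l : ℕ} {i j k z : ι} (a : Fin m) (s : ℕ)

theorem Op.outer_idx (hl : l + 1 = m + 1 + n) {hk : i + j = k} {hk' : z + j = k} (hz : i = z)
    (g : ∀ z, i = z → ℕ → B.X (m + 1) z) (y : B.X n j) :
    B.outer a hl hk s (g i rfl) y = B.outer a hl hk' s (g z hz) y := by
  subst hz; rfl

theorem Op.inner_idx (hl : l + 1 + 1 = m + (n + 1)) {hk : i + j = k} {hk' : i + z = k}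
    (hz : j = z) (x : B.X m i) (g : ∀ z, j = z → ℕ → B.X (n + 1) z) :
    B.inner a hl hk s x (g j rfl) = B.inner a hl hk' s x (g z hz) := by
  subst hz; rfl

theorem Op.comp_idx_left (hl : l + 1 = m + n) {hk : i + j = k} {hk' : z + j = k} (hz : i = z)
    (g : ∀ z, i = z → B.X m z) (y : B.X n j) :
    B.comp a hl hk (g i rfl) y = B.comp a hl hk' (g z hz) y := by
  subst hz; rfl

theorem Op.comp_idx_right (hl : l + 1 = m + n) {hk : i + j = k} {hk' : i + z = k} (hz : j = z)
    (x : B.X m i) (g : ∀ z, j = z → B.X n z) :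
    B.comp a hl hk x (g j rfl) = B.comp a hl hk' x (g z hz) := by
  subst hz; rfl

end Index

/-- The graded commutator of a shift map and a derivation. -/
def bracket {A : Op.{v, w} R S ι deg} {δ δ' ε : ι} (D : ShiftMap A A δ)
    (d : ∀ {n : ℕ} {i j : ι}, i + δ' = j → A.X n i →ₗ[R] A.X n j) (hε : δ + δ' = ε) :
    ShiftMap A A ε := fun s n i j hj =>
  (D s (show i + δ' + δ = j by rw [← hj, ← hε, add_assoc, add_comm δ])).comp (d rfl) -
    sgn R (deg δ) • (d (show i + δ + δ' = j by rw [← hj, ← hε, add_assoc])).comp (D s rfl)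

theorem bracket_apply {A : Op.{v, w} R S ι deg} {δ δ' ε : ι} (D : ShiftMap A A δ)
    (d : ∀ {n : ℕ} {i j : ι}, i + δ' = j → A.X n i →ₗ[R] A.X n j) (hε : δ + δ' = ε) (s : ℕ)
    {n : ℕ} {i j : ι} (hj : i + ε = j) (p : A.X n i) :
    bracket D d hε s hj p =
      D s (show i + δ' + δ = j by rw [← hj, ← hε, add_assoc, add_comm δ]) (d rfl p) -
      sgn R (deg δ) • d (show i + δ + δ' = j by rw [← hj, ← hε, add_assoc]) (D s rfl p) := rfl

theorem isShiftDer_bracket {A : Op.{v, w} R S ι deg} {δ δ' ε : ι} {D : ShiftMap A A δ}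
    {d : ∀ {n : ℕ} {i j : ι}, i + δ' = j → A.X n i →ₗ[R] A.X n j}
    (hD : IsShiftDer (Op.Hom.id A) δ D) (hd : IsDer A δ' d) (hε : δ + δ' = ε) :
    IsShiftDer (Op.Hom.id A) ε (bracket D d hε) where
  one h hj hs := by
    simp [bracket, hD.one h _ hs, hd.one h]
  comp {s m n l i j k k'} a hl hk hk' p q hs := by
    have e1 : sgn R (deg ε * deg i) = sgn R (deg i) * sgn R (deg δ * deg i) := by
      rw [← sgn_add, ← hε, map_add, hd.odd]
      exact sgn_congr R ⟨-deg i, by ring⟩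
    have e2 : sgn R (deg δ) * sgn R (deg (i + δ)) = sgn R (deg i) := by
      rw [← sgn_add, map_add]
      exact sgn_congr R ⟨deg δ, by ring⟩
    have e3 : sgn R (deg δ * deg (i + δ')) = sgn R (deg δ) * sgn R (deg δ * deg i) := by
      rw [← sgn_add, map_add, hd.odd]
      exact sgn_congr R ⟨-deg δ, by ring⟩
    simp only [bracket_apply]
    rw [hd.comp, LinearMap.map_add, LinearMap.map_smul, hD.comp _ _ _ _ _ _ hs,
      hD.comp _ _ _ _ _ _ hs,
      hD.comp _ _ _ _ _ _ hs, LinearMap.map_add, LinearMap.map_smul, hd.outer, hd.inner]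
    simp only [sub_eq_add_neg, Op.outer_add_left, Op.inner_add_right, ← neg_smul,
      Op.outer_smul_left, Op.inner_smul_right, smul_add, smul_smul]
    rw [Op.outer_idx (hk' := by rw [← hk', ← hk, add_right_comm]) a s _ (by rw [← hε, add_assoc, add_comm δ] : i + δ' + δ = i + ε)
        (fun z h t => D t h (d rfl p)),
      Op.outer_idx (hk' := by rw [← hk', ← hk, add_right_comm]) a s _ (by rw [← hε, add_assoc] : i + δ + δ' = i + ε)
        (fun z h t => d h (D t rfl p)),
      Op.inner_idx (hk' := by rw [← hk', ← hk, add_assoc]) a s _ (by rw [← hε, add_assoc, add_comm δ] : j + δ' + δ = j + ε)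
        _ (fun z h t => D t h (d rfl q)),
      Op.inner_idx (hk' := by rw [← hk', ← hk, add_assoc]) a s _ (by rw [← hε, add_assoc] : j + δ + δ' = j + ε)
        _ (fun z h t => d h (D t rfl q))]
    simp only [Op.Hom.id, LinearMap.id_apply, neg_mul, e1, e2, e3, mul_neg]
    module
  act hS σ hj p := by
    simp [bracket, hD.act, hd.act]

end Brackets
end
end TwistOperad

namespace TwistOperad

noncomputable section

section Commute

variable {R : Type v} [CommRing R] {S : Prop} {ι : Type} [AddCommMonoid ι] {deg : ι →+ ℤ}

open Classical in
theorem IsShiftDer.comp_ns {A : Op.{v, w} R S ι deg} {B : Op.{v, w'} R S ι deg} {F : Op.Hom A B}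
    {δ : ι} {D : ShiftMap A B δ} (h : IsShiftDer F δ D) (hS : ¬S) {s m n l : ℕ}
    {i j k k' i' j' : ι} {a : Fin m} (b c : Fin (m + 1)) {hl : l + 1 = m + n} {hk : i + j = k}
    {hk' : k + δ = k'} {p : A.X m i} {q : A.X n j} (hb : (b : ℕ) = a + 1) (hc : (c : ℕ) = a)
    (hl' : l + 1 + 1 = m + 1 + n) (hl'' : l + 1 + 1 = m + (n + 1)) (hi : i + δ = i')
    (hj : j + δ = j') (hk₁ : i' + j = k') (hk₂ : i + j' = k') (hs : s ≤ l) :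
    D s hk' (A.comp a hl hk p q) =
      (if s ≤ a then B.comp b hl' hk₁ (D s hi p) (F.f n j q) else 0) +
      (if a + n ≤ s then B.comp c hl' hk₁ (D (s + 1 - n) hi p) (F.f n j q) else 0) +
      sgn R (deg δ * deg i) •
        if a ≤ s ∧ s ≤ a + n then B.comp a hl'' hk₂ (F.f m i p) (D (s - a) hj q) else 0 := by
  subst hi hj
  rw [h.comp a hl hk hk' p q ⟨hs, fun h => (hS h).elim⟩, Op.outer_ns _ hS, Op.inner_ns _ hS]
  obtain rfl : b = a.succ := Fin.ext (by simpa using hb)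
  obtain rfl : c = a.castSucc := Fin.ext (by simpa using hc)
  rfl

theorem IsShiftDer.comp_sym {A : Op.{v, w} R S ι deg} {B : Op.{v, w'} R S ι deg} {F : Op.Hom A B}
    {δ : ι} {D : ShiftMap A B δ} (h : IsShiftDer F δ D) (hS : S) {m n l : ℕ}
    {i j k k' i' j' : ι} {a : Fin m} (b : Fin (m + 1)) (c : Fin (l + 1)) {hl : l + 1 = m + n}
    {hk : i + j = k} {hk' : k + δ = k'} {p : A.X m i} {q : A.X n j} (hb : (b : ℕ) = a + 1)
    (hc : (c : ℕ) = a) (hl' : l + 1 + 1 = m + 1 + n) (hl'' : l + 1 + 1 = m + (n + 1))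
    (hi : i + δ = i') (hj : j + δ = j') (hk₁ : i' + j = k') (hk₂ : i + j' = k') :
    D 0 hk' (A.comp a hl hk p q) =
      B.comp b hl' hk₁ (D 0 hi p) (F.f n j q) +
      sgn R (deg δ * deg i) •
        B.act hS (cyc c) (B.comp a hl'' hk₂ (F.f m i p) (D 0 hj q)) := by
  subst hi hj
  rw [h.comp a hl hk hk' p q (slot_zero S l), Op.outer_sym _ hS, Op.inner_sym _ hS]
  obtain rfl : b = a.succ := Fin.ext (by simpa using hb)
  rw [show c = ⟨a, by omega⟩ from Fin.ext (by simpa using hc)]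

theorem ite_nested {M : Type w} [AddCommGroup M] [Module R M] (T a b c : Prop) [Decidable T]
    [Decidable a] [Decidable b] [Decidable c] (u : R) (x y z : M) :
    (if T then (if a then x else 0) + (if b then y else 0) + u • (if c then z else 0) else 0) =
      (if T ∧ a then x else 0) + (if T ∧ b then y else 0) + u • (if T ∧ c then z else 0) := by
  by_cases h : T <;> simp [h]

theorem ite_smul_congr {M : Type w} [AddCommGroup M] [Module R M] {a a' : Prop} [Decidable a]
    [Decidable a'] (r : R) {x x' : M} (h : a ↔ a') (hx : a → x = r • x') :
    (if a then x else 0) = r • (if a' then x' else 0) := by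
  by_cases ha : a
  · rw [if_pos ha, if_pos (h.1 ha), hx ha]
  · rw [if_neg ha, if_neg (ha ∘ h.2), smul_zero]

/-- The comparison of the nine terms of each of two iterated shifts of a composite. -/
theorem ite_shuffle {M : Type w} [AddCommGroup M] [Module R M]
    {T₁ T₂ T₃ A₁ A₂ A₃ B₁ B₂ B₃ C₁ C₂ C₃ : Prop} {T₁' T₂' T₃' A₁' A₂' A₃' B₁' B₂' B₃' C₁' C₂' C₃' : Prop}
    [Decidable T₁] [Decidable T₂] [Decidable T₃] [Decidable A₁] [Decidable A₂] [Decidable A₃]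
    [Decidable B₁] [Decidable B₂] [Decidable B₃] [Decidable C₁] [Decidable C₂] [Decidable C₃]
    [Decidable T₁'] [Decidable T₂'] [Decidable T₃'] [Decidable A₁'] [Decidable A₂'] [Decidable A₃']
    [Decidable B₁'] [Decidable B₂'] [Decidable B₃'] [Decidable C₁'] [Decidable C₂'] [Decidable C₃']
    {u₁ u₂ u₃ v u₁' u₂' u₃' v' g : R} {x₁ x₂ x₃ y₁ y₂ y₃ z₁ z₂ z₃ : M}
    {x₁' x₂' x₃' y₁' y₂' y₃' z₁' z₂' z₃' : M}
    (i₁ : ¬(T₁ ∧ A₂)) (i₂ : ¬(T₁ ∧ A₃)) (i₃ : ¬(T₃ ∧ C₂)) (i₁' : ¬(T₂' ∧ B₁')) (i₂' : ¬(T₂' ∧ B₃'))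
    (i₃' : ¬(T₃' ∧ C₁')) (m₁ : T₁ ∧ A₁ ↔ T₁' ∧ A₁') (m₂ : T₂ ∧ B₁ ↔ T₁' ∧ A₂')
    (m₃ : T₃ ∧ C₁ ↔ T₁' ∧ A₃') (m₄ : T₂ ∧ B₂ ↔ T₂' ∧ B₂') (m₅ : T₂ ∧ B₃ ↔ T₃' ∧ C₂')
    (m₆ : T₃ ∧ C₃ ↔ T₃' ∧ C₃') (r₁ : v = g * u₁') (r₂ : u₂ = g * v') (r₃ : v * u₃ = v' * u₃')
    (e₁ : T₁ ∧ A₁ → x₁ = g • x₁') (e₂ : T₂ ∧ B₁ → y₁ = g • x₂') (e₃ : T₃ ∧ C₁ → z₁ = (1 : R) • x₃')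
    (e₄ : T₂ ∧ B₂ → y₂ = g • y₂') (e₅ : T₂ ∧ B₃ → y₃ = (1 : R) • z₂') (e₆ : T₃ ∧ C₃ → z₃ = g • z₃') :
    (if T₁ then (if A₁ then x₁ else 0) + (if A₂ then x₂ else 0) + u₁ • (if A₃ then x₃ else 0)
        else 0) +
      (if T₂ then (if B₁ then y₁ else 0) + (if B₂ then y₂ else 0) + u₂ • (if B₃ then y₃ else 0)
        else 0) +
      v • (if T₃ then (if C₁ then z₁ else 0) + (if C₂ then z₂ else 0) +
        u₃ • (if C₃ then z₃ else 0) else 0) =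
    g • ((if T₁' then (if A₁' then x₁' else 0) + (if A₂' then x₂' else 0) +
        u₁' • (if A₃' then x₃' else 0) else 0) +
      (if T₂' then (if B₁' then y₁' else 0) + (if B₂' then y₂' else 0) +
        u₂' • (if B₃' then y₃' else 0) else 0) +
      v' • (if T₃' then (if C₁' then z₁' else 0) + (if C₂' then z₂' else 0) +
        u₃' • (if C₃' then z₃' else 0) else 0)) := by
  simp only [ite_nested]
  rw [if_neg i₁, if_neg i₂, if_neg i₃, if_neg i₁', if_neg i₂', if_neg i₃', ite_smul_congr g m₁ e₁,
    ite_smul_congr g m₂ e₂, ite_smul_congr 1 m₃ e₃, ite_smul_congr g m₄ e₄, ite_smul_congr 1 m₅ e₅,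
    ite_smul_congr g m₆ e₆]
  simp only [smul_add, smul_zero, add_zero, zero_add, smul_smul, mul_one]
  rw [show v * (u₃ * g) = g * (v' * u₃') by linear_combination g * r₃, r₁, r₂]
  abel

/-- The graded commutation rule of two shift maps, at an element. -/
structure SComm {A : Op.{v, w} R S ι deg} {δ δ' : ι} (D : ShiftMap A A δ) (D' : ShiftMap A A δ')
    {n : ℕ} {i : ι} (x : A.X n i) : Prop where
  sym : ∀ (hS : S) {j j' k : ι} (h₁ : i + δ' = j') (h₁' : j' + δ = k) (h₂ : i + δ = j)
    (h₂' : j + δ' = k), D 0 h₁' (D' 0 h₁ x) =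
      sgn R (deg δ * deg δ') • A.act hS (cyc 1) (D' 0 h₂' (D 0 h₂ x))
  ns : ∀ (_ : ¬S) {s t : ℕ} {j j' k : ι} (h₁ : i + δ' = j') (h₁' : j' + δ = k) (h₂ : i + δ = j)
    (h₂' : j + δ' = k), s ≤ t → t ≤ n → D s h₁' (D' t h₁ x) =
      sgn R (deg δ * deg δ') • D' (t + 1) h₂' (D s h₂ x)

namespace SComm

variable {A : Op.{v, w} R S ι deg} {δ δ' : ι} {D : ShiftMap A A δ} {D' : ShiftMap A A δ'}

theorem zero {n : ℕ} {i : ι} : SComm D D' (0 : A.X n i) where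
  sym _ _ _ _ _ _ _ _ := by simp only [LinearMap.map_zero, smul_zero]
  ns _ _ _ _ _ _ _ _ _ _ _ _ := by simp only [LinearMap.map_zero, smul_zero]

theorem add {n : ℕ} {i : ι} {x y : A.X n i} (hx : SComm D D' x) (hy : SComm D D' y) :
    SComm D D' (x + y) where
  sym hS _ _ _ h₁ h₁' h₂ h₂' := by
    simp only [LinearMap.map_add, smul_add, hx.sym hS h₁ h₁' h₂ h₂', hy.sym hS h₁ h₁' h₂ h₂']
  ns hS _ _ _ _ _ h₁ h₁' h₂ h₂' hs ht := by
    simp only [LinearMap.map_add, smul_add, hx.ns hS h₁ h₁' h₂ h₂' hs ht,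
      hy.ns hS h₁ h₁' h₂ h₂' hs ht]

theorem smul {n : ℕ} {i : ι} (r : R) {x : A.X n i} (hx : SComm D D' x) : SComm D D' (r • x) where
  sym hS _ _ _ h₁ h₁' h₂ h₂' := by
    simp only [LinearMap.map_smul, hx.sym hS h₁ h₁' h₂ h₂', smul_comm r]
  ns hS _ _ _ _ _ h₁ h₁' h₂ h₂' hs ht := by
    simp only [LinearMap.map_smul, hx.ns hS h₁ h₁' h₂ h₂' hs ht, smul_comm r]

variable (hD : IsShiftDer (Op.Hom.id A) δ D) (hD' : IsShiftDer (Op.Hom.id A) δ' D')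

include hD hD'

theorem one {i : ι} (hi : i = 0) : SComm D D' (A.one hi) where
  sym _ _ _ _ h₁ h₁' h₂ h₂' := by
    rw [hD.one hi h₂ (slot_zero S 1), hD'.one hi h₁ (slot_zero S 1)]
    simp only [LinearMap.map_zero, smul_zero]
  ns hS _ _ _ _ _ h₁ h₁' h₂ h₂' hs ht := by
    rw [hD.one hi h₂ ⟨hs.trans ht, fun h => (hS h).elim⟩,
      hD'.one hi h₁ ⟨ht, fun h => (hS h).elim⟩]
    simp only [LinearMap.map_zero, smul_zero]

omit hD hD' in
theorem cyc_one_mul_up_up {n : ℕ} (σ : Equiv.Perm (Fin n)) :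
    up (up σ) * cyc 1 = cyc 1 * up (up σ) := by
  have c0 : (cyc 1 : Equiv.Perm (Fin (n + 2))) 0 = (0 : Fin (n + 1)).succ := by
    ext; rw [cyc_val]; simp
  have c1 : (cyc 1 : Equiv.Perm (Fin (n + 2))) (0 : Fin (n + 1)).succ = 0 := by
    ext; rw [cyc_val]; simp
  have c2 : ∀ x : Fin n, (cyc 1 : Equiv.Perm (Fin (n + 2))) x.succ.succ = x.succ.succ := by
    intro x; ext; rw [cyc_val]; simp
  refine Equiv.ext fun x => ?_
  rw [Equiv.Perm.mul_apply, Equiv.Perm.mul_apply]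
  induction x using Fin.cases with
  | zero => rw [c0, up_succ, up_zero, up_zero, c0]
  | succ x =>
    induction x using Fin.cases with
    | zero => rw [c1, up_zero, up_succ, up_zero, c1]
    | succ x => rw [c2, up_succ, up_succ, c2]

theorem act {n : ℕ} {i : ι} (hS : S) (σ : Equiv.Perm (Fin n)) {x : A.X n i} (hx : SComm D D' x) :
    SComm D D' (A.act hS σ x) where
  sym _ _ _ _ h₁ h₁' h₂ h₂' := by
    rw [hD.act hS, hD'.act hS, hD'.act hS, hD.act hS, hx.sym hS h₁ h₁' h₂ h₂', LinearMap.map_smul,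
      A.act_mul, A.act_mul, cyc_one_mul_up_up]
  ns hS' := (hS' hS).elim

omit hD hD' in
theorem cyc_succ_mul {n : ℕ} (b : Fin (n + 2)) (a : Fin (n + 1)) (h : (b : ℕ) = a + 1) :
    cyc b * cyc 1 = up (cyc a) := by
  refine Equiv.ext fun x => ?_
  rw [Equiv.Perm.mul_apply]
  ext
  rw [cyc_val, cyc_val]
  induction x using Fin.cases with
  | zero => simp [h]
  | succ x =>
    rw [up_succ, Fin.val_succ, Fin.val_succ, cyc_val, h]
    have : ((1 : Fin (n + 2)) : ℕ) = 1 := rfl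
    grind

omit hD hD' in
theorem isBlockPerm_cyc {m n l : ℕ} (a : Fin m) (b : Fin (l + 1)) (c : Fin (l + 2))
    (hl : l + 1 = m + n) (hb : (b : ℕ) = a) (hc : (c : ℕ) = a) :
    IsBlockPerm a 1 (cyc 1 : Equiv.Perm (Fin (n + 2)))
      (cyc c * up (cyc b) * cyc 1 * (cyc c * up (cyc b))⁻¹) := by
  have ho : ((1 : Fin (l + 2)) : ℕ) = 1 := rfl
  have ho' : ((1 : Fin (n + 2)) : ℕ) = 1 := rfl
  have hu : ∀ x : Fin (l + 2), ((up (cyc b))⁻¹ x : ℕ) =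
      if (x : ℕ) = 0 then (0 : ℕ) else if (x : ℕ) ≤ a then (x : ℕ) + 1 else
        if (x : ℕ) = a + 1 then (1 : ℕ) else (x : ℕ) := by
    intro x
    induction x using Fin.cases with
    | zero => rw [Equiv.Perm.inv_eq_iff_eq.2 (up_zero _).symm]; simp
    | succ x =>
      have : (up (cyc b))⁻¹ x.succ = ((cyc b)⁻¹ x).succ := by
        rw [Equiv.Perm.inv_eq_iff_eq, up_succ, perm_apply_inv]
      rw [this, Fin.val_succ, Fin.val_succ, cyc_inv_val]
      grind
  have hu' : ∀ x : Fin (l + 2), (up (cyc b) x : ℕ) =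
      if (x : ℕ) = 0 then (0 : ℕ) else if (x : ℕ) = 1 then (a : ℕ) + 1 else
        if (x : ℕ) ≤ a + 1 then (x : ℕ) - 1 else (x : ℕ) := by
    intro x
    induction x using Fin.cases with
    | zero => simp
    | succ x =>
      rw [up_succ, Fin.val_succ, Fin.val_succ, cyc_val]
      grind
  constructor
  · intro j x hj hx
    have hj' : (j : ℕ) ≠ a := fun h => hj (Fin.ext h)
    simp only [outerPlace, Equiv.Perm.mul_apply, mul_inv_rev, Equiv.Perm.one_apply, cyc_val,
      cyc_inv_val, hu, hu', hc, ho] at hx ⊢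
    have : (j : ℕ) < m := j.2
    split_ifs at hx
    · simp only [hx]; grind
    · simp only [hx]; grind
  · intro k x hx
    simp only [Equiv.Perm.mul_apply, mul_inv_rev, Equiv.Perm.one_apply, cyc_val,
      cyc_inv_val, hu, hu', hc, ho, ho', hx]
    have : (k : ℕ) < n + 2 := k.2
    grind

theorem comp {m n l : ℕ} {i j k : ι} (a : Fin m) (hl : l + 1 = m + n) (hk : i + j = k)
    {p : A.X m i} {q : A.X n j} (hp : SComm D D' p) (hq : SComm D D' q) :
    SComm D D' (A.comp a hl hk p q) where
  sym hS x y z h₁ h₁' h₂ h₂' := by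
    subst h₁ h₂ hk h₁'
    have ha : (a : ℕ) < l + 1 := by omega
    have e1 : sgn R (deg δ * deg (i + δ')) = sgn R (deg δ * deg i) * sgn R (deg δ * deg δ') := by
      rw [← sgn_add, map_add, mul_add]
    have e2 : sgn R (deg δ' * deg (i + δ)) = sgn R (deg δ' * deg i) * sgn R (deg δ * deg δ') := by
      rw [← sgn_add, map_add, mul_add, mul_comm (deg δ')  (deg δ)]
    have e3 : sgn R (deg δ * deg δ') * sgn R (deg δ * deg δ') = 1 := by
      rw [← sgn_add, ← sgn_zero R]
      exact sgn_congr R ⟨deg δ * deg δ', by ring⟩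
    have d1 := hD.comp_sym hS (a := a.succ) (hl := show l + 1 + 1 = m + 1 + n by omega)
      (hk := show i + δ' + j = i + j + δ' by abel) (k' := i + j + δ' + δ) (hk' := rfl)
      (p := D' 0 rfl p) (q := q) a.succ.succ
      ⟨a + 1, by omega⟩ rfl rfl (by omega) (by omega) rfl rfl (by abel) (by abel)
    have d2 := hD.comp_sym hS (a := a) (hl := show l + 1 + 1 = m + (n + 1) by omega)
      (hk := show i + (j + δ') = i + j + δ' by abel) (k' := i + j + δ' + δ) (hk' := rfl)
      (p := p) (q := D' 0 rfl q) a.succ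
      ⟨a, by omega⟩ rfl rfl (by omega) (by omega) rfl rfl (by abel) (by abel)
    have d3 := hD'.comp_sym hS (a := a.succ) (hl := show l + 1 + 1 = m + 1 + n by omega)
      (hk := show i + δ + j = i + j + δ by abel) (k' := i + j + δ' + δ) (hk' := h₂')
      (p := D 0 rfl p) (q := q) a.succ.succ
      ⟨a + 1, by omega⟩ rfl rfl (by omega) (by omega) (show _ = i + δ' + δ by abel) rfl
      (by abel) (by abel)
    have d4 := hD'.comp_sym hS (a := a) (hl := show l + 1 + 1 = m + (n + 1) by omega)
      (hk := show i + (j + δ) = i + j + δ by abel) (k' := i + j + δ' + δ) (hk' := h₂')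
      (p := p) (q := D 0 rfl q) a.succ
      ⟨a, by omega⟩ rfl rfl (by omega) (by omega) rfl (show _ = j + δ' + δ by abel)
      (by abel) (by abel)
    simp only [Op.Hom.id, LinearMap.id_apply] at d1 d2 d3 d4
    have c1 : (cyc 1 : Equiv.Perm (Fin (m + 2))) a.succ.succ = a.succ.succ := by
      ext; rw [cyc_val]; simp
    have c2 : (cyc 1 : Equiv.Perm (Fin (l + 2))) * cyc 1 = 1 := by
      rw [cyc_succ_mul 1 0 rfl, cyc_zero _ rfl, up_one]
    have f1 : ∀ (y : A.X (m + 2) (i + δ' + δ)) (h : l + 1 + 1 + 1 = m + 1 + 1 + n)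
        (h' : i + δ' + δ + j = i + j + δ' + δ), A.comp a.succ.succ h h' (A.act hS (cyc 1) y) q =
        A.act hS (cyc 1) (A.comp a.succ.succ h h' y q) := by
      intro y h h'
      rw [A.comp_act_left hS _ _ _ _ (cyc 1), c1]
      have ho : ((1 : Fin (m + 2)) : ℕ) = 1 := rfl
      have ho' : ((1 : Fin (l + 2)) : ℕ) = 1 := rfl
      constructor
      · intro x y hx hy
        have hx' : (x : ℕ) ≠ a + 2 := fun h => hx (Fin.ext (by simpa using h))
        simp only [outerPlace, Fin.val_succ, cyc_val, ho, ho'] at hy ⊢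
        grind
      · intro x y hy
        simp only [Fin.val_succ, cyc_val, Equiv.Perm.one_apply, ho, ho'] at hy ⊢
        grind
    rw [hD'.comp_sym hS a.succ ⟨a, ha⟩ (by simp) rfl (by omega) (by omega) rfl rfl
        (by abel) (by abel),
      hD.comp_sym hS a.succ ⟨a, ha⟩ (by simp) rfl (by omega) (by omega) rfl rfl
        (by abel) (by abel), LinearMap.map_add, LinearMap.map_add, LinearMap.map_smul,
      LinearMap.map_smul, hD.act, hD'.act]
    simp only [Op.Hom.id, LinearMap.id_apply]
    rw [d1, d2, d3, d4, hp.sym hS rfl rfl rfl (show _ = i + δ' + δ by abel),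
      hq.sym hS rfl rfl rfl (show _ = j + δ' + δ by abel)]
    simp only [LinearMap.map_smul, LinearMap.smul_apply, LinearMap.map_add, f1,
      A.comp_act_right hS _ _ _ _ _ (isBlockPerm_cyc a ⟨a, ha⟩ ⟨a, by omega⟩
        (show l + 1 = m + n by omega) rfl rfl), A.act_mul, e1, e2]
    have g1 : ∀ C U c : Equiv.Perm (Fin (l + 2)), C * U * c * (C * U)⁻¹ * C * U = C * U * c := by
      intro C U c
      group
    have g2 : up (cyc (⟨a, ha⟩ : Fin (l + 1))) * cyc 1 = cyc ⟨a + 1, by omega⟩ := by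
      rw [← cyc_succ_mul ⟨a + 1, by omega⟩ ⟨a, ha⟩ rfl, mul_assoc, c2, mul_one]
    have e4 : ∀ x, sgn R (deg δ * deg δ') * (x * sgn R (deg δ * deg δ')) = x := fun x => by
      linear_combination x * e3
    rw [g1, g2, cyc_succ_mul ⟨a + 1, by omega⟩ ⟨a, ha⟩ rfl]
    simp only [smul_add, smul_smul, e4]
    module
  ns hS s t x y z h₁ h₁' h₂ h₂' hst ht := by
    subst h₁ h₂ hk h₁'
    have e1 : sgn R (deg δ * deg (i + δ')) = sgn R (deg δ * deg i) * sgn R (deg δ * deg δ') := by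
      rw [← sgn_add, map_add, mul_add]
    have e2 : sgn R (deg δ' * deg (i + δ)) = sgn R (deg δ' * deg i) * sgn R (deg δ * deg δ') := by
      rw [← sgn_add, map_add, mul_add, mul_comm (deg δ')  (deg δ)]
    have e3 : sgn R (deg δ * deg δ') * sgn R (deg δ * deg δ') = 1 := by
      rw [← sgn_add, ← sgn_zero R]
      exact sgn_congr R ⟨deg δ * deg δ', by ring⟩
    have e4 : ∀ x, sgn R (deg δ * deg δ') * (x * sgn R (deg δ * deg δ')) = x := fun x => by
      linear_combination x * e3
    have eD := fun {s'} (hs' : s' ≤ l) => hD.comp_ns hS (s := s') (a := a) (hl := hl)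
      (hk := rfl) (hk' := rfl)
      (p := p) (q := q) a.succ a.castSucc rfl rfl (by omega) (by omega) rfl rfl (by abel) (by abel) hs'
    have eD' := fun {s'} (hs' : s' ≤ l) => hD'.comp_ns hS (s := s') (a := a) (hl := hl)
      (hk := rfl) (hk' := rfl)
      (p := p) (q := q) a.succ a.castSucc rfl rfl (by omega) (by omega) rfl rfl (by abel) (by abel) hs'
    have d1 := fun {s'} (b : Fin (m + 1)) (hs' : s' ≤ l + 1) {t'} => hD.comp_ns hS (s := s') (a := b)
      (hl := show l + 1 + 1 = m + 1 + n by omega)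
      (hk := show i + δ' + j = i + j + δ' by abel) (k' := i + j + δ' + δ) (hk' := rfl)
      (p := D' t' rfl p) (q := q) b.succ b.castSucc rfl rfl (by omega) (by omega) rfl rfl
      (by abel) (by abel) hs'
    have d2 := fun {s'} (hs' : s' ≤ l + 1) {t'} => hD.comp_ns hS (s := s') (a := a)
      (hl := show l + 1 + 1 = m + (n + 1) by omega)
      (hk := show i + (j + δ') = i + j + δ' by abel) (k' := i + j + δ' + δ) (hk' := rfl)
      (p := p) (q := D' t' rfl q) a.succ a.castSucc rfl rfl (by omega) (by omega) rfl rfl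
      (by abel) (by abel) hs'
    have d3 := fun {s'} (b : Fin (m + 1)) (hs' : s' ≤ l + 1) {t'} => hD'.comp_ns hS (s := s') (a := b)
      (hl := show l + 1 + 1 = m + 1 + n by omega)
      (hk := show i + δ + j = i + j + δ by abel) (k' := i + j + δ' + δ) (hk' := h₂')
      (p := D t' rfl p) (q := q) b.succ b.castSucc rfl rfl (by omega) (by omega)
      (show _ = i + δ' + δ by abel) rfl (by abel) (by abel) hs'
    have d4 := fun {s'} (hs' : s' ≤ l + 1) {t'} => hD'.comp_ns hS (s := s') (a := a)
      (hl := show l + 1 + 1 = m + (n + 1) by omega)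
      (hk := show i + (j + δ) = i + j + δ by abel) (k' := i + j + δ' + δ) (hk' := h₂')
      (p := p) (q := D t' rfl q) a.succ a.castSucc rfl rfl (by omega) (by omega) rfl
      (show _ = j + δ' + δ by abel) (by abel) (by abel) hs'
    simp only [Op.Hom.id, LinearMap.id_apply] at d1 d2 d3 d4 eD eD'
    have hp' := fun {s' t'} (h : s' ≤ t') (h' : t' ≤ m) =>
      hp.ns hS rfl rfl rfl (show _ = i + δ' + δ by abel) h h'
    have hq' := fun {s' t'} (h : s' ≤ t') (h' : t' ≤ n) =>
      hq.ns hS rfl rfl rfl (show _ = j + δ' + δ by abel) h h'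
    rw [eD' ht, eD (hst.trans ht)]
    simp only [LinearMap.map_add, LinearMap.map_smul, apply_ite (D s _), apply_ite (D' (t + 1) _),
      LinearMap.map_zero]
    rw [d1 a.succ (by omega), d1 a.castSucc (by omega), d2 (by omega), d3 a.succ (by omega),
      d3 a.castSucc (by omega), d4 (by omega)]
    simp only [Fin.val_succ, Fin.val_castSucc, e1, e2]
    refine ite_shuffle ?_ ?_ ?_ ?_ ?_ ?_ ?_ ?_ ?_ ?_ ?_ ?_ ?_ ?_ ?_ ?_ ?_ ?_ ?_ ?_ ?_
    iterate 12 omega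
    · rw [e4]
    · rw [mul_comm]
    · rw [mul_comm]
    · intro h
      rw [hp' hst (by omega), LinearMap.map_smul, LinearMap.smul_apply]
    · intro h
      rw [hp' (by omega) (by omega), LinearMap.map_smul, LinearMap.smul_apply,
        show t + 1 - n + 1 = t + 1 + 1 - n by omega]
      rfl
    · intro h
      rw [one_smul, show t + 1 - (a + 1) = t - a by omega]
    · intro h
      rw [hp' (by omega) (by omega), LinearMap.map_smul, LinearMap.smul_apply,
        show t + 1 - n + 1 = t + 1 + 1 - n by omega]
    · intro h
      rw [one_smul, show t + 1 + 1 - (n + 1) = t + 1 - n by omega]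
    · intro h
      rw [hq' (by omega) (by omega), LinearMap.map_smul, show t - a + 1 = t + 1 - a by omega]

end SComm
end Commute
end
end TwistOperad

namespace TwistOperad

noncomputable section

section ShiftSeq

variable {R : Type v} [CommRing R] {S : Prop} {ι : Type} [AddCommMonoid ι] {deg : ι →+ ℤ}

theorem scomm_pres {G : ℕ → ι → Type w} {E : ∀ (n : ℕ) (i : ι), Tm R S G n i →
    Tm R S G n i → Prop} {δ δ' : ι} {D : ShiftMap (presOp deg E) (presOp deg E) δ}
    {D' : ShiftMap (presOp deg E) (presOp deg E) δ'}
    (h : IsShiftDer (Op.Hom.id _) δ D) (h' : IsShiftDer (Op.Hom.id _) δ' D')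
    (hg : ∀ {n i} (g : G n i), SComm D D' (Pres.cl (.gen g) : (presOp deg E).X n i))
    {n : ℕ} {i : ι} (x : (presOp deg E).X n i) : SComm D D' x := by
  induction x using Pres.cl_ind with | h p => ?_
  induction p with
  | gen g => exact hg g
  | one hi => exact .one h h' hi
  | comp a hl hk p q ih ih' => exact .comp h h' a hl hk ih ih'
  | act hS σ p ih => exact .act h h' hS σ ih
  | zero => exact .zero
  | add p q ih ih' => exact .add ih ih'
  | smul r p ih => exact .smul r ih

/-- The iterated first shifts of an operation of arity zero. -/
def shiftSeq {A : Op.{v, w} R S ι deg} (N : ShiftMap A A 0) {e : ι} (x : A.X 0 e) :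
    ∀ n : ℕ, A.X n e
  | 0 => x
  | n + 1 => N 0 (add_zero e) (shiftSeq N x n)

theorem perm_generated {n : ℕ} {C : Equiv.Perm (Fin (n + 2)) → Prop}
    (hmul : ∀ σ τ, C σ → C τ → C (σ * τ)) (hup : ∀ σ, C (up σ)) (hcyc : C (cyc 1))
    (ρ : Equiv.Perm (Fin (n + 2))) : C ρ := by
  have key : ∀ ρ : Equiv.Perm (Fin (n + 2)), ρ 0 = 0 → C ρ := by
    intro ρ h
    obtain ⟨⟨p, e⟩, rfl⟩ := Equiv.Perm.decomposeFin.symm.surjective ρ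
    rw [Equiv.Perm.decomposeFin_symm_apply_zero] at h
    subst h
    convert hup e
    ext x
    induction x using Fin.cases with
    | zero => simp
    | succ x => simp
  by_cases h0 : ρ 0 = 0
  · exact key ρ h0
  · obtain ⟨a, ha⟩ := Fin.exists_succ_eq.2 h0
    have h1 : (up (Equiv.swap 0 a) * cyc 1 : Equiv.Perm (Fin (n + 2))) 0 = ρ 0 := by
      have : (cyc 1 : Equiv.Perm (Fin (n + 2))) 0 = (0 : Fin (n + 1)).succ := by
        ext; rw [cyc_val]; simp
      rw [Equiv.Perm.mul_apply, this, up_succ, Equiv.swap_apply_left, ha]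
    have h2 := hmul _ _ (hmul _ _ (hup (Equiv.swap 0 a)) hcyc)
      (key ((up (Equiv.swap 0 a) * cyc 1)⁻¹ * ρ) (by
        rw [Equiv.Perm.mul_apply, Equiv.Perm.inv_eq_iff_eq, h1]))
    rwa [mul_inv_cancel_left] at h2

section

variable {A : Op.{v, w} R S ι deg} {N : ShiftMap A A 0} (hN : IsShiftDer (Op.Hom.id A) 0 N)
  (hc : ∀ {n i} (x : A.X n i), SComm N N x) {e : ι} (x : A.X 0 e)

include hN hc

theorem act_shiftSeq (hS : S) : ∀ (n : ℕ) (σ : Equiv.Perm (Fin n)),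
    A.act hS σ (shiftSeq N x n) = shiftSeq N x n
  | 0, σ => by rw [Subsingleton.elim σ 1, A.act_one]
  | 1, σ => by rw [Subsingleton.elim σ 1, A.act_one]
  | n + 2, σ => by
    refine perm_generated (C := fun σ => A.act hS σ (shiftSeq N x (n + 2)) = shiftSeq N x (n + 2))
      ?_ ?_ ?_ σ
    · intro σ τ h h'
      rw [← A.act_mul, h, h']
    · intro σ
      change A.act hS (up σ) (N 0 _ (shiftSeq N x (n + 1))) = _
      rw [← hN.act, act_shiftSeq hS (n + 1)]
      rfl
    · have h := (hc (shiftSeq N x n)).sym hS (add_zero e) (add_zero e) (add_zero e) (add_zero e)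
      rw [map_zero, mul_zero, sgn_zero, one_smul] at h
      exact h.symm

theorem shift_shiftSeq {s n : ℕ} (hs : Slot S s n) (he : e + 0 = e) :
    N s he (shiftSeq N x n) = shiftSeq N x (n + 1) := by
  induction n generalizing s with
  | zero =>
    obtain rfl : s = 0 := Nat.le_zero.1 hs.1
    rfl
  | succ n ih =>
    cases s with
    | zero => rfl
    | succ s =>
      have hS : ¬S := fun h => by have := hs.2 h; omega
      have h := (hc (shiftSeq N x n)).ns hS (add_zero e) (add_zero e) (add_zero e) (add_zero e)
        (Nat.zero_le s) (by have := hs.1; omega)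
      rw [map_zero, mul_zero, sgn_zero, one_smul,
        ih ⟨by have := hs.1; omega, fun h => (hS h).elim⟩] at h
      exact h.symm

end
end ShiftSeq

section Stasheff

variable {R : Type v} [CommRing R] {S : Prop}

open Classical in
/-- The right hand side of the structure equations of curved homotopy algebras. -/
def stash (A : ZOp.{v, w} R S) (m : ∀ n : ℕ, A.X n (-1)) (n : ℕ) : A.X n (-1 + -1) :=
  if hS : S then
    -∑ q : Fin (n + 1), ∑ σ : Equiv.Perm (Fin n) with IsInvShuffle q σ,
      A.act hS σ (A.comp (0 : Fin (n - q + 1)) (n := q) (by omega) rfl (m (n - q + 1)) (m q))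
  else -∑ p : Fin (n + 1), ∑ q : Fin (n + 1 - p),
    A.comp (⟨p, by omega⟩ : Fin (p + 1 + (n - p - q))) (n := q) (by omega) rfl
      (m (p + 1 + (n - p - q))) (m q)

theorem stash_map {A : ZOp.{v, w} R S} {B : ZOp.{v, w'} R S} (F : Op.Hom A B)
    (m : ∀ n : ℕ, A.X n (-1)) (n : ℕ) :
    F.f n _ (stash A m n) = stash B (fun n => F.f n _ (m n)) n := by
  unfold stash
  split_ifs with hS
  · simp only [map_neg, map_sum, F.map_act, F.map_comp]
  · simp only [map_neg, map_sum, F.map_comp]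

theorem invShuffle_up {n q : ℕ} {σ : Equiv.Perm (Fin n)} :
    IsInvShuffle (q + 1) (up σ) ↔ IsInvShuffle q σ := by
  have hu : ∀ x : Fin n, (up σ)⁻¹ x.succ = (σ⁻¹ x).succ := fun x => by
    rw [Equiv.Perm.inv_eq_iff_eq, up_succ, perm_apply_inv]
  have hu0 : (up σ)⁻¹ 0 = 0 := by rw [Equiv.Perm.inv_eq_iff_eq, up_zero]
  constructor
  · intro h i j hij hb
    have := h i.succ j.succ (by simpa using hij) (by simpa using hb)
    rwa [hu, hu, Fin.succ_lt_succ_iff] at this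
  · intro h i j hij hb
    induction j using Fin.cases with
    | zero => exact absurd hij (by simp)
    | succ j =>
      induction i using Fin.cases with
      | zero => rw [hu, hu0]; simp
      | succ i =>
        rw [hu, hu, Fin.succ_lt_succ_iff]
        exact h i j (by simpa using hij) (by simpa using hb)

theorem invShuffle_cyc_up {n q : ℕ} (hq : q < n + 1) {σ : Equiv.Perm (Fin n)} :
    IsInvShuffle q (cyc ⟨q, hq⟩ * up σ) ↔ IsInvShuffle q σ := by
  have hu : ∀ x : Fin n, (up σ)⁻¹ x.succ = (σ⁻¹ x).succ := fun x => by
    rw [Equiv.Perm.inv_eq_iff_eq, up_succ, perm_apply_inv]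
  have hu0 : (up σ)⁻¹ 0 = 0 := by rw [Equiv.Perm.inv_eq_iff_eq, up_zero]
  have h1 : ∀ x : Fin n, (x : ℕ) < q → (cyc ⟨q, hq⟩)⁻¹ x.castSucc = x.succ := fun x hx => by
    ext; rw [cyc_inv_val]; simp [hx]
  have h2 : ∀ x : Fin n, q ≤ (x : ℕ) → (cyc ⟨q, hq⟩)⁻¹ x.succ = x.succ := fun x hx => by
    ext; rw [cyc_inv_val, if_neg (by simp; omega), if_neg (by simp; omega)]
  have h0 : (cyc ⟨q, hq⟩)⁻¹ ⟨q, hq⟩ = 0 := by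
    ext; rw [cyc_inv_val, if_neg (by simp), if_pos rfl]; rfl
  simp only [IsInvShuffle, mul_inv_rev, Equiv.Perm.mul_apply]
  constructor
  · intro h i j hij hb
    have hij' : (i : ℕ) < j := hij
    rcases hb with hb | hb
    · have := h i.castSucc j.castSucc (by simpa using hij) (by simp [hb])
      rwa [h1 _ hb, h1 _ (by omega), hu, hu, Fin.succ_lt_succ_iff] at this
    · have := h i.succ j.succ (by simpa using hij) (by simp; omega)
      rwa [h2 _ hb, h2 _ (by omega), hu, hu, Fin.succ_lt_succ_iff] at this
  · intro h i j hij hb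
    have hij' : (i : ℕ) < j := hij
    rcases hb with hb | hb
    · have := h ⟨i, by omega⟩ ⟨j, by omega⟩ hij (Or.inl hb)
      have e1 := h1 ⟨i, by omega⟩ (by simp; omega)
      have e2 := h1 ⟨j, by omega⟩ (by simp; omega)
      simp only [Fin.castSucc_mk, Fin.eta] at e1 e2
      rwa [e1, e2, hu, hu, Fin.succ_lt_succ_iff]
    · have e2 := h2 ⟨j - 1, by omega⟩ (by simp; omega)
      have e3 : (⟨j - 1, by omega⟩ : Fin n).succ = j := Fin.ext (by simp; omega)
      rw [e3] at e2
      rw [e2]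
      rcases eq_or_lt_of_le hb with h4 | h4
      · rw [show i = ⟨q, hq⟩ from Fin.ext h4.symm, h0, hu0, ← e3, hu]
        simp
      · have e4 := h2 ⟨i - 1, by omega⟩ (by simp; omega)
        have e5 : (⟨i - 1, by omega⟩ : Fin n).succ = i := Fin.ext (by simp; omega)
        rw [e5] at e4
        have e6 : (up σ)⁻¹ j = (σ⁻¹ ⟨j - 1, by omega⟩).succ := by rw [← hu, e3]
        have e7 : (up σ)⁻¹ i = (σ⁻¹ ⟨i - 1, by omega⟩).succ := by rw [← hu, e5]
        rw [e4, e6, e7, Fin.succ_lt_succ_iff]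
        exact h _ _ (by rw [Fin.lt_def]; simp; omega) (Or.inr (by simp; omega))

theorem eq_up_of_zero {n : ℕ} {ρ : Equiv.Perm (Fin (n + 1))} (h : ρ 0 = 0) : ∃ σ, ρ = up σ := by
  obtain ⟨⟨p, e⟩, rfl⟩ := Equiv.Perm.decomposeFin.symm.surjective ρ
  rw [Equiv.Perm.decomposeFin_symm_apply_zero] at h
  subst h
  refine ⟨e, ?_⟩
  ext x
  induction x using Fin.cases with
  | zero => simp
  | succ x => simp

theorem up_injective {n : ℕ} : Function.Injective (up : Equiv.Perm (Fin n) → _) := by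
  intro σ τ h
  ext x
  have := congrArg (fun ρ : Equiv.Perm (Fin (n + 1)) => (ρ x.succ : ℕ)) h
  simpa using this

theorem invShuffle_zero {n q : ℕ} {ρ : Equiv.Perm (Fin (n + 1))} (h : IsInvShuffle q ρ) :
    (ρ 0 : ℕ) = 0 ∨ (ρ 0 : ℕ) = q := by
  by_contra hc
  push Not at hc
  have h0 : ρ⁻¹ (ρ 0) = 0 := by rw [Equiv.Perm.inv_eq_iff_eq]
  rcases lt_or_gt_of_ne hc.2 with h1 | h1
  · have := h 0 (ρ 0) (show 0 < (ρ 0 : ℕ) by omega) (Or.inl h1)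
    rw [h0] at this
    exact absurd this (by simp)
  · have := h ⟨q, by omega⟩ (ρ 0) h1 (Or.inr le_rfl)
    rw [h0] at this
    exact absurd this (by simp)

open Classical in
theorem sum_invShuffle_succ {M : Type w} [AddCommMonoid M] {n : ℕ}
    (F : ℕ → Equiv.Perm (Fin (n + 1)) → M) :
    ∑ q : Fin (n + 2), ∑ ρ : Equiv.Perm (Fin (n + 1)) with IsInvShuffle q ρ, F q ρ =
      (∑ q : Fin (n + 1), ∑ σ : Equiv.Perm (Fin n) with IsInvShuffle q σ,
        F q (cyc ⟨q, q.2⟩ * up σ)) +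
      ∑ q : Fin (n + 1), ∑ σ : Equiv.Perm (Fin n) with IsInvShuffle q σ, F (q + 1) (up σ) := by
  have hsplit : ∀ q : Fin (n + 2), ∑ ρ : Equiv.Perm (Fin (n + 1)) with IsInvShuffle q ρ, F q ρ =
      (∑ ρ : Equiv.Perm (Fin (n + 1)) with IsInvShuffle q ρ ∧ (ρ 0 : ℕ) = q, F q ρ) +
      ∑ ρ : Equiv.Perm (Fin (n + 1)) with IsInvShuffle q ρ ∧ (ρ 0 : ℕ) ≠ q, F q ρ := by
    intro q
    rw [← Finset.sum_filter_add_sum_filter_not _ (fun ρ => (ρ 0 : ℕ) = q), Finset.filter_filter,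
      Finset.filter_filter]
  simp only [hsplit]
  rw [Finset.sum_add_distrib]
  congr 1
  · rw [Fin.sum_univ_castSucc, Finset.sum_eq_zero (s := Finset.univ.filter _), add_zero]
    · refine Finset.sum_congr rfl fun q _ => ?_
      symm
      refine Finset.sum_nbij (fun σ => cyc ⟨q, q.2⟩ * up σ) ?_ ?_ ?_ ?_
      · intro σ hσ
        simp only [Finset.mem_filter, Finset.mem_univ, true_and, Fin.val_castSucc] at hσ ⊢
        refine ⟨(invShuffle_cyc_up q.2).2 hσ, ?_⟩
        rw [Equiv.Perm.mul_apply, up_zero, cyc_val]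
        simp
      · intro σ _ τ _ h
        exact up_injective (mul_left_cancel h)
      · intro ρ hρ
        simp only [Finset.coe_filter, Finset.mem_univ, true_and, Set.mem_setOf_eq,
          Fin.val_castSucc] at hρ
        obtain ⟨σ, hσ⟩ := eq_up_of_zero (ρ := (cyc ⟨q, q.2⟩)⁻¹ * ρ) (by
          rw [Equiv.Perm.mul_apply, Equiv.Perm.inv_eq_iff_eq]
          ext
          rw [hρ.2, cyc_val]
          simp)
        rw [inv_mul_eq_iff_eq_mul] at hσ
        refine ⟨σ, ?_, hσ.symm⟩
        simp only [Finset.coe_filter, Finset.mem_univ, true_and, Set.mem_setOf_eq]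
        rw [← invShuffle_cyc_up q.2, ← hσ]
        exact hρ.1
      · intro σ _
        rfl
    · intro ρ hρ
      simp only [Finset.mem_filter, Finset.mem_univ, true_and, Fin.val_last] at hρ
      have := (ρ 0).2
      omega
  · rw [Fin.sum_univ_succ, Finset.sum_eq_zero (s := Finset.univ.filter _), zero_add]
    · refine Finset.sum_congr rfl fun q _ => ?_
      symm
      refine Finset.sum_nbij (fun σ => up σ) ?_ ?_ ?_ ?_
      · intro σ hσ
        simp only [Finset.mem_filter, Finset.mem_univ, true_and, Fin.val_succ] at hσ ⊢
        refine ⟨invShuffle_up.2 hσ, ?_⟩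
        rw [up_zero]
        simp
      · intro σ _ τ _ h
        exact up_injective h
      · intro ρ hρ
        simp only [Finset.coe_filter, Finset.mem_univ, true_and, Set.mem_setOf_eq,
          Fin.val_succ] at hρ
        obtain ⟨σ, rfl⟩ := eq_up_of_zero (ρ := ρ) (by
          ext
          exact (invShuffle_zero hρ.1).resolve_right hρ.2)
        refine ⟨σ, ?_, rfl⟩
        simpa using invShuffle_up.1 hρ.1
      · intro σ _
        rfl
    · intro ρ hρ
      have hρ' := (Finset.mem_filter.1 hρ).2
      rcases invShuffle_zero hρ'.1 with h | h
      exacts [(hρ'.2 h).elim, (hρ'.2 h).elim]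

theorem sum_range_shift {M : Type w} [AddCommMonoid M] (f : ℕ → M) (N : ℕ) (h0 : f 0 = 0)
    (hN : f N = 0) : ∑ p ∈ Finset.range N, f (p + 1) = ∑ p ∈ Finset.range N, f p := by
  have h1 := Finset.sum_range_succ' f N
  have h2 := Finset.sum_range_succ f N
  rw [h0, add_zero] at h1
  rw [hN, add_zero] at h2
  rw [← h1, h2]

section StashTerm

variable (A : ZOp.{v, w} R S) (m : ∀ n : ℕ, A.X n (-1))

/-- The composite of two operations in a sequence. -/
def stashTerm (l p u q : ℕ) (hp : p < u) (hl : l + 1 = u + q) : A.X l (-1 + -1) :=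
  A.comp (⟨p, hp⟩ : Fin u) hl rfl (m u) (m q)

variable {A m}

theorem stashTerm_congr {l p p' u u' q : ℕ} {hp : p < u} {hl : l + 1 = u + q} (h : p = p')
    (hu : u = u') : stashTerm A m l p u q hp hl =
      stashTerm A m l p' u' q (h ▸ hu ▸ hp) (hu ▸ hl) := by
  subst h hu
  rfl

variable {N : ShiftMap A A 0} (hN : IsShiftDer (Op.Hom.id A) 0 N)
  (hm : ∀ s n, Slot S s n → N s (add_zero _) (m n) = m (n + 1))

include hN hm in
theorem shift_stashTerm_ns (hS : ¬S) {s l p u q : ℕ} (hp : p < u) (hl : l + 1 = u + q)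
    (hs : s ≤ l) : N s (add_zero _) (stashTerm A m l p u q hp hl) =
      (if s ≤ p then stashTerm A m (l + 1) (p + 1) (u + 1) q (by omega) (by omega) else 0) +
      (if p + q ≤ s then stashTerm A m (l + 1) p (u + 1) q (by omega) (by omega) else 0) +
      (if p ≤ s ∧ s ≤ p + q then stashTerm A m (l + 1) p u (q + 1) hp (by omega) else 0) := by
  rw [stashTerm, hN.comp_ns hS (⟨p + 1, by omega⟩ : Fin (u + 1)) ⟨p, by omega⟩ rfl rfl (by omega)
    (by omega) (add_zero _) (add_zero _) rfl rfl hs]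
  simp only [map_zero, zero_mul, sgn_zero, one_smul]
  congr 1
  · congr 1
    · split_ifs with h
      · rw [hm _ _ ⟨by omega, fun h => (hS h).elim⟩]
        rfl
      · rfl
    · split_ifs with h
      · rw [hm _ _ ⟨by omega, fun h => (hS h).elim⟩]
        rfl
      · rfl
  · split_ifs with h
    · rw [hm _ _ ⟨by omega, fun h => (hS h).elim⟩]
      rfl
    · rfl

variable (A m) in
/-- The terms of the nonsymmetric structure equations, extended by zero. -/
def stashNs (n p q : ℕ) : A.X n (-1 + -1) :=
  if h : p + q ≤ n then stashTerm A m n p (p + 1 + (n - p - q)) q (by omega) (by omega) else 0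

theorem stash_ns (hS : ¬S) {n L : ℕ} (hL : n + 1 ≤ L) :
    stash A m n = -∑ p ∈ Finset.range L, ∑ q ∈ Finset.range L, stashNs A m n p q := by
  rw [stash, dif_neg hS]
  congr 1
  have h0 : ∀ p q, ¬(p + q ≤ n) → stashNs A m n p q = 0 := fun p q h => dif_neg h
  rw [← Finset.sum_subset (Finset.range_subset_range.2 hL), ← Fin.sum_univ_eq_sum_range
    (fun p => ∑ q ∈ Finset.range L, stashNs A m n p q)]
  · refine Finset.sum_congr rfl fun p _ => ?_
    rw [← Finset.sum_subset (Finset.range_subset_range.2 (show n + 1 - p ≤ L by omega)),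
      ← Fin.sum_univ_eq_sum_range (fun q => stashNs A m n p q)]
    · refine Finset.sum_congr rfl fun q _ => ?_
      rw [stashNs, dif_pos (by omega)]
      rfl
    · intro q _ hq
      rw [Finset.mem_range] at hq
      exact h0 _ _ (by omega)
  · intro p _ hp
    rw [Finset.mem_range] at hp
    exact Finset.sum_eq_zero fun q _ => h0 _ _ (by omega)

include hN hm in
theorem stash_shift_ns (hS : ¬S) {s n : ℕ} (hs : s ≤ n) :
    N s (add_zero _) (stash A m n) = stash A m (n + 1) := by
  have h0 : ∀ p q, ¬(p + q ≤ n + 1) → stashNs A m (n + 1) p q = 0 := fun p q h => dif_neg h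
  rw [stash_ns hS (show n + 1 ≤ n + 2 by omega), stash_ns hS (show n + 1 + 1 ≤ n + 2 by omega),
    map_neg, map_sum]
  simp only [map_sum]
  congr 1
  have h1 : ∀ p q, N s (add_zero _) (stashNs A m n p q) =
      (if s + 1 ≤ p + 1 then stashNs A m (n + 1) (p + 1) q else 0) +
      (if p + q ≤ s then stashNs A m (n + 1) p q else 0) +
      (if p ≤ s ∧ s + 1 ≤ p + (q + 1) then stashNs A m (n + 1) p (q + 1) else 0) := by
    intro p q
    by_cases h : p + q ≤ n
    · simp only [stashNs]
      rw [dif_pos h, dif_pos (by omega), dif_pos (by omega), dif_pos (by omega),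
        shift_stashTerm_ns hN hm hS _ _ hs]
      congr 1
      · congr 1
        · simp only [Nat.add_le_add_iff_right]
          congr 1
          exact stashTerm_congr rfl (by omega)
        · congr 1
          exact stashTerm_congr rfl (by omega)
      · simp only [← add_assoc, Nat.add_le_add_iff_right]
        congr 1
        exact stashTerm_congr rfl (by omega)
    · rw [stashNs, dif_neg h, h0 (p + 1) q (by omega), h0 p (q + 1) (by omega),
        if_neg (show ¬(p + q ≤ s) by omega), map_zero]
      simp
  have h2 : ∀ p q, stashNs A m (n + 1) p q =
      (if s + 1 ≤ p then stashNs A m (n + 1) p q else 0) +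
      (if p + q ≤ s then stashNs A m (n + 1) p q else 0) +
      (if p ≤ s ∧ s + 1 ≤ p + q then stashNs A m (n + 1) p q else 0) := by
    intro p q
    by_cases c1 : s + 1 ≤ p
    · rw [if_pos c1, if_neg (by omega), if_neg (by omega), add_zero, add_zero]
    · by_cases c2 : p + q ≤ s
      · rw [if_neg c1, if_pos c2, if_neg (by omega), add_zero, zero_add]
      · rw [if_neg c1, if_neg c2, if_pos (by omega), zero_add, zero_add]
  simp only [h1]
  conv_rhs =>
    enter [2, p, 2, q]
    rw [h2]
  simp only [Finset.sum_add_distrib]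
  congr 1
  · congr 1
    refine sum_range_shift (fun p => ∑ q ∈ Finset.range (n + 2),
      if s + 1 ≤ p then stashNs A m (n + 1) p q else 0) (n + 2) ?_ ?_
    · exact Finset.sum_eq_zero fun q _ => if_neg (by omega)
    · refine Finset.sum_eq_zero fun q _ => ?_
      rw [h0 _ _ (by omega), ite_self]
  · refine Finset.sum_congr rfl fun p _ => ?_
    refine sum_range_shift (fun q => if p ≤ s ∧ s + 1 ≤ p + q then stashNs A m (n + 1) p q else 0)
      (n + 2) ?_ ?_
    · exact if_neg (by omega)
    · rw [h0 _ _ (by omega), ite_self]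

include hN hm in
theorem stash_shift_sym (hS : S) (hinv : ∀ n σ, A.act hS σ (m n) = m n) {n : ℕ} :
    N 0 (add_zero _) (stash A m n) = stash A m (n + 1) := by
  classical
  have h1 : ∀ (q : Fin (n + 1)), N 0 (add_zero _) (A.comp (0 : Fin (n - q + 1)) (n := q)
      (l := n) (by omega) (rfl : (-1 : ℤ) + -1 = _) (m (n - q + 1)) (m q)) =
      A.act hS (cyc ⟨q, by omega⟩) (stashTerm A m (n + 1) 0 (n + 1 - q + 1) q (by omega) (by omega)) +
      stashTerm A m (n + 1) 0 (n + 1 - (q + 1) + 1) (q + 1) (by omega) (by omega) := by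
    intro q
    rw [hN.comp_sym hS (1 : Fin (n - q + 1 + 1)) (0 : Fin (n + 1)) rfl rfl (by omega) (by omega)
      (add_zero _) (add_zero _) rfl rfl, map_zero, zero_mul, sgn_zero, one_smul,
      hm 0 _ (slot_zero S _), hm 0 _ (slot_zero S _), cyc_zero _ rfl, A.act_one]
    congr 1
    · rw [← hinv (n - q + 1 + 1) (cyc 1), A.comp_act_left hS _ _ _ _ (cyc ⟨q, by omega⟩)]
      · congr 1
        have e : (cyc 1 : Equiv.Perm (Fin (n - q + 1 + 1))) 1 = 0 := by
          ext
          rw [cyc_val]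
          simp
        rw [e]
        exact stashTerm_congr (hp := Nat.succ_pos _) (hl := by omega) rfl (by omega)
      · have ho : ((1 : Fin (n - q + 1 + 1)) : ℕ) = 1 := rfl
        constructor
        · intro j x hj hx
          have hj' : (j : ℕ) ≠ 1 := fun h => hj (Fin.ext h)
          simp only [outerPlace, cyc_val, ho] at hx ⊢
          grind
        · intro k x hx
          simp only [cyc_val, ho, Equiv.Perm.one_apply] at hx ⊢
          grind
    · exact stashTerm_congr (hp := Nat.succ_pos _) (hl := by omega) rfl (by omega)
  rw [stash, dif_pos hS, stash, dif_pos hS, map_neg, map_sum]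
  congr 1
  let F : ℕ → Equiv.Perm (Fin (n + 1)) → A.X (n + 1) (-1 + -1) := fun q ρ =>
    if h : q ≤ n + 1 then
      A.act hS ρ (stashTerm A m (n + 1) 0 (n + 1 - q + 1) q (by omega) (by omega)) else 0
  have hF := sum_invShuffle_succ F
  have h2 : ∀ (q : Fin (n + 2)) ρ, F q ρ = A.act hS ρ (A.comp (0 : Fin (n + 1 - q + 1)) (n := q)
      (l := n + 1) (by omega) (rfl : (-1 : ℤ) + -1 = _) (m (n + 1 - q + 1)) (m q)) :=
    fun q ρ => dif_pos (by omega)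
  simp only [h2] at hF
  rw [hF, ← Finset.sum_add_distrib]
  refine Finset.sum_congr rfl fun q _ => ?_
  rw [map_sum, ← Finset.sum_add_distrib]
  refine Finset.sum_congr rfl fun σ _ => ?_
  rw [hN.act, h1, map_add, A.act_mul]
  congr 1
  · rw [show F q _ = _ from dif_pos (show (q : ℕ) ≤ n + 1 by omega)]
  · rw [show F (q + 1) _ = _ from dif_pos (show (q : ℕ) + 1 ≤ n + 1 by omega)]

include hN hm in
theorem stash_shift (hinv : ∀ hS n σ, A.act hS σ (m n) = m n) {s n : ℕ} (hs : Slot S s n)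
    (he : (-1 : ℤ) + -1 + 0 = -1 + -1) :
    N s he (stash A m n) = stash A m (n + 1) := by
  by_cases hS : S
  · rw [hs.2 hS]
    exact stash_shift_sym hN hm hS (hinv hS)
  · exact stash_shift_ns hN hm hS hs.1

end StashTerm

end Stasheff
end
end TwistOperad

namespace TwistOperad

noncomputable section

section Plug

variable {R : Type v} [CommRing R] {S : Prop} {ι : Type} [AddCommMonoid ι] {deg : ι →+ ℤ}
  {A : Op.{v, w} R S ι deg}

/-- The composite of an operation with an operation of arity zero. -/
def plug {e : ι} (z : A.X 0 e) {n : ℕ} {i i' : ι} (hi : i' + e = i) (j : ℕ) (hj : j ≤ n) :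
    A.X (n + 1) i' →ₗ[R] A.X n i :=
  (A.comp (n := 0) (⟨j, by omega⟩ : Fin (n + 1)) rfl hi).flip z

theorem plug_def {e : ι} (z : A.X 0 e) {n : ℕ} {i i' : ι} (hi : i' + e = i) (j : ℕ) (hj : j ≤ n)
    (y : A.X (n + 1) i') :
    plug z hi j hj y = A.comp (n := 0) (⟨j, by omega⟩ : Fin (n + 1)) rfl hi y z := rfl

theorem sgn_mul_self (m : ℤ) : sgn R m * sgn R m = 1 := by
  rw [← sgn_add, ← sgn_zero R]
  exact sgn_congr R ⟨m, by ring⟩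

theorem plug_plug {e : ι} (z : A.X 0 e) {n : ℕ} {i i' i'' : ι} (hi : i' + e = i)
    (hi' : i'' + e = i') {j t : ℕ} (hj : j ≤ t) (ht : t ≤ n) (y : A.X (n + 2) i'') :
    plug z hi j (hj.trans ht) (plug z hi' (t + 1) (by omega) y) =
      sgn R (deg e * deg e) • plug z hi t ht (plug z hi' j (by omega) y) := by
  have h := A.comp_par (n := 0) (r := 0) (l := n + 1) (l' := n + 1) (t := n) (⟨j, by omega⟩ : Fin (n + 2)) ⟨t + 1, by omega⟩ (⟨t, by omega⟩ : Fin (n + 1))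
    ⟨j, by omega⟩ (by rw [Fin.lt_def]; simp; omega) rfl rfl rfl rfl rfl rfl hi' hi hi' hi y z z
  simp only [plug_def]
  rw [h, smul_smul, sgn_mul_self, one_smul]

variable {e δ : ι} (z : A.X 0 e) (D : ShiftMap A A δ) (ω : ι →+ ℤ)

/-- An operation `z` of arity zero, a shift derivation that sends `z` to the identity, and an
additive weight for which `z` has weight one, such that elements of positive weight are sums of
composites with `z`. -/
structure PlugSystem : Prop where
  shift : IsShiftDer (Op.Hom.id A) δ D
  add : e + δ = 0
  val : ∀ {j : ι} (h : e + δ = j) (h' : j = 0), D 0 h z = A.one h'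
  comm : ∀ {n : ℕ} {i : ι} (x : A.X n i), SComm D D x
  wt : ω e = 1
  neg : ∀ {n : ℕ} {i : ι} (x : A.X n i), ω i < 0 → x = 0
  span : ∀ {n : ℕ} {i : ι} (x : A.X n i), 0 < ω i → x ∈ Submodule.span R
    {y | ∃ (j : ℕ) (hj : j ≤ n) (i' : ι) (hi : i' + e = i) (y' : A.X (n + 1) i'),
      y = plug z hi j hj y'}

namespace PlugSystem

variable {z D ω} (h : PlugSystem z D ω)

include h

theorem wt_shift : ω δ = -1 := by
  have := h.wt
  have h' := congrArg ω h.add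
  rw [map_add, map_zero] at h'
  omega

theorem deg_shift : deg δ = -deg e := by
  have h' := congrArg deg h.add
  rw [map_add, map_zero] at h'
  omega

theorem comp_one_shift {n : ℕ} {i' j : ι} (hj : e + δ = j) (hk : i' + j = i') (a : Fin (n + 1))
    (hl) (y : A.X (n + 1) i') :
    A.comp (n := 0 + 1) a hl hk y (D 0 hj z) = y := by
  rw [h.val hj (hj.symm.trans h.add)]
  exact A.comp_one _ _ _ _ _

open Classical in
theorem shift_plug_ns (hS : ¬S) {n s j : ℕ} {i i' i'' : ι} (hi : i' + e = i) (hi' : i + δ = i')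
    (h₁ : i' + δ = i'') (h₂ : i'' + e = i') (hj : j ≤ n) (hs : s ≤ n) (y : A.X (n + 1) i') :
    D s hi' (plug z hi j hj y) =
      (if s ≤ j then plug z h₂ (j + 1) (by omega) (D s h₁ y) else 0) +
      (if j ≤ s then plug z h₂ j (by omega) (D (s + 1) h₁ y) else 0) +
      sgn R (deg δ * deg i') • if j = s then y else 0 := by
  rw [plug_def, h.shift.comp_ns hS (⟨j + 1, by omega⟩ : Fin (n + 2)) ⟨j, by omega⟩ rfl rfl (by omega) (by omega)
    h₁ rfl h₂ (by rw [← add_assoc, hi, hi']) hs]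
  simp only [Op.Hom.id, LinearMap.id_apply]
  congr 2
  by_cases h' : j = s
  · subst h'
    rw [if_pos rfl, if_pos ⟨le_rfl, le_rfl⟩]
    simp only [Nat.sub_self]
    exact h.comp_one_shift _ _ _ _ _
  · rw [if_neg h', if_neg (by simp; omega)]

theorem shift_plug_sym (hS : S) {n : ℕ} {i i' i'' : ι} (hi : i' + e = i) (hi' : i + δ = i')
    (h₁ : i' + δ = i'') (h₂ : i'' + e = i') (y : A.X (n + 1) i') :
    D 0 hi' (plug z hi 0 (Nat.zero_le n) y) = plug z h₂ 1 (by omega) (D 0 h₁ y) +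
      sgn R (deg δ * deg i') • y := by
  rw [plug_def, h.shift.comp_sym hS (⟨1, by omega⟩ : Fin (n + 2)) ⟨0, by omega⟩ rfl rfl (by omega) (by omega)
    h₁ rfl h₂ (by rw [← add_assoc, hi, hi']), cyc_zero _ rfl, A.act_one]
  simp only [Op.Hom.id, LinearMap.id_apply]
  rw [h.comp_one_shift]
  rfl

/-- In the symmetric case, elements of positive weight are composites at the first place. -/
theorem exists_plug (hS : S) {n : ℕ} {i i' : ι} (hi : i' + e = i) (x : A.X n i) (hx : 0 < ω i) :
    ∃ y : A.X (n + 1) i', x = plug z hi 0 (Nat.zero_le n) y := by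
  induction h.span x hx using Submodule.span_induction with
  | mem x hx' =>
    obtain ⟨j, hj, k, hk, y, rfl⟩ := hx'
    obtain rfl : k = i' := by
      rw [← add_zero k, ← add_zero i', ← h.add, ← add_assoc, ← add_assoc, hk, hi]
    refine ⟨A.act hS (cyc ⟨j, by omega⟩) y, ?_⟩
    rw [plug_def, plug_def, A.comp_act_left hS _ _ _ _ 1, A.act_one]
    · exact Op.comp_eq (by rw [cyc_val]; simp) _ _ _ _
    · constructor
      · intro k x hk hx
        have hk' : (k : ℕ) ≠ 0 := fun h => hk (Fin.ext h)
        simp only [outerPlace, cyc_val, Equiv.Perm.one_apply] at hx ⊢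
        grind
      · intro k
        exact k.elim0
  | zero => exact ⟨0, by rw [map_zero]⟩
  | add x y _ _ hx hy =>
    obtain ⟨x', rfl⟩ := hx
    obtain ⟨y', rfl⟩ := hy
    exact ⟨x' + y', by rw [map_add]⟩
  | smul r x _ hx =>
    obtain ⟨x', rfl⟩ := hx
    exact ⟨r • x', by rw [map_smul]⟩

theorem euler (hS : S) : ∀ (k : ℕ) {n : ℕ} {i i' : ι} (hi : i' + e = i) (hi' : i + δ = i')
    (x : A.X n i), ω i = k → plug z hi 0 (Nat.zero_le n) (D 0 hi' x) =
      sgn R (deg e * (deg i + 1)) • (k : R) • x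
  | 0, n, i, i', hi, hi', x, hx => by
    have h1 : ω i' = ω i + ω δ := by rw [← hi', map_add]
    rw [h.neg (D 0 hi' x) (by rw [h1, h.wt_shift, hx]; simp)]
    simp
  | k + 1, n, i, i', hi, hi', x, hx => by
    obtain ⟨y, rfl⟩ := h.exists_plug hS hi x (by omega)
    have h₂ : i' + δ + e = i' := by rw [add_assoc, add_comm δ, h.add, add_zero]
    have hω : ω i' = ω i + ω δ := by rw [← hi', map_add]
    have hd : deg i = deg i' + deg e := by rw [← hi, map_add]
    rw [h.shift_plug_sym hS hi hi' rfl h₂, map_add, map_smul,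
      ← one_smul R (plug z hi 0 _ (plug z h₂ 1 _ _)), plug_plug z hi h₂ le_rfl (Nat.zero_le n),
      euler hS k h₂ rfl y (by rw [hω, h.wt_shift, hx]; push_cast; ring),
      map_smul, map_smul, h.deg_shift, one_smul, smul_smul, smul_smul, smul_smul, hd,
      Nat.cast_succ]
    rw [show sgn R (deg e * (deg i' + deg e + 1)) = sgn R (-deg e * deg i') from ?_,
      show sgn R (deg e * deg e) * sgn R (deg e * (deg i' + 1)) =
        sgn R (-deg e * deg i') from ?_]
    · rw [← add_smul]
      congr 1
      ring
    · rw [← sgn_add]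
      obtain ⟨c, hc⟩ := Int.even_mul_succ_self (deg e)
      exact sgn_congr R ⟨c + deg e * deg i', by linear_combination hc⟩
    · obtain ⟨c, hc⟩ := Int.even_mul_succ_self (deg e)
      exact sgn_congr R ⟨c + deg e * deg i', by linear_combination hc⟩

end PlugSystem

variable (δ) in
/-- Sums of iterated composites in which `z` is placed after at most `b` inputs, in order. -/
inductive Sorted : ℕ → ∀ {n : ℕ} {i : ι}, A.X n i → Prop
  | base {b n : ℕ} {i : ι} (x : A.X n i) : ω i ≤ 0 → Sorted b x
  | zero {b n : ℕ} {i : ι} : Sorted b (0 : A.X n i)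
  | add {b n : ℕ} {i : ι} {x y : A.X n i} : Sorted b x → Sorted b y → Sorted b (x + y)
  | smul {b n : ℕ} {i : ι} (r : R) {x : A.X n i} : Sorted b x → Sorted b (r • x)
  | plug {b n : ℕ} {i i' : ι} (hi : i' + e = i) (hi' : i + δ = i') (j : ℕ) (hj : j ≤ n)
      (hb : j ≤ b) {y : A.X (n + 1) i'} : Sorted j y → Sorted b (plug z hi j hj y)

namespace PlugSystem

variable {z D ω} (h : PlugSystem z D ω)

include h

theorem sorted_plug {c m : ℕ} {i' : ι} {y : A.X m i'} (hy : Sorted δ z ω c y) :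
    ∀ {n : ℕ} (hm : m = n + 1) {i : ι} (hi : i' + e = i) {b j : ℕ} (hj : j ≤ n), j ≤ b →
      c ≤ b + 1 → Sorted δ z ω b (TwistOperad.plug z hi j hj (hm ▸ y)) := by
  have hδ : ∀ {i i' : ι}, i' + e = i → i + δ = i' := fun h' => by
    rw [← h', add_assoc, h.add, add_zero]
  induction hy with
  | base y hy =>
    rintro n rfl i hi b j hj hjb hcb
    exact .plug hi (hδ hi) j hj hjb (.base y hy)
  | zero =>
    rintro n rfl i hi b j hj hjb hcb
    simp only [map_zero]
    exact .zero
  | add _ _ h1 h2 =>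
    rintro n rfl i hi b j hj hjb hcb
    simp only [map_add]
    exact .add (h1 rfl hi hj hjb hcb) (h2 rfl hi hj hjb hcb)
  | smul r _ h1 =>
    rintro n rfl i hi b j hj hjb hcb
    simp only [map_smul]
    exact .smul r (h1 rfl hi hj hjb hcb)
  | plug hi' hi'' t ht htb hv ih =>
    rintro n rfl i hi b j hj hjb hcb
    rcases Nat.lt_or_ge j t with hjt | hjt
    · obtain ⟨t, rfl⟩ : ∃ t', t = t' + 1 := ⟨t - 1, by omega⟩
      have : t ≤ n := by omega
      simp only [plug_plug z hi hi' (show j ≤ t by omega) this]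
      exact .smul _ (.plug hi (hδ hi) t this (by omega)
        (ih rfl hi' (by omega) (by omega) le_rfl))
    · exact .plug hi (hδ hi) j hj hjb (.plug hi' hi'' t ht hjt hv)

theorem sorted_all : ∀ (k : ℕ) {n : ℕ} {i : ι} (x : A.X n i), ω i ≤ k → Sorted δ z ω n x
  | 0, n, i, x, hx => .base x hx
  | k + 1, n, i, x, hx => by
    by_cases h0 : 0 < ω i
    · induction h.span x h0 using Submodule.span_induction with
      | mem x hx' =>
        obtain ⟨j, hj, i', hi, y, rfl⟩ := hx'
        refine h.sorted_plug (sorted_all k y ?_) rfl hi hj hj le_rfl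
        rw [← hi, map_add, h.wt] at hx
        push_cast at hx
        omega
      | zero => exact .zero
      | add x y _ _ hx hy => exact .add hx hy
      | smul r x _ hx => exact .smul r hx
    · exact .base x (by omega)

theorem sorted_shift (hS : ¬S) {b n : ℕ} {i : ι} {x : A.X n i} (hx : Sorted δ z ω b x) {s : ℕ}
    (hb : b < s) (hs : s ≤ n) {j : ι} (hj : i + δ = j) : D s hj x = 0 := by
  induction hx generalizing s j with
  | base x hx =>
    refine h.neg _ ?_
    rw [← hj, map_add, h.wt_shift]
    omega
  | zero => exact map_zero _
  | add _ _ h1 h2 => rw [map_add, h1 hb hs hj, h2 hb hs hj, add_zero]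
  | smul r _ h1 => rw [map_smul, h1 hb hs hj, smul_zero]
  | plug hi hi' t ht htb _ ih =>
    obtain rfl := hi'.symm.trans hj
    have h₂ : ∀ i, i + δ + e = i := fun i => by rw [add_assoc, add_comm δ, h.add, add_zero]
    rw [h.shift_plug_ns hS hi hj rfl (h₂ _) ht hs, if_neg (by omega), if_pos (by omega),
      if_neg (by omega), ih (by omega) (by omega) rfl, map_zero, smul_zero, add_zero, add_zero]

theorem sorted_split {b n : ℕ} {i : ι} {x : A.X n i} (hx : Sorted δ z ω b x) (hb : b ≤ n)
    {i' : ι} (hi : i' + e = i) (h0 : 0 < ω i) :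
    ∃ (y : A.X (n + 1) i') (x' : A.X n i), Sorted δ z ω b y ∧
      x = TwistOperad.plug z hi b hb y + x' ∧ (b = 0 ∧ x' = 0 ∨ 0 < b ∧ Sorted δ z ω (b - 1) x') := by
  induction hx generalizing i' with
  | base x hx => omega
  | @zero b =>
    refine ⟨0, 0, .zero, by rw [map_zero, add_zero], ?_⟩
    rcases Nat.eq_zero_or_pos b with h' | h'
    exacts [Or.inl ⟨h', rfl⟩, Or.inr ⟨h', .zero⟩]
  | add _ _ h1 h2 =>
    obtain ⟨y, x, hy, rfl, hx⟩ := h1 hb hi h0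
    obtain ⟨y', x', hy', rfl, hx'⟩ := h2 hb hi h0
    refine ⟨y + y', x + x', .add hy hy', by rw [map_add]; abel, ?_⟩
    rcases hx with hx | hx <;> rcases hx' with hx' | hx'
    · exact Or.inl ⟨hx.1, by rw [hx.2, hx'.2, add_zero]⟩
    · omega
    · omega
    · exact Or.inr ⟨hx.1, .add hx.2 hx'.2⟩
  | smul r _ h1 =>
    obtain ⟨y, x, hy, rfl, hx⟩ := h1 hb hi h0
    refine ⟨r • y, r • x, .smul r hy, by rw [map_smul, smul_add], ?_⟩
    rcases hx with hx | hx
    · exact Or.inl ⟨hx.1, by rw [hx.2, smul_zero]⟩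
    · exact Or.inr ⟨hx.1, .smul r hx.2⟩
  | @plug b n i k hk hk' t ht htb y hy _ =>
    obtain rfl : k = i' := by rw [← hk', ← hi, add_assoc, h.add, add_zero]
    rcases eq_or_lt_of_le htb with rfl | htb
    · refine ⟨y, 0, hy, by rw [add_zero], ?_⟩
      rcases Nat.eq_zero_or_pos t with h' | h'
      exacts [Or.inl ⟨h', rfl⟩, Or.inr ⟨h', .zero⟩]
    · exact ⟨0, _, .zero, by rw [map_zero, zero_add],
        Or.inr ⟨by omega, .plug hk hk' t ht (by omega) hy⟩⟩

theorem eq_zero_of_plug (hS : ¬S) : ∀ (k : ℕ) {n b : ℕ} {i i' : ι} (y : A.X n i) (hi : i + δ = i')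
    (hi' : i' + e = i) (hb : b + 1 ≤ n) (c : R), ω i ≤ k → D (b + 1) hi y = 0 →
      y = c • plug z hi' (b + 1) hb (D b hi y) → y = 0
  | 0, n, b, i, i', y, hi, hi', hb, c, hk, _, hy => by
    rw [hy, h.neg (D b hi y) (by rw [← hi, map_add, h.wt_shift]; push_cast at hk; omega), map_zero,
      smul_zero]
  | k + 1, n, b, i, i', y, hi, hi', hb, c, hk, h0, hy => by
    have h₂ : i' + δ + e = i' := by rw [add_assoc, add_comm δ, h.add, add_zero]
    have h1 := h.shift_plug_ns hS hi' hi rfl h₂ hb hb (D b hi y)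
    have h2 := (h.comm y).ns hS hi rfl hi rfl (Nat.le_succ b) hb
    rw [h0, map_zero] at h2
    have h3 : D (b + 1 + 1) (rfl : i' + δ = _) (D b hi y) = 0 := by
      rw [← one_smul R (D (b + 1 + 1) _ _), ← sgn_mul_self (R := R) (deg δ * deg δ), mul_smul, ← h2,
        smul_zero]
    rw [if_pos le_rfl, if_pos le_rfl, if_pos rfl, h3, map_zero, add_zero] at h1
    have h4 := congrArg (D (b + 1) hi) hy
    rw [h0, map_smul, h1] at h4
    have h5 : c • D b hi y = 0 := by
      refine eq_zero_of_plug hS k (b := b + 1) (c • D b hi y) rfl h₂ (by omega)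
        (-sgn R (deg δ * deg i')) ?_ (by rw [map_smul, h3, smul_zero]) ?_
      · rw [← hi, map_add, h.wt_shift]
        push_cast at hk
        omega
      · rw [map_smul, map_smul, neg_smul, eq_neg_iff_add_eq_zero]
        have h6 := sgn_mul_self (R := R) (deg δ * deg i')
        generalize sgn R (deg δ * deg i') = s at h4 h6 ⊢
        trans s • c • (TwistOperad.plug z h₂ (b + 1 + 1) (by omega) (D (b + 1) rfl (D b hi y)) +
          s • D b hi y)
        · simp only [smul_add, smul_smul]
          rw [show s * (c * s) = c by linear_combination c * h6]
          abel
        · rw [← h4, smul_zero]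
    rw [hy, ← map_smul, h5, map_zero]

/-- Elements of positive weight are detected by shifts. -/
theorem eq_zero (hRS : S → ∀ n : ℕ, IsUnit ((n + 1 : ℕ) : R)) {n : ℕ} {i j : ι} (hj : i + δ = j)
    (x : A.X n i) (h0 : 0 < ω i) (hx : ∀ s, Slot S s n → D s hj x = 0) : x = 0 := by
  have hj' : j + e = i := by rw [← hj, add_assoc, add_comm δ, h.add, add_zero]
  by_cases hS : S
  · obtain ⟨k, hk⟩ : ∃ k : ℕ, ω i = ((k + 1 : ℕ) : ℤ) := ⟨(ω i).toNat - 1, by omega⟩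
    have h1 := h.euler hS (k + 1) hj' hj x hk
    rw [hx 0 (slot_zero S n), map_zero, smul_smul] at h1
    have h2 : IsUnit (sgn R (deg e * (deg i + 1)) * ((k + 1 : ℕ) : R)) :=
      (IsUnit.of_mul_eq_one _ (sgn_mul_self _)).mul (hRS hS k)
    exact (h2.smul_eq_zero).1 h1.symm
  · have hx' : ∀ s, s ≤ n → D s hj x = 0 := fun s hs => hx s ⟨hs, fun h => (hS h).elim⟩
    have step : ∀ b, b ≤ n → Sorted δ z ω b x → b = 0 ∧ x = 0 ∨ 0 < b ∧ Sorted δ z ω (b - 1) x := by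
      intro b hb hs
      obtain ⟨y, x', hy, hxy, hx''⟩ := h.sorted_split hs hb hj' h0
      have h2 : j + δ + e = j := by rw [add_assoc, add_comm δ, h.add, add_zero]
      have h3 : D b hj x' = 0 := by
        rcases hx'' with h' | h'
        · rw [h'.2, map_zero]
        · exact h.sorted_shift hS h'.2 (by omega) hb hj
      have h4 : D (b + 1) (rfl : j + δ = _) y = 0 :=
        h.sorted_shift hS hy (Nat.lt_succ_self b) (by omega) rfl
      have h5 := hx' b hb
      rw [hxy, map_add, h3, add_zero, h.shift_plug_ns hS hj' hj rfl h2 hb hb, if_pos le_rfl,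
        if_pos le_rfl, if_pos rfl, h4, map_zero, add_zero] at h5
      have h6 : y = 0 := by
        refine h.eq_zero_of_plug hS (ω j).toNat (b := b) y rfl h2 (by omega)
          (-sgn R (deg δ * deg j)) (by omega) h4 ?_
        have h7 := sgn_mul_self (R := R) (deg δ * deg j)
        rw [neg_smul, eq_neg_iff_add_eq_zero]
        generalize sgn R (deg δ * deg j) = s at h5 h7 ⊢
        rw [← smul_zero s, ← h5, smul_add, smul_smul, h7, one_smul]
        abel
      rw [h6, map_zero, zero_add] at hxy
      rw [hxy]
      exact hx''
    have key : ∀ b, b ≤ n → Sorted δ z ω b x → x = 0 := by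
      intro b
      induction b with
      | zero =>
        intro hb hs
        rcases step 0 hb hs with h' | h'
        exacts [h'.2, absurd h'.1 (lt_irrefl 0)]
      | succ b ih =>
        intro hb hs
        rcases step (b + 1) hb hs with h' | h'
        exacts [h'.2, ih (by omega) h'.2]
    exact key n le_rfl (h.sorted_all (ω i).toNat x (by omega))

end PlugSystem
end Plug
end
end TwistOperad

namespace TwistOperad

noncomputable section

section AdjoinShift

variable {R : Type v} [CommRing R] {S : Prop} (P : ZOp.{v, w} R S) {Z : Type} (z : Z → Tri)

/-- An additive weight on the coproduct of `P` with a free operad, which counts the occurrences of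
some of the new operations. -/
structure IsWeight (ω : Tri →+ ℤ) : Prop where
  old : ∀ d : ℤ, ω (d, 0, 0) = 0
  new : ∀ x, 0 ≤ ω (z x)

variable {P z}

theorem IsWeight.neg {ω : Tri →+ ℤ} (h : IsWeight z ω) {n : ℕ} {i : Tri} (x : (adjoin P z).X n i)
    (hx : ω i < 0) : x = 0 := by
  induction x using Pres.cl_ind with | h p => ?_
  induction p with
  | gen g =>
    cases g with
    | old hi p =>
      rw [← hi, h.old] at hx
      omega
    | new x hi =>
      rw [← hi] at hx
      exact absurd (h.new x) (by omega)
  | one hi =>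
    rw [hi, map_zero] at hx
    omega
  | @comp m n l i j k a hl hk p q ih ih' =>
    rw [← hk, map_add] at hx
    rw [Pres.cl_comp]
    by_cases h' : ω i < 0
    · rw [ih h', map_zero, LinearMap.zero_apply]
    · rw [ih' (by omega), map_zero]
  | act hS σ p ih => rw [Pres.cl_act, ih hx, map_zero]
  | zero => rfl
  | add p q ih ih' => rw [Pres.cl_add, ih hx, ih' hx, add_zero]
  | smul r p ih => rw [Pres.cl_smul, ih hx, smul_zero]

theorem IsWeight.exists_old {ω : Tri →+ ℤ} (h : IsWeight z ω) (h' : ∀ x, 0 < ω (z x)) {n : ℕ}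
    {i : Tri} (x : (adjoin P z).X n i) (hx : ω i = 0) :
    x = 0 ∨ ∃ (d : ℤ) (hd : ((d, 0, 0) : Tri) = i) (p : P.X n d), x = inOld P z hd p := by
  induction x using Pres.cl_ind with | h p => ?_
  induction p with
  | gen g =>
    cases g with
    | old hi p => exact Or.inr ⟨_, hi, p, rfl⟩
    | new x hi =>
      rw [← hi] at hx
      exact absurd (h' x) (by omega)
  | one hi =>
    subst hi
    exact Or.inr ⟨0, rfl, P.one rfl, (inOld_one P z rfl rfl rfl).symm⟩
  | @comp m n l i j k a hl hk p q ih ih' =>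
    rw [← hk, map_add] at hx
    rw [Pres.cl_comp]
    rcases lt_trichotomy (ω i) 0 with hi | hi | hi
    · have h1 : (Pres.cl p : (adjoin P z).X m i) = 0 := h.neg _ hi
      exact Or.inl (by rw [h1, map_zero, LinearMap.zero_apply])
    · rcases ih hi with h1 | ⟨d, hd, p', hp⟩
      · exact Or.inl (by rw [h1, map_zero, LinearMap.zero_apply])
      rcases ih' (by omega) with h1 | ⟨d', hd', q', hq⟩
      · exact Or.inl (by rw [h1, map_zero])
      refine Or.inr ⟨d + d', by rw [← hk, ← hd, ← hd']; simp, P.comp a hl rfl p' q', ?_⟩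
      rw [hp, hq]
      exact (inOld_comp P z a hl rfl hd hd' _ hk p' q').symm
    · have h1 : (Pres.cl q : (adjoin P z).X n j) = 0 := h.neg _ (by omega)
      exact Or.inl (by rw [h1, map_zero])
  | act hS σ p ih =>
    rw [Pres.cl_act]
    rcases ih hx with h1 | ⟨d, hd, p', hp⟩
    · exact Or.inl (by rw [h1, map_zero])
    · exact Or.inr ⟨d, hd, P.act hS σ p', by rw [hp, inOld_act]⟩
  | zero => exact Or.inl rfl
  | @add n i p q ih ih' =>
    rw [Pres.cl_add]
    rcases ih hx with h1 | ⟨d, hd, p', hp⟩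
    · rw [h1, zero_add]
      exact ih' hx
    · rcases ih' hx with h1 | ⟨d', hd', q', hq⟩
      · rw [h1, add_zero]
        exact Or.inr ⟨d, hd, p', hp⟩
      · obtain rfl : d = d' := congrArg Prod.fst (hd.trans hd'.symm)
        exact Or.inr ⟨d, hd, p' + q', by rw [hp, hq, map_add]⟩
  | smul r p ih =>
    rw [Pres.cl_smul]
    rcases ih hx with h1 | ⟨d, hd, p', hp⟩
    · exact Or.inl (by rw [h1, smul_zero])
    · exact Or.inr ⟨d, hd, r • p', by rw [hp, map_smul]⟩

/-- The elements of weight zero come from `P`. -/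
theorem IsWeight.inOld_surjective {ω : Tri →+ ℤ} (h : IsWeight z ω) (h' : ∀ x, 0 < ω (z x)) {n : ℕ}
    {d : ℤ} {i : Tri} (hd : ((d, 0, 0) : Tri) = i) (x : (adjoin P z).X n i) :
    ∃ p, x = inOld P z hd p := by
  rcases h.exists_old h' x (by rw [← hd, h.old]) with h1 | ⟨d', hd', p, hp⟩
  · exact ⟨0, by rw [h1, map_zero]⟩
  · obtain rfl : d = d' := congrArg Prod.fst (hd.trans hd'.symm)
    exact ⟨p, hp⟩

variable (P z)

/-- Values on generators of the shift of a new operation `x₀`. -/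
def adjShiftGen (x₀ : Z) (δ : Tri) (hδ : z x₀ + δ = 0) : ∀ (_ n : ℕ) (i j : Tri), i + δ = j →
    AdjGen P z n i → (adjoin P z).X (n + 1) j
  | _, _, _, _, _, .old _ _ => 0
  | _, _, _, _, h, .new x hx =>
    open Classical in
    if h' : x = x₀ then (adjoin P z).one (by rw [← h, ← hx, h', hδ]) else 0

/-- The shift derivation that sends the new operation `x₀` to the identity, and the other new
operations as well as all elements of `P` to zero. -/
def adjShift (x₀ : Z) (δ : Tri) (hδ : z x₀ + δ = 0) : ShiftMap (adjoin P z) (adjoin P z) δ :=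
  Pres.shift δ (adjShiftGen P z x₀ δ hδ) (by
    intro s n i j h p q hr hs
    cases hr with
    | one hd h hi => rfl
    | comp a hl hf hi hj hk hijk p q =>
      change (0 : (adjoin P z).X _ _) = (adjoin P z).outer a _ _ s (fun t => 0) _ + _ •
        (adjoin P z).inner a _ _ s _ (fun t => 0)
      rw [Op.outer_zero_left, Op.inner_zero_right, smul_zero, add_zero]
    | act hS σ hi p =>
      change (0 : (adjoin P z).X _ _) = (adjoin P z).act hS (up σ) 0
      rw [map_zero]
    | add hi p q =>
      change (0 : (adjoin P z).X _ _) = 0 + 0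
      rw [add_zero]
    | smul hi r p =>
      change (0 : (adjoin P z).X _ _) = r • 0
      rw [smul_zero])

variable {P z} {x₀ : Z} {δ : Tri} {hδ : z x₀ + δ = 0}

theorem isShiftDer_adjShift : IsShiftDer (Op.Hom.id _) δ (adjShift P z x₀ δ hδ) :=
  Pres.isShiftDer_shift _

theorem adjShift_gen {s n : ℕ} {i j : Tri} (h : i + δ = j) (hs : Slot S s n) (g : AdjGen P z n i) :
    adjShift P z x₀ δ hδ s h (Pres.cl (.gen g)) = adjShiftGen P z x₀ δ hδ s n i j h g :=
  Pres.shift_cl h hs _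

theorem adjShift_old {s n : ℕ} {d : ℤ} {i j : Tri} (h : i + δ = j) (hs : Slot S s n)
    (hd : ((d, 0, 0) : Tri) = i) (p : P.X n d) :
    adjShift P z x₀ δ hδ s h (inOld P z hd p) = 0 :=
  adjShift_gen h hs (.old hd p)

theorem adjShift_new {i j : Tri} (h : i + δ = j) (hi : z x₀ = i) (hj : j = 0) :
    adjShift P z x₀ δ hδ 0 h (inNew P z x₀ hi) = (adjoin P z).one hj :=
  (adjShift_gen h (slot_zero S 0) (.new x₀ hi)).trans (dif_pos rfl)

theorem adjShift_new_ne {x : Z} (hx : x ≠ x₀) {i j : Tri} (h : i + δ = j) (hi : z x = i) :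
    adjShift P z x₀ δ hδ 0 h (inNew P z x hi) = 0 :=
  (adjShift_gen h (slot_zero S 0) (.new x hi)).trans (dif_neg hx)

variable {ω : Tri →+ ℤ}

theorem adjoin_span (h0 : ∀ d : ℤ, ω (d, 0, 0) = 0) (h1 : ω (z x₀) = 1)
    (h2 : ∀ x, x ≠ x₀ → ω (z x) = 0) {n : ℕ} {i : Tri} (x : (adjoin P z).X n i) (hx : 0 < ω i) :
    x ∈ Submodule.span R {y | ∃ (j : ℕ) (hj : j ≤ n) (i' : Tri) (hi : i' + z x₀ = i)
      (y' : (adjoin P z).X (n + 1) i'), y = plug (inNew P z x₀ rfl) hi j hj y'} := by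
  have hw : IsWeight z ω := ⟨h0, fun x => by
    by_cases h : x = x₀
    · rw [h, h1]; exact zero_le_one
    · rw [h2 x h]⟩
  induction x using Pres.cl_ind with | h p => ?_
  induction p with
  | gen g =>
    cases g with
    | old hi p =>
      rw [← hi, h0] at hx
      omega
    | @new i x hi =>
      by_cases h : x = x₀
      · subst h
        subst hi
        refine Submodule.subset_span ⟨0, le_rfl, 0, zero_add _, (adjoin P z).one rfl, ?_⟩
        rw [plug_def]
        exact ((adjoin P z).one_comp (n := 0) _ rfl rfl (zero_add _) _).symm
      · rw [← hi, h2 x h] at hx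
        omega
  | one hi =>
    rw [hi, map_zero] at hx
    omega
  | @comp m n l i j k a hl hk p q ih ih' =>
    rw [Pres.cl_comp]
    rw [← hk, map_add] at hx
    by_cases hi : 0 < ω i
    · have := ih hi
      generalize (Pres.cl p : (adjoin P z).X m i) = p' at this
      induction this using Submodule.span_induction with
      | mem x hx =>
        obtain ⟨b, hb, i', hi', y, rfl⟩ := hx
        have hdd : i' + j + z x₀ = k := by rw [← hk, ← hi']; abel
        have ha := a.2
        rcases Nat.lt_or_ge a b with hab | hab
        · have := (adjoin P z).comp_par (m := m + 1) (n := n) (r := 0) (l := l + 1) (l' := m)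
            (t := l) (⟨a, by omega⟩ : Fin (m + 1)) ⟨b, by omega⟩ ⟨b + n - 1, by omega⟩ a
            hab (by simp; omega) rfl (by omega) rfl rfl hl rfl hdd hi' hk y (Pres.cl q)
            (inNew P z x₀ rfl)
          have h3 := congrArg (fun t => sgn R (triDeg j * triDeg (z x₀)) • t) this
          simp only [smul_smul, sgn_mul_self, one_smul] at h3
          rw [plug_def, ← h3]
          exact Submodule.smul_mem _ _ (Submodule.subset_span ⟨b + n - 1, by omega, _, hdd, _, rfl⟩)
        · have := (adjoin P z).comp_par (m := m + 1) (n := 0) (r := n) (l := m) (l' := l + 1)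
            (t := l) (⟨b, by omega⟩ : Fin (m + 1)) ⟨a + 1, by omega⟩ a ⟨b, by omega⟩
            (by rw [Fin.lt_def]; simp; omega) (by simp) rfl rfl hl (by omega) rfl hi' hk rfl hdd y
            (inNew P z x₀ rfl) (Pres.cl q)
          rw [plug_def, this]
          exact Submodule.smul_mem _ _ (Submodule.subset_span ⟨b, by omega, _, hdd, _, rfl⟩)
      | zero =>
        rw [map_zero, LinearMap.zero_apply]
        exact Submodule.zero_mem _
      | add x y _ _ hx hy =>
        rw [map_add, LinearMap.add_apply]
        exact Submodule.add_mem _ hx hy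
      | smul r x _ hx =>
        rw [map_smul, LinearMap.smul_apply]
        exact Submodule.smul_mem _ _ hx
    · have := ih' (by omega)
      generalize (Pres.cl q : (adjoin P z).X n j) = q' at this
      induction this using Submodule.span_induction with
      | mem x hx =>
        obtain ⟨b, hb, j', hj', y, rfl⟩ := hx
        have hdd : i + j' + z x₀ = k := by rw [← hk, ← hj']; abel
        have ha := a.2
        have := (adjoin P z).comp_seq (m := m) (n := n + 1) (r := 0) (l := l + 1) (l' := n)
          (t := l) a ⟨b, by omega⟩ ⟨a + b, by omega⟩ rfl (by omega) rfl rfl hl rfl hdd hj' hk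
          (Pres.cl p) y (inNew P z x₀ rfl)
        rw [plug_def, ← this]
        exact Submodule.subset_span ⟨a + b, by omega, _, hdd, _, rfl⟩
      | zero =>
        rw [map_zero]
        exact Submodule.zero_mem _
      | add x y _ _ hx hy =>
        rw [map_add]
        exact Submodule.add_mem _ hx hy
      | smul r x _ hx =>
        rw [map_smul]
        exact Submodule.smul_mem _ _ hx
  | @act n i hS σ p ih =>
    rw [Pres.cl_act]
    have := ih hx
    generalize (Pres.cl p : (adjoin P z).X n i) = p' at this
    induction this using Submodule.span_induction with
    | mem x hx =>
      obtain ⟨b, hb, i', hi', y, rfl⟩ := hx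
      refine Submodule.subset_span ⟨0, Nat.zero_le _, i', hi',
        (adjoin P z).act hS (cyc ⟨b, by omega⟩ * up σ) y, ?_⟩
      rw [plug_def, plug_def, (adjoin P z).comp_act_left hS _ _ _ _ σ]
      · congr 1
      · constructor
        · intro k x hk hx
          induction k using Fin.cases with
          | zero => exact (hk rfl).elim
          | succ k =>
            obtain rfl : x = k := Fin.ext (by simpa [outerPlace] using hx)
            change _ = outerPlace (cyc _ (up σ 0) : ℕ) 0 (cyc _ (up σ x.succ) : ℕ)
            rw [up_zero, up_succ, cyc_val, cyc_val]
            simp only [outerPlace, Fin.val_zero, Fin.val_succ]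
            grind
        · intro k
          exact k.elim0
    | zero =>
      rw [map_zero]
      exact Submodule.zero_mem _
    | add x y _ _ hx hy =>
      rw [map_add]
      exact Submodule.add_mem _ hx hy
    | smul r x _ hx =>
      rw [map_smul]
      exact Submodule.smul_mem _ _ hx
  | zero => exact Submodule.zero_mem _
  | add p q ih ih' => exact Submodule.add_mem _ (ih hx) (ih' hx)
  | smul r p ih => exact Submodule.smul_mem _ _ (ih hx)

theorem adjShift_adjShift {x₁ : Z} {δ₁ : Tri} {hδ₁ : z x₁ + δ₁ = 0} {n : ℕ} {i : Tri}
    (x : (adjoin P z).X n i) :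
    SComm (adjShift P z x₀ δ hδ) (adjShift P z x₁ δ₁ hδ₁) x := by
  refine scomm_pres isShiftDer_adjShift isShiftDer_adjShift (fun {n i} g => ?_) x
  have h1 : ∀ {s n : ℕ} {i j j' : Tri} (g : AdjGen P z n i) {x₀ x₁ : Z} {δ δ₁ : Tri}
      {hδ : z x₀ + δ = 0} {hδ₁ : z x₁ + δ₁ = 0} (h : i + δ = j) (h' : j + δ₁ = j') (t : ℕ),
      Slot S t n → Slot S s (n + 1) → adjShift P z x₁ δ₁ hδ₁ s h' (adjShift P z x₀ δ hδ t h
        (Pres.cl (.gen g))) = 0 := by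
    intro s n i j j' g x₀ x₁ δ δ₁ hδ hδ₁ h h' t ht hs
    rw [adjShift_gen h ht]
    cases g with
    | old hd p => exact map_zero _
    | new x hx =>
      simp only [adjShiftGen]
      split_ifs with h''
      · exact isShiftDer_adjShift.one _ _ hs
      · exact map_zero _
  constructor
  · intro hS j j' k h₁ h₁' h₂ h₂'
    rw [h1 g h₁ h₁' 0 (slot_zero S _) (slot_zero S _),
      h1 g h₂ h₂' 0 (slot_zero S _) (slot_zero S _), map_zero, smul_zero]
  · intro hS s t j j' k h₁ h₁' h₂ h₂' hst ht
    rw [h1 g h₁ h₁' t ⟨ht, fun h => (hS h).elim⟩ ⟨by omega, fun h => (hS h).elim⟩,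
      h1 g h₂ h₂' s ⟨by omega, fun h => (hS h).elim⟩ ⟨by omega, fun h => (hS h).elim⟩, smul_zero]

theorem adjoin_plugSystem (h0 : ∀ d : ℤ, ω (d, 0, 0) = 0) (h1 : ω (z x₀) = 1)
    (h2 : ∀ x, x ≠ x₀ → ω (z x) = 0) :
    PlugSystem (inNew P z x₀ rfl) (adjShift P z x₀ δ hδ) ω where
  shift := isShiftDer_adjShift
  add := hδ
  val h h' := adjShift_new h rfl h'
  comm := adjShift_adjShift
  wt := h1
  neg x := (show IsWeight z ω from ⟨h0, fun x => by
    by_cases h : x = x₀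
    · rw [h, h1]; exact zero_le_one
    · rw [h2 x h]⟩).neg x
  span := adjoin_span h0 h1 h2

end AdjoinShift
end
end TwistOperad

namespace TwistOperad

noncomputable section

section OddShift

variable {R : Type v} [CommRing R] {S : Prop}

section Bracket

variable {A : ZOp.{v, w} R S} {d : ∀ {n : ℕ} {i j : ℤ}, i + -1 = j → A.X n i →ₗ[R] A.X n j}
  (hd : IsDer A (-1) d) {D : ShiftMap A A 1} {N : ShiftMap A A 0}

theorem bracket_odd (s : ℕ) {n : ℕ} {i j j' j'' : ℤ} (h : i + 0 = j) (h₁ : i + -1 = j')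
    (h₁' : j' + 1 = j) (h₂ : i + 1 = j'') (h₂' : j'' + -1 = j) (x : A.X n i) :
    bracket D d (add_neg_cancel 1) s h x = D s h₁' (d h₁ x) + d h₂' (D s h₂ x) := by
  subst h₁ h₂
  rw [bracket_apply, AddMonoidHom.id_apply, show sgn R 1 = -1 by simp [sgn], neg_one_smul,
    sub_neg_eq_add]

include hd in
theorem SComm.bracket (hN : ∀ (s : ℕ) {n : ℕ} {i j j' k : ℤ} (h₁ : i + 0 = j) (h₁' : j + -1 = k)
      (h₂ : i + -1 = j') (h₂' : j' + 0 = k) (x : A.X n i), Slot S s n →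
      d h₁' (N s h₁ x) = N s h₂' (d h₂ x))
    (hc : ∀ {n i} (x : A.X n i), SComm D N x) {n : ℕ} {i : ℤ} (x : A.X n i) :
    SComm (TwistOperad.bracket D d (add_neg_cancel 1)) N x where
  sym hS j j' k h₁ h₁' h₂ h₂' := by
    obtain rfl : j' = i := by omega
    obtain rfl : j = j' := by omega
    obtain rfl : k = j := by omega
    have hs : ∀ n, Slot S 0 n := slot_zero S
    have e : sgn R (AddMonoidHom.id ℤ (1 : ℤ) * AddMonoidHom.id ℤ (0 : ℤ)) = 1 := by simp [sgn]
    rw [show sgn R (AddMonoidHom.id ℤ (0 : ℤ) * AddMonoidHom.id ℤ (0 : ℤ)) = 1 by simp [sgn],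
      one_smul, bracket_odd 0 h₁' rfl (by omega) rfl (by omega),
      bracket_odd 0 h₁ rfl (by omega) rfl (by omega), hN 0 h₁ rfl rfl (by omega) x (hs _),
      (hc _).sym hS _ _ (show k + -1 + 1 = k by omega) h₁', e, one_smul,
      (hc _).sym hS _ _ (show k + 1 = k + 1 from rfl) (add_zero _), e, one_smul, hd.act,
      hN 0 (add_zero (k + 1)) (by omega) (show k + 1 + -1 = k by omega) h₁' _ (hs _),
      LinearMap.map_add, LinearMap.map_add]
  ns hS s t j j' k h₁ h₁' h₂ h₂' hst ht := by
    obtain rfl : j' = i := by omega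
    obtain rfl : j = j' := by omega
    obtain rfl : k = j := by omega
    have hs : ∀ s n, s ≤ n → Slot S s n := fun s n h => ⟨h, fun h => (hS h).elim⟩
    have e : sgn R (AddMonoidHom.id ℤ (1 : ℤ) * AddMonoidHom.id ℤ (0 : ℤ)) = 1 := by simp [sgn]
    rw [show sgn R (AddMonoidHom.id ℤ (0 : ℤ) * AddMonoidHom.id ℤ (0 : ℤ)) = 1 by simp [sgn],
      one_smul, bracket_odd s h₁' rfl (by omega) rfl (by omega),
      bracket_odd s h₁ rfl (by omega) rfl (by omega), hN t h₁ rfl rfl (by omega) x (hs _ _ ht),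
      (hc _).ns hS _ _ (show k + -1 + 1 = k by omega) h₁' hst ht, e, one_smul,
      (hc _).ns hS _ _ (show k + 1 = k + 1 from rfl) (add_zero _) hst ht, e, one_smul,
      hN (t + 1) (add_zero (k + 1)) (by omega) (show k + 1 + -1 = k by omega) h₁' _
        (hs _ _ (by omega)), LinearMap.map_add]

end Bracket

/-- A shift derivation of degree one of a dg operad that commutes with its commutator with the
differential. -/
structure IsOddShift (P : PreDG.{v, w} R S) (D : ShiftMap P.op P.op 1) : Prop where
  shift : IsShiftDer (Op.Hom.id _) 1 D
  comm : ∀ {n i} (x : P.op.X n i), SComm D (bracket D P.d (add_neg_cancel 1)) x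

/-- The commutator of a shift derivation of degree one with the differential. -/
abbrev nabla {P : PreDG.{v, w} R S} (D : ShiftMap P.op P.op 1) : ShiftMap P.op P.op 0 :=
  bracket D P.d (add_neg_cancel 1)

section Nabla

variable {P : PreDG.{v, w} R S} (hP : IsDG P) {D : ShiftMap P.op P.op 1}

include hP

theorem nabla_d (s : ℕ) {n : ℕ} {i j j' k : ℤ} (h₁ : i + 0 = j) (h₁' : j + -1 = k)
    (h₂ : i + -1 = j') (h₂' : j' + 0 = k) (x : P.op.X n i) :
    P.d h₁' (nabla D s h₁ x) = nabla D s h₂' (P.d h₂ x) := by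
  rw [bracket_odd s h₁ h₂ (by omega) rfl (by omega),
    bracket_odd s h₂' rfl (by omega) (show j' + 1 = j by omega) h₁', LinearMap.map_add, hP.d_d,
    hP.d_d, LinearMap.map_zero, add_zero, zero_add]

namespace IsOddShift

variable (h : IsOddShift P D)

include h

theorem nabla_shift : IsShiftDer (Op.Hom.id _) 0 (nabla D) :=
  isShiftDer_bracket h.shift hP.isDer _

theorem nabla_comm {n : ℕ} {i : ℤ} (x : P.op.X n i) : SComm (nabla D) (nabla D) x :=
  SComm.bracket hP.isDer (fun s _ _ _ _ _ h₁ h₁' h₂ h₂' x _ => nabla_d hP s h₁ h₁' h₂ h₂' x)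
    h.comm x

theorem d_shiftSeq (x : P.op.X 0 (-1))
    (h0 : P.d rfl x = stash P.op (shiftSeq (nabla D) x) 0) : ∀ n : ℕ,
    P.d rfl (shiftSeq (nabla D) x n) = stash P.op (shiftSeq (nabla D) x) n
  | 0 => h0
  | n + 1 => by
    change P.d rfl (nabla D 0 _ _) = _
    rw [nabla_d hP 0 _ rfl rfl (add_zero _), d_shiftSeq x h0 n]
    exact stash_shift (h.nabla_shift hP)
      (fun s n hs => shift_shiftSeq (h.nabla_shift hP) (h.nabla_comm hP) x hs _)
      (fun hS n σ => act_shiftSeq (h.nabla_shift hP) (h.nabla_comm hP) x hS n σ) (slot_zero S n) _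

end IsOddShift
end Nabla

theorem stash_zero (A : ZOp.{v, w} R S) (m : ∀ n : ℕ, A.X n (-1)) :
    stash A m 0 = -A.comp (0 : Fin 1) (n := 0) rfl rfl (m 1) (m 0) := by
  unfold stash
  split_ifs with hS
  · congr 1
    refine (Fin.sum_univ_one _).trans ?_
    rw [Finset.sum_eq_single 1]
    · exact A.act_one hS _
    · intro σ _ h
      exact (h (Subsingleton.elim _ _)).elim
    · intro h
      refine (h ?_).elim
      simp only [Finset.mem_filter, Finset.mem_univ, true_and]
      exact fun i => i.elim0
  · congr 1
    exact (Fin.sum_univ_one _).trans (Fin.sum_univ_one _)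

end OddShift

section Pull

variable {R : Type v} [CommRing R] {S : Prop}

/-- An operad with the homological grading, regarded as having all its elements in each of the
additional degrees. -/
def triPull (M : ZOp.{v, w} R S) : Op.{v, w} R S Tri triDeg where
  X n i := M.X n i.1
  one h := M.one (congrArg Prod.fst h)
  comp a hl hk := M.comp a hl (congrArg Prod.fst hk)
  act hS σ := M.act hS σ
  one_comp _ _ _ _ _ := M.one_comp _ _ _ _ _
  comp_one _ _ _ _ _ := M.comp_one _ _ _ _ _
  comp_seq _ _ _ h _ _ _ _ _ _ _ _ _ _ _ := M.comp_seq _ _ _ h _ _ _ _ _ _ _ _ _ _ _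
  comp_par _ _ _ _ h h' h'' _ _ _ _ _ _ _ _ _ _ _ :=
    M.comp_par _ _ _ _ h h' h'' _ _ _ _ _ _ _ _ _ _ _
  act_one _ _ := M.act_one _ _
  act_mul _ _ _ _ := M.act_mul _ _ _ _
  comp_act _ _ _ _ _ _ _ h _ _ := M.comp_act _ _ _ _ _ _ _ h _ _

/-- A shift map, regarded as having additional degrees. -/
def triShift {M : ZOp.{v, w} R S} (δ : Tri) (D : ShiftMap M M δ.1) :
    ShiftMap (triPull M) (triPull M) δ :=
  fun s _ _ _ h => D s (congrArg Prod.fst h)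

theorem isShiftDer_triShift {M : ZOp.{v, w} R S} {δ : Tri} {D : ShiftMap M M δ.1}
    (h : IsShiftDer (Op.Hom.id M) δ.1 D) :
    IsShiftDer (Op.Hom.id (triPull M)) δ (triShift δ D) where
  one hi hj hs := h.one (congrArg Prod.fst hi) (congrArg Prod.fst hj) hs
  comp a hl hk hk' p q hs := h.comp a hl (congrArg Prod.fst hk) (congrArg Prod.fst hk') p q hs
  act hS σ hj p := h.act hS σ (congrArg Prod.fst hj) p

/-- The morphism out of a coproduct that is given by a morphism and by values of the new
operations. -/
def adjEvalHom {P M : ZOp.{v, w} R S} (F : Op.Hom P M) {Z : Type} (z : Z → Tri)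
    (y : ∀ x, M.X 0 (z x).1) : Op.Hom (adjoin P z) (triPull M) where
  f _ _ := adjEval F z y
  map_one _ := rfl
  map_comp := by
    intro m n l i j k a hl hk p q
    induction p using Pres.cl_ind with | h p => ?_
    induction q using Pres.cl_ind with | h q => ?_
    rfl
  map_act := by
    intro n i hS σ p
    induction p using Pres.cl_ind with | h p => ?_
    rfl

section AdjEval

variable {P M : ZOp.{v, w} R S} (F : Op.Hom P M) {Z : Type} (z : Z → Tri)
  (y : ∀ x, M.X 0 (z x).1)

theorem adjEval_comp {m n l : ℕ} {i j k : Tri} (a : Fin m) (hl : l + 1 = m + n)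
    (hk : i + j = k) (p : (adjoin P z).X m i) (q : (adjoin P z).X n j) :
    adjEval F z y ((adjoin P z).comp a hl hk p q) =
      M.comp a hl (congrArg Prod.fst hk) (adjEval F z y p) (adjEval F z y q) :=
  (adjEvalHom F z y).map_comp a hl hk p q

theorem adjEval_act {n : ℕ} {i : Tri} (hS : S) (σ : Equiv.Perm (Fin n))
    (p : (adjoin P z).X n i) :
    adjEval F z y ((adjoin P z).act hS σ p) = M.act hS σ (adjEval F z y p) :=
  (adjEvalHom F z y).map_act hS σ p

theorem adjEval_old {n : ℕ} {d : ℤ} {i₂ : ℤ × ℤ} (h : ((d, 0, 0) : Tri) = (d, i₂)) (p : P.X n d) :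
    adjEval F z y (inOld P z h p) = F.f n d p := by
  obtain rfl : (0, 0) = i₂ := congrArg Prod.snd h
  rfl

variable {F z y}

/-- A shift derivation that vanishes on `P`, and on the new operations except for one that it
sends to the identity, restricts to the corresponding shift derivation of the coproduct. -/
theorem adjEval_shift {x₀ : Z} {δ : Tri} {hδ : z x₀ + δ = 0} {D : ShiftMap M M δ.1}
    (hD : IsShiftDer (Op.Hom.id M) δ.1 D)
    (hF : ∀ {s n : ℕ} {i j : ℤ} (h : i + δ.1 = j) (p : P.X n i), Slot S s n →
      D s h (F.f n i p) = 0)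
    (h1 : ∀ {j : ℤ} (h : (z x₀).1 + δ.1 = j) (hj : j = 0), D 0 h (y x₀) = M.one hj)
    (h2 : ∀ x, x ≠ x₀ → ∀ {j : ℤ} (h : (z x).1 + δ.1 = j), D 0 h (y x) = 0)
    {s n : ℕ} (hs : Slot S s n) {i j : Tri} (h : i + δ = j) (x : (adjoin P z).X n i) :
    D s (congrArg Prod.fst h) (adjEval F z y x) = adjEval F z y (adjShift P z x₀ δ hδ s h x) := by
  refine shiftAgree_pres (F := adjEvalHom F z y)
    ((isShiftDer_triShift hD).comp_hom (adjEvalHom F z y) _ fun _ _ _ => rfl)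
    ((isShiftDer_adjShift (P := P) (z := z) (x₀ := x₀) (δ := δ) (hδ := hδ)).hom_comp
      (adjEvalHom F z y) _ fun _ _ _ => rfl) ?_ x s j h hs
  intro n i g s j h hs
  change D s (congrArg Prod.fst h) (adjEval F z y (Pres.cl (.gen g))) =
    adjEval F z y (adjShift P z x₀ δ hδ s h (Pres.cl (.gen g)))
  rw [adjShift_gen h hs]
  cases g with
  | old hi p =>
    subst hi
    exact (hF _ p hs).trans (map_zero _).symm
  | new x hx =>
    subst hx
    obtain rfl : s = 0 := by have := hs.1; omega
    simp only [adjShiftGen]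
    split_ifs with h'
    · subst h'
      exact h1 _ _
    · rw [map_zero]
      exact h2 x h' _

end AdjEval
end Pull
end
end TwistOperad

namespace TwistOperad

noncomputable section

section Weights

variable {R : Type v} [CommRing R] {S : Prop}

/-- The number of `κ`. -/
abbrev kappaWt : Tri →+ ℤ := (AddMonoidHom.fst ℤ ℤ).comp (AddMonoidHom.snd ℤ (ℤ × ℤ))

/-- The number of `α`. -/
abbrev alphaWt : Tri →+ ℤ := (AddMonoidHom.snd ℤ ℤ).comp (AddMonoidHom.snd ℤ (ℤ × ℤ))

/-- The degree of the operation that removes one `κ`. -/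
abbrev kappaInv : Tri := (1, -1, 0)

variable (Q : Quad.{v, w} R S)

/-- The inclusion of the suboperad of a quadruple. -/
def Quad.incl : Op.Hom Q.sub.toOp Q.dg.op where
  f n i := (Q.sub.carrier n i).subtype
  map_one := fun _ => rfl
  map_comp := fun _ _ _ _ _ => rfl
  map_act := fun _ _ _ => rfl

/-- The natural morphism to `Q` from the coproduct `Q₀ ∨ [κ]`. -/
abbrev Quad.ev {n : ℕ} {i : Tri} :
    (adjoin Q.sub.toOp kDeg).X n i →ₗ[R] Q.dg.op.X n i.1 :=
  adjEval Q.incl kDeg (fun _ => Q.κ)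

theorem Quad.ev_one {i : Tri} (h : i = 0) :
    Q.ev ((adjoin Q.sub.toOp kDeg).one h) = Q.dg.op.one (congrArg Prod.fst h) := rfl

theorem Quad.ev_comp {m n l : ℕ} {i j k : Tri} (a : Fin m) (hl : l + 1 = m + n)
    (hk : i + j = k) (p : (adjoin Q.sub.toOp kDeg).X m i) (q : (adjoin Q.sub.toOp kDeg).X n j) :
    Q.ev ((adjoin Q.sub.toOp kDeg).comp a hl hk p q) =
      Q.dg.op.comp a hl (congrArg Prod.fst hk) (Q.ev p) (Q.ev q) :=
  adjEval_comp _ _ _ a hl hk p q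

theorem Quad.ev_act {n : ℕ} {i : Tri} (hS : S) (σ : Equiv.Perm (Fin n))
    (p : (adjoin Q.sub.toOp kDeg).X n i) :
    Q.ev ((adjoin Q.sub.toOp kDeg).act hS σ p) = Q.dg.op.act hS σ (Q.ev p) :=
  adjEval_act _ _ _ hS σ p

/-- The shift derivation of `Q₀ ∨ [κ]` that sends `κ` to the identity. -/
abbrev Quad.freeShift : ShiftMap (adjoin Q.sub.toOp kDeg) (adjoin Q.sub.toOp kDeg) kappaInv :=
  adjShift Q.sub.toOp kDeg () kappaInv rfl

theorem Quad.plugSystem : PlugSystem (inNew Q.sub.toOp kDeg () rfl) Q.freeShift kappaWt :=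
  adjoin_plugSystem (fun _ => rfl) rfl (fun x hx => (hx rfl).elim)

theorem isWeight_kappaWt (P : ZOp.{v, w} R S) : IsWeight kDeg kappaWt :=
  ⟨fun _ => rfl, fun _ => zero_le_one⟩

variable {Q}

theorem Quad.mem_wt_zero {n : ℕ} {d : ℤ} {x : Q.dg.op.X n d} :
    x ∈ Q.wt n d 0 ↔ x ∈ Q.sub.carrier n d := by
  constructor
  · rintro ⟨y, rfl⟩
    obtain ⟨q, rfl⟩ := (isWeight_kappaWt Q.sub.toOp).inOld_surjective (fun _ => one_pos)
      (d := d) rfl y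
    exact q.2
  · intro hx
    exact ⟨inOld _ kDeg rfl (⟨x, hx⟩ : Q.sub.carrier n d), rfl⟩

theorem Quad.κ_mem_wt : Q.κ ∈ Q.wt 0 (-1) 1 := ⟨inNew _ kDeg () rfl, rfl⟩

section Criterion

variable {D : ShiftMap Q.dg.op Q.dg.op 1} (hD : IsShiftDer (Op.Hom.id _) 1 D)
  (h0 : ∀ {s n : ℕ} {i j : ℤ} (h : i + 1 = j) (p : Q.dg.op.X n i), p ∈ Q.sub.carrier n i →
    Slot S s n → D s h p = 0)
  (h1 : ∀ {j : ℤ} (h : -1 + 1 = j) (hj : j = 0), D 0 h Q.κ = Q.dg.op.one hj)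

include hD h0 h1

theorem Quad.shift_ev {s n : ℕ} (hs : Slot S s n) {i j : Tri} (h : i + kappaInv = j)
    (x : (adjoin Q.sub.toOp kDeg).X n i) :
    D s (congrArg Prod.fst h) (Q.ev x) = Q.ev (Q.freeShift s h x) :=
  adjEval_shift (F := Q.incl) (δ := kappaInv) hD (fun h p hs => h0 h (Subtype.val p) p.2 hs)
    (fun h hj => h1 h hj) (fun x hx => (hx rfl).elim) hs h x

theorem Quad.naturalWt_injective (hRS : S → ∀ n : ℕ, IsUnit ((n + 1 : ℕ) : R)) (K : ℕ) :
    ∀ (n : ℕ) (d : ℤ) (y : ∀ k : ℕ, (adjoin Q.sub.toOp kDeg).X n (d, (k : ℤ), 0)),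
    ∑ k ∈ Finset.range (K + 1), Q.naturalWt n d k (y k) = 0 → ∀ k ≤ K, y k = 0 := by
  have base : ∀ (n : ℕ) (d : ℤ) (y : ∀ k : ℕ, (adjoin Q.sub.toOp kDeg).X n (d, (k : ℤ), 0)),
      Q.naturalWt n d 0 (y 0) = 0 → y 0 = 0 := by
    intro n d y h
    obtain ⟨q, hq⟩ := (isWeight_kappaWt Q.sub.toOp).inOld_surjective (fun _ => one_pos)
      (d := d) rfl (y 0)
    rw [hq] at h ⊢
    have : q = 0 := Subtype.ext h
    rw [this, map_zero]
  induction K with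
  | zero =>
    intro n d y hy k hk
    obtain rfl : k = 0 := by omega
    exact base n d y (by simpa using hy)
  | succ K ih =>
    intro n d y hy
    have hk : ∀ k : ℕ, ((d, ((k + 1 : ℕ) : ℤ), 0) : Tri) + kappaInv = (d + 1, (k : ℤ), 0) := by
      intro k
      simp
    have h2 : ∀ s, Slot S s n → ∀ k ≤ K, Q.freeShift s (hk k) (y (k + 1)) = 0 := by
      intro s hs
      refine ih (n + 1) (d + 1) (fun k => Q.freeShift s (hk k) (y (k + 1))) ?_
      have h3 := congrArg (D s (rfl : d + 1 = d + 1)) hy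
      rw [map_sum, LinearMap.map_zero, Finset.sum_range_succ'] at h3
      have h4 : D s (rfl : d + 1 = d + 1) (Q.naturalWt n d 0 (y 0)) = 0 :=
        h0 _ _ (Quad.mem_wt_zero.1 ⟨_, rfl⟩) hs
      rw [h4, add_zero] at h3
      rw [← h3]
      exact Finset.sum_congr rfl fun k _ => (Quad.shift_ev hD h0 h1 hs (hk k) (y (k + 1))).symm
    have h5 : ∀ k ≤ K, y (k + 1) = 0 := fun k hk' =>
      Q.plugSystem.eq_zero hRS (hk k) _ (by change (0 : ℤ) < ((k + 1 : ℕ) : ℤ); omega)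
        fun s hs => h2 s hs k hk'
    intro k hk'
    cases k with
    | zero =>
      refine base n d y ?_
      rw [Finset.sum_range_succ', Finset.sum_eq_zero, zero_add] at hy
      · exact hy
      · intro k hk
        rw [Finset.mem_range] at hk
        rw [h5 k (by omega), map_zero]
    | succ k => exact h5 k (by omega)

theorem Quad.natural_injective (hRS : S → ∀ n : ℕ, IsUnit ((n + 1 : ℕ) : R)) (n : ℕ) (d : ℤ) :
    Function.Injective (Q.natural n d) := by
  classical
  rw [← LinearMap.ker_eq_bot, LinearMap.ker_eq_bot']
  intro y hy
  obtain ⟨K, hK⟩ : ∃ K, ∀ k, K < k → y k = 0 := by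
    refine ⟨(DFinsupp.support y).sup id, fun k hk => ?_⟩
    by_contra h
    exact absurd (Finset.le_sup (f := id) (DFinsupp.mem_support_iff.2 h)) (not_le.2 hk)
  have h2 : Q.natural n d y = ∑ k ∈ Finset.range (K + 1), Q.naturalWt n d k (y k) := by
    rw [Quad.natural, DirectSum.toModule, DFinsupp.lsum_apply_apply, DFinsupp.sumAddHom_apply,
      DFinsupp.sum]
    refine Finset.sum_subset (fun k hk => ?_) fun k _ hk => ?_
    · rw [Finset.mem_range]
      by_contra h
      exact DFinsupp.mem_support_iff.1 hk (hK k (by omega))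
    · rw [DFinsupp.notMem_support_iff.1 hk]
      exact map_zero _
  rw [h2] at hy
  refine DFinsupp.ext fun k => ?_
  by_cases hk : K < k
  · exact hK k hk
  · exact Quad.naturalWt_injective hD h0 h1 hRS K n d _ hy k (by omega)

theorem Quad.κ_not_mem (hne : Q.dg.op.one (rfl : (0 : ℤ) = 0) ≠ 0) :
    Q.κ ∉ Q.sub.carrier 0 (-1) := fun h =>
  hne ((h1 (neg_add_cancel 1) rfl).symm.trans (h0 _ _ h (slot_zero S 0)))

end Criterion

/-- The image of the part of `Q₀ ∨ [κ]` of given additional degrees. -/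
def Quad.part (Q : Quad.{v, w} R S) (n : ℕ) (d : ℤ) (u : ℤ × ℤ) : Submodule R (Q.dg.op.X n d) :=
  LinearMap.range (Q.ev : (adjoin Q.sub.toOp kDeg).X n (d, u) →ₗ[R] Q.dg.op.X n d)

theorem Quad.comp_mem_part {m n l : ℕ} {i j k : ℤ} {u u' t : ℤ × ℤ} (ht : u + u' = t) (a : Fin m)
    (hl : l + 1 = m + n) (hk : i + j = k) {p : Q.dg.op.X m i} {q : Q.dg.op.X n j}
    (hp : p ∈ Q.part m i u) (hq : q ∈ Q.part n j u') : Q.dg.op.comp a hl hk p q ∈ Q.part l k t := by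
  obtain ⟨p, rfl⟩ := hp
  obtain ⟨q, rfl⟩ := hq
  exact ⟨(adjoin Q.sub.toOp kDeg).comp a hl (by rw [← hk, ← ht]; rfl) p q,
    Q.ev_comp _ _ _ _ _⟩

theorem Quad.act_mem_part {n : ℕ} {i : ℤ} {u : ℤ × ℤ} (hS : S) (σ : Equiv.Perm (Fin n))
    {p : Q.dg.op.X n i} (hp : p ∈ Q.part n i u) : Q.dg.op.act hS σ p ∈ Q.part n i u := by
  obtain ⟨p, rfl⟩ := hp
  exact ⟨(adjoin Q.sub.toOp kDeg).act hS σ p, Q.ev_act _ _ _⟩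

theorem Quad.d_ev_mem (hQ : IsDG Q.dg)
    (hsub : ∀ {n : ℕ} {i j : ℤ} (h : i + -1 = j) (q : Q.dg.op.X n i), q ∈ Q.sub.carrier n i →
      Q.dg.d h q ∈ Q.part n j 0 ⊔ Q.part n j (1, 0))
    (hκ : Q.dg.d rfl Q.κ ∈ Q.part 0 (-1 + -1) (1, 0)) {n : ℕ} {i : Tri}
    (p : (adjoin Q.sub.toOp kDeg).X n i) : ∀ {j : ℤ} (h : i.1 + -1 = j),
    Q.dg.d h (Q.ev p) ∈ Q.part n j i.2 ⊔ Q.part n j (i.2 + (1, 0)) := by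
  induction p using Pres.cl_ind with | h p => ?_
  induction p with
  | gen g =>
    intro j h
    cases g with
    | old hi q =>
      subst hi
      have := hsub h q.1 q.2
      rwa [← zero_add ((1, 0) : ℤ × ℤ)] at this
    | new x hi =>
      subst hi
      subst h
      exact Submodule.mem_sup_left hκ
  | one hi =>
    intro j h
    rw [Pres.cl_one, Q.ev_one, hQ.d_one]
    exact Submodule.zero_mem _
  | @comp m n l i i' k a hl hk p q ih ih' =>
    intro j h
    rw [Pres.cl_comp, Q.ev_comp, hQ.leibniz a hl _ rfl rfl]
    subst hk
    refine Submodule.add_mem _ ?_ (Submodule.smul_mem _ _ ?_)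
    · obtain ⟨x, hx, y, hy, hxy⟩ := Submodule.mem_sup.1 (ih rfl)
      rw [← hxy, map_add, LinearMap.add_apply]
      exact Submodule.add_mem_sup
        (Quad.comp_mem_part rfl a hl _ hx ⟨_, rfl⟩)
        (Quad.comp_mem_part (add_right_comm _ _ _) a hl _ hy ⟨_, rfl⟩)
    · obtain ⟨x, hx, y, hy, hxy⟩ := Submodule.mem_sup.1 (ih' rfl)
      rw [← hxy, map_add]
      exact Submodule.add_mem_sup
        (Quad.comp_mem_part rfl a hl _ ⟨_, rfl⟩ hx)
        (Quad.comp_mem_part (add_assoc _ _ _).symm a hl _ ⟨_, rfl⟩ hy)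
  | act hS σ p ih =>
    intro j h
    rw [Pres.cl_act, Q.ev_act, hQ.d_act]
    obtain ⟨x, hx, y, hy, hxy⟩ := Submodule.mem_sup.1 (ih h)
    rw [← hxy, map_add]
    exact Submodule.add_mem_sup (Quad.act_mem_part hS σ hx) (Quad.act_mem_part hS σ hy)
  | zero =>
    intro j h
    rw [Pres.cl_zero, map_zero, map_zero]
    exact Submodule.zero_mem _
  | add p q ih ih' =>
    intro j h
    rw [Pres.cl_add, map_add, map_add]
    exact Submodule.add_mem _ (ih h) (ih' h)
  | smul r p ih =>
    intro j h
    rw [Pres.cl_smul, map_smul, map_smul]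
    exact Submodule.smul_mem _ _ (ih h)

/-- A criterion for quadruples to satisfy the conditions. -/
theorem isCurv_of_shift (hRS : S → ∀ n : ℕ, IsUnit ((n + 1 : ℕ) : R)) (hQ : IsDG Q.dg)
    {D : ShiftMap Q.dg.op Q.dg.op 1} (hD : IsShiftDer (Op.Hom.id _) 1 D)
    (h0 : ∀ {s n : ℕ} {i j : ℤ} (h : i + 1 = j) (p : Q.dg.op.X n i), p ∈ Q.sub.carrier n i →
      Slot S s n → D s h p = 0)
    (h1 : ∀ {j : ℤ} (h : -1 + 1 = j) (hj : j = 0), D 0 h Q.κ = Q.dg.op.one hj)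
    (hsurj : ∀ n d, Function.Surjective (Q.natural n d))
    (hsub : ∀ {n : ℕ} {i j : ℤ} (h : i + -1 = j) (q : Q.dg.op.X n i), q ∈ Q.sub.carrier n i →
      Q.dg.d h q ∈ Q.wt n j 0 ⊔ Q.wt n j 1)
    (hκ : Q.dg.d rfl Q.κ ∈ Q.wt 0 (-1 + -1) 1) : IsCurv Q where
  isDG := hQ
  not_mem := Quad.κ_not_mem hD h0 h1 hQ.one_ne
  bijective n d := ⟨Quad.natural_injective hD h0 h1 hRS n d, hsurj n d⟩
  mixed := by
    rintro n i j h k p ⟨p, rfl⟩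
    have := Quad.d_ev_mem hQ hsub hκ p h
    have e : ((((k : ℕ) : ℤ), (0 : ℤ)) + (1, 0) : ℤ × ℤ) = (((k + 1 : ℕ) : ℤ), 0) := by simp
    rwa [e] at this
  d_one := hκ

end Weights
end
end TwistOperad

namespace TwistOperad

noncomputable section

section CurvShift

variable {R : Type v} [CommRing R] {S : Prop} {Q : Quad.{v, w} R S}

theorem IsShiftDer.comp_arity_zero {A : ZOp.{v, w} R S} {δ : ℤ} {D : ShiftMap A A δ}
    (hD : IsShiftDer (Op.Hom.id A) δ D) {i j k k' j' : ℤ} {hk : i + j = k} {hk' : k + δ = k'}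
    (hj : j + δ = j') (hk₂ : i + j' = k') (p : A.X 1 i) (x : A.X 0 j)
    (hp : ∀ s i' (hi : i + δ = i'), Slot S s 1 → D s hi p = 0) :
    D 0 hk' (A.comp (0 : Fin 1) (n := 0) rfl hk p x) =
      sgn R (δ * i) • A.comp (0 : Fin 1) (n := 0 + 1) rfl hk₂ p (D 0 hj x) := by
  subst hj
  rw [hD.comp _ _ _ _ _ _ (slot_zero S 0),
    Op.outer_congr _ _ _ (slot_zero S 0) (fun t ht => hp t _ rfl ht), Op.outer_zero_left]
  refine (zero_add (M := A.X (0 + 1) k') _).trans (congrArg _ ?_)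
  unfold Op.inner
  split_ifs with hS h
  · exact (congrArg (fun σ => A.act hS σ _) (cyc_zero (n := 0) ⟨0, Nat.one_pos⟩ rfl)).trans
      (A.act_one hS _)
  · rfl
  · exact (h ⟨le_rfl, Nat.zero_le _⟩).elim

theorem Quad.naturalWt_comp {m n l : ℕ} {i j k : ℤ} {c e : ℕ} (a : Fin m) (hl : l + 1 = m + n)
    (hk : i + j = k) (hk' : ((i, (c : ℤ), 0) : Tri) + (j, (e : ℤ), 0) = (k, ((c + e : ℕ) : ℤ), 0))
    (p : (adjoin Q.sub.toOp kDeg).X m (i, (c : ℤ), 0))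
    (q : (adjoin Q.sub.toOp kDeg).X n (j, (e : ℤ), 0)) :
    Q.dg.op.comp a hl hk (Q.naturalWt m i c p) (Q.naturalWt n j e q) =
      Q.naturalWt l k (c + e) ((adjoin Q.sub.toOp kDeg).comp a hl hk' p q) :=
  (Q.ev_comp a hl hk' p q).symm

theorem Quad.naturalWt_act {n : ℕ} {i : ℤ} {k : ℕ} (hS : S) (σ : Equiv.Perm (Fin n))
    (p : (adjoin Q.sub.toOp kDeg).X n (i, (k : ℤ), 0)) :
    Q.dg.op.act hS σ (Q.naturalWt n i k p) =
      Q.naturalWt n i k ((adjoin Q.sub.toOp kDeg).act hS σ p) :=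
  (Q.ev_act hS σ p).symm

namespace IsCurv

variable (hQ : IsCurv Q)

section Induction

include hQ

/-- Every element is a sum of elements of pure weight. -/
theorem wt_induction {n : ℕ} {d : ℤ} {C : Q.dg.op.X n d → Prop} (zero : C 0)
    (add : ∀ x y, C x → C y → C (x + y)) (wt : ∀ k x, C (Q.naturalWt n d k x)) (x : Q.dg.op.X n d) :
    C x := by
  classical
  obtain ⟨y, rfl⟩ := (hQ.bijective n d).2 x
  induction y using DirectSum.induction_on with
  | zero => rwa [map_zero]
  | of k y =>
    rw [Quad.natural, ← DirectSum.lof_eq_of R, DirectSum.toModule_lof]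
    exact wt k y
  | add x y hx hy =>
    rw [map_add]
    exact add _ _ hx hy

theorem wt_ext {n : ℕ} {d : ℤ} {M : Type w'} [AddCommGroup M] [Module R M]
    {f g : Q.dg.op.X n d →ₗ[R] M} (h : ∀ k x, f (Q.naturalWt n d k x) = g (Q.naturalWt n d k x))
    (x : Q.dg.op.X n d) : f x = g x :=
  hQ.wt_induction (C := fun x => f x = g x) (by rw [map_zero, map_zero])
    (fun x y hx hy => by rw [map_add, map_add, hx, hy]) h x

/-- The operad is generated by `Q₀` and `κ`. -/
theorem induction {C : ∀ {n : ℕ} {i : ℤ}, Q.dg.op.X n i → Prop}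
    (sub : ∀ {n : ℕ} {i : ℤ} (q : Q.dg.op.X n i), q ∈ Q.sub.carrier n i → C q) (kappa : C Q.κ)
    (comp : ∀ {m n l : ℕ} {i j k : ℤ} (a : Fin m) (hl : l + 1 = m + n) (hk : i + j = k)
      (p : Q.dg.op.X m i) (q : Q.dg.op.X n j), C p → C q → C (Q.dg.op.comp a hl hk p q))
    (act : ∀ {n : ℕ} {i : ℤ} (hS : S) (σ : Equiv.Perm (Fin n)) (p : Q.dg.op.X n i), C p →
      C (Q.dg.op.act hS σ p))
    (add : ∀ {n : ℕ} {i : ℤ} (p q : Q.dg.op.X n i), C p → C q → C (p + q))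
    (smul : ∀ {n : ℕ} {i : ℤ} (r : R) (p : Q.dg.op.X n i), C p → C (r • p))
    {n : ℕ} {i : ℤ} (x : Q.dg.op.X n i) : C x := by
  have zero : ∀ {n : ℕ} {i : ℤ}, C (0 : Q.dg.op.X n i) := sub 0 (Submodule.zero_mem _)
  have key : ∀ {n : ℕ} {i : Tri} (x : (adjoin Q.sub.toOp kDeg).X n i), C (Q.ev x) := by
    intro n i x
    induction x using Pres.cl_ind with | h p => ?_
    induction p with
    | gen g =>
      cases g with
      | old hi q =>
        subst hi
        exact sub q.1 q.2
      | new x hi =>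
        subst hi
        exact kappa
    | one hi =>
      rw [Pres.cl_one, Q.ev_one]
      exact sub _ (Q.sub.one_mem _)
    | comp a hl hk p q ih ih' =>
      rw [Pres.cl_comp, Q.ev_comp]
      exact comp _ _ _ _ _ ih ih'
    | act hS σ p ih =>
      rw [Pres.cl_act, Q.ev_act]
      exact act _ _ _ ih
    | zero =>
      rw [Pres.cl_zero, map_zero]
      exact zero
    | add p q ih ih' =>
      rw [Pres.cl_add, map_add]
      exact add _ _ ih ih'
    | smul r p ih =>
      rw [Pres.cl_smul, map_smul]
      exact smul _ _ ih
  exact hQ.wt_induction zero (fun x y => add x y) (fun k x => key x) x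

end Induction

/-- The shift derivation that sends `κ` to the identity and vanishes on `Q₀`. -/
def shift : ShiftMap Q.dg.op Q.dg.op 1 := fun s n i j h =>
  (DirectSum.toModule R ℕ (Q.dg.op.X (n + 1) j) fun k =>
    (Q.ev : (adjoin Q.sub.toOp kDeg).X (n + 1) (j, (k : ℤ) + -1, 0) →ₗ[R] Q.dg.op.X (n + 1) j).comp
      (Q.freeShift s (by rw [← h]; rfl))).comp
    (LinearEquiv.ofBijective (Q.natural n i) (hQ.bijective n i)).symm.toLinearMap

theorem shift_naturalWt {s n : ℕ} {i j : ℤ} (h : i + 1 = j) {k : ℕ} {j' : ℤ × ℤ}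
    (h' : ((i, (k : ℤ), 0) : Tri) + kappaInv = (j, j'))
    (x : (adjoin Q.sub.toOp kDeg).X n (i, (k : ℤ), 0)) :
    hQ.shift s h (Q.naturalWt n i k x) = Q.ev (Q.freeShift s h' x) := by
  classical
  obtain rfl : ((k : ℤ) + -1, 0) = j' := congrArg Prod.snd h'
  have : (LinearEquiv.ofBijective (Q.natural n i) (hQ.bijective n i)).symm
      (Q.naturalWt n i k x) = DirectSum.lof R ℕ _ k x := by
    rw [LinearEquiv.symm_apply_eq, LinearEquiv.ofBijective_apply, Quad.natural,
      DirectSum.toModule_lof]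
  rw [shift, LinearMap.comp_apply, LinearEquiv.coe_coe, this, DirectSum.toModule_lof]
  rfl

theorem isShiftDer_shift : IsShiftDer (Op.Hom.id _) 1 hQ.shift where
  one {s i j} h hj hs := by
    have h0 : ((i, ((0 : ℕ) : ℤ), 0) : Tri) = 0 := by rw [h]; rfl
    have h1 := hQ.shift_naturalWt (s := s) hj (j' := (-1, 0)) (by rw [← hj]; rfl)
      ((adjoin Q.sub.toOp kDeg).one h0)
    exact h1.trans ((congrArg Q.ev (isShiftDer_adjShift.one h0 _ hs)).trans (map_zero _))
  comp {s m n l i j k k'} a hl hk hk' p q hs := by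
    refine hQ.wt_induction (C := fun p => hQ.shift s hk' (Q.dg.op.comp a hl hk p q) =
      Q.dg.op.outer a (by omega) (by rw [← hk', ← hk, add_right_comm]) s
        (fun t => hQ.shift t rfl p) q + sgn R (1 * i) • Q.dg.op.inner a (by omega)
          (by rw [← hk', ← hk, add_assoc]) s p (fun t => hQ.shift t rfl q)) ?_ ?_ ?_ p
    · simp only [map_zero, LinearMap.zero_apply, Op.outer_zero_left, Op.inner_zero_left,
        smul_zero, add_zero]
    · intro x y hx hy
      simp only [map_add, LinearMap.add_apply, Op.outer_add_left, Op.inner_add_left, hx, hy,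
        smul_add]
      abel
    intro c p
    refine hQ.wt_induction (C := fun q => hQ.shift s hk' (Q.dg.op.comp a hl hk _ q) =
      Q.dg.op.outer a (by omega) (by rw [← hk', ← hk, add_right_comm]) s
        (fun t => hQ.shift t rfl _) q + sgn R (1 * i) • Q.dg.op.inner a (by omega)
          (by rw [← hk', ← hk, add_assoc]) s _ (fun t => hQ.shift t rfl q)) ?_ ?_ ?_ q
    · simp only [map_zero, Op.outer_zero_right, Op.inner_zero_right,
        smul_zero, add_zero]
    · intro x y hx hy
      simp only [map_add, Op.outer_add_right, Op.inner_add_right, hx, hy,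
        smul_add]
      abel
    intro e q
    have hk₃ : ((i, (c : ℤ), 0) : Tri) + (j, (e : ℤ), 0) = (k, ((c + e : ℕ) : ℤ), 0) := by
      rw [← hk]
      simp
    have hk₄ : ((k, ((c + e : ℕ) : ℤ), 0) : Tri) + kappaInv = (k', ((c + e : ℕ) : ℤ) + -1, 0) := by
      rw [← hk']
      rfl
    have key := ((isShiftDer_adjShift (P := Q.sub.toOp) (z := kDeg) (x₀ := ()) (δ := kappaInv)
      (hδ := rfl)).hom_comp (adjEvalHom Q.incl kDeg fun _ => Q.κ) _ fun _ _ _ => rfl).comp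
        a hl hk₃ hk₄ p q hs
    rw [Quad.naturalWt_comp a hl hk hk₃]
    rw [Op.outer_congr (B := Q.dg.op) a _ _ hs
        (u' := fun t => (Q.ev (Q.freeShift t rfl p) : Q.dg.op.X (m + 1) (i + 1)))
        (fun t _ => hQ.shift_naturalWt rfl rfl p),
      Op.inner_congr (B := Q.dg.op) a _ _ _ _
        (v' := fun t => (Q.ev (Q.freeShift t rfl q) : Q.dg.op.X (n + 1) (j + 1)))
        (fun t _ => hQ.shift_naturalWt rfl rfl q)]
    exact (hQ.shift_naturalWt hk' hk₄ _).trans key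
  act {n i j} hS σ hj p := by
    refine hQ.wt_ext (f := (hQ.shift 0 hj).comp (Q.dg.op.act hS σ))
      (g := (Q.dg.op.act hS (up σ)).comp (hQ.shift 0 hj)) (fun k x => ?_) p
    have hk₄ : ((i, (k : ℤ), 0) : Tri) + kappaInv = (j, (k : ℤ) + -1, 0) := by
      rw [← hj]
      rfl
    rw [LinearMap.comp_apply, LinearMap.comp_apply, hQ.shift_naturalWt hj hk₄,
      Quad.naturalWt_act]
    refine (hQ.shift_naturalWt hj hk₄ ((adjoin Q.sub.toOp kDeg).act hS σ x)).trans ?_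
    exact (congrArg Q.ev (isShiftDer_adjShift.act hS σ hk₄ x)).trans (Q.ev_act _ _ _)

theorem shift_sub {s n : ℕ} {i j : ℤ} (h : i + 1 = j) {q : Q.dg.op.X n i}
    (hq : q ∈ Q.sub.carrier n i) (hs : Slot S s n) : hQ.shift s h q = 0 := by
  have h1 := hQ.shift_naturalWt (s := s) (k := 0) h (j' := (-1, 0)) (by rw [← h]; rfl)
    (inOld Q.sub.toOp kDeg rfl ⟨q, hq⟩)
  exact h1.trans ((congrArg Q.ev (adjShift_old _ hs _ _)).trans (map_zero _))

theorem shift_kappa {j : ℤ} (h : -1 + 1 = j) (hj : j = 0) :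
    hQ.shift 0 h Q.κ = Q.dg.op.one hj := by
  have h2 : ((j, 0) : Tri) = 0 := by rw [hj]; rfl
  have h1 := hQ.shift_naturalWt (s := 0) (k := 1) h (j' := 0) (by rw [← h]; rfl)
    (inNew Q.sub.toOp kDeg () rfl)
  exact h1.trans (congrArg Q.ev (adjShift_new _ rfl h2))

theorem shift_mem_sub {s n : ℕ} {i j : ℤ} (h : i + 1 = j) {q : Q.dg.op.X n i}
    (hq : q ∈ Q.wt n i 0 ⊔ Q.wt n i 1) (hs : Slot S s n) :
    hQ.shift s h q ∈ Q.sub.carrier (n + 1) j := by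
  obtain ⟨x, hx, y, ⟨y, rfl⟩, rfl⟩ := Submodule.mem_sup.1 hq
  rw [LinearMap.map_add, hQ.shift_sub h (Quad.mem_wt_zero.1 hx) hs, zero_add,
    hQ.shift_naturalWt h (j' := (((0 : ℕ) : ℤ), 0)) (by rw [← h]; rfl)]
  exact Quad.mem_wt_zero.1 ⟨_, rfl⟩

include hQ in
theorem d_sub {n : ℕ} {i j : ℤ} (h : i + -1 = j) {q : Q.dg.op.X n i}
    (hq : q ∈ Q.sub.carrier n i) : Q.dg.d h q ∈ Q.wt n j 0 ⊔ Q.wt n j 1 :=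
  hQ.mixed h 0 q (Quad.mem_wt_zero.2 hq)

theorem nabla_mem_sub {s n : ℕ} {i j : ℤ} (h : i + 0 = j) {q : Q.dg.op.X n i}
    (hq : q ∈ Q.sub.carrier n i) (hs : Slot S s n) :
    nabla hQ.shift s h q ∈ Q.sub.carrier (n + 1) j := by
  rw [bracket_odd s h rfl (by omega) rfl (by omega), hQ.shift_sub rfl hq hs, LinearMap.map_zero,
    add_zero]
  exact hQ.shift_mem_sub _ (hQ.d_sub rfl hq) hs

theorem nabla_kappa_mem {j : ℤ} (h : -1 + 0 = j) : nabla hQ.shift 0 h Q.κ ∈ Q.sub.carrier 1 j := by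
  rw [bracket_odd 0 h rfl (by omega) rfl (by omega), hQ.shift_kappa rfl (by omega), hQ.isDG.d_one,
    add_zero]
  exact hQ.shift_mem_sub _ (Submodule.mem_sup_right hQ.d_one) (slot_zero S 0)

theorem isOddShift : IsOddShift Q.dg hQ.shift where
  shift := hQ.isShiftDer_shift
  comm {n i} x := by
    have hn := isShiftDer_bracket hQ.isShiftDer_shift hQ.isDG.isDer (add_neg_cancel 1)
    have hs : ∀ s n, s ≤ n → ¬S → Slot S s n := fun s n h h' => ⟨h, fun h => (h' h).elim⟩
    refine hQ.induction (C := fun x => SComm hQ.shift (nabla hQ.shift) x) ?_ ?_ ?_ ?_ ?_ ?_ x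
    · intro n i q hq
      constructor
      · intro hS j j' k h₁ h₁' h₂ h₂'
        rw [hQ.shift_sub h₁' (hQ.nabla_mem_sub h₁ hq (slot_zero S n)) (slot_zero S _),
          hQ.shift_sub h₂ hq (slot_zero S n), LinearMap.map_zero, LinearMap.map_zero, smul_zero]
      · intro hS s t j j' k h₁ h₁' h₂ h₂' hst ht
        rw [hQ.shift_sub h₁' (hQ.nabla_mem_sub h₁ hq (hs _ _ ht hS)) (hs _ _ (by omega) hS),
          hQ.shift_sub h₂ hq (hs _ _ (by omega) hS), LinearMap.map_zero, smul_zero]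
    · constructor
      · intro hS j j' k h₁ h₁' h₂ h₂'
        rw [hQ.shift_sub h₁' (hQ.nabla_kappa_mem h₁) (slot_zero S _),
          hQ.shift_kappa h₂ (by omega), hn.one _ _ (slot_zero S _), LinearMap.map_zero, smul_zero]
      · intro hS s t j j' k h₁ h₁' h₂ h₂' hst ht
        obtain rfl : t = 0 := by omega
        obtain rfl : s = 0 := by omega
        rw [hQ.shift_sub h₁' (hQ.nabla_kappa_mem h₁) (slot_zero S _),
          hQ.shift_kappa h₂ (by omega), hn.one _ _ (hs _ _ le_rfl hS), smul_zero]
    · intro m n l i j k a hl hk p q hp hq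
      exact SComm.comp hQ.isShiftDer_shift hn a hl hk hp hq
    · intro n i hS σ p hp
      exact SComm.act hQ.isShiftDer_shift hn hS σ hp
    · intro n i p q hp hq
      exact hp.add hq
    · intro n i r p hp
      exact hp.smul r

/-- The iterated shifts of `κ`. -/
def seq : ∀ n : ℕ, Q.dg.op.X n (-1) := shiftSeq (nabla hQ.shift) Q.κ

theorem seq_mem (n : ℕ) : hQ.seq (n + 1) ∈ Q.sub.carrier (n + 1) (-1) := by
  induction n with
  | zero => exact hQ.nabla_kappa_mem _
  | succ n ih => exact hQ.nabla_mem_sub _ ih (slot_zero S _)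

theorem act_seq (hS : S) (n : ℕ) (σ : Equiv.Perm (Fin n)) :
    Q.dg.op.act hS σ (hQ.seq n) = hQ.seq n :=
  act_shiftSeq (hQ.isOddShift.nabla_shift hQ.isDG) (hQ.isOddShift.nabla_comm hQ.isDG) _ hS n σ

theorem nabla_seq {s n : ℕ} (hs : Slot S s n) {j : ℤ} (h : -1 + 0 = j) :
    nabla hQ.shift s h (hQ.seq n) = Q.dg.op.cast rfl (by omega) (hQ.seq (n + 1)) := by
  obtain rfl : j = -1 := by omega
  exact shift_shiftSeq (hQ.isOddShift.nabla_shift hQ.isDG) (hQ.isOddShift.nabla_comm hQ.isDG) _ hs _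

theorem shift_comp_kappa {i j k : ℤ} (h : i + -1 = j) (h' : j + 1 = k) (hk : k = i)
    (q : Q.dg.op.X 1 i) (hq : q ∈ Q.sub.carrier 1 i) :
    hQ.shift 0 h' (Q.dg.op.comp (0 : Fin 1) (n := 0) rfl h q Q.κ) =
      sgn R i • Q.dg.op.cast rfl hk.symm q := by
  subst hk
  have e : sgn R (1 * k) = sgn R k := by rw [one_mul]
  have h2 : hQ.shift 0 (rfl : -1 + 1 = (0 : ℤ)) Q.κ = Q.dg.op.one rfl := hQ.shift_kappa _ _
  have h3 : Q.dg.op.comp (0 : Fin 1) (n := 0 + 1) rfl (add_zero k) q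
      (hQ.shift 0 (rfl : -1 + 1 = (0 : ℤ)) Q.κ) = q :=
    (congrArg _ h2).trans (Q.dg.op.comp_one _ _ _ _ _)
  refine (hQ.isShiftDer_shift.comp_arity_zero rfl (add_zero k) _ _
    fun s j hj hs => hQ.shift_sub hj hq hs).trans ?_
  rw [e]
  exact congrArg _ h3

theorem d_kappa : Q.dg.d rfl Q.κ = -Q.dg.op.comp (0 : Fin 1) (n := 0) rfl rfl (hQ.seq 1) Q.κ := by
  obtain ⟨x, hx⟩ := hQ.d_one
  have key : ∃ q : Q.sub.toOp.X 1 (-1), x =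
      plug (inNew Q.sub.toOp kDeg () rfl) (i' := (-1, 0, 0)) rfl 0 le_rfl
        (inOld Q.sub.toOp kDeg rfl q) := by
    have := Q.plugSystem.span x (by decide)
    clear hx
    induction this using Submodule.span_induction with
    | mem x h =>
      obtain ⟨j, hj, i', hi, y, rfl⟩ := h
      obtain rfl : i' = (-1, 0, 0) := add_right_cancel (hi.trans (b := (_ : Tri)) rfl)
      obtain rfl : j = 0 := by omega
      obtain ⟨q, rfl⟩ := (isWeight_kappaWt Q.sub.toOp).inOld_surjective (fun _ => one_pos)
        (d := -1) rfl y
      exact ⟨q, rfl⟩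
    | zero => exact ⟨0, by rw [map_zero, map_zero]; rfl⟩
    | add x y _ _ hx hy =>
      obtain ⟨q, rfl⟩ := hx
      obtain ⟨q', rfl⟩ := hy
      exact ⟨q + q', by rw [map_add, map_add]; rfl⟩
    | smul r x _ hx =>
      obtain ⟨q, rfl⟩ := hx
      exact ⟨r • q, by rw [map_smul, map_smul]; rfl⟩
  obtain ⟨q, rfl⟩ := key
  have hx' : Q.dg.op.comp (0 : Fin 1) (n := 0) rfl rfl (Q.incl.f 1 (-1) q) Q.κ =
    Q.dg.d rfl Q.κ := hx
  have h1 : hQ.seq 1 = -Q.incl.f 1 (-1) q := by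
    change nabla hQ.shift 0 _ Q.κ = _
    rw [bracket_odd 0 _ rfl (by omega) rfl (by omega), hQ.shift_kappa rfl (by omega),
      hQ.isDG.d_one, add_zero, ← hx']
    refine (hQ.shift_comp_kappa rfl _ rfl _ q.2).trans ?_
    rw [show sgn R (-1) = -1 by simp [sgn], neg_one_smul]
    rfl
  rw [h1, ← hx', map_neg, LinearMap.neg_apply, neg_neg]

theorem d_seq (n : ℕ) : Q.dg.d rfl (hQ.seq n) = stash Q.dg.op hQ.seq n :=
  hQ.isOddShift.d_shiftSeq hQ.isDG Q.κ ((hQ.d_kappa).trans (stash_zero _ _).symm) n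

end IsCurv

section Lift

variable (hQ : IsCurv Q) {M : ZOp.{v, w} R S} (F : Op.Hom Q.sub.toOp M) (y : M.X 0 (-1))

/-- The linear maps that underlie the morphism with given values on `Q₀` and at `κ`. -/
def IsCurv.liftMap (n : ℕ) (i : ℤ) : Q.dg.op.X n i →ₗ[R] M.X n i :=
  (DirectSum.toModule R ℕ (M.X n i) fun k =>
    (adjEval F kDeg (fun _ => y) : (adjoin Q.sub.toOp kDeg).X n (i, (k : ℤ), 0) →ₗ[R] M.X n i)).comp
    (LinearEquiv.ofBijective (Q.natural n i) (hQ.bijective n i)).symm.toLinearMap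

theorem IsCurv.liftMap_naturalWt {n : ℕ} {i : ℤ} {k : ℕ}
    (x : (adjoin Q.sub.toOp kDeg).X n (i, (k : ℤ), 0)) :
    hQ.liftMap F y n i (Q.naturalWt n i k x) = adjEval F kDeg (fun _ => y) x := by
  classical
  have : (LinearEquiv.ofBijective (Q.natural n i) (hQ.bijective n i)).symm
      (Q.naturalWt n i k x) = DirectSum.lof R ℕ _ k x := by
    rw [LinearEquiv.symm_apply_eq, LinearEquiv.ofBijective_apply, Quad.natural,
      DirectSum.toModule_lof]
  rw [liftMap, LinearMap.comp_apply, LinearEquiv.coe_coe, this, DirectSum.toModule_lof]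

/-- The morphism with given values on `Q₀` and at `κ`. -/
def IsCurv.lift : Op.Hom Q.dg.op M where
  f := hQ.liftMap F y
  map_one {i} h := by
    have h0 : ((i, ((0 : ℕ) : ℤ), 0) : Tri) = 0 := by rw [h]; rfl
    exact hQ.liftMap_naturalWt F y ((adjoin Q.sub.toOp kDeg).one h0)
  map_comp {m n l i j k} a hl hk p q := by
    refine hQ.wt_ext (f := (hQ.liftMap F y l k).comp ((Q.dg.op.comp a hl hk).flip q))
      (g := ((M.comp a hl hk).flip (hQ.liftMap F y n j q)).comp (hQ.liftMap F y m i))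
      (fun c p => ?_) p
    refine hQ.wt_ext (f := (hQ.liftMap F y l k).comp (Q.dg.op.comp a hl hk _))
      (g := (M.comp a hl hk (hQ.liftMap F y m i _)).comp (hQ.liftMap F y n j))
      (fun e q => ?_) q
    have hk₃ : ((i, (c : ℤ), 0) : Tri) + (j, (e : ℤ), 0) = (k, ((c + e : ℕ) : ℤ), 0) := by
      rw [← hk]
      simp
    rw [LinearMap.comp_apply, LinearMap.comp_apply, hQ.liftMap_naturalWt, hQ.liftMap_naturalWt,
      Quad.naturalWt_comp a hl hk hk₃]
    exact (hQ.liftMap_naturalWt F y ((adjoin Q.sub.toOp kDeg).comp a hl hk₃ p q)).trans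
      (adjEval_comp _ _ _ a hl hk₃ p q)
  map_act {n i} hS σ p := by
    refine hQ.wt_ext (f := (hQ.liftMap F y n i).comp (Q.dg.op.act hS σ))
      (g := (M.act hS σ).comp (hQ.liftMap F y n i)) (fun k x => ?_) p
    rw [LinearMap.comp_apply, LinearMap.comp_apply, hQ.liftMap_naturalWt, Quad.naturalWt_act]
    exact (hQ.liftMap_naturalWt F y ((adjoin Q.sub.toOp kDeg).act hS σ x)).trans
      (adjEval_act _ _ _ hS σ x)

theorem IsCurv.lift_sub {n : ℕ} {i : ℤ} (q : Q.sub.carrier n i) :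
    (hQ.lift F y).f n i (q : Q.dg.op.X n i) = F.f n i q :=
  hQ.liftMap_naturalWt F y (k := 0) (inOld Q.sub.toOp kDeg rfl q)

theorem IsCurv.lift_kappa : (hQ.lift F y).f 0 (-1) Q.κ = y :=
  hQ.liftMap_naturalWt F y (k := 1) (inNew Q.sub.toOp kDeg () rfl)

end Lift
end CurvShift
end
end TwistOperad

namespace TwistOperad

noncomputable section

section PresHom

variable {R : Type v} [CommRing R] {S : Prop} {ι : Type} [AddCommMonoid ι] {deg : ι →+ ℤ}

section Lift

variable {G : ℕ → ι → Type w} {E : ∀ (n : ℕ) (i : ι), Tm R S G n i → Tm R S G n i → Prop}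
  {M : Op.{v, w'} R S ι deg}

/-- The morphism out of a presented operad with given values on generators. -/
def presHom (f : ∀ (n : ℕ) (i : ι), G n i → M.X n i)
    (hE : ∀ (n : ℕ) (i : ι) (p q : Tm R S G n i), E n i p q →
      Pres.evalTm (AddMonoidHom.id ι) M f p = Pres.evalTm (AddMonoidHom.id ι) M f q) :
    Op.Hom (presOp deg E) M where
  f n i := Pres.eval (AddMonoidHom.id ι) M f (fun _ => rfl) hE
  map_one h := rfl
  map_comp := by
    intro m n l i j k a hl hk p q
    induction p using Pres.cl_ind with | h p => ?_
    induction q using Pres.cl_ind with | h q => ?_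
    rfl
  map_act := by
    intro n i hS σ p
    induction p using Pres.cl_ind with | h p => ?_
    rfl

/-- A morphism out of a presented operad commutes with derivations if it does so on generators. -/
theorem pres_hom_der {δ : ι}
    {d : ∀ {n : ℕ} {i j : ι}, i + δ = j → (presOp deg E).X n i →ₗ[R] (presOp deg E).X n j}
    {d' : ∀ {n : ℕ} {i j : ι}, i + δ = j → M.X n i →ₗ[R] M.X n j} (hd : IsDer (presOp deg E) δ d)
    (hd' : IsDer M δ d') (F : Op.Hom (presOp deg E) M)
    (hg : ∀ n i j (h : i + δ = j) (g : G n i), F.f n j (d h (Pres.cl (.gen g))) =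
      d' h (F.f n i (Pres.cl (.gen g)))) {n : ℕ} {i : ι} (x : (presOp deg E).X n i) :
    ∀ {j : ι} (h : i + δ = j), F.f n j (d h x) = d' h (F.f n i x) := by
  induction x using Pres.cl_ind with | h p => ?_
  induction p with
  | gen g => exact fun h => hg _ _ _ h g
  | one hi =>
    intro j h
    rw [Pres.cl_one, hd.one, F.map_one, hd'.one, map_zero]
  | comp a hl hk p q ih ih' =>
    intro j h
    rw [Pres.cl_comp, hd.comp, F.map_comp, hd'.comp, map_add, map_smul, F.map_comp, F.map_comp, ih,
      ih']
  | act hS σ p ih =>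
    intro j h
    rw [Pres.cl_act, hd.act, F.map_act, F.map_act, hd'.act, ih]
  | zero =>
    intro j h
    rw [Pres.cl_zero]
    simp only [LinearMap.map_zero]
  | add p q ih ih' =>
    intro j h
    rw [Pres.cl_add]
    simp only [LinearMap.map_add, ih, ih']
  | smul r p ih =>
    intro j h
    rw [Pres.cl_smul]
    simp only [LinearMap.map_smul, ih]

/-- A derivation of a presented operad whose square vanishes on generators has square zero. -/
theorem pres_der_der {δ : ι}
    {d : ∀ {n : ℕ} {i j : ι}, i + δ = j → (presOp deg E).X n i →ₗ[R] (presOp deg E).X n j}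
    (hd : IsDer (presOp deg E) δ d)
    (hg : ∀ n i j k (h : i + δ = j) (h' : j + δ = k) (g : G n i),
      d h' (d h (Pres.cl (.gen g))) = 0) {n : ℕ} {i : ι} (x : (presOp deg E).X n i) :
    ∀ {j k : ι} (h : i + δ = j) (h' : j + δ = k), d h' (d h x) = 0 := by
  induction x using Pres.cl_ind with | h p => ?_
  induction p with
  | gen g => exact fun h h' => hg _ _ _ _ h h' g
  | one hi =>
    intro j k h h'
    rw [Pres.cl_one, hd.one, LinearMap.map_zero]
  | @comp m n l i i' k a hl hk p q ih ih' =>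
    intro j k h h'
    rw [Pres.cl_comp, hd.comp, LinearMap.map_add, LinearMap.map_smul, hd.comp, hd.comp,
      ih rfl rfl, ih' rfl rfl, map_zero, map_zero, LinearMap.zero_apply, smul_zero, zero_add,
      add_zero, ← add_smul]
    have : sgn R (deg (i + δ)) + sgn R (deg i) = 0 := by
      rw [map_add, hd.odd, sgn_add, show sgn R (-1) = -1 by simp [sgn]]
      ring
    rw [this, zero_smul]
  | act hS σ p ih =>
    intro j k h h'
    rw [Pres.cl_act, hd.act, hd.act, ih, LinearMap.map_zero]
  | zero =>
    intro j k h h'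
    rw [Pres.cl_zero]
    simp only [LinearMap.map_zero]
  | add p q ih ih' =>
    intro j k h h'
    rw [Pres.cl_add]
    simp only [LinearMap.map_add, ih, ih', add_zero]
  | smul r p ih =>
    intro j k h h'
    rw [Pres.cl_smul]
    simp only [LinearMap.map_smul, ih, smul_zero]

end Lift

section Parity

variable (R S)

/-- An operad in which the identity operation is nonzero if `R` is nontrivial: the scalars in even
degrees. -/
def parityOp : ZOp.{v, v} R S where
  X _ i := ({ carrier := {r : R | Odd i → r = 0}
              add_mem' := fun ha hb h => by rw [ha h, hb h, add_zero]
              zero_mem' := fun _ => rfl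
              smul_mem' := fun c r hr h => by rw [hr h, smul_zero] } : Submodule R R)
  one h := ⟨1, fun h' => by rw [h] at h'; exact absurd h' (by decide)⟩
  comp {m n l i j k} _ _ hk := LinearMap.mk₂ R
    (fun p q => ⟨p.1 * q.1, fun h => by
      rw [← hk, Int.odd_add] at h
      by_cases hi : Odd i
      · rw [p.2 hi, zero_mul]
      · rw [q.2 (Int.not_even_iff_odd.1 fun h' => hi (h.2 h')), mul_zero]⟩)
    (fun p p' q => Subtype.ext (add_mul _ _ _))
    (fun r p q => Subtype.ext (mul_assoc _ _ _))
    (fun p q q' => Subtype.ext (mul_add _ _ _))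
    (fun r p q => Subtype.ext (mul_left_comm _ _ _))
  act _ _ := LinearMap.id
  one_comp _ _ _ _ _ := Subtype.ext (one_mul _)
  comp_one _ _ _ _ _ := Subtype.ext (mul_one _)
  comp_seq _ _ _ _ _ _ _ _ _ _ _ _ _ _ _ := Subtype.ext (mul_assoc _ _ _)
  comp_par {m n r l l' t i j k ij ik ijk} _ _ _ _ _ _ _ _ _ _ _ _ _ _ _ p q s := Subtype.ext (by
    change p.1 * q.1 * s.1 = sgn R (j * k) * (p.1 * s.1 * q.1)
    by_cases hj : Odd j
    · rw [q.2 hj, mul_zero, zero_mul, mul_zero, mul_zero]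
    · have : sgn R (j * k) = 1 := by
        rw [Int.not_odd_iff_even] at hj
        rw [sgn, Int.negOnePow_even _ (hj.mul_right k)]
        simp
      rw [this]
      ring)
  act_one _ _ := rfl
  act_mul _ _ _ _ := rfl
  comp_act _ _ _ _ _ _ _ _ _ _ := rfl

end Parity
end PresHom

section StashMem

variable {R : Type v} [CommRing R] {S : Prop}

theorem stash_mem {A : ZOp.{v, w} R S} {m : ∀ n : ℕ, A.X n (-1)} {n : ℕ}
    {V : Submodule R (A.X n (-1 + -1))} (hV : ∀ (hS : S) (σ) (x), x ∈ V → A.act hS σ x ∈ V)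
    (h : ∀ (u q : ℕ) (a : Fin u) (hl : n + 1 = u + q), A.comp a hl rfl (m u) (m q) ∈ V) :
    stash A m n ∈ V := by
  unfold stash
  split_ifs with hS
  · exact Submodule.neg_mem _ (Submodule.sum_mem _ fun q _ => Submodule.sum_mem _ fun σ _ =>
      hV hS σ _ (h _ _ _ _))
  · exact Submodule.neg_mem _ (Submodule.sum_mem _ fun q _ => Submodule.sum_mem _ fun σ _ =>
      h _ _ _ _)

/-- The elements that a shift derivation annihilates. -/
def shiftKer {A : ZOp.{v, w} R S} {δ : ℤ} {D : ShiftMap A A δ}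
    (hD : IsShiftDer (Op.Hom.id A) δ D) : SubOp A where
  carrier n i := ⨅ (s : ℕ) (j : ℤ) (h : i + δ = j) (_ : Slot S s n), LinearMap.ker (D s h)
  one_mem h := by
    simp only [Submodule.mem_iInf, LinearMap.mem_ker]
    exact fun s j hj hs => hD.one h hj hs
  comp_mem a hl hk p q hp hq := by
    simp only [Submodule.mem_iInf, LinearMap.mem_ker] at hp hq ⊢
    intro s j hj hs
    rw [hD.comp a hl hk hj _ _ hs, Op.outer_congr _ _ _ hs fun t ht => hp t _ rfl ht,
      Op.inner_congr _ _ _ _ _ fun t ht => hq t _ rfl ht, Op.outer_zero_left, Op.inner_zero_right,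
      smul_zero, add_zero]
  act_mem hS σ p hp := by
    simp only [Submodule.mem_iInf, LinearMap.mem_ker] at hp ⊢
    intro s j hj hs
    rw [hs.2 hS, hD.act hS σ hj, hp 0 _ hj (slot_zero S _), LinearMap.map_zero]

theorem mem_shiftKer {A : ZOp.{v, w} R S} {δ : ℤ} {D : ShiftMap A A δ}
    (hD : IsShiftDer (Op.Hom.id A) δ D) {n : ℕ} {i : ℤ} {x : A.X n i} :
    x ∈ (shiftKer hD).carrier n i ↔ ∀ s j (h : i + δ = j), Slot S s n → D s h x = 0 := by
  simp only [shiftKer, Submodule.mem_iInf, LinearMap.mem_ker]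

theorem SubOp.generated_le {A : ZOp.{v, w} R S} {T : ∀ (n : ℕ) (i : ℤ), Set (A.X n i)}
    (Q : SubOp A) (h : ∀ n i, T n i ⊆ Q.carrier n i) {n : ℕ} {i : ℤ} {x : A.X n i}
    (hx : x ∈ (SubOp.generated A T).carrier n i) : x ∈ Q.carrier n i :=
  (Submodule.mem_iInf _).1 hx ⟨Q, h⟩

theorem SubOp.mem_generated {A : ZOp.{v, w} R S} {T : ∀ (n : ℕ) (i : ℤ), Set (A.X n i)}
    {n : ℕ} {i : ℤ} {x : A.X n i} (hx : x ∈ T n i) : x ∈ (SubOp.generated A T).carrier n i :=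
  (Submodule.mem_iInf _).2 fun Q => Q.2 n i hx

/-- The preimage of a suboperad. -/
def SubOp.comap {A : ZOp.{v, w} R S} {B : ZOp.{v, w'} R S} (F : Op.Hom A B) (Q : SubOp B) :
    SubOp A where
  carrier n i := (Q.carrier n i).comap (F.f n i)
  one_mem h := by
    rw [Submodule.mem_comap, F.map_one]
    exact Q.one_mem h
  comp_mem a hl hk p q hp hq := by
    rw [Submodule.mem_comap, F.map_comp]
    exact Q.comp_mem a hl hk hp hq
  act_mem hS σ p hp := by
    rw [Submodule.mem_comap, F.map_act]
    exact Q.act_mem hS σ hp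

/-- The image of the natural morphism, as a suboperad. -/
def Quad.rangeSub (Q : Quad.{v, w} R S) : SubOp Q.dg.op where
  carrier n i := ⨆ k, Q.wt n i k
  one_mem h := Submodule.mem_iSup_of_mem 0 (Quad.mem_wt_zero.2 (Q.sub.one_mem h))
  comp_mem {m n l i j k} a hl hk p q hp hq := by
    induction hp using Submodule.iSup_induction' with
    | mem c p hp =>
      induction hq using Submodule.iSup_induction' with
      | mem e q hq =>
        refine Submodule.mem_iSup_of_mem (c + e) ?_
        exact Quad.comp_mem_part (by simp) a hl hk hp hq
      | zero =>
        rw [map_zero]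
        exact Submodule.zero_mem _
      | add x y _ _ hx hy =>
        rw [map_add]
        exact Submodule.add_mem _ hx hy
    | zero =>
      rw [map_zero, LinearMap.zero_apply]
      exact Submodule.zero_mem _
    | add x y _ _ hx hy =>
      rw [map_add, LinearMap.add_apply]
      exact Submodule.add_mem _ hx hy
  act_mem hS σ p hp := by
    induction hp using Submodule.iSup_induction' with
    | mem c p hp => exact Submodule.mem_iSup_of_mem c (Quad.act_mem_part hS σ hp)
    | zero =>
      rw [map_zero]
      exact Submodule.zero_mem _
    | add x y _ _ hx hy =>
      rw [map_add]
      exact Submodule.add_mem _ hx hy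

theorem Quad.natural_surjective (Q : Quad.{v, w} R S) {n : ℕ} {i : ℤ}
    (h : ∀ x : Q.dg.op.X n i, x ∈ Q.rangeSub.carrier n i) : Function.Surjective (Q.natural n i) := by
  classical
  intro x
  have : (⨆ k, Q.wt n i k) ≤ LinearMap.range (Q.natural n i) := by
    refine iSup_le fun k => ?_
    rintro _ ⟨y, rfl⟩
    refine ⟨DirectSum.lof R ℕ _ k y, ?_⟩
    rw [Quad.natural, DirectSum.toModule_lof]
  exact this (h x)

end StashMem
end
end TwistOperad

namespace TwistOperad

noncomputable section

section MuCurv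

variable {R : Type v} [CommRing R] {S : Prop}

variable (R S) in
/-- The shift derivation that sends each generator to the next one. -/
def muRaise : ShiftMap (muOp.{v, w} R S) (muOp.{v, w} R S) 0 :=
  Pres.shift (deg := AddMonoidHom.id ℤ) (0 : ℤ) (fun _ n i _ h g => match n, i, h, g with
    | n, _, h, .mu _ => (muOp R S).cast rfl h (mu R S (n + 1))) (by
    intro s n i j h p q hr hs
    cases hr with
    | inv hS σ =>
      subst h
      exact act_mu R S hS _)

variable (R S) in
/-- The shift derivation that sends the generator of arity zero to the identity, and the other
generators to zero. -/
def muLower : ShiftMap (muOp.{v, w} R S) (muOp.{v, w} R S) 1 :=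
  Pres.shift (deg := AddMonoidHom.id ℤ) (1 : ℤ) (fun _ n i _ h g => match n, i, h, g with
    | 0, _, h, .mu _ => (muOp R S).one h.symm
    | _ + 1, _, _, .mu _ => 0) (by
    intro s n i j h p q hr hs
    cases hr with
    | inv hS σ =>
      cases n with
      | zero =>
        obtain rfl : σ = 1 := Subsingleton.elim _ _
        refine (congrArg (fun τ => (muOp R S).act hS τ _) up_one).trans ((muOp R S).act_one hS _)
      | succ n => exact map_zero ((muOp R S).act hS (up σ)))

theorem isShiftDer_muRaise : IsShiftDer (Op.Hom.id _) 0 (muRaise.{v, w} R S) :=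
  Pres.isShiftDer_shift _

theorem isShiftDer_muLower : IsShiftDer (Op.Hom.id _) 1 (muLower.{v, w} R S) :=
  Pres.isShiftDer_shift _

theorem muRaise_mu {s n : ℕ} (hs : Slot S s n) {j : ℤ} (h : -1 + 0 = j) :
    muRaise.{v, w} R S s h (mu R S n) = (muOp R S).cast rfl h (mu R S (n + 1)) :=
  Pres.shift_cl h hs _

theorem muLower_zero {j : ℤ} (h : -1 + 1 = j) (hj : j = 0) :
    muLower.{v, w} R S 0 h (mu R S 0) = (muOp R S).one hj :=
  Pres.shift_cl h (slot_zero S 0) _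

theorem muLower_succ {s n : ℕ} (hs : Slot S s (n + 1)) {j : ℤ} (h : -1 + 1 = j) :
    muLower.{v, w} R S s h (mu R S (n + 1)) = 0 :=
  Pres.shift_cl h hs _

variable {D : ∀ n : ℕ, (muOp.{v, w} R S).X n (-1 + -1)}
  {hD : ∀ (hS : S) (n : ℕ) (σ : Equiv.Perm (Fin n)), (muOp R S).act hS σ (D n) = D n}

variable (D hD) in
/-- The differential of `muDG`. -/
def muD : ∀ {n : ℕ} {i j : ℤ}, i + -1 = j → (muOp.{v, w} R S).X n i →ₗ[R] (muOp R S).X n j :=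
  (muDG D hD).d

theorem isDer_mu : IsDer (muOp.{v, w} R S) (-1) (muD D hD) :=
  isDer_der rfl (by
    intro n i j h p q hr
    cases hr with
    | inv hS σ =>
      subst h
      exact hD hS _ σ)

theorem muD_mu (n : ℕ) : muD D hD rfl (mu R S n) = D n := rfl

section Stasheff

variable (hst : ∀ n, D n = stash (muOp.{v, w} R S) (mu R S) n)

include hst

theorem muRaise_d {s n : ℕ} (hs : Slot S s n) {i j j' k : ℤ} (h₁ : i + 0 = j) (h₁' : j + -1 = k)
    (h₂ : i + -1 = j') (h₂' : j' + 0 = k) (x : (muOp.{v, w} R S).X n i) :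
    muD D hD h₁' (muRaise R S s h₁ x) = muRaise R S s h₂' (muD D hD h₂ x) := by
  have h := shiftAgree_pres
    (isShiftDer_bracket isShiftDer_muRaise (isDer_mu (hD := hD)) (zero_add (-1)))
    (isShiftDer_zero (Op.Hom.id (muOp.{v, w} R S)) (-1)) (fun {n i} g => ?_) x s k (by omega) hs
  · subst h₁ h₂
    rw [bracket_apply, map_zero, sgn_zero, one_smul, LinearMap.zero_apply, sub_eq_zero] at h
    exact h.symm
  · intro s j hj hs
    cases g with
    | mu =>
      change bracket _ _ _ s hj (mu R S n) = 0
      subst hj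
      rw [bracket_apply, map_zero, sgn_zero, one_smul, sub_eq_zero, muD_mu, muRaise_mu hs, hst]
      refine (stash_shift isShiftDer_muRaise (fun s n hs => muRaise_mu hs _)
        (fun hS n σ => act_mu R S hS σ) hs _).trans (hst (n + 1)).symm

theorem muD_muD_zero (hRS : S → ∀ n : ℕ, IsUnit ((n + 1 : ℕ) : R)) :
    muD D hD rfl (muD D hD (rfl : (-1 : ℤ) + -1 = -1 + -1) (mu R S 0)) = 0 := by
  have hd := isDer_mu (hD := hD)
  have hR := isShiftDer_muRaise (R := R) (S := S)
  have e0 : muD D hD (rfl : (-1 : ℤ) + -1 = -1 + -1) (mu R S 0) =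
      -(muOp R S).comp (0 : Fin 1) (n := 0) rfl rfl (mu R S 1) (mu R S 0) := by
    rw [muD_mu, hst, stash_zero]
  have hm : ∀ n (h : (-1 : ℤ) + 0 = -1), muRaise R S 0 h (mu R S n) = mu R S (n + 1) :=
    fun n h => muRaise_mu (slot_zero S n) h
  have e1 : muD D hD (rfl : (-1 : ℤ) + -1 = -1 + -1) (mu R S 1) =
      -muRaise R S 0 (add_zero _)
        ((muOp R S).comp (0 : Fin 1) (n := 0) rfl rfl (mu R S 1) (mu R S 0)) := by
    rw [← hm 0 (add_zero _), muRaise_d hst (slot_zero S 0) _ rfl rfl (add_zero _), e0, map_neg,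
      hm 0]
  have par : (muOp R S).comp (0 : Fin 1) (n := 0) rfl (k := -1 + -1 + -1) rfl
        ((muOp R S).comp (0 : Fin 2) (n := 0) rfl rfl (mu R S 2) (mu R S 0)) (mu R S 0) =
      -(muOp R S).comp (0 : Fin 1) (n := 0) rfl rfl
        ((muOp R S).comp (1 : Fin 2) (n := 0) rfl rfl (mu R S 2) (mu R S 0)) (mu R S 0) := by
    refine ((muOp R S).comp_par (n := 0) (r := 0) (l := 1) (l' := 1) (t := 0) (0 : Fin 2) 1 0 0 (by decide) rfl rfl rfl rfl rfl rfl rfl rfl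
      (rfl : (-1 : ℤ) + -1 = -1 + -1) rfl _ _ _).trans ?_
    rw [show sgn R ((AddMonoidHom.id ℤ) (-1) * (AddMonoidHom.id ℤ) (-1)) = -1 by simp [sgn],
      neg_smul, one_smul]
  have seq : (muOp R S).comp (0 : Fin 1) (n := 0) rfl (k := -1 + -1 + -1) rfl
        ((muOp R S).comp (0 : Fin 1) (n := 1) rfl rfl (mu R S 1) (mu R S 1)) (mu R S 0) =
      (muOp R S).comp (0 : Fin 1) (n := 0) rfl rfl (mu R S 1)
        ((muOp R S).comp (0 : Fin 1) (n := 0) rfl rfl (mu R S 1) (mu R S 0)) :=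
    (muOp R S).comp_seq _ _ _ rfl _ _ _ _ _ _ _ _ _ _ _
  have e2 : (muOp R S).comp (0 : Fin 1) (n := 0) rfl (k := -1 + -1 + -1) rfl
        (muD D hD rfl (mu R S 1)) (mu R S 0) =
      -(muOp R S).comp (0 : Fin 1) (n := 0) rfl rfl (mu R S 1)
        ((muOp R S).comp (0 : Fin 1) (n := 0) rfl rfl (mu R S 1) (mu R S 0)) := by
    rw [e1, map_neg, LinearMap.neg_apply, ← seq]
    refine congrArg Neg.neg ?_
    by_cases hS : S
    · have h1 := hR.comp_sym hS (a := (0 : Fin 1)) (1 : Fin 2) (0 : Fin 1) (hl := rfl)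
        (hk := rfl) (hk' := add_zero (-1 + -1)) (p := mu R S 1) (q := mu R S 0) rfl rfl rfl rfl
        (add_zero _) (add_zero _) rfl rfl
      have h2 : (muOp R S).comp (1 : Fin 2) (n := 0) rfl (k := -1 + -1) rfl (mu R S 2) (mu R S 0) =
          (muOp R S).comp (0 : Fin 2) (n := 0) rfl rfl (mu R S 2) (mu R S 0) := by
        have h3 := (muOp R S).comp_act_left hS (1 : Fin 2) (n := 0) (k := -1 + -1) (l := 1) rfl rfl
          (Equiv.swap 0 1) 1 ⟨fun j x hj hx => ?_, fun k => k.elim0⟩ (mu R S 2) (mu R S 0)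
        · rw [act_mu, Equiv.swap_apply_right, (muOp R S).act_one] at h3
          exact h3
        · obtain rfl : j = 0 := by omega
          rw [Subsingleton.elim x 0]
          rfl
      rw [h1, hm, hm, map_zero, zero_mul, sgn_zero, one_smul, cyc_zero _ rfl, (muOp R S).act_one,
        map_add, LinearMap.add_apply]
      refine add_eq_right.2 ?_
      rw [← h2] at par
      have h4 := (hRS hS 1).smul_eq_zero (x := (muOp R S).comp (0 : Fin 1) (n := 0) rfl
        (k := -1 + -1 + -1) rfl
        ((muOp R S).comp (1 : Fin 2) (n := 0) rfl rfl (mu R S 2) (mu R S 0)) (mu R S 0))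
      refine h4.1 (Eq.trans ?_ (eq_neg_iff_add_eq_zero.1 par))
      rw [Nat.cast_add, Nat.cast_one, add_smul, one_smul]
    · have h1 := hR.comp_ns hS (n := 0) (s := 0) (a := (0 : Fin 1)) (1 : Fin 2) (0 : Fin 2) (hl := rfl)
        (hk := rfl) (hk' := add_zero (-1 + -1)) (p := mu R S 1) (q := mu R S 0) rfl rfl rfl rfl
        (add_zero _) (add_zero _) rfl rfl le_rfl
      have h2 : muRaise R S 1 (add_zero (-1)) (mu R S 1) = mu R S 2 :=
        muRaise_mu ⟨le_rfl, fun h => (hS h).elim⟩ _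
      rw [h1, if_pos (Nat.zero_le _), if_pos (show ((0 : Fin 1) : ℕ) + 0 ≤ 0 from le_rfl),
        if_pos (show ((0 : Fin 1) : ℕ) ≤ 0 ∧ 0 ≤ ((0 : Fin 1) : ℕ) + 0 from ⟨le_rfl, le_rfl⟩), map_zero, zero_mul, sgn_zero, one_smul]
      refine (congrArg (fun x => (muOp R S).comp (0 : Fin 1) (n := 0) rfl
        (k := -1 + -1 + -1) rfl x (mu R S 0)) (congrArg₂ (· + ·) (congrArg₂ (· + ·)
          (congrArg (fun x => (muOp R S).comp (1 : Fin 2) (n := 0) rfl (k := -1 + -1) rfl x _)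
            (hm 1 _))
          (congrArg (fun x => (muOp R S).comp (0 : Fin 2) (n := 0) rfl (k := -1 + -1) rfl x _) h2))
          (congrArg _ (hm 0 _)))).trans ?_
      rw [map_add, map_add, LinearMap.add_apply, LinearMap.add_apply]
      exact (congrArg (· + _) ((congrArg (_ + ·) par).trans (add_neg_cancel _))).trans (zero_add _)
  rw [e0, map_neg, hd.comp (0 : Fin 1) (n := 0) rfl rfl rfl, e2, e0,
    show sgn R ((AddMonoidHom.id ℤ) (-1)) = -1 by simp [sgn], map_neg, neg_smul, one_smul, neg_neg, neg_add_cancel,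
    neg_zero]

theorem muD_muD (hRS : S → ∀ n : ℕ, IsUnit ((n + 1 : ℕ) : R)) (n : ℕ) :
    muD D hD rfl (muD D hD (rfl : (-1 : ℤ) + -1 = -1 + -1) (mu R S n)) = 0 := by
  induction n with
  | zero => exact muD_muD_zero hst hRS
  | succ n ih =>
    have h1 : mu R S (n + 1) = muRaise R S 0 (add_zero (-1)) (mu.{v, w} R S n) :=
      (muRaise_mu (R := R) (slot_zero S n) (add_zero _)).symm
    rw [h1, muRaise_d hst (slot_zero S n) _ rfl rfl (add_zero _),
      muRaise_d hst (slot_zero S n) _ rfl rfl (add_zero _), ih, map_zero]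

theorem isDG_mu [Nontrivial R] (hRS : S → ∀ n : ℕ, IsUnit ((n + 1 : ℕ) : R)) :
    IsDG (muDG D hD) where
  one_ne h := by
    let F : Op.Hom (muOp.{v, w} R S) (parityOp R S) := presHom (fun _ _ _ => 0) (by
      intro n i p q hr
      cases hr
      rfl)
    have h1 := congrArg (F.f 1 0) (show (muOp.{v, w} R S).one rfl = 0 from h)
    rw [F.map_one, map_zero] at h1
    exact one_ne_zero (congrArg Subtype.val h1)
  leibniz a hl hk hi hj hk' p q := by
    subst hi hj
    exact (isDer_mu (hD := hD)).comp a hl hk hk' p q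
  d_act := (isDer_mu (hD := hD)).act
  d_d h h' p := by
    refine pres_der_der (isDer_mu (hD := hD)) (fun n i j k h h' g => ?_) p h h'
    subst h h'
    cases g with
    | mu => exact muD_muD hst hRS _

end Stasheff

theorem muQuad_induction {C : ∀ n i, Submodule R ((muOp.{v, w} R S).X n i)}
    (one : ∀ {i : ℤ} (h : i = 0), (muOp R S).one h ∈ C 1 i)
    (comp : ∀ {m n l : ℕ} {i j k : ℤ} (a : Fin m) (hl : l + 1 = m + n) (hk : i + j = k)
      (p : (muOp R S).X m i) (q : (muOp R S).X n j), p ∈ C m i → q ∈ C n j →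
        (muOp R S).comp a hl hk p q ∈ C l k)
    (act : ∀ {n : ℕ} {i : ℤ} (hS : S) (σ : Equiv.Perm (Fin n)) (p : (muOp R S).X n i), p ∈ C n i →
      (muOp R S).act hS σ p ∈ C n i) (gen : ∀ n, mu R S n ∈ C n (-1))
    {n : ℕ} {i : ℤ} (x : (muOp R S).X n i) : x ∈ C n i := by
  induction x using Pres.cl_ind with | h p => ?_
  induction p with
  | gen g =>
    cases g with
    | mu => exact gen _
  | one hi => exact one hi
  | comp a hl hk p q ih ih' => exact comp a hl hk _ _ ih ih'
  | act hS σ p ih => exact act hS σ _ ih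
  | zero => exact Submodule.zero_mem _
  | add p q ih ih' => exact Submodule.add_mem _ ih ih'
  | smul r p ih => exact Submodule.smul_mem _ r ih

theorem mu_mem_sub (n : ℕ) : mu R S (n + 1) ∈ (muQuad D hD).sub.carrier (n + 1) (-1) :=
  SubOp.mem_generated ⟨Nat.succ_pos n, .mu (n + 1), rfl⟩

theorem mu_mem_part : ∀ n : ℕ, ∃ u ∈ ({0, (1, 0)} : Set (ℤ × ℤ)),
    mu R S n ∈ (muQuad D hD).part n (-1) u
  | 0 => ⟨(1, 0), by simp, Quad.κ_mem_wt⟩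
  | n + 1 => ⟨0, by simp, Quad.mem_wt_zero.2 (mu_mem_sub n)⟩

/-- The elements of the suboperad whose differential has weight at most one. -/
def smallSub (Q : Quad.{v, w} R S) (hQ : IsDG Q.dg) : SubOp Q.dg.op where
  carrier n i := Q.sub.carrier n i ⊓ ⨅ (j : ℤ) (h : i + -1 = j),
    (Q.part n j 0 ⊔ Q.part n j (1, 0)).comap (Q.dg.d h)
  one_mem h := by
    simp only [Submodule.mem_inf, Submodule.mem_iInf, Submodule.mem_comap]
    refine ⟨Q.sub.one_mem h, fun j hj => ?_⟩
    rw [hQ.d_one]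
    exact Submodule.zero_mem _
  comp_mem a hl hk p q hp hq := by
    simp only [Submodule.mem_inf, Submodule.mem_iInf, Submodule.mem_comap] at hp hq ⊢
    refine ⟨Q.sub.comp_mem a hl hk hp.1 hq.1, fun j hj => ?_⟩
    rw [hQ.leibniz a hl hk rfl rfl hj]
    refine Submodule.add_mem _ ?_ (Submodule.smul_mem _ _ ?_)
    · obtain ⟨x, hx, y, hy, hxy⟩ := Submodule.mem_sup.1 (hp.2 _ rfl)
      rw [← hxy, map_add, LinearMap.add_apply]
      exact Submodule.add_mem_sup
        (Quad.comp_mem_part (zero_add 0) a hl _ hx (Quad.mem_wt_zero.2 hq.1))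
        (Quad.comp_mem_part (add_zero _) a hl _ hy (Quad.mem_wt_zero.2 hq.1))
    · obtain ⟨x, hx, y, hy, hxy⟩ := Submodule.mem_sup.1 (hq.2 _ rfl)
      rw [← hxy, map_add]
      exact Submodule.add_mem_sup
        (Quad.comp_mem_part (zero_add 0) a hl _ (Quad.mem_wt_zero.2 hp.1) hx)
        (Quad.comp_mem_part (zero_add _) a hl _ (Quad.mem_wt_zero.2 hp.1) hy)
  act_mem hS σ p hp := by
    simp only [Submodule.mem_inf, Submodule.mem_iInf, Submodule.mem_comap] at hp ⊢
    refine ⟨Q.sub.act_mem hS σ hp.1, fun j hj => ?_⟩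
    rw [hQ.d_act]
    obtain ⟨x, hx, y, hy, hxy⟩ := Submodule.mem_sup.1 (hp.2 _ hj)
    rw [← hxy, map_add]
    exact Submodule.add_mem_sup (Quad.act_mem_part hS σ hx) (Quad.act_mem_part hS σ hy)

theorem isCurv_muQuad [Nontrivial R] (hst : ∀ n, D n = stash (muOp.{v, w} R S) (mu R S) n)
    (hRS : S → ∀ n : ℕ, IsUnit ((n + 1 : ℕ) : R)) : IsCurv (muQuad D hD) := by
  have hDG : IsDG (muDG D hD) := isDG_mu hst hRS
  have hker : ∀ {n : ℕ} {i : ℤ} (p : (muOp.{v, w} R S).X n i),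
      p ∈ (muQuad D hD).sub.carrier n i →
      p ∈ (shiftKer isShiftDer_muLower).carrier n i := fun p hp => by
    refine SubOp.generated_le _ ?_ hp
    rintro n i x ⟨hn, g, rfl⟩
    rw [SetLike.mem_coe, mem_shiftKer]
    intro s j h hs
    cases g with
    | mu =>
      obtain ⟨n, rfl⟩ := Nat.exists_eq_succ_of_ne_zero hn.ne'
      exact muLower_succ hs h
  have hstash : ∀ n, stash (muOp.{v, w} R S) (mu R S) (n + 1) ∈
      (muQuad D hD).part (n + 1) (-1 + -1) 0 ⊔ (muQuad D hD).part (n + 1) (-1 + -1) (1, 0) := by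
    intro n
    refine stash_mem (fun hS σ x hx => ?_) fun u q a hl => ?_
    · obtain ⟨x, hx, y, hy, hxy⟩ := Submodule.mem_sup.1 hx
      rw [← hxy, map_add]
      exact Submodule.add_mem_sup (Quad.act_mem_part (Q := muQuad D hD) hS σ hx)
        (Quad.act_mem_part (Q := muQuad D hD) hS σ hy)
    · obtain ⟨u, rfl⟩ : ∃ u', u = u' + 1 := ⟨u - 1, by have := a.2; omega⟩
      have h0 := Quad.mem_wt_zero.2 (mu_mem_sub (D := D) (hD := hD) u)
      obtain ⟨t, ht, h1⟩ := mu_mem_part (D := D) (hD := hD) q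
      have := Quad.comp_mem_part (zero_add t) a hl rfl h0 h1
      rcases ht with rfl | rfl
      · exact Submodule.mem_sup_left this
      · exact Submodule.mem_sup_right this
  refine isCurv_of_shift hRS hDG (D := muLower R S) isShiftDer_muLower ?_ ?_ ?_ ?_ ?_
  · intro s n i j h p hp hs
    exact (mem_shiftKer _).1 (hker p hp) s j h hs
  · exact fun h hj => muLower_zero h hj
  · intro n i
    refine Quad.natural_surjective _ fun x => ?_
    refine muQuad_induction (C := (muQuad D hD).rangeSub.carrier) (muQuad D hD).rangeSub.one_mem
      (fun a hl hk _ _ => (muQuad D hD).rangeSub.comp_mem a hl hk)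
      (fun hS σ _ => (muQuad D hD).rangeSub.act_mem hS σ) (fun n => ?_) x
    cases n with
    | zero => exact Submodule.mem_iSup_of_mem (p := (muQuad D hD).wt 0 (-1)) 1 Quad.κ_mem_wt
    | succ n =>
      exact Submodule.mem_iSup_of_mem (p := (muQuad D hD).wt (n + 1) (-1)) 0
        (Quad.mem_wt_zero.2 (mu_mem_sub n))
  · intro n i j h q hq
    have : q ∈ (smallSub (muQuad D hD) hDG).carrier n i := by
      refine SubOp.generated_le _ ?_ hq
      rintro n i x ⟨hn, g, rfl⟩
      cases g with
      | mu =>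
        cases n with
        | zero => omega
        | succ n =>
          refine Submodule.mem_inf.2 ⟨mu_mem_sub n, (Submodule.mem_iInf _).2 fun j =>
            (Submodule.mem_iInf _).2 fun h => ?_⟩
          subst h
          have := hstash n
          rw [← hst] at this
          exact this
    exact ((Submodule.mem_iInf _).1 ((Submodule.mem_iInf _).1 this.2 j) h)
  · change D 0 ∈ _
    rw [hst, stash_zero]
    exact Submodule.neg_mem _ (Quad.comp_mem_part (zero_add _) _ _ _
      (Quad.mem_wt_zero.2 (mu_mem_sub 0)) Quad.κ_mem_wt)

end MuCurv
end
end TwistOperad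

namespace TwistOperad

noncomputable section

section Initial

variable {R : Type v} [CommRing R] {S : Prop}

/-- The shift derivations of curved operads are natural. -/
theorem IsCurv.hom_shift {Q Q' : Quad.{v, w} R S} (hQ : IsCurv Q) (hQ' : IsCurv Q')
    (G : Quad.Hom Q Q') {s n : ℕ} {i j : ℤ} (h : i + 1 = j) (hs : Slot S s n)
    (x : Q.dg.op.X n i) :
    (PreDG.Hom.toHom G.toDG).f (n + 1) j (hQ.shift s h x) =
      hQ'.shift s h ((PreDG.Hom.toHom G.toDG).f n i x) := by
  have h1 := hQ.isShiftDer_shift.hom_comp (PreDG.Hom.toHom G.toDG) (PreDG.Hom.toHom G.toDG)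
    fun _ _ _ => rfl
  have h2 := hQ'.isShiftDer_shift.comp_hom (PreDG.Hom.toHom G.toDG) (PreDG.Hom.toHom G.toDG)
    fun _ _ _ => rfl
  refine hQ.induction (C := fun {n i} x => ShiftAgree _ _ x) ?_ ?_
    (fun a hl hk p q hp hq => ShiftAgree.comp h1 h2 a hl hk hp hq)
    (fun hS σ p hp => ShiftAgree.act h1 h2 hS σ hp) (fun p q hp hq => hp.add hq)
    (fun r p hp => hp.smul r) x s j h hs
  · intro n i q hq s j hj hs
    change (PreDG.Hom.toHom G.toDG).f (n + 1) j (hQ.shift s hj q) =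
      hQ'.shift s hj ((PreDG.Hom.toHom G.toDG).f n i q)
    rw [hQ.shift_sub hj hq hs, map_zero, hQ'.shift_sub hj (G.map_sub hq) hs]
  · intro s j hj hs
    obtain rfl : s = 0 := Nat.le_zero.1 hs.1
    change (PreDG.Hom.toHom G.toDG).f 1 j (hQ.shift 0 hj Q.κ) =
      hQ'.shift 0 hj ((PreDG.Hom.toHom G.toDG).f 0 (-1) Q.κ)
    have hj' : j = 0 := by omega
    rw [hQ.shift_kappa hj hj', G.map_κ, hQ'.shift_kappa hj hj']
    exact Op.Hom.map_one _ _

theorem IsCurv.hom_nabla {Q Q' : Quad.{v, w} R S} (hQ : IsCurv Q) (hQ' : IsCurv Q')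
    (G : Quad.Hom Q Q') {s n : ℕ} {i j : ℤ} (h : i + 0 = j) (hs : Slot S s n)
    (x : Q.dg.op.X n i) :
    (PreDG.Hom.toHom G.toDG).f (n + 1) j (nabla hQ.shift s h x) =
      nabla hQ'.shift s h ((PreDG.Hom.toHom G.toDG).f n i x) := by
  rw [nabla, nabla, bracket_odd s h rfl (by omega) rfl (by omega),
    bracket_odd s h rfl (by omega) rfl (by omega), map_add, hQ.hom_shift hQ' G _ hs,
    PreDG.Hom.map_d, PreDG.Hom.map_d, hQ.hom_shift hQ' G _ hs]

theorem IsCurv.hom_seq {Q Q' : Quad.{v, w} R S} (hQ : IsCurv Q) (hQ' : IsCurv Q')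
    (G : Quad.Hom Q Q') :
    ∀ n : ℕ, (PreDG.Hom.toHom G.toDG).f n (-1) (hQ.seq n) = hQ'.seq n
  | 0 => G.map_κ
  | n + 1 => (hQ.hom_nabla hQ' G (add_zero (-1)) (slot_zero S n) (hQ.seq n)).trans
      (congrArg (nabla hQ'.shift 0 (add_zero (-1))) (hom_seq hQ hQ' G n))

variable {D : ∀ n : ℕ, (muOp.{v, w} R S).X n (-1 + -1)}
  {hD : ∀ (hS : S) (n : ℕ) (σ : Equiv.Perm (Fin n)), (muOp R S).act hS σ (D n) = D n}
  (hA : IsCurv (muQuad D hD))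

section

variable (hst : ∀ n, D n = stash (muOp.{v, w} R S) (mu R S) n)

include hst

theorem nabla_mu (n : ℕ) :
    nabla hA.shift 0 (add_zero (-1)) (mu R S n) = mu R S (n + 1) := by
  let L : ShiftMap (muOp.{v, w} R S) (muOp R S) 1 := hA.shift
  have hL : IsShiftDer (Op.Hom.id _) 1 L := hA.isShiftDer_shift
  have L0 : ∀ {j : ℤ} (h : -1 + 1 = j) (hj : j = 0), L 0 h (mu R S 0) = (muOp R S).one hj :=
    fun h hj => hA.shift_kappa h hj
  have L1 : ∀ {s n : ℕ} {j : ℤ} (h : -1 + 1 = j), Slot S s (n + 1) → L s h (mu R S (n + 1)) = 0 :=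
    fun h hs => hA.shift_sub h (mu_mem_sub _) hs
  have hc : ∀ {n i} (x : (muOp.{v, w} R S).X n i), SComm L (muRaise R S) x := by
    refine fun x => scomm_pres hL isShiftDer_muRaise (fun {n i} g => ?_) x
    cases g with
    | mu =>
      have hL' : ∀ (s : ℕ) {j k : ℤ} (h : -1 + 1 = j) (h' : j + 0 = k), Slot S s n → ∀ t,
          Slot S t (n + 1) → muRaise R S t h' (L s h (mu R S n)) = 0 := by
        intro s j k h h' hs t ht
        cases n with
        | zero =>
          obtain rfl : s = 0 := Nat.le_zero.1 hs.1
          rw [L0 h (by omega)]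
          exact isShiftDer_muRaise.one _ _ ht
        | succ n => rw [L1 h hs, map_zero]
      constructor
      · intro hS j j' k h₁ h₁' h₂ h₂'
        obtain rfl : j' = -1 := by omega
        refine (congrArg (L 0 h₁') (muRaise_mu (slot_zero S n) h₁)).trans ?_
        refine (L1 h₁' (slot_zero S _)).trans ?_
        exact ((congrArg _ ((congrArg _ (hL' 0 h₂ h₂' (slot_zero S _) 0 (slot_zero S _))).trans
          (map_zero _))).trans (smul_zero _)).symm
      · intro hS s t j j' k h₁ h₁' h₂ h₂' hst ht
        have hsl : ∀ {a b : ℕ}, a ≤ b → Slot S a b := fun h => ⟨h, fun h => (hS h).elim⟩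
        obtain rfl : j' = -1 := by omega
        refine (congrArg (L s h₁') (muRaise_mu (hsl ht) h₁)).trans ?_
        refine (L1 h₁' (hsl (by omega))).trans ?_
        exact ((congrArg _ (hL' s h₂ h₂' (hsl (hst.trans ht)) (t + 1) (hsl (by omega)))).trans
          (smul_zero _)).symm
  have hb : ∀ {n i} (x : (muOp.{v, w} R S).X n i),
      SComm (bracket L (muD D hD) (add_neg_cancel 1)) (muRaise R S) x :=
    fun x => SComm.bracket (isDer_mu (hD := hD))
      (fun s n i j j' k h₁ h₁' h₂ h₂' x hs => muRaise_d hst hs h₁ h₁' h₂ h₂' x) hc x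
  have hz : ∀ n, bracket L (muD D hD) (add_neg_cancel 1) 0 (add_zero (-1)) (mu R S n) =
      mu R S (n + 1) := by
    intro n
    induction n with
    | zero =>
      rw [bracket_odd 0 _ rfl (by omega) rfl (by omega), muD_mu, hst, stash_zero, L0 _ rfl,
        (isDer_mu (hD := hD)).one, add_zero, map_neg]
      refine (congrArg Neg.neg ((hA.shift_comp_kappa (i := -1) rfl (by omega) rfl (mu R S 1)
        (mu_mem_sub 0)).trans ?_)).trans (neg_neg (mu R S 1))
      rw [show sgn R (-1) = -1 by simp [sgn], neg_smul, one_smul]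
      rfl
    | succ n ih =>
      have hm := muRaise_mu (R := R) (slot_zero S n) (add_zero (-1))
      by_cases hS : S
      · have h1 := (hb (mu R S n)).sym hS (add_zero _) (add_zero _) (add_zero _) (add_zero _)
        have h2 : muRaise R S 0 (add_zero _) (mu R S (n + 1)) = mu R S (n + 2) :=
          muRaise_mu (slot_zero S _) (add_zero (-1))
        rw [ih, h2, act_mu, map_zero, zero_mul, sgn_zero, one_smul] at h1
        exact (congrArg _ hm.symm).trans h1
      · have h1 := (hb (mu R S n)).ns hS (add_zero _) (add_zero _) (add_zero _) (add_zero _)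
          (le_refl 0) (Nat.zero_le n)
        have h2 : muRaise R S 1 (add_zero _) (mu R S (n + 1)) = mu R S (n + 2) :=
          muRaise_mu ⟨by omega, fun h => (hS h).elim⟩ (add_zero (-1))
        rw [ih, map_zero, zero_mul, sgn_zero, one_smul] at h1
        exact ((congrArg _ hm.symm).trans h1).trans h2
  exact hz n

theorem seq_muQuad : ∀ n : ℕ, hA.seq n = mu R S n
  | 0 => rfl
  | n + 1 => (congrArg (nabla hA.shift 0 (add_zero (-1))) (seq_muQuad n)).trans
      (nabla_mu hA hst n)

/-- The morphism from the free operad that sends its generators to the canonical sequence. -/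
def fromMu {Q : Quad.{v, max v w} R S} (hQ : IsCurv Q) : Quad.Hom (muQuad D hD) Q where
  toDG := ⟨presHom (fun n i g => match n, i, g with
      | n, _, .mu _ => hQ.seq n) (by
      intro n i p q hr
      cases hr with
      | inv hS σ => exact hQ.act_seq hS _ σ), fun h p => by
    refine pres_hom_der (isDer_mu (hD := hD)) hQ.isDG.isDer _ (fun n i j h g => ?_) p h
    subst h
    cases g with
    | mu =>
      refine (congrArg _ (hst _)).trans ((stash_map _ _ _).trans ?_)
      exact (hQ.d_seq _).symm⟩
  map_κ := rfl
  map_sub {n i p} hp := by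
    refine SubOp.generated_le (SubOp.comap _ Q.sub) ?_ hp
    rintro n i x ⟨hn, g, rfl⟩
    cases g with
    | mu =>
      obtain ⟨n, rfl⟩ := Nat.exists_eq_succ_of_ne_zero hn.ne'
      exact hQ.seq_mem n

/-- The free operad with the structure equations as differential is initial. -/
def muQuadIsInitial : Limits.IsInitial (⟨muQuad D hD, hA⟩ : Curv.{v, max v w} R S) :=
  Limits.IsInitial.ofUniqueHom (fun Q => ObjectProperty.homMk (fromMu hst Q.property))
    fun Q m => by
      refine ObjectProperty.hom_ext _ (Quad.Hom.ext' (PreDG.Hom.ext' fun n i x => ?_))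
      refine pres_hom_ext _ _ (fun n i g => ?_) x
      cases g with
      | mu =>
        refine (congrArg _ (seq_muQuad hA hst _).symm).trans ?_
        exact hA.hom_seq Q.property m.hom _

end

theorem dMu_eq_stash (n : ℕ) : dMu.{v, w} R False n = stash (muOp R False) (mu R False) n := by
  rw [stash, dif_neg not_false]
  rfl

theorem dEll_eq_stash (n : ℕ) : dEll.{v, w} R n = stash (muOp R True) (mu R True) n := by
  rw [stash, dif_pos trivial]
  rfl

end Initial
end
end TwistOperad

namespace TwistOperad

noncomputable section

section ComplShift

variable {R : Type v} [CommRing R] {S : Prop} {A : Op.{v, w} R S Tri triDeg}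

theorem complComp_attach {m n l : ℕ} {i j k : ℤ} (a : Fin m) (hl : l + 1 = m + n) (hk : i + j = k)
    (f : complX A m i) (g : complX A n j) (c : ℕ × ℕ) :
    (complComp a hl hk f g).1 c = ∑ x ∈ (splits c).attach,
      A.comp a hl (idx_add hk (mem_splits.1 x.2)) (f.1 x.1.1) (g.1 x.1.2) := by
  rw [complComp_apply, ← Finset.sum_attach]
  exact Finset.sum_congr rfl fun x _ => by rw [A.tcomp_eq a hl (idx_add hk (mem_splits.1 x.2))]

theorem sum_splits_left {M : Type w} [AddCommMonoid M] (e c : ℕ × ℕ)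
    (F : ∀ x y : ℕ × ℕ, x + y = c + e → M)
    (h0 : ∀ x y h, (x.1 < e.1 ∨ x.2 < e.2) → F x y h = 0) :
    ∑ x ∈ (splits (c + e)).attach, F x.1.1 x.1.2 (mem_splits.1 x.2) =
      ∑ x ∈ (splits c).attach, F (x.1.1 + e) x.1.2
        (by rw [add_right_comm, mem_splits.1 x.2]) := by
  symm
  refine Finset.sum_of_injOn (fun x => ⟨(x.1.1 + e, x.1.2), mem_splits.2
    (by rw [add_right_comm, mem_splits.1 x.2])⟩) ?_ (fun _ _ => Finset.mem_coe.2
      (Finset.mem_attach _ _)) ?_ fun _ _ => rfl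
  · rintro ⟨⟨x, y⟩, hx⟩ _ ⟨⟨x', y'⟩, hx'⟩ _ h
    simp only [Subtype.mk.injEq, Prod.mk.injEq, add_left_inj] at h
    exact Subtype.ext (Prod.ext h.1 h.2)
  · rintro ⟨⟨x, y⟩, hx⟩ _ h
    refine h0 _ _ _ ?_
    by_contra hlt
    push Not at hlt
    have hx' : x - e + e = x := Prod.ext (Nat.sub_add_cancel hlt.1) (Nat.sub_add_cancel hlt.2)
    refine h ⟨⟨(x - e, y), mem_splits.2 ?_⟩, Finset.mem_coe.2 (Finset.mem_attach _ _), ?_⟩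
    · have := mem_splits.1 hx
      change x - e + y = c
      rw [← hx', add_right_comm] at this
      exact add_right_cancel this
    · exact Subtype.ext (Prod.ext hx' rfl)

theorem sum_splits_right {M : Type w} [AddCommMonoid M] (e c : ℕ × ℕ)
    (F : ∀ x y : ℕ × ℕ, x + y = c + e → M)
    (h0 : ∀ x y h, (y.1 < e.1 ∨ y.2 < e.2) → F x y h = 0) :
    ∑ x ∈ (splits (c + e)).attach, F x.1.1 x.1.2 (mem_splits.1 x.2) =
      ∑ x ∈ (splits c).attach, F x.1.1 (x.1.2 + e)
        (by rw [← add_assoc, mem_splits.1 x.2]) := by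
  have hs : ∀ (c : ℕ × ℕ) (G : ∀ x y : ℕ × ℕ, x + y = c → M),
      ∑ x ∈ (splits c).attach, G x.1.1 x.1.2 (mem_splits.1 x.2) =
        ∑ x ∈ (splits c).attach, G x.1.2 x.1.1 (by rw [add_comm, mem_splits.1 x.2]) := by
    intro c G
    refine Finset.sum_nbij' (fun x => ⟨x.1.swap, mem_splits.2 ((add_comm _ _).trans
      (mem_splits.1 x.2))⟩) (fun x => ⟨x.1.swap, mem_splits.2 ((add_comm _ _).trans
      (mem_splits.1 x.2))⟩) ?_ ?_ ?_ ?_ ?_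
    · exact fun _ _ => Finset.mem_attach _ _
    · exact fun _ _ => Finset.mem_attach _ _
    · exact fun _ _ => rfl
    · exact fun _ _ => rfl
    · exact fun _ _ => rfl
  rw [hs (c + e), sum_splits_left e c (fun x y h => F y x ((add_comm _ _).trans h))
    fun x y h => h0 _ _ _, hs c (fun x y h => F x (y + e) (by rw [← add_assoc, h]))]

theorem compl_outer {m n l : ℕ} {i j k : ℤ} (a : Fin m) (hl : l + 1 = m + 1 + n) (hk : i + j = k)
    (s : ℕ) (u : ℕ → complX A (m + 1) i) (y : complX A n j) (c : ℕ × ℕ) :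
    ((compl A).outer a hl hk s u y : complX A l k).1 c = ∑ x ∈ (splits c).attach,
      A.outer a hl (idx_add hk (mem_splits.1 x.2)) s (fun t => (u t).1 x.1.1) (y.1 x.1.2) := by
  by_cases hS : S
  · refine (congrArg (fun f : complX A l k => f.1 c)
      ((compl A).outer_sym hS a hl hk s u y)).trans ?_
    exact (complComp_attach _ _ hk _ _ _).trans (Finset.sum_congr rfl fun x _ =>
      (A.outer_sym hS a hl _ s (fun t => (u t).1 x.1.1) (y.1 x.1.2)).symm)
  · refine (congrArg (fun f : complX A l k => f.1 c)
      ((compl A).outer_ns hS a hl hk s u y)).trans ?_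
    refine Eq.trans ?_ (Finset.sum_congr rfl fun x _ => 
      (A.outer_ns hS a hl _ s (fun t => (u t).1 x.1.1) (y.1 x.1.2)).symm)
    rw [Finset.sum_add_distrib]
    refine congrArg₂ (α := A.X _ _) (β := A.X _ _) (· + ·) ?_ ?_
    · split_ifs with h
      · exact complComp_attach _ _ hk _ _ _
      · exact Finset.sum_const_zero.symm
    · split_ifs with h
      · exact complComp_attach _ _ hk _ _ _
      · exact Finset.sum_const_zero.symm

theorem compl_inner {m n l : ℕ} {i j k : ℤ} (a : Fin m) (hl : l + 1 + 1 = m + (n + 1))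
    (hk : i + j = k) (s : ℕ) (x : complX A m i) (u : ℕ → complX A (n + 1) j) (c : ℕ × ℕ) :
    ((compl A).inner a hl hk s x u : complX A (l + 1) k).1 c = ∑ z ∈ (splits c).attach,
      A.inner a hl (idx_add hk (mem_splits.1 z.2)) s (x.1 z.1.1) (fun t => (u t).1 z.1.2) := by
  by_cases hS : S
  · refine (congrArg (fun f : complX A (l + 1) k => f.1 c)
      ((compl A).inner_sym hS a hl hk s x u)).trans ?_
    refine Eq.trans ?_ (Finset.sum_congr rfl fun z _ =>
      (A.inner_sym hS a hl _ s (x.1 z.1.1) (fun t => (u t).1 z.1.2)).symm)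
    refine (congrArg (A.act hS _) (complComp_attach a hl hk x (u 0) c)).trans ?_
    rw [map_sum]
  · refine (congrArg (fun f : complX A (l + 1) k => f.1 c)
      ((compl A).inner_ns hS a hl hk s x u)).trans ?_
    refine Eq.trans ?_ (Finset.sum_congr rfl fun z _ =>
      (A.inner_ns hS a hl _ s (x.1 z.1.1) (fun t => (u t).1 z.1.2)).symm)
    split_ifs with h
    · exact complComp_attach _ _ hk _ _ _
    · exact Finset.sum_const_zero.symm

theorem idx_shift {δ : Tri} {e : ℕ × ℕ} (hδ : δ.2 + ((e.1 : ℤ), (e.2 : ℤ)) = 0) {i j : ℤ}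
    (h : i + δ.1 = j) (c : ℕ × ℕ) :
    ((i, ((c + e).1 : ℤ), ((c + e).2 : ℤ)) : Tri) + δ = (j, (c.1 : ℤ), (c.2 : ℤ)) := by
  obtain ⟨d, u, t⟩ := δ
  obtain ⟨e, e'⟩ := e
  simp only [Prod.mk_add_mk, Prod.mk_eq_zero] at hδ
  simp only [Prod.mk_add_mk, Prod.mk.injEq, Prod.fst_add, Prod.snd_add]
  refine ⟨h, ?_, ?_⟩ <;> push_cast <;> omega

/-- A shift map that lowers the weights by `e`, on formal infinite sums. -/
def complShift {δ : Tri} {e : ℕ × ℕ} (hδ : δ.2 + ((e.1 : ℤ), (e.2 : ℤ)) = 0)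
    (D : ShiftMap A A δ) : ShiftMap (compl A) (compl A) δ.1 := fun s n i j h =>
  { toFun := fun (f : complX A n i) => (⟨fun c => D s (idx_shift hδ h c) (f.1 (c + e)), by
      obtain ⟨W, hW⟩ := mem_complX.1 f.2
      refine mem_complX.2 ⟨W, fun c hc => ?_⟩
      rw [hW (c + e) (hc.trans (Nat.le_add_right _ _)), map_zero]⟩ : complX A (n + 1) j)
    map_add' := fun f g => complX_ext fun c => map_add (D s _) (f.1 (c + e)) (g.1 (c + e))
    map_smul' := fun r f => complX_ext fun c => map_smul (D s _) r (f.1 (c + e)) }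

theorem complShift_apply {δ : Tri} {e : ℕ × ℕ} (hδ : δ.2 + ((e.1 : ℤ), (e.2 : ℤ)) = 0)
    (D : ShiftMap A A δ) (s : ℕ) {n : ℕ} {i j : ℤ} (h : i + δ.1 = j) (f : complX A n i)
    (c : ℕ × ℕ) : (complShift hδ D s h f : complX A (n + 1) j).1 c =
      D s (idx_shift hδ h c) (f.1 (c + e)) := rfl

variable (hA : ∀ {n : ℕ} {i : Tri} (x : A.X n i), (i.2.1 < 0 ∨ i.2.2 < 0) → x = 0)

include hA

theorem eq_zero_of_lt {δ : Tri} {e : ℕ × ℕ} (hδ : δ.2 + ((e.1 : ℤ), (e.2 : ℤ)) = 0) (x : ℕ × ℕ)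
    (d : ℤ) (hx : x.1 < e.1 ∨ x.2 < e.2) {n : ℕ}
    (y : A.X n (((d, (x.1 : ℤ), (x.2 : ℤ)) : Tri) + δ)) : y = 0 := by
  refine hA y ?_
  have h1 := congrArg Prod.fst hδ
  have h2 := congrArg Prod.snd hδ
  simp only [Prod.fst_add, Prod.snd_add, Prod.fst_zero, Prod.snd_zero] at h1 h2 ⊢
  omega

theorem sum_outer_complShift {δ : Tri} {e : ℕ × ℕ} (hδ : δ.2 + ((e.1 : ℤ), (e.2 : ℤ)) = 0)
    (D : ShiftMap A A δ) {m n l : ℕ} {i i' j k : ℤ} (a : Fin m) (hl : l + 1 = m + 1 + n)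
    (hi : i + δ.1 = i') (hk : i' + j = k)
    (s : ℕ) (p : complX A m i) (q : complX A n j) (c : ℕ × ℕ)
    (hx : ∀ x y : ℕ × ℕ, x + y = c + e → ((i, (x.1 : ℤ), (x.2 : ℤ)) : Tri) + δ +
      (j, (y.1 : ℤ), (y.2 : ℤ)) = (k, (c.1 : ℤ), (c.2 : ℤ))) :
    ∑ x ∈ (splits (c + e)).attach, A.outer a hl (hx _ _ (mem_splits.1 x.2)) s
        (fun t => D t rfl (p.1 x.1.1)) (q.1 x.1.2) =
      ((compl A).outer a hl hk s (fun t => complShift hδ D t hi p) q : complX A l k).1 c := by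
  refine (sum_splits_left e c (fun x y h => A.outer a hl (hx _ _ h) s
    (fun t => D t rfl (p.1 x)) (q.1 y)) fun x y h hx' => ?_).trans ?_
  · rw [← Op.outer_zero_left a hl (hx _ _ h) s (q.1 y)]
    exact congrArg (fun u => A.outer a hl (hx _ _ h) s u (q.1 y))
      (funext fun t => eq_zero_of_lt hA hδ x i hx' _)
  · refine Eq.trans ?_ (compl_outer a hl hk s (fun t => complShift hδ D t hi p) q c).symm
    exact Finset.sum_congr rfl fun x _ => Op.outer_idx a s hl (idx_shift hδ hi x.1.1)
      (fun z hz t => D t hz (p.1 (x.1.1 + e))) (q.1 x.1.2)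

theorem sum_inner_complShift {δ : Tri} {e : ℕ × ℕ} (hδ : δ.2 + ((e.1 : ℤ), (e.2 : ℤ)) = 0)
    (D : ShiftMap A A δ) {m n l : ℕ} {i j j' k : ℤ} (a : Fin m) (hl : l + 1 + 1 = m + (n + 1))
    (hj : j + δ.1 = j') (hk : i + j' = k)
    (s : ℕ) (p : complX A m i) (q : complX A n j) (c : ℕ × ℕ)
    (hx : ∀ x y : ℕ × ℕ, x + y = c + e → ((i, (x.1 : ℤ), (x.2 : ℤ)) : Tri) +
      ((j, (y.1 : ℤ), (y.2 : ℤ)) + δ) = (k, (c.1 : ℤ), (c.2 : ℤ))) :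
    ∑ x ∈ (splits (c + e)).attach, A.inner a hl (hx _ _ (mem_splits.1 x.2)) s (p.1 x.1.1)
        (fun t => D t rfl (q.1 x.1.2)) =
      ((compl A).inner a hl hk s p (fun t => complShift hδ D t hj q) : complX A (l + 1) k).1 c := by
  refine (sum_splits_right e c (fun x y h => A.inner a hl (hx _ _ h) s (p.1 x)
    (fun t => D t rfl (q.1 y))) fun x y h hx' => ?_).trans ?_
  · rw [← Op.inner_zero_right a hl (hx _ _ h) s (p.1 x)]
    exact congrArg (fun u => A.inner a hl (hx _ _ h) s (p.1 x) u)
      (funext fun t => eq_zero_of_lt hA hδ y j hx' _)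
  · refine Eq.trans ?_ (compl_inner a hl hk s p (fun t => complShift hδ D t hj q) c).symm
    exact Finset.sum_congr rfl fun x _ => Op.inner_idx a s hl (idx_shift hδ hj x.1.2) (p.1 x.1.1)
      (fun z hz t => D t hz (q.1 (x.1.2 + e)))

theorem isShiftDer_complShift {δ : Tri} {e : ℕ × ℕ} (hδ : δ.2 + ((e.1 : ℤ), (e.2 : ℤ)) = 0)
    {D : ShiftMap A A δ} (hD : IsShiftDer (Op.Hom.id A) δ D) :
    IsShiftDer (Op.Hom.id (compl A)) δ.1 (complShift hδ D) where
  one {s i j} h hj hs := complX_ext fun c => by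
    refine (complShift_apply hδ D s hj _ c).trans ?_
    by_cases hc : c + e = 0
    · have : ∀ (u : ℕ × ℕ) (hu : u = 0) (k : Tri) (h' : ((i, (u.1 : ℤ), (u.2 : ℤ)) : Tri) + δ = k),
          D s h' ((complOne A h).1 u) = 0 := by
        rintro u rfl k h'
        rw [complOne_zero]
        exact hD.one _ _ hs
      exact this _ hc _ _
    · exact (congrArg (D s _) (complOne_ne A h hc)).trans (map_zero _)
  comp {s m n l i j k k'} a hl hk hk' p q hs := complX_ext fun c => by
    refine (congrArg (D s _) (complComp_attach a hl hk p q (c + e))).trans ?_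
    rw [map_sum]
    refine (Finset.sum_congr rfl fun x _ => hD.comp a hl _ _ _ _ hs).trans ?_
    rw [Finset.sum_add_distrib]
    refine congrArg₂ (α := A.X _ _) (β := A.X _ _) (· + ·)
      (sum_outer_complShift hA hδ D a _ rfl _ s p q c fun x y h => ?_)
      ((Finset.smul_sum (r := sgn R (δ.1 * i))).symm.trans (congrArg (sgn R (δ.1 * i) • ·)
        (sum_inner_complShift hA hδ D a _ rfl _ s p q c fun x y h => ?_)))
    · rw [← idx_shift hδ hk' c, ← idx_add hk h, add_right_comm]
    · rw [← idx_shift hδ hk' c, ← idx_add hk h, add_assoc]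
  act hS σ hj p := complX_ext fun c => hD.act hS σ _ _

omit hA

theorem scomm_complShift {δ δ' : Tri} {e e' : ℕ × ℕ} (hδ : δ.2 + ((e.1 : ℤ), (e.2 : ℤ)) = 0)
    (hδ' : δ'.2 + ((e'.1 : ℤ), (e'.2 : ℤ)) = 0) {D : ShiftMap A A δ} {D' : ShiftMap A A δ'}
    (h : ∀ {n i} (x : A.X n i), SComm D D' x) {n : ℕ} {i : ℤ} (x : (compl A).X n i) :
    SComm (complShift hδ D) (complShift hδ' D') x := by
  constructor
  · intro hS j j' k h₁ h₁' h₂ h₂'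
    refine complX_ext fun c => ?_
    have key : ∀ (u t : ℕ × ℕ) (_ : u = t) {z z' : Tri} (g₁ : (i, (u.1 : ℤ), (u.2 : ℤ)) + δ' = z)
        (g₁' : z + δ = (k, (c.1 : ℤ), (c.2 : ℤ))) (g₂ : (i, (t.1 : ℤ), (t.2 : ℤ)) + δ = z')
        (g₂' : z' + δ' = (k, (c.1 : ℤ), (c.2 : ℤ))), D 0 g₁' (D' 0 g₁ ((x : complX A n i).1 u)) =
        sgn R (δ.1 * δ'.1) • A.act hS (cyc 1) (D' 0 g₂' (D 0 g₂ ((x : complX A n i).1 t))) := by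
      rintro u _ rfl z z' g₁ g₁' g₂ g₂'
      exact (h _).sym hS g₁ g₁' g₂ g₂'
    exact key (c + e + e') (c + e' + e) (add_right_comm _ _ _) _ _ _ _
  · intro hS s t j j' k h₁ h₁' h₂ h₂' hst ht
    refine complX_ext fun c => ?_
    have key : ∀ (u r : ℕ × ℕ) (_ : u = r) {z z' : Tri} (g₁ : (i, (u.1 : ℤ), (u.2 : ℤ)) + δ' = z)
        (g₁' : z + δ = (k, (c.1 : ℤ), (c.2 : ℤ))) (g₂ : (i, (r.1 : ℤ), (r.2 : ℤ)) + δ = z')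
        (g₂' : z' + δ' = (k, (c.1 : ℤ), (c.2 : ℤ))), D s g₁' (D' t g₁ ((x : complX A n i).1 u)) =
        sgn R (δ.1 * δ'.1) • D' (t + 1) g₂' (D s g₂ ((x : complX A n i).1 r)) := by
      rintro u _ rfl z z' g₁ g₁' g₂ g₂'
      exact (h _).ns hS g₁ g₁' g₂ g₂' hst ht
    exact key (c + e + e') (c + e' + e) (add_right_comm _ _ _) _ _ _ _

end ComplShift
end
end TwistOperad

namespace TwistOperad

noncomputable section

section PresDer

variable {R : Type v} [CommRing R] {S : Prop} {ι : Type} [AddCommMonoid ι] {deg : ι →+ ℤ}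
  {G : ℕ → ι → Type w} {E : ∀ (n : ℕ) (i : ι), Tm R S G n i → Tm R S G n i → Prop}

theorem pres_der_anti {δ δ' : ι}
    {d : ∀ {n : ℕ} {i j : ι}, i + δ = j → (presOp deg E).X n i →ₗ[R] (presOp deg E).X n j}
    {d' : ∀ {n : ℕ} {i j : ι}, i + δ' = j → (presOp deg E).X n i →ₗ[R] (presOp deg E).X n j}
    (hd : IsDer (presOp deg E) δ d) (hd' : IsDer (presOp deg E) δ' d')
    (hg : ∀ n i j j' k (h₁ : i + δ = j) (h₁' : j + δ' = k) (h₂ : i + δ' = j') (h₂' : j' + δ = k)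
      (g : G n i), d' h₁' (d h₁ (Pres.cl (.gen g))) + d h₂' (d' h₂ (Pres.cl (.gen g))) = 0)
    {n : ℕ} {i : ι} (x : (presOp deg E).X n i) :
    ∀ {j j' k : ι} (h₁ : i + δ = j) (h₁' : j + δ' = k) (h₂ : i + δ' = j') (h₂' : j' + δ = k),
      d' h₁' (d h₁ x) + d h₂' (d' h₂ x) = 0 := by
  induction x using Pres.cl_ind with | h p => ?_
  induction p with
  | gen g => exact fun h₁ h₁' h₂ h₂' => hg _ _ _ _ _ h₁ h₁' h₂ h₂' g
  | one hi =>
    intro j j' k h₁ h₁' h₂ h₂'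
    rw [Pres.cl_one, hd.one, hd'.one, LinearMap.map_zero, LinearMap.map_zero, add_zero]
  | @comp m n l i i' t a hl hk p q ih ih' =>
    intro j j' k h₁ h₁' h₂ h₂'
    have e1 : i + δ + δ' = i + δ' + δ := add_right_comm _ _ _
    have e2 : i' + δ + δ' = i' + δ' + δ := add_right_comm _ _ _
    have s1 : sgn R (deg (i + δ)) = -sgn R (deg i) := by
      rw [map_add, hd.odd, sgn_add, show sgn R (-1) = -1 by simp [sgn], mul_neg_one]
    have s2 : sgn R (deg (i + δ')) = -sgn R (deg i) := by
      rw [map_add, hd'.odd, sgn_add, show sgn R (-1) = -1 by simp [sgn], mul_neg_one]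
    have c1 : ∀ (h : _) (h' : _), (presOp deg E).comp a hl (k := k) h (d' rfl (d rfl (Pres.cl p)))
        (Pres.cl q) = -(presOp deg E).comp a hl h' (d rfl (d' rfl (Pres.cl p))) (Pres.cl q) := by
      intro h h'
      rw [eq_neg_iff_add_eq_zero, Op.comp_idx_left a hl (hk' := h') e1
        (fun z hz => d' hz (d rfl (Pres.cl p))), ← LinearMap.add_apply, ← map_add, ih, map_zero,
        LinearMap.zero_apply]
    have c2 : ∀ (h : _) (h' : _), (presOp deg E).comp a hl (k := k) h (Pres.cl p)
        (d' rfl (d rfl (Pres.cl q))) =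
          -(presOp deg E).comp a hl h' (Pres.cl p) (d rfl (d' rfl (Pres.cl q))) := by
      intro h h'
      rw [eq_neg_iff_add_eq_zero, Op.comp_idx_right a hl (hk' := h') e2 (Pres.cl p)
        (fun z hz => d' hz (d rfl (Pres.cl q))), ← map_add, ih', map_zero]
    rw [Pres.cl_comp, hd.comp, hd'.comp, LinearMap.map_add, LinearMap.map_add, LinearMap.map_smul,
      LinearMap.map_smul, hd.comp, hd.comp, hd'.comp, hd'.comp, s1, s2,
      c1 _ (by rw [← h₂', ← h₂, ← hk]; abel), c2 _ (by rw [← h₂', ← h₂, ← hk]; abel)]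
    simp only [neg_smul, smul_add, smul_neg]
    abel
  | act hS σ p ih =>
    intro j j' k h₁ h₁' h₂ h₂'
    rw [Pres.cl_act, hd.act hS σ h₁, hd'.act hS σ h₁', hd'.act hS σ h₂, hd.act hS σ h₂', ← map_add,
      ih, map_zero]
  | zero =>
    intro j j' k h₁ h₁' h₂ h₂'
    rw [Pres.cl_zero]
    simp only [LinearMap.map_zero, add_zero]
  | add p q ih ih' =>
    intro j j' k h₁ h₁' h₂ h₂'
    rw [Pres.cl_add]
    simp only [LinearMap.map_add]
    rw [add_add_add_comm, ih, ih', add_zero]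
  | smul r p ih =>
    intro j j' k h₁ h₁' h₂ h₂'
    rw [Pres.cl_smul]
    simp only [LinearMap.map_smul]
    rw [← smul_add, ih, smul_zero]

/-- The commutator of a shift derivation and a derivation is determined on generators. -/
theorem shift_der_comm {δ δ' ε : ι} (hε : δ + δ' = ε)
    {D : ShiftMap (presOp deg E) (presOp deg E) δ} (hD : IsShiftDer (Op.Hom.id _) δ D)
    {d : ∀ {n : ℕ} {i j : ι}, i + δ' = j → (presOp deg E).X n i →ₗ[R] (presOp deg E).X n j}
    (hd : IsDer (presOp deg E) δ' d)
    {D' : ShiftMap (presOp deg E) (presOp deg E) ε} (hD' : IsShiftDer (Op.Hom.id _) ε D')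
    (hg : ∀ {s n : ℕ} {i j j' j'' : ι} (h₁ : i + δ' = j') (h₁' : j' + δ = j) (h₂ : i + δ = j'')
      (h₂' : j'' + δ' = j) (h : i + ε = j) (g : G n i), Slot S s n →
      D s h₁' (d h₁ (Pres.cl (.gen g))) = D' s h (Pres.cl (.gen g)) +
        sgn R (deg δ) • d h₂' (D s h₂ (Pres.cl (.gen g))))
    {s n : ℕ} (hs : Slot S s n) {i j j' j'' : ι} (h₁ : i + δ' = j') (h₁' : j' + δ = j)
    (h₂ : i + δ = j'') (h₂' : j'' + δ' = j) (h : i + ε = j) (x : (presOp deg E).X n i) :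
    D s h₁' (d h₁ x) = D' s h x + sgn R (deg δ) • d h₂' (D s h₂ x) := by
  have h3 := shiftAgree_pres (isShiftDer_bracket hD hd hε) hD' (fun {n i} g s j hj hs => by
    rw [bracket_apply, sub_eq_iff_eq_add]
    exact hg rfl _ rfl _ hj g hs) x s j h hs
  subst h₁ h₂
  rw [bracket_apply, sub_eq_iff_eq_add] at h3
  exact h3

end PresDer

section WithT

variable {R : Type v} [CommRing R] {S : Prop}

theorem isDer_dOld {P : PreDG.{v, w} R S} (hP : IsDG P) {Z : Type} (z : Z → Tri) :
    IsDer (adjoin P.op z) (-1, 0, 0) (dOld hP z) := by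
  unfold dOld
  exact isDer_der rfl _

theorem isDer_dT (P : ZOp.{v, w} R S) : IsDer (withT P) (-1, 1, -1) (dT P) := by
  unfold dT
  exact isDer_der rfl _

abbrev kShift (P : ZOp.{v, w} R S) : ShiftMap (withT P) (withT P) (1, -1, 0) :=
  adjShift P tDeg .kappa (1, -1, 0) rfl

abbrev aShift (P : ZOp.{v, w} R S) : ShiftMap (withT P) (withT P) (0, 0, -1) :=
  adjShift P tDeg .alpha (0, 0, -1) rfl

theorem adjShift_dOld {P : PreDG.{v, w} R S} (hP : IsDG P) {Z : Type} {z : Z → Tri} {x₀ : Z}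
    {δ : Tri} {hδ : z x₀ + δ = 0} {s n : ℕ} (hs : Slot S s n) {i j j' j'' : Tri}
    (h₁ : i + (-1, 0, 0) = j') (h₁' : j' + δ = j) (h₂ : i + δ = j'') (h₂' : j'' + (-1, 0, 0) = j)
    (x : (adjoin P.op z).X n i) :
    adjShift P.op z x₀ δ hδ s h₁' (dOld hP z h₁ x) =
      sgn R (triDeg δ) • dOld hP z h₂' (adjShift P.op z x₀ δ hδ s h₂ x) := by
  refine (shift_der_comm rfl isShiftDer_adjShift (isDer_dOld hP z)
    (isShiftDer_zero (Op.Hom.id _) _) ?_ hs h₁ h₁' h₂ h₂'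
      (by rw [← h₁', ← h₁, add_assoc, add_comm δ]) x).trans (zero_add _)
  intro s n i j j' j'' h₁ h₁' h₂ h₂' h g hs
  rw [LinearMap.zero_apply, zero_add]
  cases g with
  | old hi p =>
    refine (adjShift_old _ hs _ (P.d rfl p)).trans ?_
    exact ((congrArg _ ((congrArg _ (adjShift_old _ hs _ p)).trans (LinearMap.map_zero _))).trans
      (smul_zero _)).symm
  | new x hx =>
    obtain rfl : s = 0 := Nat.le_zero.1 hs.1
    refine (LinearMap.map_zero _).trans ((congrArg (sgn R (triDeg δ) • ·)
      (?_ : dOld hP z h₂' _ = 0)).trans (smul_zero _)).symm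
    by_cases hx' : x = x₀
    · subst hx'
      refine (congrArg _ (adjShift_new h₂ hx (by rw [← h₂, ← hx, hδ]))).trans ?_
      exact (isDer_dOld hP z).one _ _
    · exact (congrArg _ (adjShift_new_ne hx' h₂ hx)).trans (LinearMap.map_zero _)

theorem kShift_dT (P : ZOp.{v, w} R S) {s n : ℕ} (hs : Slot S s n) {i j j' j'' : Tri}
    (h₁ : i + (-1, 1, -1) = j') (h₁' : j' + (1, -1, 0) = j) (h₂ : i + (1, -1, 0) = j'')
    (h₂' : j'' + (-1, 1, -1) = j) (h : i + (0, 0, -1) = j) (x : (withT P).X n i) :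
    kShift P s h₁' (dT P h₁ x) = aShift P s h x - dT P h₂' (kShift P s h₂ x) := by
  refine (shift_der_comm (D := kShift P) (D' := aShift P) rfl isShiftDer_adjShift (isDer_dT P)
    isShiftDer_adjShift ?_ hs h₁ h₁' h₂ h₂' h x).trans ?_
  · intro s n i j j' j'' h₁ h₁' h₂ h₂' h g hs
    cases g with
    | old hi p =>
      refine (LinearMap.map_zero _).trans ((congrArg₂ (· + ·) (adjShift_old _ hs hi p)
        ((congrArg _ ((congrArg (dT P h₂') (adjShift_old h₂ hs hi p)).trans
        (LinearMap.map_zero _))).trans (smul_zero _))).trans (add_zero _)).symm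
    | new x hx =>
      obtain rfl : s = 0 := Nat.le_zero.1 hs.1
      cases x with
      | kappa =>
        refine (LinearMap.map_zero _).trans ((congrArg₂ (· + ·)
          (adjShift_new_ne (by simp) h hx) ((congrArg _ ((congrArg (dT P h₂')
            (adjShift_new h₂ hx (by rw [← h₂, ← hx]; rfl))).trans ?_)).trans
            (smul_zero _))).trans (add_zero _)).symm
        exact (isDer_dT P).one _ _
      | alpha =>
        have hj : tDeg .kappa = j' := by rw [← h₁, ← hx]; rfl
        refine (adjShift_new h₁' hj (by rw [← h₁', ← hj]; rfl)).trans
          ((congrArg₂ (· + ·) (adjShift_new h hx (by rw [← h, ← hx]; rfl))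
          ((congrArg _ ((congrArg (dT P h₂') (adjShift_new_ne (by simp) h₂ hx)).trans
          (LinearMap.map_zero _))).trans (smul_zero _))).trans (add_zero _)).symm
  · rw [show sgn R (triDeg (1, -1, 0)) = -1 by simp [sgn], neg_smul, one_smul, sub_eq_add_neg]

theorem dOld_dOld {P : PreDG.{v, w} R S} (hP : IsDG P) {Z : Type} (z : Z → Tri) {n : ℕ}
    {i j k : Tri} (h : i + (-1, 0, 0) = j) (h' : j + (-1, 0, 0) = k) (x : (adjoin P.op z).X n i) :
    dOld hP z h' (dOld hP z h x) = 0 := by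
  refine pres_der_der (isDer_dOld hP z) (fun n i j k h h' g => ?_) x h h'
  cases g with
  | old hi p =>
    refine (congrArg (inOld P.op z _) (hP.d_d rfl rfl p)).trans (LinearMap.map_zero _)
  | new x hx => exact LinearMap.map_zero _

theorem dT_dT (P : ZOp.{v, w} R S) {n : ℕ} {i j k : Tri} (h : i + (-1, 1, -1) = j)
    (h' : j + (-1, 1, -1) = k) (x : (withT P).X n i) : dT P h' (dT P h x) = 0 := by
  refine pres_der_der (isDer_dT P) (fun n i j k h h' g => ?_) x h h'
  cases g with
  | old hi p => exact LinearMap.map_zero _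
  | new x hx =>
    cases x with
    | kappa => exact LinearMap.map_zero _
    | alpha => rfl

theorem dOld_dT {P : PreDG.{v, w} R S} (hP : IsDG P) {n : ℕ} {i j j' k : Tri}
    (h₁ : i + (-1, 0, 0) = j) (h₁' : j + (-1, 1, -1) = k) (h₂ : i + (-1, 1, -1) = j')
    (h₂' : j' + (-1, 0, 0) = k) (x : (withT P.op).X n i) :
    dT P.op h₁' (dOld hP tDeg h₁ x) + dOld hP tDeg h₂' (dT P.op h₂ x) = 0 := by
  refine pres_der_anti (isDer_dOld hP tDeg) (isDer_dT P.op)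
    (fun n i j j' k h₁ h₁' h₂ h₂' g => ?_) x h₁ h₁' h₂ h₂'
  cases g with
  | old hi p => exact (congrArg₂ (· + ·) rfl (LinearMap.map_zero _)).trans (add_zero _)
  | new x hx =>
    cases x with
    | kappa =>
      exact (congrArg₂ (· + ·) (LinearMap.map_zero _) (LinearMap.map_zero _)).trans (add_zero _)
    | alpha => exact (congrArg₂ (· + ·) (LinearMap.map_zero _) rfl).trans (add_zero _)

theorem isWeight_tDeg_kappa : IsWeight tDeg kappaWt :=
  ⟨fun _ => rfl, fun x => by cases x <;> simp [tDeg]⟩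

theorem isWeight_tDeg_alpha : IsWeight tDeg alphaWt :=
  ⟨fun _ => rfl, fun x => by cases x <;> simp [tDeg]⟩

theorem isWeight_tDeg_total : IsWeight tDeg (kappaWt + alphaWt) :=
  ⟨fun _ => rfl, fun x => by cases x <;> simp [tDeg]⟩

theorem total_tDeg_pos (x : TGen) : 0 < (kappaWt + alphaWt) (tDeg x) := by
  cases x <;> simp [tDeg]

theorem withT_eq_zero (P : ZOp.{v, w} R S) {n : ℕ} {i : Tri} (x : (withT P).X n i)
    (h : i.2.1 < 0 ∨ i.2.2 < 0) : x = 0 :=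
  h.elim (isWeight_tDeg_kappa.neg x) (isWeight_tDeg_alpha.neg x)

theorem kappa_plugSystem (P : ZOp.{v, w} R S) :
    PlugSystem (inNew P tDeg .kappa rfl) (kShift P) kappaWt :=
  adjoin_plugSystem (fun _ => rfl) rfl fun x hx => by
    cases x
    · exact (hx rfl).elim
    · rfl

theorem alpha_plugSystem (P : ZOp.{v, w} R S) :
    PlugSystem (inNew P tDeg .alpha rfl) (aShift P) alphaWt :=
  adjoin_plugSystem (fun _ => rfl) rfl fun x hx => by
    cases x
    · rfl
    · exact (hx rfl).elim

end WithT
end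
end TwistOperad

namespace TwistOperad

noncomputable section

section TwistDG

variable {R : Type v} [CommRing R] {S : Prop} {P : PreDG.{v, w} R S} (hP : IsDG P)

theorem idx_old {i j : ℤ} (h : i + -1 = j) (c : ℕ × ℕ) :
    ((i, (c.1 : ℤ), (c.2 : ℤ)) : Tri) + (-1, 0, 0) = (j, (c.1 : ℤ), (c.2 : ℤ)) := by
  rw [← h]
  simp

theorem idx_tri {i j : ℤ} (h : i + -1 = j) (c : ℕ × ℕ) :
    ((i, ((c + (0, 1)).1 : ℤ), ((c + (0, 1)).2 : ℤ)) : Tri) + (-1, 1, -1) =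
      (j, ((c + (1, 0)).1 : ℤ), ((c + (1, 0)).2 : ℤ)) := by
  rw [← h]
  simp

/-- The part of the differential that comes from `T`. -/
def dTPart (P : ZOp.{v, w} R S) {n : ℕ} {i j : ℤ} (h : i + -1 = j) (f : complX (withT P) n i) :
    ∀ c : ℕ × ℕ, (withT P).X n (j, (c.1 : ℤ), (c.2 : ℤ))
  | (0, _) => 0
  | (w + 1, k) => dT P (idx_tri h (w, k)) (f.1 ((w, k) + (0, 1)))

theorem dTPart_add (P : ZOp.{v, w} R S) {n : ℕ} {i j : ℤ} (h : i + -1 = j)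
    (f : complX (withT P) n i) (c : ℕ × ℕ) :
    dTPart P h f (c + (1, 0)) = dT P (idx_tri h c) (f.1 (c + (0, 1))) := rfl

theorem dTPart_zero (P : ZOp.{v, w} R S) {n : ℕ} {i j : ℤ} (h : i + -1 = j)
    (f : complX (withT P) n i) {c : ℕ × ℕ} (hc : c.1 < 1) : dTPart P h f c = 0 := by
  obtain ⟨_ | w, k⟩ := c
  · rfl
  · exact absurd hc (by simp)

theorem twistDiff_apply {n : ℕ} {i j : ℤ} (h : i + -1 = j) (f : complX (withT P.op) n i)
    (c : ℕ × ℕ) : (twistDiff hP h f).1 c =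
      dOld hP tDeg (idx_old h c) (f.1 c) + dTPart P.op h f c := by
  obtain ⟨_ | w, k⟩ := c
  · exact (add_zero _).symm
  · rfl

theorem dOld_complComp {m n l : ℕ} {i j k i' j' k' : ℤ} (a : Fin m) (hl : l + 1 = m + n)
    (hk : i + j = k) (hi : i + -1 = i') (hj : j + -1 = j') (hk' : k + -1 = k')
    (h₁ : i' + j = k') (h₂ : i + j' = k')
    (p : complX (withT P.op) m i) (q : complX (withT P.op) n j) (c : ℕ × ℕ) :
    dOld hP tDeg (idx_old hk' c) ((complComp a hl hk p q).1 c) =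
      (∑ x ∈ (splits c).attach, (withT P.op).comp a hl (idx_add h₁ (mem_splits.1 x.2))
        (dOld hP tDeg (idx_old hi x.1.1) (p.1 x.1.1)) (q.1 x.1.2)) +
      sgn R i • ∑ x ∈ (splits c).attach, (withT P.op).comp a hl (idx_add h₂ (mem_splits.1 x.2))
        (p.1 x.1.1) (dOld hP tDeg (idx_old hj x.1.2) (q.1 x.1.2)) := by
  rw [complComp_attach a hl hk, map_sum, Finset.smul_sum, ← Finset.sum_add_distrib]
  refine Finset.sum_congr rfl fun x _ => ?_
  refine ((isDer_dOld hP tDeg).comp a hl _ _ (p.1 x.1.1) (q.1 x.1.2)).trans ?_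
  refine congrArg₂ (· + ·) ?_ (congrArg (sgn R i • ·) ?_)
  · exact Op.comp_idx_left a hl (idx_old hi x.1.1) (fun z hz => dOld hP tDeg hz (p.1 x.1.1)) _
  · exact Op.comp_idx_right a hl (idx_old hj x.1.2) _ (fun z hz => dOld hP tDeg hz (q.1 x.1.2))

theorem dTPart_complComp (P : ZOp.{v, w} R S) {m n l : ℕ} {i j k i' j' k' : ℤ} (a : Fin m)
    (hl : l + 1 = m + n) (hk : i + j = k) (hi : i + -1 = i') (hj : j + -1 = j') (hk' : k + -1 = k')
    (h₁ : i' + j = k') (h₂ : i + j' = k')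
    (p : complX (withT P) m i) (q : complX (withT P) n j) (c : ℕ × ℕ) :
    dTPart P hk' (complComp a hl hk p q) c =
      (∑ x ∈ (splits c).attach, (withT P).comp a hl (idx_add h₁ (mem_splits.1 x.2))
        (dTPart P hi p x.1.1) (q.1 x.1.2)) +
      sgn R i • ∑ x ∈ (splits c).attach, (withT P).comp a hl (idx_add h₂ (mem_splits.1 x.2))
        (p.1 x.1.1) (dTPart P hj q x.1.2) := by
  by_cases hc : c.1 < 1
  · rw [dTPart_zero P hk' _ hc, Finset.sum_eq_zero, Finset.sum_eq_zero, smul_zero, add_zero]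
    · rintro ⟨⟨x, y⟩, hx⟩ _
      have := congrArg Prod.fst (mem_splits.1 hx)
      rw [dTPart_zero P hj q (by simp at this ⊢; omega), map_zero]
    · rintro ⟨⟨x, y⟩, hx⟩ _
      have := congrArg Prod.fst (mem_splits.1 hx)
      rw [dTPart_zero P hi p (by simp at this ⊢; omega), map_zero, LinearMap.zero_apply]
  obtain ⟨c, rfl⟩ : ∃ c' : ℕ × ℕ, c = c' + (1, 0) :=
    ⟨(c.1 - 1, c.2), Prod.ext (by simp; omega) rfl⟩
  have hx : ∀ x y : ℕ × ℕ, x + y = c + (0, 1) →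
      ((i, (x.1 : ℤ), (x.2 : ℤ)) : Tri) + (j, (y.1 : ℤ), (y.2 : ℤ)) + (-1, 1, -1) =
        (k', ((c + (1, 0)).1 : ℤ), ((c + (1, 0)).2 : ℤ)) := fun x y h => by
    rw [← idx_tri hk' c, ← idx_add hk h]
  rw [dTPart_add, complComp_attach a hl hk, map_sum,
    Finset.sum_congr rfl fun x _ => (isDer_dT P).comp a hl (idx_add hk (mem_splits.1 x.2))
      (idx_tri hk' c) (p.1 x.1.1) (q.1 x.1.2), Finset.sum_add_distrib]
  refine congrArg₂ (· + ·) ?_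
    ((Finset.smul_sum (r := sgn R i)).symm.trans (congrArg (sgn R i • ·) ?_))
  · refine (sum_splits_left (0, 1) c (fun x y h => (withT P).comp a hl
      (by rw [← hx x y h, add_right_comm]) (dT P rfl (p.1 x)) (q.1 y)) fun x y h hx' => ?_).trans
      (Eq.trans ?_ (sum_splits_left (1, 0) c (fun x y h => (withT P).comp a hl (idx_add h₁ h)
        (dTPart P hi p x) (q.1 y)) fun x y h hx' => ?_).symm)
    · have : dT P rfl (p.1 x) = 0 := withT_eq_zero P _ (Or.inr (by simp at hx' ⊢; omega))
      rw [this, map_zero, LinearMap.zero_apply]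
    · refine Finset.sum_congr rfl fun x _ => ?_
      exact Op.comp_idx_left a hl (idx_tri hi x.1.1) (fun z hz => dT P hz _) _
    · rw [dTPart_zero P hi p (by simpa using hx'), map_zero, LinearMap.zero_apply]
  · refine (sum_splits_right (0, 1) c (fun x y h => (withT P).comp a hl
      (by rw [← hx x y h, add_assoc]) (p.1 x) (dT P rfl (q.1 y))) fun x y h hx' => ?_).trans
      (Eq.trans ?_ (sum_splits_right (1, 0) c (fun x y h => (withT P).comp a hl (idx_add h₂ h)
        (p.1 x) (dTPart P hj q y)) fun x y h hx' => ?_).symm)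
    · have : dT P rfl (q.1 y) = 0 := withT_eq_zero P _ (Or.inr (by simp at hx' ⊢; omega))
      rw [this, map_zero]
    · refine Finset.sum_congr rfl fun x _ => ?_
      exact Op.comp_idx_right a hl (idx_tri hj x.1.2) _ (fun z hz => dT P hz _)
    · rw [dTPart_zero P hj q (by simpa using hx'), map_zero]

theorem twistDiff_twistDiff {n : ℕ} {i j k : ℤ} (h : i + -1 = j) (h' : j + -1 = k)
    (f : complX (withT P.op) n i) : twistDiff hP h' (twistDiff hP h f) = 0 := by
  refine complX_ext ?_
  rintro ⟨_ | _ | w, k⟩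
  · exact dOld_dOld hP tDeg _ _ _
  · refine (congrArg₂ (· + ·) (LinearMap.map_add _ _ _) rfl).trans ?_
    exact (congrArg₂ (· + ·) ((congrArg₂ (· + ·) (dOld_dOld hP tDeg _ _ _) rfl).trans
      (zero_add _)) rfl).trans ((add_comm _ _).trans (dOld_dT hP _ _ _ _ _))
  · refine (congrArg₂ (· + ·) (LinearMap.map_add _ _ _) (LinearMap.map_add _ _ _)).trans ?_
    exact (congrArg₂ (· + ·) ((congrArg₂ (· + ·) (dOld_dOld hP tDeg _ _ _) rfl).trans
      (zero_add _)) ((congrArg₂ (· + ·) rfl (dT_dT P.op _ _ _)).trans (add_zero _))).trans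
      ((add_comm _ _).trans (dOld_dT hP _ _ _ _ _))

/-- The map `1_P ∨ 0` as a morphism of operads. -/
def epsilonHom (P : ZOp.{v, w} R S) : Op.Hom (compl (withT P)) P where
  f n d :=
    { toFun := epsilon P
      map_add' := fun x y => LinearMap.map_add (adjEval (Op.Hom.id P) tDeg fun _ => 0) _ _
      map_smul' := fun r x => LinearMap.map_smul (adjEval (Op.Hom.id P) tDeg fun _ => 0) _ _ }
  map_one h := by
    subst h
    rfl
  map_comp {m n l i j k} a hl hk p q := by
    refine (congrArg (adjEval (Op.Hom.id P) tDeg fun _ => 0)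
      (complComp_attach a hl hk p q (0, 0))).trans ?_
    rw [map_sum, Finset.sum_eq_single ⟨(0, 0), mem_splits.2 rfl⟩]
    · exact adjEval_comp _ _ _ a hl _ _ _
    · rintro ⟨⟨⟨x, x'⟩, ⟨y, y'⟩⟩, hx⟩ _ hne
      refine (hne ?_).elim
      have := mem_splits.1 hx
      simp at this
      simp [Subtype.ext_iff, this]
    · exact fun h => (h (Finset.mem_attach _ _)).elim
  map_act hS σ p := adjEval_act _ _ _ hS σ _

theorem twistDiff_comp {m n l : ℕ} {i j k i' j' k' : ℤ} (a : Fin m) (hl : l + 1 = m + n)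
    (hk : i + j = k) (hi : i + -1 = i') (hj : j + -1 = j') (hk' : k + -1 = k')
    (h₁ : i' + j = k') (h₂ : i + j' = k')
    (p : complX (withT P.op) m i) (q : complX (withT P.op) n j) :
    twistDiff hP hk' (complComp a hl hk p q) = complComp a hl h₁ (twistDiff hP hi p) q +
      sgn R i • complComp a hl h₂ p (twistDiff hP hj q) := by
  refine complX_ext fun c => ?_
  rw [twistDiff_apply, dOld_complComp hP a hl hk hi hj hk' h₁ h₂ p q c,
    dTPart_complComp P.op a hl hk hi hj hk' h₁ h₂ p q c, add_add_add_comm, ← smul_add,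
    ← Finset.sum_add_distrib, ← Finset.sum_add_distrib]
  refine congrArg₂ (· + ·) (Eq.trans ?_ (complComp_attach a hl h₁ (twistDiff hP hi p) q c).symm)
    (congrArg (sgn R i • ·) (Eq.trans ?_ (complComp_attach a hl h₂ p (twistDiff hP hj q) c).symm))
  · refine Finset.sum_congr rfl fun x _ => ?_
    rw [twistDiff_apply, map_add, LinearMap.add_apply]
  · refine Finset.sum_congr rfl fun x _ => ?_
    rw [twistDiff_apply, map_add]

theorem isDG_twistDG : IsDG (twistDG hP) where
  one_ne h := hP.one_ne (by
    rw [← (epsilonHom P.op).map_one rfl]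
    exact (congrArg _ h).trans (map_zero _))
  leibniz a hl hk hi hj hk' p q := twistDiff_comp hP a hl hk hi hj hk' (by omega) (by omega) p q
  d_act {n i j} hS σ h p := complX_ext fun c => by
    refine (twistDiff_apply hP h _ c).trans ?_
    refine Eq.trans ?_ (congrArg ((withT P.op).act hS σ) (twistDiff_apply hP h p c)).symm
    rw [map_add]
    refine congrArg₂ (· + ·) ((isDer_dOld hP tDeg).act hS σ _ _) ?_
    obtain ⟨_ | w, k⟩ := c
    · exact (map_zero _).symm
    · exact (isDer_dT P.op).act hS σ _ _
  d_d := twistDiff_twistDiff hP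

theorem epsilon_d {n : ℕ} {i j : ℤ} (h : i + -1 = j) (x : (twistDG hP).op.X n i) :
    epsilon P.op ((twistDG hP).d h x) = P.d h (epsilon P.op x) := by
  subst h
  obtain ⟨p, hp⟩ := isWeight_tDeg_total.inOld_surjective total_tDeg_pos
    (rfl : ((i, 0, 0) : Tri) = (i, ((0 : ℕ) : ℤ), ((0 : ℕ) : ℤ))) ((x : complX _ n i).1 (0, 0))
  have h2 : epsilon P.op x = p := (congrArg (adjEval (Op.Hom.id P.op) tDeg fun _ => 0) hp).trans
    (adjEval_old (Op.Hom.id P.op) tDeg (fun _ => 0) rfl p)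
  rw [h2]
  exact (congrArg (fun z => adjEval (Op.Hom.id P.op) tDeg (fun _ => 0)
    (dOld hP tDeg (idx_old rfl (0, 0)) z)) hp).trans
    (adjEval_old (Op.Hom.id P.op) tDeg (fun _ => 0) (d := i + -1) rfl (P.d rfl p))

end TwistDG
end
end TwistOperad

namespace TwistOperad

noncomputable section

section TwistShift

variable {R : Type v} [CommRing R] {S : Prop}

/-- The shift derivation of the completed coproduct that removes one `κ`. -/
def kapShift (P : ZOp.{v, w} R S) : ShiftMap (compl (withT P)) (compl (withT P)) 1 :=
  complShift (δ := (1, -1, 0)) (e := (1, 0)) rfl (kShift P)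

/-- The shift derivation of the completed coproduct that removes one `α`. -/
def alpShift (P : ZOp.{v, w} R S) : ShiftMap (compl (withT P)) (compl (withT P)) 0 :=
  complShift (δ := (0, 0, -1)) (e := (0, 1)) rfl (aShift P)

theorem isShiftDer_kapShift (P : ZOp.{v, w} R S) : IsShiftDer (Op.Hom.id _) 1 (kapShift P) :=
  isShiftDer_complShift (withT_eq_zero P) (δ := (1, -1, 0)) (e := (1, 0)) rfl isShiftDer_adjShift

theorem isShiftDer_alpShift (P : ZOp.{v, w} R S) : IsShiftDer (Op.Hom.id _) 0 (alpShift P) :=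
  isShiftDer_complShift (withT_eq_zero P) (δ := (0, 0, -1)) (e := (0, 1)) rfl isShiftDer_adjShift

theorem idx_kap {i j : ℤ} (h : i + 1 = j) (c : ℕ × ℕ) :
    ((i, ((c + (1, 0)).1 : ℤ), ((c + (1, 0)).2 : ℤ)) : Tri) + (1, -1, 0) =
      (j, (c.1 : ℤ), (c.2 : ℤ)) := idx_shift (δ := (1, -1, 0)) (e := (1, 0)) rfl h c

theorem idx_alp {i j : ℤ} (h : i + 0 = j) (c : ℕ × ℕ) :
    ((i, ((c + (0, 1)).1 : ℤ), ((c + (0, 1)).2 : ℤ)) : Tri) + (0, 0, -1) =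
      (j, (c.1 : ℤ), (c.2 : ℤ)) := idx_shift (δ := (0, 0, -1)) (e := (0, 1)) rfl h c

theorem kapShift_apply (P : ZOp.{v, w} R S) (s : ℕ) {n : ℕ} {i j : ℤ} (h : i + 1 = j)
    (f : complX (withT P) n i) (c : ℕ × ℕ) :
    (kapShift P s h f : complX (withT P) (n + 1) j).1 c =
      kShift P s (idx_kap h c) (f.1 (c + (1, 0))) := rfl

theorem alpShift_apply (P : ZOp.{v, w} R S) (s : ℕ) {n : ℕ} {i j : ℤ} (h : i + 0 = j)
    (f : complX (withT P) n i) (c : ℕ × ℕ) :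
    (alpShift P s h f : complX (withT P) (n + 1) j).1 c =
      aShift P s (idx_alp h c) (f.1 (c + (0, 1))) := rfl

theorem nabla_kapShift {P : PreDG.{v, w} R S} (hP : IsDG P) {s n : ℕ} {i j : ℤ} (h : i + 0 = j)
    (hs : Slot S s n) (x : complX (withT P.op) n i) :
    nabla (P := twistDG hP) (kapShift P.op) s h x = alpShift P.op s h x := by
  have h₁' : i + -1 + 1 = j := by omega
  have h₂' : i + 1 + -1 = j := by omega
  refine (bracket_odd (A := compl (withT P.op)) (d := twistDiff hP) (D := kapShift P.op) s h rfl h₁' rfl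
    h₂' x).trans (complX_ext fun c => ?_)
  refine (congrArg₂ (α := (withT P.op).X _ _) (β := (withT P.op).X _ _) (· + ·)
    ((congrArg (kShift P.op s (idx_kap h₁' c)) (twistDiff_apply hP rfl x (c + (1, 0)))).trans
      (map_add _ _ _)) (twistDiff_apply hP h₂' (kapShift P.op s rfl x) c)).trans ?_
  have e1 := adjShift_dOld (x₀ := .kappa) (δ := (1, -1, 0)) (hδ := rfl) hP hs
    (idx_old rfl (c + (1, 0))) (idx_kap h₁' c) (idx_kap rfl c) (idx_old h₂' c) (x.1 (c + (1, 0)))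
  have e2 := kShift_dT P.op hs (idx_tri rfl c) (idx_kap h₁' c) rfl
    (by rw [add_right_comm, idx_tri rfl c, idx_kap h₁' c]) (idx_alp h c) (x.1 (c + (0, 1)))
  have e3 : dTPart P.op h₂' (kapShift P.op s rfl x) c = dT P.op
      (by rw [add_right_comm, idx_tri (rfl : i + -1 = i + -1) c, idx_kap h₁' c])
      (kShift P.op s rfl (x.1 (c + (0, 1)))) := by
    obtain ⟨_ | w, k⟩ := c
    · have : kShift P.op s rfl (x.1 ((0, k) + (0, 1))) = 0 := withT_eq_zero _ _ (Or.inl (by simp))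
      rw [this, map_zero]
      rfl
    · have key : ∀ (z : Tri) (hz : _ = z) (hz' : z + _ = _), dT P.op hz'
          (kShift P.op s hz (x.1 ((w + 1, k) + (0, 1)))) = dT P.op
            (by rw [add_right_comm, idx_tri (rfl : i + -1 = i + -1) (w + 1, k), idx_kap h₁' _])
            (kShift P.op s rfl (x.1 ((w + 1, k) + (0, 1)))) := by
        rintro z rfl hz'
        rfl
      exact key _ (idx_kap rfl ((w, k) + (0, 1))) _
  rw [show sgn R (triDeg (1, -1, 0)) = -1 by simp [sgn], neg_smul, one_smul] at e1
  rw [e3]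
  refine (congrArg₂ (· + ·) (congrArg₂ (· + ·) e1 e2) rfl).trans ?_
  rw [alpShift_apply, kapShift_apply]
  abel

theorem epsilon_eq_zero (P : ZOp.{v, w} R S) {n : ℕ} {i : ℤ} (x : complX (withT P) n i)
    (hx : epsilon P x = 0) : x.1 (0, 0) = 0 := by
  obtain ⟨p, hp⟩ := isWeight_tDeg_total.inOld_surjective total_tDeg_pos
    (rfl : ((i, 0, 0) : Tri) = (i, ((0 : ℕ) : ℤ), ((0 : ℕ) : ℤ))) (x.1 (0, 0))
  have h2 : epsilon P x = p := (congrArg (adjEval (Op.Hom.id P) tDeg fun _ => 0) hp).trans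
    (adjEval_old (Op.Hom.id P) tDeg (fun _ => 0) rfl p)
  rw [hp, ← h2, hx]
  exact map_zero _

theorem alpShift_mem_kappaFree {P : ZOp.{v, w} R S} {s n : ℕ} {i j : ℤ} (h : i + 0 = j)
    {x : (compl (withT P)).X n i} (hx : x ∈ (kappaFree P).carrier n i) :
    alpShift P s h x ∈ (kappaFree P).carrier (n + 1) j := fun c hc =>
  (congrArg (aShift P s (idx_alp h c)) (hx (c + (0, 1)) hc)).trans (map_zero _)

theorem kapShift_kappaFree {P : ZOp.{v, w} R S} {s n : ℕ} {i j : ℤ} (h : i + 1 = j)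
    {x : (compl (withT P)).X n i} (hx : x ∈ (kappaFree P).carrier n i) :
    kapShift P s h x = 0 := complX_ext fun c =>
  (congrArg (kShift P s (idx_kap h c)) (hx (c + (1, 0)) (Nat.succ_ne_zero _))).trans (map_zero _)

variable (hRS : S → ∀ n : ℕ, IsUnit ((n + 1 : ℕ) : R))
include hRS

theorem mem_kappaFree_of_kapShift {P : ZOp.{v, w} R S} {n : ℕ} {i j : ℤ} (h : i + 1 = j)
    {x : (compl (withT P)).X n i} (hx : ∀ s, Slot S s n → kapShift P s h x = 0) :
    x ∈ (kappaFree P).carrier n i := by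
  intro c hc
  obtain ⟨c, rfl⟩ : ∃ c' : ℕ × ℕ, c = c' + (1, 0) :=
    ⟨(c.1 - 1, c.2), Prod.ext (by simp; omega) rfl⟩
  refine (kappa_plugSystem P).eq_zero hRS (idx_kap h c) _ (by simp) fun s hs => ?_
  exact congrArg (fun y : complX (withT P) (n + 1) j => y.1 c) (hx s hs)

/-- An element without `κ` vanishes if all its Taylor coefficients with respect to `α` do. -/
theorem eq_zero_of_alpShift {P : ZOp.{v, w} R S}
    {C : ∀ (n : ℕ) (i : ℤ), (compl (withT P)).X n i → Prop}
    (hκ : ∀ {n i x}, C n i x → x ∈ (kappaFree P).carrier n i)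
    (hε : ∀ {n i x}, C n i x → epsilon P x = 0)
    (hα : ∀ {s n i j x} (h : i + 0 = j), C n i x → Slot S s n → C (n + 1) j (alpShift P s h x))
    {n : ℕ} {i : ℤ} {x : (compl (withT P)).X n i} (hx : C n i x) : x = 0 := by
  have key : ∀ (k : ℕ) {n : ℕ} {i : ℤ} (x : complX (withT P) n i), C n i x → x.1 (0, k) = 0 := by
    intro k
    induction k with
    | zero => exact fun x hx => epsilon_eq_zero P x (hε hx)
    | succ k ih =>
      intro n i x hx
      refine (alpha_plugSystem P).eq_zero hRS (i := (i, ((0 : ℕ) : ℤ), ((k + 1 : ℕ) : ℤ)))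
        (idx_alp (add_zero i) (0, k)) _ (by simp) fun s hs => ?_
      exact ih _ (hα (add_zero i) hx hs)
  refine complX_ext ?_
  rintro ⟨_ | w, k⟩
  · exact key k _ hx
  · exact hκ hx (w + 1, k) (Nat.succ_ne_zero _)

omit hRS

theorem exists_plugs (P : ZOp.{v, w} R S) {n : ℕ} {i i' : Tri} (hi : i' + tDeg .kappa = i)
    (hi0 : 0 < i.2.1) (x : (withT P).X n i) : ∃ y : Fin (n + 1) → (withT P).X (n + 1) i',
      x = ∑ j, (withT P).comp j (n := 0) rfl hi (y j) (inNew P tDeg .kappa rfl) := by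
  induction (kappa_plugSystem P).span x hi0 using Submodule.span_induction with
  | mem x hx =>
    obtain ⟨j, hj, i'', hi'', y, rfl⟩ := hx
    obtain rfl : i'' = i' := add_right_cancel (hi''.trans hi.symm)
    refine ⟨Pi.single ⟨j, by omega⟩ y, ?_⟩
    rw [Finset.sum_eq_single ⟨j, by omega⟩]
    · rw [Pi.single_eq_same]
      rfl
    · intro t _ ht
      rw [Pi.single_eq_of_ne ht, map_zero, LinearMap.zero_apply]
    · exact fun h => (h (Finset.mem_univ _)).elim
  | zero => exact ⟨0, by simp⟩
  | add x x' _ _ h h' =>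
    obtain ⟨y, rfl⟩ := h
    obtain ⟨y', rfl⟩ := h'
    exact ⟨y + y', by simp [Finset.sum_add_distrib]⟩
  | smul r x _ h =>
    obtain ⟨y, rfl⟩ := h
    exact ⟨r • y, by simp [Finset.smul_sum]⟩

/-- Splitting off the part of highest weight. -/
theorem exists_top (P : ZOp.{v, w} R S) {n : ℕ} {i i' : ℤ} (hi : i' + -1 = i)
    (κ' : complX (withT P) 0 (-1)) (hκ : κ'.1 (0 + (1, 0)) = inNew P tDeg .kappa (by simp [tDeg]))
    (hκ' : ∀ c, c ≠ 0 → κ'.1 (c + (1, 0)) = 0) (W : ℕ) (x : complX (withT P) n i)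
    (hx : ∀ c, W + 2 ≤ c.1 → x.1 c = 0) :
    ∃ (Y : Fin (n + 1) → complX (withT P) (n + 1) i') (r : complX (withT P) n i),
      (∀ j c, c.1 ≠ W → (Y j).1 c = 0) ∧ (∀ c, W + 1 ≤ c.1 → r.1 c = 0) ∧
      x = (∑ j, complComp j (n := 0) rfl hi (Y j) κ') + r := by
  have hidx : ∀ c : ℕ × ℕ, ((i', (c.1 : ℤ), (c.2 : ℤ)) : Tri) + tDeg .kappa =
      (i, ((c + (1, 0)).1 : ℤ), ((c + (1, 0)).2 : ℤ)) := fun c => by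
    rw [← hi]
    simp [tDeg]
  choose y hy using fun c : ℕ × ℕ => exists_plugs P (hidx c) (by simp) (x.1 (c + (1, 0)))
  let Y : Fin (n + 1) → complX (withT P) (n + 1) i' := fun j => ⟨fun c => if c.1 = W then y c j
    else 0, mem_complX.2 ⟨W + 1, fun c hc => if_neg (by omega)⟩⟩
  refine ⟨Y, x - ∑ j, complComp j (n := 0) rfl hi (Y j) κ', fun j c hc => if_neg hc, ?_,
    (by abel)⟩
  intro c hc
  obtain ⟨c, rfl⟩ : ∃ c' : ℕ × ℕ, c = c' + (1, 0) :=
    ⟨(c.1 - 1, c.2), Prod.ext (by simp; omega) rfl⟩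
  rw [Submodule.coe_sub, Pi.sub_apply, Submodule.coe_sum, Finset.sum_apply, sub_eq_zero]
  have hterm : ∀ j : Fin (n + 1), (complComp j (n := 0) rfl hi (Y j) κ').1 (c + (1, 0)) = if c.1 = W then (withT P).comp j (n := 0) rfl (hidx c) (y c j)
        (inNew P tDeg .kappa rfl) else 0 := by
    intro j
    refine (complComp_attach j (n := 0) rfl hi (Y j) κ' (c + (1, 0))).trans ?_
    refine (sum_splits_right (1, 0) c (fun x z h => (withT P).comp j (n := 0) rfl (idx_add hi h)
      (if x.1 = W then y x j else 0) (κ'.1 z)) fun x z h hz => ?_).trans ?_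
    · have := congrArg Prod.fst h
      rw [if_neg (by simp at this hz hc; omega), map_zero, LinearMap.zero_apply]
    · rw [Finset.sum_eq_single ⟨(c, 0), mem_splits.2 (add_zero c)⟩]
      · rw [hκ]
        split_ifs
        · rfl
        · rw [map_zero, LinearMap.zero_apply]
      · rintro ⟨⟨x, z⟩, hz⟩ _ hne
        rw [hκ' z (fun h0 => hne ?_), map_zero]
        obtain rfl : z = 0 := h0
        have := mem_splits.1 hz
        simp at this
        simp [this]
      · exact fun h => (h (Finset.mem_attach _ _)).elim
  rw [Finset.sum_congr rfl fun j _ => hterm j]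
  by_cases hW : c.1 = W
  · simp only [if_pos hW]
    exact hy c
  · simp only [if_neg hW, Finset.sum_const_zero]
    exact hx _ (by simp at hc ⊢; omega)

end TwistShift
end
end TwistOperad

namespace TwistOperad

noncomputable section

section TwistCurv

variable {R : Type v} [CommRing R] {S : Prop}

theorem kapShift_kappa (P : ZOp.{v, w} R S) {j : ℤ} (h : -1 + 1 = j) (hj : j = 0) :
    kapShift P 0 h (kappa P) = (compl (withT P)).one hj := by
  refine complX_ext ?_
  rintro ⟨_ | w, _ | k⟩
  · exact adjShift_new (P := P) (z := tDeg) (x₀ := .kappa) (δ := (1, -1, 0)) (hδ := rfl)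
      (idx_kap h (0, 0)) rfl (by rw [hj]; rfl)
  all_goals exact map_zero _

theorem alpShift_kappa (P : ZOp.{v, w} R S) {j : ℤ} (h : -1 + 0 = j) :
    alpShift P 0 h (kappa P) = 0 := by
  refine complX_ext ?_
  rintro ⟨_ | _ | w, k⟩
  all_goals exact map_zero _

theorem epsilon_kappa (P : ZOp.{v, w} R S) : epsilon P (kappa P) = 0 := map_zero _

/-- A sequence of elements of the completed coproduct without `κ` whose initial terms are the `mₙ`,
and which is formed from its term of arity zero by removing copies of `α`. -/
structure TwistSeq {P : ZOp.{v, w} R S} (m : ∀ n : ℕ, P.X n (-1))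
    (M : ∀ n : ℕ, (compl (withT P)).X n (-1)) : Prop where
  alpha : ∀ n, alpShift P 0 (add_zero _) (M n) = M (n + 1)
  free : ∀ n, M n ∈ (kappaFree P).carrier n (-1)
  eps : ∀ n, epsilon P (M n) = m n

variable {P : PreDG.{v, w} R S} (hP : IsDG P)

/-- The quadruple of the completed coproduct with `T`, with distinguished element `κ + M₀`. -/
def twistedQuad (M : ∀ n : ℕ, (compl (withT P.op)).X n (-1)) : Quad.{v, max v w} R S where
  dg := twistDG hP
  κ := kappa P.op + M 0
  sub := kappaFree P.op

variable {hP} {m : ∀ n : ℕ, P.op.X n (-1)} {M : ∀ n : ℕ, (compl (withT P.op)).X n (-1)}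
  (ht : TwistSeq m M)

include ht

theorem TwistSeq.kapShift_κ {j : ℤ} (h : -1 + 1 = j) (hj : j = 0) :
    kapShift P.op 0 h (kappa P.op + M 0) = (compl (withT P.op)).one hj := by
  rw [LinearMap.map_add, kapShift_kappa P.op h hj, kapShift_kappaFree h (ht.free 0), add_zero]

/-- The sequence that begins with `κ + M₀`. -/
theorem TwistSeq.shiftSeq_alp (n : ℕ) :
    shiftSeq (alpShift P.op) (kappa P.op + M 0) (n + 1) = M (n + 1) := by
  induction n with
  | zero =>
    refine (LinearMap.map_add (alpShift P.op 0 (add_zero (-1))) (kappa P.op) (M 0)).trans ?_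
    exact (congrArg₂ (· + ·) (alpShift_kappa P.op _) (ht.alpha 0)).trans (zero_add _)
  | succ n ih => exact (congrArg (alpShift P.op 0 (add_zero _)) ih).trans (ht.alpha (n + 1))

theorem TwistSeq.epsilon_shiftSeq : ∀ n : ℕ, epsilon P.op
    (shiftSeq (alpShift P.op) (kappa P.op + M 0) n) = m n
  | 0 => (((epsilonHom P.op).f 0 (-1)).map_add (kappa P.op) (M 0)).trans
      ((congrArg₂ (· + ·) (epsilon_kappa P.op) (ht.eps 0)).trans (zero_add _))
  | n + 1 => (congrArg (epsilon P.op) (ht.shiftSeq_alp n)).trans (ht.eps (n + 1))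

omit ht in
theorem twist_stash_zero (x : (compl (withT P.op)).X 0 (-1)) :
    stash (compl (withT P.op)) (shiftSeq (alpShift P.op) x) 0 = -(compl (withT P.op)).comp
      (0 : Fin 1) (n := 0) rfl rfl (alpShift P.op 0 (add_zero (-1)) x) x := stash_zero _ _

theorem TwistSeq.alpShift_κ : alpShift P.op 0 (add_zero (-1)) (kappa P.op + M 0) = M 1 :=
  ht.shiftSeq_alp 0

theorem TwistSeq.kapShift_d {j : ℤ} (h : -1 + -1 + 1 = j) :
    kapShift P.op 0 h ((twistDG hP).d rfl (kappa P.op + M 0)) = kapShift P.op 0 h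
      (stash (compl (withT P.op)) (shiftSeq (alpShift P.op) (kappa P.op + M 0)) 0) := by
  obtain rfl : j = -1 := h.symm
  have h1 : M 1 = kapShift P.op 0 h ((twistDG hP).d rfl (kappa P.op + M 0)) := by
    refine ht.alpShift_κ.symm.trans ((nabla_kapShift hP (add_zero (-1)) (slot_zero S 0) _).symm.trans
      ((bracket_odd (A := compl (withT P.op)) (d := twistDiff hP) (D := kapShift P.op) 0
        (add_zero (-1)) rfl h rfl (by omega) (kappa P.op + M 0)).trans
          ((congrArg₂ (· + ·) rfl ?_).trans (add_zero _))))
    exact (congrArg _ (ht.kapShift_κ rfl (by omega))).trans ((isDG_twistDG hP).d_one (by omega)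
      (by omega : -1 + 1 + -1 = (-1 : ℤ)))
  have h4 : (compl (withT P.op)).comp (0 : Fin 1) (n := 0 + 1) rfl (by omega : -1 + (-1 + 1) = -1)
      (M 1) (kapShift P.op 0 (rfl : -1 + 1 = (-1 + 1 : ℤ)) (kappa P.op + M 0)) = M 1 := by
    rw [ht.kapShift_κ rfl (by omega)]
    exact (compl (withT P.op)).comp_one _ _ _ _ _
  have h5 := (isShiftDer_kapShift P.op).comp_arity_zero (hk := rfl) (hk' := h) rfl
    (by omega : -1 + (-1 + 1) = -1) (M 1) (kappa P.op + M 0)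
    fun s i' hi hs => kapShift_kappaFree hi (ht.free 1)
  rw [h4, show sgn R (1 * -1) = -1 by simp [sgn]] at h5
  rw [← h1, twist_stash_zero, ht.alpShift_κ, LinearMap.map_neg, h5, neg_smul, neg_neg, one_smul]

variable (hRS : S → ∀ n : ℕ, IsUnit ((n + 1 : ℕ) : R))
include hRS

omit hRS ht in
theorem alpShift_d (hP : IsDG P) {s n : ℕ} (hs : Slot S s n) {i j j' k : ℤ} (h₁ : i + 0 = j)
    (h₁' : j + -1 = k) (h₂ : i + -1 = j') (h₂' : j' + 0 = k) (x : (compl (withT P.op)).X n i) :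
    (twistDG hP).d h₁' (alpShift P.op s h₁ x) = alpShift P.op s h₂' ((twistDG hP).d h₂ x) :=
  (congrArg ((twistDG hP).d h₁') (nabla_kapShift hP h₁ hs x)).symm.trans
    ((nabla_d (isDG_twistDG hP) s h₁ h₁' h₂ h₂' x).trans (nabla_kapShift hP h₂' hs _))

omit hRS ht in
theorem alpShift_alpShift (P : ZOp.{v, w} R S) {n : ℕ} {i : ℤ} (x : (compl (withT P)).X n i) :
    SComm (alpShift P) (alpShift P) x :=
  scomm_complShift (δ := (0, 0, -1)) (e := (0, 1)) (δ' := (0, 0, -1)) (e' := (0, 1)) rfl rfl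
    (fun x => adjShift_adjShift x) x

omit ht in
/-- The structure equations of a sequence formed by removing copies of `α` hold if they hold for
its initial terms. -/
theorem twist_d_shiftSeq (x : (compl (withT P.op)).X 0 (-1)) (hκ : ∀ {j : ℤ} (h : -1 + -1 + 1 = j),
      kapShift P.op 0 h ((twistDG hP).d rfl x) =
        kapShift P.op 0 h (stash (compl (withT P.op)) (shiftSeq (alpShift P.op) x) 0))
    (hε : ∀ n, P.d rfl (epsilon P.op (shiftSeq (alpShift P.op) x n)) =
      stash P.op (fun n => epsilon P.op (shiftSeq (alpShift P.op) x n)) n) :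
    (twistDG hP).d rfl x = stash (compl (withT P.op)) (shiftSeq (alpShift P.op) x) 0 := by
  let E : ∀ n, (compl (withT P.op)).X n (-1 + -1) := fun n =>
    (show (compl (withT P.op)).X n (-1 + -1) from
      (twistDG hP).d rfl (shiftSeq (alpShift P.op) x n)) -
    stash (compl (withT P.op)) (shiftSeq (alpShift P.op) x) n
  have hNs := isShiftDer_alpShift P.op
  have hNc := fun {n i} x => alpShift_alpShift P.op (n := n) (i := i) x
  have hEα : ∀ (n s : ℕ) (h : (-1 : ℤ) + -1 + 0 = -1 + -1), Slot S s n →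
      alpShift P.op s h (E n) = E (n + 1) := by
    intro n s h hs
    refine (LinearMap.map_sub (alpShift P.op s h) _ _).trans (congrArg₂ (· - ·) ?_ ?_)
    · refine (alpShift_d hP hs (add_zero (-1)) rfl rfl h _).symm.trans ?_
      exact congrArg _ (shift_shiftSeq hNs hNc x hs _)
    · exact stash_shift hNs (fun s n hs => shift_shiftSeq hNs hNc x hs _)
        (fun hS n σ => act_shiftSeq hNs hNc x hS n σ) hs h
  have hEκ : ∀ n, E n ∈ (kappaFree P.op).carrier n (-1 + -1) := by
    intro n
    induction n with
    | zero =>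
      refine mem_kappaFree_of_kapShift hRS rfl fun s hs => ?_
      obtain rfl : s = 0 := Nat.le_zero.1 hs.1
      exact (LinearMap.map_sub _ _ _).trans (sub_eq_zero.2 (hκ rfl))
    | succ n ih =>
      rw [← hEα n 0 (by omega) (slot_zero S n)]
      exact alpShift_mem_kappaFree _ ih
  have hE0 := eq_zero_of_alpShift hRS (P := P.op) (C := fun n i x => ∃ h : -1 + -1 = i,
    x = (compl (withT P.op)).cast rfl h (E n)) ?_ ?_ ?_ (x := E 0) ⟨rfl, rfl⟩
  · exact sub_eq_zero.1 hE0
  · rintro n i x ⟨rfl, rfl⟩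
    exact hEκ n
  · rintro n i x' ⟨rfl, rfl⟩
    refine (((epsilonHom P.op).f n _).map_sub _ _).trans (sub_eq_zero.2 ?_)
    refine (epsilon_d hP rfl (shiftSeq (alpShift P.op) x n)).trans ((hε n).trans ?_)
    exact (stash_map (epsilonHom P.op) (shiftSeq (alpShift P.op) x) n).symm
  · rintro s n i j x h ⟨rfl, rfl⟩ hs
    obtain rfl : -1 + -1 = j := by omega
    exact ⟨rfl, hEα n s h hs⟩

theorem TwistSeq.d_κ (hm : ∀ n, P.d rfl (m n) = stash P.op m n) :
    (twistDG hP).d rfl (kappa P.op + M 0) = -(compl (withT P.op)).comp (0 : Fin 1) (n := 0) rfl rfl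
      (M 1) (kappa P.op + M 0) := by
  refine (twist_d_shiftSeq hRS _ (fun h => ht.kapShift_d h) fun n => ?_).trans
    ((twist_stash_zero _).trans ?_)
  · have := funext ht.epsilon_shiftSeq
    rw [ht.epsilon_shiftSeq, hm, this]
  · rw [ht.alpShift_κ]

end TwistCurv
end
end TwistOperad

namespace TwistOperad

noncomputable section

section TwistCurv

variable {R : Type v} [CommRing R] {S : Prop} {P : PreDG.{v, w} R S} (hP : IsDG P)
  {m : ∀ n : ℕ, P.op.X n (-1)} {M : ∀ n : ℕ, (compl (withT P.op)).X n (-1)}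
  (ht : TwistSeq m M)

include ht

theorem TwistSeq.κ_one : ((kappa P.op + M 0 : (compl (withT P.op)).X 0 (-1)) :
    complX (withT P.op) 0 (-1)).1 (0 + (1, 0)) = inNew P.op tDeg .kappa (by simp [tDeg]) :=
  (congrArg₂ (α := (withT P.op).X _ _) (β := (withT P.op).X _ _) (· + ·) rfl
    (ht.free 0 (1, 0) one_ne_zero)).trans (add_zero _)

theorem TwistSeq.κ_ne {c : ℕ × ℕ} (hc : c ≠ 0) :
    ((kappa P.op + M 0 : (compl (withT P.op)).X 0 (-1)) :
    complX (withT P.op) 0 (-1)).1 (c + (1, 0)) = 0 := by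
  refine (congrArg₂ (α := (withT P.op).X _ _) (β := (withT P.op).X _ _) (· + ·) ?_
    (ht.free 0 (c + (1, 0)) (Nat.succ_ne_zero _))).trans (add_zero _)
  obtain ⟨_ | w, _ | k⟩ := c
  · exact (hc rfl).elim
  all_goals rfl

theorem TwistSeq.mem_rangeSub : ∀ (W : ℕ) {n : ℕ} {i : ℤ} (x : (twistedQuad hP M).dg.op.X n i),
    (∀ c, W ≤ c.1 → (x : complX (withT P.op) n i).1 c = 0) → x ∈ (twistedQuad hP M).rangeSub.carrier n i
  | 0, n, i, x, hx => by
    obtain rfl : x = 0 := complX_ext fun c => hx c (Nat.zero_le _)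
    exact Submodule.zero_mem _
  | 1, n, i, x, hx => Submodule.mem_iSup_of_mem 0 (Quad.mem_wt_zero.2 fun c hc =>
      hx c (Nat.one_le_iff_ne_zero.2 hc))
  | W + 2, n, i, x, hx => by
    obtain ⟨Y, r, hY, hr, rfl⟩ := exists_top P.op (by omega : i + 1 + -1 = i) _ ht.κ_one
      (fun c hc => ht.κ_ne hc) W x hx
    refine Submodule.add_mem _ (Submodule.sum_mem _ fun j _ => ?_)
      (TwistSeq.mem_rangeSub (W + 1) r hr)
    refine (twistedQuad hP M).rangeSub.comp_mem j (n := 0) rfl (by omega : i + 1 + -1 = i)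
      (TwistSeq.mem_rangeSub (W + 1) (Y j) fun c hc => hY j c (by omega)) ?_
    exact Submodule.mem_iSup_of_mem 1 Quad.κ_mem_wt

theorem TwistSeq.d_mem {n : ℕ} {i j : ℤ} (h : i + -1 = j) (q : (twistedQuad hP M).dg.op.X n i)
    (hq : q ∈ (twistedQuad hP M).sub.carrier n i) : (twistedQuad hP M).dg.d h q ∈
      (twistedQuad hP M).wt n j 0 ⊔ (twistedQuad hP M).wt n j 1 := by
  obtain ⟨Y, r, hY, hr, hx⟩ := exists_top P.op h _ ht.κ_one
    (fun c hc => ht.κ_ne hc) 0 (twistDiff hP h q) fun c hc => by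
      obtain ⟨_ | _ | w, k⟩ := c
      · simp at hc
      · simp at hc
      · exact (congrArg₂ (· + ·) ((congrArg (dOld hP tDeg _) (hq (w + 2, k)
          (Nat.succ_ne_zero _))).trans (map_zero _)) ((congrArg (dT P.op _) (hq (w + 1, k + 1)
          (Nat.succ_ne_zero _))).trans (map_zero _))).trans (add_zero _)
  refine (congrArg (· ∈ (twistedQuad hP M).wt n j 0 ⊔ (twistedQuad hP M).wt n j 1)
    (hx.trans (add_comm _ _))).mpr ?_
  refine Submodule.add_mem_sup (Quad.mem_wt_zero.2 fun c hc =>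
      hr c (Nat.one_le_iff_ne_zero.2 hc)) (Submodule.sum_mem _ fun t _ => ?_)
  exact Quad.comp_mem_part (Q := twistedQuad hP M) (u := 0) (u' := (1, 0)) (t := (1, 0))
    (zero_add _) t (n := 0) rfl h (Quad.mem_wt_zero.2 (hY t)) Quad.κ_mem_wt

theorem TwistSeq.isCurv (hRS : S → ∀ n : ℕ, IsUnit ((n + 1 : ℕ) : R))
    (hm : ∀ n, P.d rfl (m n) = stash P.op m n) : IsCurv (twistedQuad hP M) := by
  refine isCurv_of_shift (Q := twistedQuad hP M) hRS (isDG_twistDG hP) (D := kapShift P.op)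
    (isShiftDer_kapShift P.op) (fun h p hp _ => kapShift_kappaFree h hp) ht.kapShift_κ
    (fun n d => Quad.natural_surjective _ fun x => ?_) (ht.d_mem hP) ?_
  · obtain ⟨W, hW⟩ := mem_complX.1 x.2
    exact ht.mem_rangeSub hP W x hW
  · refine (congrArg (· ∈ (twistedQuad hP M).wt 0 (-1 + -1) 1) (ht.d_κ (hP := hP) hRS hm)).mpr ?_
    refine Submodule.neg_mem _ ?_
    exact Quad.comp_mem_part (Q := twistedQuad hP M) (u := 0) (u' := (1, 0)) (t := (1, 0))
      (zero_add _) 0 (n := 0) rfl rfl (Quad.mem_wt_zero.2 (ht.free 1)) Quad.κ_mem_wt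

variable {hP} (hR : IsCurv (twistedQuad hP M))

theorem TwistSeq.shift_eq {s n : ℕ} {i j : ℤ} (h : i + 1 = j) (hs : Slot S s n)
    (x : (compl (withT P.op)).X n i) : hR.shift s h x = kapShift P.op s h x := by
  have key : ∀ {n : ℕ} {i : ℤ} (x : (twistedQuad hP M).dg.op.X n i),
      ShiftAgree hR.shift (kapShift P.op) x := fun x => by
    have h' := isShiftDer_kapShift P.op
    refine hR.induction (C := fun x => ShiftAgree hR.shift (kapShift P.op) x)
      (fun q hq s j hj hs => ?_) (fun s j hj hs => ?_)
      (fun a hl hk p q => .comp hR.isShiftDer_shift h' a hl hk)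
      (fun hS σ p => .act hR.isShiftDer_shift h' hS σ) (fun p q => .add) (fun r p => .smul r) x
    · exact (hR.shift_sub hj hq hs).trans (kapShift_kappaFree hj hq).symm
    · obtain rfl : s = 0 := Nat.le_zero.1 hs.1
      exact (hR.shift_kappa hj (by omega)).trans (ht.kapShift_κ hj (by omega)).symm
  exact key x s j h hs

theorem TwistSeq.nabla_eq {s n : ℕ} {i j : ℤ} (h : i + 0 = j) (hs : Slot S s n)
    (x : (compl (withT P.op)).X n i) : nabla hR.shift s h x = alpShift P.op s h x := by
  refine Eq.trans ?_ (nabla_kapShift hP h hs x)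
  refine (bracket_odd (A := compl (withT P.op)) (d := twistDiff hP) (D := hR.shift) s h rfl
    (by omega : i + -1 + 1 = j) rfl (by omega : i + 1 + -1 = j) x).trans
    (Eq.trans ?_ (bracket_odd (A := compl (withT P.op)) (d := twistDiff hP) (D := kapShift P.op)
    s h rfl (by omega : i + -1 + 1 = j) rfl (by omega : i + 1 + -1 = j) x).symm)
  exact congrArg₂ (· + ·) (ht.shift_eq hR _ hs _) (congrArg _ (ht.shift_eq hR _ hs _))

theorem TwistSeq.seq_succ : ∀ n : ℕ, hR.seq (n + 1) = M (n + 1)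
  | 0 => (ht.nabla_eq hR (add_zero (-1)) (slot_zero S 0) _).trans ht.alpShift_κ
  | n + 1 => (congrArg (nabla hR.shift 0 (add_zero (-1))) (TwistSeq.seq_succ n)).trans
      ((ht.nabla_eq hR (add_zero (-1)) (slot_zero S _) _).trans (ht.alpha _))

theorem TwistSeq.epsilon_seq : ∀ n : ℕ, epsilon P.op (hR.seq n) = m n
  | 0 => ht.epsilon_shiftSeq 0
  | n + 1 => (congrArg (epsilon P.op) (ht.seq_succ hR n)).trans (ht.eps _)

end TwistCurv
end
end TwistOperad

namespace TwistOperad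

noncomputable section

section Taylor

variable {R : Type v} [CommRing R] {S : Prop} {A : ZOp.{v, w'} R S} {P : ZOp.{v, w} R S}
  (N : ShiftMap A A 0) (f : Op.Hom A P) (r : ℕ → R)

theorem idx_alpha (i : ℤ) (k : ℕ) : ((i, ((0 : ℕ) : ℤ), (k : ℤ)) : Tri) + tDeg .alpha =
    (i, ((0 : ℕ) : ℤ), ((k + 1 : ℕ) : ℤ)) := by
  simp [tDeg]

theorem isBlockPerm_cyc_one (n : ℕ) : IsBlockPerm (l := n + 1) (⟨0, by omega⟩ : Fin (n + 2))
    (cyc 1) (1 : Equiv.Perm (Fin 0)) 1 := by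
  refine ⟨fun j x hj hx => ?_, fun j => j.elim0⟩
  have hj' : (j : ℕ) ≠ 0 := fun h => hj (Fin.ext h)
  simp only [outerPlace, cyc_val, Equiv.Perm.one_apply] at hx ⊢
  grind

theorem add_one_smul' {M : Type*} [AddCommGroup M] [Module R M] (k : ℕ) (x : M) :
    ((k + 1 : ℕ) : R) • x + x = ((k + 1 + 1 : ℕ) : R) • x := by
  rw [Nat.cast_succ (k + 1), add_smul, one_smul]

/-- The coefficient of order `k` in `α` of the Taylor series of an operation, in which `α` is
placed, in order, after at most `b` inputs. -/
def taylorCoeff : ∀ (k _ : ℕ) {n : ℕ} {i : ℤ},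
    A.X n i →ₗ[R] (withT P).X n (i, ((0 : ℕ) : ℤ), (k : ℤ))
  | 0, _, n, i => (inOld P tDeg rfl).comp (f.f n i)
  | k + 1, b, n, i => r k • ∑ j : Fin (n + 1), if (j : ℕ) ≤ b then
      (plug (alpha P) (idx_alpha i k) j (Nat.le_of_lt_succ j.2)).comp
        ((taylorCoeff k j).comp (N j (add_zero i))) else 0

theorem taylorCoeff_zero (b : ℕ) {n : ℕ} {i : ℤ} (q : A.X n i) :
    taylorCoeff N f r 0 b q = inOld P tDeg rfl (f.f n i q) := rfl

theorem taylorCoeff_succ (k b : ℕ) {n : ℕ} {i : ℤ} (q : A.X n i) :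
    taylorCoeff N f r (k + 1) b q = r k • ∑ j : Fin (n + 1), if (j : ℕ) ≤ b then
      plug (alpha P) (idx_alpha i k) j (Nat.le_of_lt_succ j.2)
        (taylorCoeff N f r k j (N j (add_zero i) q)) else 0 := by
  rw [taylorCoeff, LinearMap.smul_apply, LinearMap.sum_apply]
  refine congrArg (r k • ·) (Finset.sum_congr rfl fun j _ => ?_)
  split_ifs <;> rfl

theorem taylorCoeff_succ_zero (k : ℕ) {n : ℕ} {i : ℤ} (q : A.X n i) :
    taylorCoeff N f r (k + 1) 0 q = r k • plug (alpha P) (idx_alpha i k) 0 (Nat.zero_le n)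
        (taylorCoeff N f r k 0 (N 0 (add_zero i) q)) := by
  rw [taylorCoeff_succ, Finset.sum_eq_single 0]
  · rfl
  · intro j _ hj
    rw [if_neg fun h => hj (Fin.ext (Nat.le_zero.1 h))]
  · exact fun h => (h (Finset.mem_univ _)).elim

variable {N f r} (hN : IsShiftDer (Op.Hom.id A) 0 N)
  (hc : ∀ {n : ℕ} {i : ℤ} (x : A.X n i), SComm N N x)
include hN

theorem act_taylorCoeff (hS : S) (k : ℕ) : ∀ {n : ℕ} {i : ℤ} (σ : Equiv.Perm (Fin n)) (q : A.X n i),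
    taylorCoeff N f r k 0 (A.act hS σ q) = (withT P).act hS σ (taylorCoeff N f r k 0 q) := by
  induction k with
  | zero =>
    intro n i σ q
    rw [taylorCoeff_zero, taylorCoeff_zero, f.map_act, inOld_act]
  | succ k ih =>
    intro n i σ q
    rw [taylorCoeff_succ_zero, taylorCoeff_succ_zero, hN.act hS, map_smul, ih]
    refine congrArg (r k • ·) ?_
    refine (withT P).comp_act_left hS (⟨0, by omega⟩ : Fin (n + 1)) (n := 0) rfl _ (up σ) σ
      ⟨fun j x hj hx => ?_, fun j => j.elim0⟩ _ _
    obtain ⟨j, rfl⟩ := Fin.exists_succ_eq.2 hj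
    have hx' : x = j := Fin.ext (by simpa [outerPlace] using hx)
    subst hx'
    simp [outerPlace, up_succ]

include hc

theorem taylorCoeff_shift_sym (hr : S → ∀ k : ℕ, ((k + 1 : ℕ) : R) * r k = 1) (hS : S) (k : ℕ)
    {n : ℕ} {i : ℤ} (h) (q : A.X n i) :
    aShift P 0 (j := (i, ((0 : ℕ) : ℤ), (k : ℤ))) h (taylorCoeff N f r (k + 1) 0 q) =
      taylorCoeff N f r k 0 (N 0 (add_zero i) q) := by
  have hp := alpha_plugSystem P
  induction k generalizing n i with
  | zero =>
    have h0 : r 0 = 1 := by simpa using hr hS 0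
    rw [taylorCoeff_succ_zero, h0, one_smul]
    refine (hp.shift_plug_sym hS (idx_alpha i 0) h rfl
      (by rw [← idx_alpha i 0, add_right_comm] at h; exact h) _).trans ?_
    have e1 : aShift P 0 rfl (taylorCoeff N f r 0 0 (N 0 (add_zero i) q)) = 0 :=
      adjShift_old _ (slot_zero S _) _ _
    rw [e1, map_zero, zero_add, show triDeg (0, 0, -1) = 0 from rfl, zero_mul, sgn_zero, one_smul]
  | succ k ih =>
    have h₁ : ((i, ((0 : ℕ) : ℤ), ((k + 1 : ℕ) : ℤ)) : Tri) + (0, 0, -1) =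
      (i, ((0 : ℕ) : ℤ), (k : ℤ)) := by simp
    rw [taylorCoeff_succ_zero, map_smul]
    refine (congrArg (r (k + 1) • ·) (hp.shift_plug_sym hS (idx_alpha i (k + 1)) h h₁
      (idx_alpha i k) _)).trans ?_
    have hsymm : A.act hS (cyc 1) (N 0 (add_zero i) (N 0 (add_zero i) q)) =
        N 0 (add_zero i) (N 0 (add_zero i) q) := by
      have := (hc q).sym hS (add_zero i) (add_zero i) (add_zero i) (add_zero i)
      rw [show sgn R ((AddMonoidHom.id ℤ) 0 * (AddMonoidHom.id ℤ) 0) = 1 by simp [sgn],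
        one_smul] at this
      exact this.symm
    have e1 : plug (alpha P) (idx_alpha i k) 1 (by omega)
        (taylorCoeff N f r k 0 (N 0 (add_zero i) (N 0 (add_zero i) q))) =
        plug (alpha P) (idx_alpha i k) 0 (by omega)
        (taylorCoeff N f r k 0 (N 0 (add_zero i) (N 0 (add_zero i) q))) := by
      conv_rhs => rw [← hsymm, act_taylorCoeff hN hS]
      refine Eq.symm (((withT P).comp_act_left hS (⟨0, by omega⟩ : Fin (n + 2)) (n := 0) rfl _
        (cyc 1) 1 (isBlockPerm_cyc_one _) _ _).trans ?_)
      rw [Op.act_one]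
      rfl
    have e2 := taylorCoeff_succ_zero N f r k (N 0 (add_zero i) q)
    have e3 : plug (alpha P) (idx_alpha i k) 0 (Nat.zero_le _)
        (taylorCoeff N f r k 0 (N 0 (add_zero i) (N 0 (add_zero i) q))) =
          ((k + 1 : ℕ) : R) • taylorCoeff N f r (k + 1) 0 (N 0 (add_zero i) q) := by
      rw [e2, smul_smul, hr hS, one_smul]
    rw [ih]
    refine (congrArg (fun y => r (k + 1) • (y + _)) (e1.trans e3)).trans ?_
    rw [show triDeg (0, 0, -1) = 0 from rfl, zero_mul, sgn_zero, one_smul]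
    have h1 := hr hS (k + 1)
    refine (congrArg (r (k + 1) • ·) (add_one_smul' _ _)).trans ?_
    rw [smul_smul, mul_comm, h1, one_smul]

theorem taylorCoeff_shift_ns (hr : ¬S → ∀ k : ℕ, r k = 1) (hS : ¬S) (k : ℕ) :
    ∀ {b s n : ℕ} {i : ℤ} (h) (_ : s ≤ n) (_ : b ≤ n) (q : A.X n i),
    aShift P s (j := (i, ((0 : ℕ) : ℤ), (k : ℤ))) h (taylorCoeff N f r (k + 1) b q) =
      if s ≤ b then taylorCoeff N f r k (b + 1) (N s (add_zero i) q) else 0 := by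
  have hp := alpha_plugSystem P
  induction k with
  | zero =>
    intro b s n i h hs hb q
    rw [taylorCoeff_succ, hr hS, one_smul, map_sum]
    have hterm : ∀ j : Fin (n + 1), aShift P s (j := (i, ((0 : ℕ) : ℤ), ((0 : ℕ) : ℤ))) h
        (if (j : ℕ) ≤ b then plug (alpha P) (idx_alpha i 0) j (Nat.le_of_lt_succ j.2)
          (taylorCoeff N f r 0 j (N j (add_zero i) q)) else 0) =
        if (j : ℕ) = s then if s ≤ b then taylorCoeff N f r 0 (b + 1) (N s (add_zero i) q)
          else 0 else 0 := by
      intro j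
      by_cases hjb : (j : ℕ) ≤ b
      · rw [if_pos hjb]
        refine (hp.shift_plug_ns hS (idx_alpha i 0) h rfl
          (by rw [← idx_alpha i 0, add_right_comm] at h; exact h) _ hs _).trans ?_
        have e1 : ∀ t ≤ n + 1, aShift P t rfl
            (taylorCoeff N f r 0 j (N j (add_zero i) q)) = 0 :=
          fun t ht => adjShift_old _ ⟨ht, fun h => (hS h).elim⟩ _ _
        rw [e1 _ (by omega), e1 _ (by omega), map_zero, map_zero, ite_self, ite_self, zero_add,
          zero_add, show triDeg (0, 0, -1) = 0 from rfl, zero_mul, sgn_zero, one_smul]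
        by_cases hjs : (j : ℕ) = s
        · subst hjs
          rw [if_pos rfl, if_pos rfl, if_pos hjb]
          rfl
        · rw [if_neg hjs, if_neg hjs]
      · rw [if_neg hjb, map_zero]
        split_ifs with h1 h2
        · omega
        · rfl
        · rfl
    rw [Finset.sum_congr rfl fun j _ => hterm j, Finset.sum_eq_single ⟨s, by omega⟩]
    · exact if_pos rfl
    · exact fun j _ hj => if_neg fun h => hj (Fin.ext h)
    · exact fun h => (h (Finset.mem_univ _)).elim
  | succ k ih =>
    intro b s n i h hs hb q
    have h₁ : ((i, ((0 : ℕ) : ℤ), ((k + 1 : ℕ) : ℤ)) : Tri) + (0, 0, -1) =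
      (i, ((0 : ℕ) : ℤ), (k : ℤ)) := by simp
    rw [taylorCoeff_succ, hr hS, one_smul, map_sum]
    let F : Fin (n + 2) → (withT P).X (n + 1) (i, ((0 : ℕ) : ℤ), ((k + 1 : ℕ) : ℤ)) := fun j =>
      plug (alpha P) (idx_alpha i k) j (Nat.le_of_lt_succ j.2)
        (taylorCoeff N f r k j (N j (add_zero i) (N s (add_zero i) q)))
    have hF : ∀ c, taylorCoeff N f r (k + 1) c (N s (add_zero i) q) =
        ∑ j : Fin (n + 2), if (j : ℕ) ≤ c then F j else 0 := fun c => by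
      rw [taylorCoeff_succ, hr hS, one_smul]
    have hterm : ∀ j : Fin (n + 1), aShift P s (j := (i, ((0 : ℕ) : ℤ), ((k + 1 : ℕ) : ℤ))) h
        (if (j : ℕ) ≤ b then plug (alpha P) (idx_alpha i (k + 1)) j (Nat.le_of_lt_succ j.2)
          (taylorCoeff N f r (k + 1) j (N j (add_zero i) q)) else 0) =
        (if s < (j.succ : ℕ) ∧ (j.succ : ℕ) ≤ b + 1 then F j.succ else 0) +
        if (j : ℕ) = s then if s ≤ b then taylorCoeff N f r (k + 1) s (N s (add_zero i) q)
          else 0 else 0 := by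
      intro j
      rw [Fin.val_succ]
      by_cases hjb : (j : ℕ) ≤ b
      · rw [if_pos hjb]
        refine (hp.shift_plug_ns hS (idx_alpha i (k + 1)) h h₁ (idx_alpha i k) _ hs _).trans ?_
        rw [ih h₁ (by omega) (by omega), ih h₁ (by omega) (by omega)]
        rw [show triDeg (0, 0, -1) = 0 from rfl, zero_mul, sgn_zero, one_smul]
        have e2 : (if (j : ℕ) ≤ s then plug (inNew P tDeg .alpha rfl) (idx_alpha i k) j (by omega)
            (if s + 1 ≤ (j : ℕ) then
              taylorCoeff N f r k (j + 1) (N (s + 1) (add_zero i) (N j (add_zero i) q)) else 0)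
            else 0) = 0 := by
          split_ifs with h1 h2
          · omega
          · exact map_zero _
          · rfl
        refine congrArg₂ (· + ·) ((congrArg (_ + ·) e2).trans ((add_zero _).trans ?_)) ?_
        · by_cases hsj : s ≤ j
          · rw [if_pos hsj, if_pos hsj, if_pos ⟨by omega, by omega⟩]
            have hcomm := (hc q).ns hS (add_zero i) (add_zero i) (add_zero i) (add_zero i)
              hsj (Nat.le_of_lt_succ j.2)
            rw [show sgn R ((AddMonoidHom.id ℤ) 0 * (AddMonoidHom.id ℤ) 0) = 1 by simp [sgn],
              one_smul] at hcomm
            rw [hcomm]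
            rfl
          · rw [if_neg hsj, if_neg fun h => hsj (by omega)]
        · by_cases hjs : (j : ℕ) = s
          · subst hjs
            rw [if_pos rfl, if_pos rfl, if_pos hjb]
          · rw [if_neg hjs, if_neg hjs]
      · rw [if_neg hjb, map_zero, if_neg fun h => hjb (by omega), zero_add]
        split_ifs with h1 h2
        · omega
        · rfl
        · rfl
    rw [Finset.sum_congr rfl fun j _ => hterm j, Finset.sum_add_distrib,
      Finset.sum_eq_single (f := fun j : Fin (n + 1) => if (j : ℕ) = s then _ else _)
        ⟨s, by omega⟩ (fun j _ hj => if_neg fun h => hj (Fin.ext h))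
        (fun h => (h (Finset.mem_univ _)).elim), if_pos rfl, hF, hF]
    have h0 : (∑ j : Fin (n + 1), if s < (j.succ : ℕ) ∧ (j.succ : ℕ) ≤ b + 1 then F j.succ else 0) =
        ∑ j : Fin (n + 2), if s < (j : ℕ) ∧ (j : ℕ) ≤ b + 1 then F j else 0 := by
      rw [Fin.sum_univ_succ (n := n + 1), if_neg fun h => Nat.not_lt_zero _ h.1, zero_add]
    rw [h0]
    by_cases hsb : s ≤ b
    · rw [if_pos hsb, if_pos hsb, ← Finset.sum_add_distrib]
      refine Finset.sum_congr rfl fun j _ => ?_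
      by_cases h1 : (j : ℕ) ≤ s
      · rw [if_neg (by omega), if_pos h1, if_pos (by omega), zero_add]
      · rw [if_neg h1, add_zero]
        exact if_congr (by omega) rfl rfl
    · rw [if_neg hsb, if_neg hsb, add_zero]
      exact Finset.sum_eq_zero fun j _ => if_neg (by omega)

end Taylor
end
end TwistOperad

namespace TwistOperad

noncomputable section

section Defect

variable {R : Type v} [CommRing R] {S : Prop} {A : ZOp.{v, w'} R S} {B : ZOp.{v, w} R S}

/-- The subspaces spanned by the failures of a map to preserve compositions. -/
inductive CompDefect (g : ∀ (n : ℕ) (i : ℤ), A.X n i →ₗ[R] B.X n i) :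
    ∀ (n : ℕ) (i : ℤ), B.X n i → Prop
  | comp {m n l : ℕ} {i j k : ℤ} (a : Fin m) (hl : l + 1 = m + n) (hk : i + j = k)
      (p : A.X m i) (q : A.X n j) :
      CompDefect g l k (g l k (A.comp a hl hk p q) - B.comp a hl hk (g m i p) (g n j q))
  | zero {n : ℕ} {i : ℤ} : CompDefect g n i 0
  | add {n : ℕ} {i : ℤ} {x y : B.X n i} : CompDefect g n i x → CompDefect g n i y →
      CompDefect g n i (x + y)
  | smul {n : ℕ} {i : ℤ} (r : R) {x : B.X n i} : CompDefect g n i x → CompDefect g n i (r • x)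
  | act {n : ℕ} {i : ℤ} (hS : S) (σ : Equiv.Perm (Fin n)) {x : B.X n i} : CompDefect g n i x →
      CompDefect g n i (B.act hS σ x)

variable {g : ∀ (n : ℕ) (i : ℤ), A.X n i →ₗ[R] B.X n i}

theorem CompDefect.of_eq {n : ℕ} {i : ℤ} {x y : B.X n i} (hx : CompDefect g n i x) (h : x = y) :
    CompDefect g n i y := h ▸ hx

theorem CompDefect.outer {m n l : ℕ} {i j k : ℤ} (a : Fin m) (hl : l + 1 = m + 1 + n)
    (hk : i + j = k) (s : ℕ) (u : ℕ → A.X (m + 1) i) (y : A.X n j) :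
    CompDefect g l k (g l k (A.outer a hl hk s u y) -
      B.outer a hl hk s (fun t => g _ _ (u t)) (g n j y)) := by
  by_cases hS : S
  · rw [A.outer_sym hS, B.outer_sym hS]
    exact .comp _ _ _ _ _
  · rw [A.outer_ns hS, B.outer_ns hS, map_add, add_sub_add_comm]
    refine .add ?_ ?_
    · split_ifs
      · exact .comp _ _ _ _ _
      · exact CompDefect.zero.of_eq (by rw [map_zero, sub_zero])
    · split_ifs
      · exact .comp _ _ _ _ _
      · exact CompDefect.zero.of_eq (by rw [map_zero, sub_zero])

theorem CompDefect.inner (hact : ∀ {n : ℕ} {i : ℤ} (hS : S) (σ : Equiv.Perm (Fin n)) (p : A.X n i),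
      g n i (A.act hS σ p) = B.act hS σ (g n i p))
    {m n l : ℕ} {i j k : ℤ} (a : Fin m) (hl : l + 1 + 1 = m + (n + 1))
    (hk : i + j = k) (s : ℕ) (x : A.X m i) (v : ℕ → A.X (n + 1) j) :
    CompDefect g (l + 1) k (g (l + 1) k (A.inner a hl hk s x v) -
      B.inner a hl hk s (g m i x) (fun t => g _ _ (v t))) := by
  by_cases hS : S
  · rw [A.inner_sym hS, B.inner_sym hS, hact, ← map_sub]
    exact .act _ _ (.comp _ _ _ _ _)
  · rw [A.inner_ns hS, B.inner_ns hS]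
    split_ifs
    · exact .comp _ _ _ _ _
    · exact CompDefect.zero.of_eq (by rw [map_zero, sub_zero])

theorem CompDefect.shift
    (hact : ∀ {n : ℕ} {i : ℤ} (hS : S) (σ : Equiv.Perm (Fin n)) (p : A.X n i),
      g n i (A.act hS σ p) = B.act hS σ (g n i p))
    {δ : ℤ} {N : ShiftMap A A δ} {N' : ShiftMap B B δ} (hN : IsShiftDer (Op.Hom.id A) δ N)
    (hN' : IsShiftDer (Op.Hom.id B) δ N')
    (hg : ∀ {s n : ℕ} {i j : ℤ} (h : i + δ = j) (x : A.X n i), Slot S s n →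
      N' s h (g n i x) = g (n + 1) j (N s h x))
    {n : ℕ} {i : ℤ} {x : B.X n i} (hx : CompDefect g n i x) :
    ∀ {s : ℕ} {j : ℤ} (h : i + δ = j), Slot S s n → CompDefect g (n + 1) j (N' s h x) := by
  induction hx with
  | @comp m n l i j k a hl hk p q =>
    intro s j' h hs
    have e1 : N' s h (g l k (A.comp a hl hk p q)) = _ :=
      (hg h _ hs).trans ((congrArg (g (l + 1) j') (hN.comp a hl hk h p q hs)).trans
        (map_add _ _ _))
    have e2 := hN'.comp a hl hk h (g m i p) (g n j q) hs
    rw [map_sub, e1, e2, add_sub_add_comm]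
    refine .add ?_ ?_
    · refine (CompDefect.outer a _ _ s _ _).of_eq (congrArg (_ - ·) ?_)
      exact Op.outer_congr a _ _ hs (fun t ht => (hg rfl p ht).symm) _
    · rw [LinearMap.map_smul, ← smul_sub]
      refine .smul _ ((CompDefect.inner hact a _ _ s _ _).of_eq (congrArg (_ - ·) ?_))
      exact Op.inner_congr a _ _ s _ (fun t ht => (hg rfl q ht).symm)
  | zero => exact fun _ _ => CompDefect.zero.of_eq (map_zero _).symm
  | add _ _ ih ih' => exact fun h hs => ((ih h hs).add (ih' h hs)).of_eq (map_add _ _ _).symm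
  | smul r _ ih => exact fun h hs => ((ih h hs).smul r).of_eq (LinearMap.map_smul _ _ _).symm
  | act hS σ _ ih =>
    intro s j h hs
    obtain rfl := hs.2 hS
    exact ((ih h (slot_zero S _)).act hS (up σ)).of_eq (hN'.act hS σ h _).symm

end Defect

section Taylor

variable {R : Type v} [CommRing R] {S : Prop} {A : ZOp.{v, w'} R S} {P : ZOp.{v, w} R S}
  (N : ShiftMap A A 0) (f : Op.Hom A P) (r : ℕ → R)

open Classical in
/-- The Taylor series of an operation. -/
def taylor (n : ℕ) (i : ℤ) : A.X n i →ₗ[R] (compl (withT P)).X n i where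
  toFun q := series P fun k => taylorCoeff N f r k (if S then 0 else n) q
  map_add' p q := complX_ext fun c => by
    obtain ⟨_ | w, k⟩ := c
    · exact map_add _ _ _
    · exact (add_zero _).symm
  map_smul' a p := complX_ext fun c => by
    obtain ⟨_ | w, k⟩ := c
    · exact map_smul _ _ _
    · exact (smul_zero (A := (withT P).X n (i, ((w + 1 : ℕ) : ℤ), (k : ℤ))) a).symm

theorem series_mem {n : ℕ} {d : ℤ} (y : ∀ k : ℕ, (withT P).X n (d, ((0 : ℕ) : ℤ), (k : ℤ))) :
    series P y ∈ (kappaFree P).carrier n d := by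
  rintro ⟨_ | w, k⟩ hu
  · exact (hu rfl).elim
  · rfl

theorem taylor_mem {n : ℕ} {i : ℤ} (q : A.X n i) :
    taylor N f r n i q ∈ (kappaFree P).carrier n i := series_mem _

theorem epsilon_taylor {n : ℕ} {i : ℤ} (q : A.X n i) :
    epsilon P (taylor N f r n i q) = f.f n i q := adjEval_old _ _ _ _ _

theorem mem_kappaFree_ext {n : ℕ} {i : ℤ} {x y : (compl (withT P)).X n i}
    (hx : x ∈ (kappaFree P).carrier n i) (hy : y ∈ (kappaFree P).carrier n i)
    (h : ∀ k, (x : complX (withT P) n i).1 (0, k) = (y : complX (withT P) n i).1 (0, k)) : x = y :=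
  complX_ext fun c => by
    obtain ⟨_ | w, k⟩ := c
    · exact h k
    · exact (hx _ (Nat.succ_ne_zero w)).trans (hy _ (Nat.succ_ne_zero w)).symm

variable {N f r} (hN : IsShiftDer (Op.Hom.id A) 0 N)
  (hc : ∀ {n : ℕ} {i : ℤ} (x : A.X n i), SComm N N x)
  (hr : S → ∀ k : ℕ, ((k + 1 : ℕ) : R) * r k = 1) (hr' : ¬S → ∀ k : ℕ, r k = 1)
include hN

theorem taylor_act {n : ℕ} {i : ℤ} (hS : S) (σ : Equiv.Perm (Fin n)) (q : A.X n i) :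
    taylor N f r n i (A.act hS σ q) = (compl (withT P)).act hS σ (taylor N f r n i q) := by
  refine mem_kappaFree_ext (taylor_mem _ _ _ _)
    ((kappaFree P).act_mem hS σ (taylor_mem _ _ _ _)) fun k => ?_
  change taylorCoeff N f r k _ _ = (withT P).act hS σ (taylorCoeff N f r k _ _)
  rw [if_pos hS]
  exact act_taylorCoeff hN hS k σ q

theorem taylor_one {i : ℤ} (h : i = 0) : taylor N f r 1 i (A.one h) = (compl (withT P)).one h := by
  subst h
  refine mem_kappaFree_ext (taylor_mem _ _ _ _) ((kappaFree P).one_mem rfl) fun k => ?_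
  cases k with
  | zero =>
    change inOld P tDeg _ (f.f 1 0 (A.one rfl)) = (withT P).one rfl
    rw [f.map_one]
    exact inOld_one _ _ _ _ _
  | succ k =>
    change taylorCoeff N f r (k + 1) _ (A.one rfl) = 0
    rw [taylorCoeff_succ]
    refine (congrArg (r k • ·) (Finset.sum_eq_zero fun j _ => ?_)).trans (smul_zero _)
    by_cases hj : (j : ℕ) ≤ if S then 0 else 1
    · rw [if_pos hj]
      have h0 : S → (j : ℕ) = 0 := fun h => by
        rw [if_pos h] at hj
        exact Nat.le_zero.1 hj
      rw [hN.one (s := j) rfl _ ⟨by omega, h0⟩, map_zero, map_zero]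
    · exact if_neg hj

include hc hr hr'

theorem alpShift_taylor {s n : ℕ} {i j : ℤ} (h : i + 0 = j) (q : A.X n i) (hs : Slot S s n) :
    alpShift P s h (taylor N f r n i q) = taylor N f r (n + 1) j (N s h q) := by
  obtain rfl : j = i := by omega
  refine mem_kappaFree_ext (alpShift_mem_kappaFree h (taylor_mem _ _ _ _)) (taylor_mem _ _ _ _)
    fun k => ?_
  refine (alpShift_apply P s h _ (0, k)).trans ?_
  change aShift P s _ (taylorCoeff N f r (k + 1) _ q) = taylorCoeff N f r k _ _
  by_cases hS : S
  · obtain rfl := hs.2 hS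
    rw [if_pos hS, if_pos hS]
    exact taylorCoeff_shift_sym hN hc hr hS k _ q
  · rw [if_neg hS, if_neg hS]
    exact (taylorCoeff_shift_ns hN hc hr' hS k _ hs.1 le_rfl q).trans (if_pos hs.1)

variable (hRS : S → ∀ n : ℕ, IsUnit ((n + 1 : ℕ) : R))
include hRS

theorem taylor_comp {m n l : ℕ} {i j k : ℤ} (a : Fin m) (hl : l + 1 = m + n) (hk : i + j = k)
    (p : A.X m i) (q : A.X n j) : taylor N f r l k (A.comp a hl hk p q) =
      (compl (withT P)).comp a hl hk (taylor N f r m i p) (taylor N f r n j q) := by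
  refine sub_eq_zero.1 (eq_zero_of_alpShift hRS
    (C := CompDefect (B := compl (withT P)) (taylor N f r)) ?_ ?_ ?_ (.comp a hl hk p q))
  · intro n i x hx
    induction hx with
    | comp a hl hk p q =>
      exact sub_mem (taylor_mem N f r _)
        ((kappaFree P).comp_mem a hl hk (taylor_mem N f r _) (taylor_mem N f r _))
    | zero => exact zero_mem _
    | add _ _ ih ih' => exact add_mem ih ih'
    | smul r _ ih => exact Submodule.smul_mem _ r ih
    | act hS σ _ ih => exact (kappaFree P).act_mem hS σ ih
  · intro n i x hx
    change (epsilonHom P).f n i x = 0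
    induction hx with
    | @comp m n l i j k a hl hk p q =>
      rw [map_sub, (epsilonHom P).map_comp]
      have he : ∀ {n : ℕ} {i : ℤ} (q : A.X n i),
          (epsilonHom P).f n i (taylor N f r n i q) = f.f n i q := epsilon_taylor N f r
      rw [he, he, he, f.map_comp, sub_self]
    | zero => exact map_zero _
    | add _ _ ih ih' => rw [map_add, ih, ih', add_zero]
    | smul r _ ih => rw [map_smul, ih, smul_zero]
    | act hS σ _ ih => rw [(epsilonHom P).map_act, ih, map_zero]
  · exact fun h hx hs => hx.shift (fun hS σ p => taylor_act hN hS σ p) hN (isShiftDer_alpShift P)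
      (fun h x hs => alpShift_taylor hN hc hr hr' h x hs) h hs

end Taylor

section TaylorHom

variable {R : Type v} [CommRing R] {S : Prop} {A : ZOp.{v, w'} R S} {P : ZOp.{v, w} R S}

open Classical in
variable (R S) in
/-- The factors in the recursion for Taylor series. -/
def taylorFactor (k : ℕ) : R := if S then Ring.inverse ((k + 1 : ℕ) : R) else 1

variable (hRS : S → ∀ n : ℕ, IsUnit ((n + 1 : ℕ) : R))
include hRS

theorem taylorFactor_sym (hS : S) (k : ℕ) : ((k + 1 : ℕ) : R) * taylorFactor R S k = 1 := by
  rw [taylorFactor, if_pos hS, Ring.mul_inverse_cancel _ (hRS hS k)]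

omit hRS in
theorem taylorFactor_ns (hS : ¬S) (k : ℕ) : taylorFactor R S k = 1 := if_neg hS

variable {N : ShiftMap A A 0} (hN : IsShiftDer (Op.Hom.id A) 0 N)
  (hc : ∀ {n : ℕ} {i : ℤ} (x : A.X n i), SComm N N x) (f : Op.Hom A P)

/-- The Taylor series, as a morphism of operads. -/
def taylorHom : Op.Hom A (compl (withT P)) where
  f := taylor N f (taylorFactor R S)
  map_one h := taylor_one hN h
  map_comp a hl hk p q :=
    taylor_comp hN hc (taylorFactor_sym hRS) taylorFactor_ns hRS a hl hk p q
  map_act hS σ p := taylor_act hN hS σ p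

end TaylorHom
end
end TwistOperad

namespace TwistOperad

noncomputable section

section Lift

variable {R : Type v} [CommRing R] {S : Prop} {Q : Quad.{v, max v w} R S} (hQ : IsCurv Q)
  {P : PreDG.{v, w} R S} (hRS : S → ∀ n : ℕ, IsUnit ((n + 1 : ℕ) : R))
  (f : Op.Hom Q.dg.op P.op)

/-- The Taylor series of the image of an operation, with respect to `∇`. -/
def IsCurv.taylor : Op.Hom Q.dg.op (compl (withT P.op)) :=
  taylorHom hRS (hQ.isOddShift.nabla_shift hQ.isDG) (hQ.isOddShift.nabla_comm hQ.isDG) f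

/-- The morphism to the completed coproduct that is given on `Q₀` by Taylor series, and
sends `κ` to the twisted `κ`. -/
def IsCurv.twist (M : ∀ n : ℕ, (compl (withT P.op)).X n (-1)) :
    Op.Hom Q.dg.op (compl (withT P.op)) :=
  hQ.lift (Q.incl.trans (hQ.taylor hRS f)) (kappa P.op + M 0)

variable {m : ∀ n : ℕ, P.op.X n (-1)} {M : ∀ n : ℕ, (compl (withT P.op)).X n (-1)}

theorem IsCurv.twist_sub {n : ℕ} {i : ℤ} {q : Q.dg.op.X n i} (hq : q ∈ Q.sub.carrier n i) :
    (hQ.twist hRS f M).f n i q = (hQ.taylor hRS f).f n i q :=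
  hQ.lift_sub _ _ ⟨q, hq⟩

theorem IsCurv.twist_κ : (hQ.twist hRS f M).f 0 (-1) Q.κ = kappa P.op + M 0 :=
  hQ.lift_kappa _ _

theorem IsCurv.taylor_mem {n : ℕ} {i : ℤ} (q : Q.dg.op.X n i) :
    (hQ.taylor hRS f).f n i q ∈ (kappaFree P.op).carrier n i := TwistOperad.taylor_mem _ _ _ q

theorem IsCurv.epsilon_taylor {n : ℕ} {i : ℤ} (q : Q.dg.op.X n i) :
    epsilon P.op ((hQ.taylor hRS f).f n i q) = f.f n i q := TwistOperad.epsilon_taylor _ _ _ q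

theorem IsCurv.alpShift_taylor {s n : ℕ} {i j : ℤ} (h : i + 0 = j) (q : Q.dg.op.X n i)
    (hs : Slot S s n) : alpShift P.op s h ((hQ.taylor hRS f).f n i q) =
      (hQ.taylor hRS f).f (n + 1) j (nabla hQ.shift s h q) :=
  TwistOperad.alpShift_taylor (hQ.isOddShift.nabla_shift hQ.isDG)
    (hQ.isOddShift.nabla_comm hQ.isDG) (taylorFactor_sym hRS) taylorFactor_ns h q hs

/-- The elements of a sequence, in the family of all elements. -/
inductive SeqMem {A : ZOp.{v, w} R S} (u : ∀ n : ℕ, A.X n (-1)) : ∀ (n : ℕ) (i : ℤ), A.X n i → Prop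
  | mk (n : ℕ) : SeqMem u n (-1) (u n)

/-- A difference of two given maps at an element of `Q₀`. -/
inductive SubDiff {A : ZOp.{v, w} R S} {B : ZOp.{v, w'} R S} (C : SubOp A) (e : ℤ)
    (u v : ∀ (n : ℕ) (i j : ℤ), i + e = j → A.X n i → B.X n j) : ∀ (n : ℕ) (i : ℤ), B.X n i → Prop
  | mk {n : ℕ} {i j : ℤ} (h : i + e = j) (q : A.X n i) : q ∈ C.carrier n i →
      SubDiff C e u v n j (u n i j h q - v n i j h q)

variable (ht : TwistSeq m M) (hfm : ∀ n, f.f n (-1) (hQ.seq n) = m n)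

include ht

theorem TwistSeq.alpShift_seq {s n : ℕ} (hs : Slot S s n) {j : ℤ} (h : -1 + 0 = j) :
    alpShift P.op s h (M n) = (compl (withT P.op)).cast rfl (by omega) (M (n + 1)) := by
  obtain rfl : j = -1 := by omega
  cases n with
  | zero =>
    obtain rfl : s = 0 := Nat.le_zero.1 hs.1
    exact ht.alpha 0
  | succ n =>
    refine (congrArg (alpShift P.op s h) (ht.shiftSeq_alp n).symm).trans ((shift_shiftSeq
      (isShiftDer_alpShift P.op) (alpShift_alpShift P.op) (kappa P.op + M 0) hs h).trans ?_)
    exact ht.shiftSeq_alp (n + 1)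

include hfm

theorem IsCurv.taylor_seq (n : ℕ) : (hQ.taylor hRS f).f n (-1) (hQ.seq n) = M n := by
  refine sub_eq_zero.1 (eq_zero_of_alpShift hRS (C := SeqMem (A := compl (withT P.op))
    fun n => (hQ.taylor hRS f).f n (-1) (hQ.seq n) - M n) ?_ ?_ ?_ (.mk n))
  · rintro n _ _ ⟨⟩
    exact sub_mem (hQ.taylor_mem hRS f _) (ht.free n)
  · rintro n _ _ ⟨⟩
    refine ((epsilonHom P.op).f n (-1)).map_sub _ _ |>.trans (sub_eq_zero.2 ?_)
    exact (hQ.epsilon_taylor hRS f _).trans ((hfm n).trans (ht.eps n).symm)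
  · rintro s n _ j _ h ⟨⟩ hs
    obtain rfl : j = -1 := by omega
    rw [LinearMap.map_sub, hQ.alpShift_taylor hRS f h _ hs, hQ.nabla_seq hs h, ht.alpShift_seq hs h]
    exact SeqMem.mk (u := fun n => (hQ.taylor hRS f).f n (-1) (hQ.seq n) - M n) (n + 1)

theorem IsCurv.epsilon_twist {n : ℕ} {i : ℤ} (x : Q.dg.op.X n i) :
    epsilon P.op ((hQ.twist hRS f M).f n i x) = f.f n i x := by
  change (epsilonHom P.op).f n i ((hQ.twist hRS f M).f n i x) = f.f n i x
  induction x using hQ.induction with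
  | sub q hq =>
    exact (congrArg (epsilon P.op) (hQ.twist_sub hRS f hq)).trans (hQ.epsilon_taylor hRS f q)
  | kappa =>
    exact (congrArg (epsilon P.op) (hQ.twist_κ hRS f)).trans
      ((ht.epsilon_shiftSeq 0).trans (hfm 0).symm)
  | comp a hl hk p q hp hq =>
    rw [Op.Hom.map_comp, Op.Hom.map_comp (epsilonHom P.op), hp, hq, Op.Hom.map_comp]
  | act hS σ p hp => rw [Op.Hom.map_act, Op.Hom.map_act (epsilonHom P.op), hp, Op.Hom.map_act]
  | add p q hp hq => rw [map_add, map_add, hp, hq, map_add]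
  | smul r p hp => rw [map_smul, map_smul, hp, map_smul]

omit hfm in
theorem IsCurv.kapShift_twist {s n : ℕ} {i j : ℤ} (h : i + 1 = j) (hs : Slot S s n)
    (x : Q.dg.op.X n i) : (hQ.twist hRS f M).f (n + 1) j (hQ.shift s h x) =
      kapShift P.op s h ((hQ.twist hRS f M).f n i x) := by
  have h1 := hQ.isShiftDer_shift.hom_comp (hQ.twist hRS f M) (hQ.twist hRS f M) fun _ _ _ => rfl
  have h2 := (isShiftDer_kapShift P.op).comp_hom (hQ.twist hRS f M) (hQ.twist hRS f M)
    fun _ _ _ => rfl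
  refine hQ.induction (C := fun {n i} x => ShiftAgree _ _ x) ?_ ?_
    (fun a hl hk p q hp hq => ShiftAgree.comp h1 h2 a hl hk hp hq)
    (fun hS σ p hp => ShiftAgree.act h1 h2 hS σ hp) (fun p q hp hq => hp.add hq)
    (fun r p hp => hp.smul r) x s j h hs
  · intro n i q hq s j hj hs
    change (hQ.twist hRS f M).f (n + 1) j (hQ.shift s hj q) =
      kapShift P.op s hj ((hQ.twist hRS f M).f n i q)
    rw [hQ.shift_sub hj hq hs, map_zero, hQ.twist_sub hRS f hq,
      kapShift_kappaFree hj (hQ.taylor_mem hRS f q)]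
  · intro s j hj hs
    obtain rfl : s = 0 := Nat.le_zero.1 hs.1
    change (hQ.twist hRS f M).f 1 j (hQ.shift 0 hj Q.κ) =
      kapShift P.op 0 hj ((hQ.twist hRS f M).f 0 (-1) Q.κ)
    have hj' : j = 0 := by omega
    rw [hQ.shift_kappa hj hj', hQ.twist_κ, ht.kapShift_κ hj hj']
    exact Op.Hom.map_one _ _

theorem IsCurv.alpShift_twist {s n : ℕ} {i j : ℤ} (h : i + 0 = j) (hs : Slot S s n)
    (x : Q.dg.op.X n i) : (hQ.twist hRS f M).f (n + 1) j (nabla hQ.shift s h x) =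
      alpShift P.op s h ((hQ.twist hRS f M).f n i x) := by
  have h1 := (hQ.isOddShift.nabla_shift hQ.isDG).hom_comp (hQ.twist hRS f M) (hQ.twist hRS f M)
    fun _ _ _ => rfl
  have h2 := (isShiftDer_alpShift P.op).comp_hom (hQ.twist hRS f M) (hQ.twist hRS f M)
    fun _ _ _ => rfl
  refine hQ.induction (C := fun {n i} x => ShiftAgree _ _ x) ?_ ?_
    (fun a hl hk p q hp hq => ShiftAgree.comp h1 h2 a hl hk hp hq)
    (fun hS σ p hp => ShiftAgree.act h1 h2 hS σ hp) (fun p q hp hq => hp.add hq)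
    (fun r p hp => hp.smul r) x s j h hs
  · intro n i q hq s j hj hs
    change (hQ.twist hRS f M).f (n + 1) j (nabla hQ.shift s hj q) =
      alpShift P.op s hj ((hQ.twist hRS f M).f n i q)
    rw [hQ.twist_sub hRS f hq, hQ.twist_sub hRS f (hQ.nabla_mem_sub hj hq hs),
      hQ.alpShift_taylor hRS f hj q hs]
  · intro s j hj hs
    obtain rfl : s = 0 := Nat.le_zero.1 hs.1
    obtain rfl : j = -1 := by omega
    change (hQ.twist hRS f M).f 1 (-1) (hQ.seq 1) =
      alpShift P.op 0 hj ((hQ.twist hRS f M).f 0 (-1) Q.κ)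
    rw [hQ.twist_κ, hQ.twist_sub hRS f (hQ.seq_mem 0), hQ.taylor_seq hRS f ht hfm]
    exact ht.alpShift_κ.symm

variable (hP : IsDG P) (hfd : ∀ {n : ℕ} {i j : ℤ} (h : i + -1 = j) (x : Q.dg.op.X n i),
  f.f n j (Q.dg.d h x) = P.d h (f.f n i x)) (hm : ∀ n, P.d rfl (m n) = stash P.op m n)
include hP hfd hm

omit hm in
theorem IsCurv.twist_d_sub {n : ℕ} {i j : ℤ} (h : i + -1 = j) {q : Q.dg.op.X n i}
    (hq : q ∈ Q.sub.carrier n i) : (twistDG hP).d h ((hQ.twist hRS f M).f n i q) =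
      (hQ.twist hRS f M).f n j (Q.dg.d h q) := by
  have hnab' : ∀ {s n : ℕ} {i j k : ℤ} (h : i + -1 = j) (h' : j + 1 = k) (q : Q.dg.op.X n i),
      Slot S s n → q ∈ Q.sub.carrier n i → nabla hQ.shift s (show i + 0 = k by omega) q =
        hQ.shift s h' (Q.dg.d h q) := by
    intro s n i j k h h' q hs hq
    rw [nabla, bracket_odd s (by omega) h h' rfl (by omega), hQ.shift_sub rfl hq hs,
      LinearMap.map_zero, add_zero]
  have hkap : ∀ {s n : ℕ} {i j k : ℤ} (h : i + -1 = j) (h' : j + 1 = k) (q : Q.dg.op.X n i),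
      Slot S s n → q ∈ Q.sub.carrier n i →
      kapShift P.op s h' ((twistDG hP).d h ((hQ.twist hRS f M).f n i q)) =
        alpShift P.op s (show i + 0 = k by omega) ((hQ.twist hRS f M).f n i q) := by
    intro s n i j k h h' q hs hq
    refine Eq.trans ?_ (nabla_kapShift hP (show i + 0 = k by omega) hs
      ((hQ.twist hRS f M).f n i q))
    refine Eq.trans ?_ (bracket_odd (A := compl (withT P.op)) (d := twistDiff hP)
      (D := kapShift P.op) s (by omega) h h' rfl (by omega) ((hQ.twist hRS f M).f n i q)).symm
    have h0 : kapShift P.op s rfl ((hQ.twist hRS f M).f n i q) = 0 := by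
      rw [hQ.twist_sub hRS f hq]
      exact kapShift_kappaFree rfl (hQ.taylor_mem hRS f q)
    exact (((congrArg _ (congrArg (twistDiff hP (n := n + 1) (by omega)) h0)).trans
      (congrArg _ (LinearMap.map_zero _))).trans (add_zero _)).symm
  refine sub_eq_zero.1 (eq_zero_of_alpShift hRS (C := SubDiff (A := Q.dg.op)
    (B := compl (withT P.op)) Q.sub (-1)
    (fun n i j h q => (twistDG hP).d h ((hQ.twist hRS f M).f n i q))
    (fun n i j h q => (hQ.twist hRS f M).f n j (Q.dg.d h q))) ?_ ?_ ?_ (.mk h q hq))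
  · rintro _ _ _ ⟨h, q, hq⟩
    refine mem_kappaFree_of_kapShift hRS rfl fun s hs => ?_
    refine (LinearMap.map_sub _ _ _).trans (sub_eq_zero.2 ?_)
    refine (hkap h rfl q hs hq).trans ((hQ.alpShift_twist hRS f ht hfm _ hs q).symm.trans ?_)
    rw [hnab' h rfl q hs hq]
    exact hQ.kapShift_twist hRS f ht rfl hs _
  · rintro _ _ _ ⟨h, q, hq⟩
    refine ((epsilonHom P.op).f _ _).map_sub _ _ |>.trans (sub_eq_zero.2 ?_)
    refine (epsilon_d hP h _).trans ?_
    refine (congrArg (P.d h) (hQ.epsilon_twist hRS f ht hfm q)).trans ?_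
    exact (hfd h q).symm.trans (hQ.epsilon_twist hRS f ht hfm _).symm
  · rintro s _ _ k _ h' ⟨h, q, hq⟩ hs
    refine (congrArg (SubDiff _ _ _ _ _ _) ((LinearMap.map_sub _ _ _).trans (congrArg₂
      (α := (compl (withT P.op)).X _ _) (β := (compl (withT P.op)).X _ _) (· - ·) ?_ ?_))).mpr
      (SubDiff.mk (show _ + 0 + -1 = k by omega) (nabla hQ.shift s rfl q)
        (hQ.nabla_mem_sub rfl hq hs))
    · refine (alpShift_d hP hs rfl (by omega) h h' _).symm.trans ?_
      exact congrArg ((twistDG hP).d _) (hQ.alpShift_twist hRS f ht hfm rfl hs q).symm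
    · refine (hQ.alpShift_twist hRS f ht hfm h' hs _).symm.trans ?_
      exact congrArg _ (nabla_d hQ.isDG s rfl _ h h' q).symm

theorem IsCurv.twist_d {n : ℕ} {i j : ℤ} (h : i + -1 = j) (x : Q.dg.op.X n i) :
    (hQ.twist hRS f M).f n j (Q.dg.d h x) =
      (twistDG hP).d h ((hQ.twist hRS f M).f n i x) := by
  have hT := isDG_twistDG hP
  induction x using hQ.induction generalizing j with
  | sub q hq => exact (hQ.twist_d_sub hRS f ht hfm hP hfd h hq).symm
  | kappa =>
    subst h
    refine (congrArg _ hQ.d_kappa).trans ((LinearMap.map_neg _ _).trans ?_)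
    refine Eq.trans ?_ ((congrArg ((twistDG hP).d rfl) (hQ.twist_κ hRS f)).trans
      (ht.d_κ hRS hm)).symm
    refine congrArg Neg.neg ((Op.Hom.map_comp _ _ _ _ _ _).trans ?_)
    rw [hQ.twist_κ, hQ.twist_sub hRS f (hQ.seq_mem 0), hQ.taylor_seq hRS f ht hfm]
  | comp a hl hk p q hp hq =>
    rw [hQ.isDG.leibniz a hl hk rfl rfl h, LinearMap.map_add, LinearMap.map_smul, Op.Hom.map_comp,
      Op.Hom.map_comp, hp, hq]
    refine Eq.trans ?_ (congrArg ((twistDG hP).d h) (Op.Hom.map_comp _ a hl hk p q)).symm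
    exact (hT.leibniz a hl hk rfl rfl h _ _).symm
  | act hS σ p hp =>
    rw [hQ.isDG.d_act, Op.Hom.map_act, hp]
    refine Eq.trans ?_ (congrArg ((twistDG hP).d h) (Op.Hom.map_act _ hS σ p)).symm
    exact (hT.d_act hS σ h _).symm
  | add p q hp hq =>
    rw [LinearMap.map_add, LinearMap.map_add, hp, hq, LinearMap.map_add]
    exact (LinearMap.map_add ((twistDG hP).d h) _ _).symm
  | smul r p hp =>
    rw [LinearMap.map_smul, LinearMap.map_smul, hp, LinearMap.map_smul]
    exact (LinearMap.map_smul ((twistDG hP).d h) _ _).symm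

/-- The morphism of quadruples that corresponds to a morphism of dg operads. -/
def IsCurv.twistQuadHom : Quad.Hom Q (twistedQuad hP M) where
  toDG := ⟨hQ.twist hRS f M, hQ.twist_d hRS f ht hfm hP hfd hm⟩
  map_κ := hQ.twist_κ hRS f
  map_sub {n i p} hp :=
    (congrArg (· ∈ (kappaFree P.op).carrier n i) (hQ.twist_sub hRS f hp)).mpr
      (hQ.taylor_mem hRS f p)

end Lift

section Unique

variable {R : Type v} [CommRing R] {S : Prop} {Q : Quad.{v, max v w} R S} (hQ : IsCurv Q)
  {P : PreDG.{v, w} R S} {hP : IsDG P} (hRS : S → ∀ n : ℕ, IsUnit ((n + 1 : ℕ) : R))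
  {m : ∀ n : ℕ, P.op.X n (-1)} {M : ∀ n : ℕ, (compl (withT P.op)).X n (-1)}
  (ht : TwistSeq m M) (hR : IsCurv (twistedQuad hP M))
include hQ hRS ht hR

/-- A morphism to the completed coproduct is determined by its composite with the counit. -/
theorem twistedQuad_hom_ext {G G' : Quad.Hom Q (twistedQuad hP M)}
    (h : ∀ {n : ℕ} {i : ℤ} (x : Q.dg.op.X n i), epsilon P.op ((PreDG.Hom.toHom G.toDG).f n i x) =
      epsilon P.op ((PreDG.Hom.toHom G'.toDG).f n i x)) : G = G' := by
  refine Quad.Hom.ext' (PreDG.Hom.ext' fun n i x => ?_)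
  induction x using hQ.induction with
  | @sub n i q hq =>
    refine sub_eq_zero.1 (eq_zero_of_alpShift hRS (P := P.op) (C := fun n i x =>
      ∃ q ∈ Q.sub.carrier n i, x = (PreDG.Hom.toHom G.toDG).f n i q -
        (PreDG.Hom.toHom G'.toDG).f n i q) ?_ ?_ ?_ ⟨q, hq, rfl⟩)
    · rintro n i _ ⟨q, hq, rfl⟩
      exact sub_mem (G.map_sub hq) (G'.map_sub hq)
    · rintro n i _ ⟨q, hq, rfl⟩
      exact ((epsilonHom P.op).f n i).map_sub _ _ |>.trans (sub_eq_zero.2 (h q))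
    · rintro s n i j _ h' ⟨q, hq, rfl⟩ hs
      refine ⟨nabla hQ.shift s h' q, hQ.nabla_mem_sub h' hq hs, ?_⟩
      refine (LinearMap.map_sub _ _ _).trans (congrArg₂
        (α := (compl (withT P.op)).X _ _) (β := (compl (withT P.op)).X _ _) (· - ·) ?_ ?_)
      · exact (ht.nabla_eq hR h' hs _).symm.trans (hQ.hom_nabla hR G h' hs q).symm
      · exact (ht.nabla_eq hR h' hs _).symm.trans (hQ.hom_nabla hR G' h' hs q).symm
  | kappa => exact G.map_κ.trans G'.map_κ.symm
  | comp a hl hk p q hp hq => rw [Op.Hom.map_comp, Op.Hom.map_comp, hp, hq]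
  | act hS σ p hp => rw [Op.Hom.map_act, Op.Hom.map_act, hp]
  | add p q hp hq => rw [map_add, map_add, hp, hq]
  | smul r p hp => rw [map_smul, map_smul, hp]

end Unique
end
end TwistOperad

namespace TwistOperad

noncomputable section

section Fills

variable {R : Type v} [CommRing R] {S : Prop} {ι : Type} [AddCommMonoid ι] {deg : ι →+ ℤ}
  (A : Op.{v, w} R S ι deg) {e : ι} (x : A.X 0 e)

theorem fill_succ (k : ℕ) {m m' l : ℕ} {i i' j : ι} (b : ℕ) (hb : b ≤ l) (hm : m = l + (k + 1))
    (hm' : m' = l + k) (hi : i + e = i') (h : i + (k + 1) • e = j) (y : A.X m i) :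
    A.fill x (k + 1) b hb hm h y = A.fill x k b hb hm' (by rw [← h, ← hi, succ_nsmul, add_assoc, add_comm e])
      (A.comp (⟨b, by omega⟩ : Fin m) (n := 0) (by omega) hi y x) := by
  subst hm' hi
  rfl

/-- The last of several copies of an operation can be plugged in separately. -/
theorem fill_succ_last (k : ℕ) : ∀ {m l : ℕ} {i i' j : ι} (b : ℕ) (hb : b ≤ l)
    (hm : m = l + (k + 1)) (hi : i + k • e = i') (hj : i' + e = j) (h : i + (k + 1) • e = j)
    (y : A.X m i), A.fill x (k + 1) b hb hm h y =
      plug x hj b hb (A.fill x k (l := l + 1) b (by omega) (by omega) hi y) := by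
  induction k with
  | zero =>
    intro m l i i' j b hb hm hi hj h y
    obtain rfl : i = i' := by simpa using hi
    subst hj
    obtain rfl : m = l + 1 := hm
    rw [fill_succ A x 0 (m' := l) b hb rfl rfl rfl]
    rfl
  | succ k ih =>
    intro m l i i' j b hb hm hi hj h y
    refine (fill_succ A x (k + 1) (m' := l + (k + 1)) b hb hm rfl rfl h y).trans ?_
    refine (ih b hb rfl (by rw [← hi, succ_nsmul, add_assoc, add_comm e]) hj _ _).trans ?_
    exact congrArg (plug x hj b hb)
      (fill_succ A x k (m' := l + (k + 1)) b (by omega) (by omega) (by omega) rfl hi y).symm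

theorem fills_cons (k : ℕ) (L : List ℕ) {m m' l : ℕ} {i i' j : ι} (b : ℕ)
    (hb : b + (k :: L).length ≤ l + 1) (hm : m = l + (k :: L).sum) (hm' : m' = l + L.sum)
    (hi : i + k • e = i') (h : i + (k :: L).sum • e = j) (y : A.X m i) :
    A.fills x (k :: L) b hb hm h y = A.fills x L (b + 1) (by simp at hb; omega) hm'
      (by rw [← h, ← hi, List.sum_cons, add_nsmul, add_assoc])
      (A.fill x k b (by simp at hb; omega) (by simp at hm; omega) hi y) := by
  subst hm' hi
  rfl

theorem fills_append (c : ℕ) : ∀ (L : List ℕ) {m m' l : ℕ} {i i' j : ι} (b : ℕ)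
    (hb : b + (L ++ [c]).length ≤ l + 1) (hm : m = l + (L ++ [c]).sum) (hm' : m' = l + c)
    (hi : i + L.sum • e = i') (hj : i' + c • e = j) (h : i + (L ++ [c]).sum • e = j) (y : A.X m i),
    A.fills x (L ++ [c]) b hb hm h y = A.fill x c (b + L.length) (by simp at hb; omega) hm' hj
      (A.fills x L b (by simp at hb; omega) (by simp at hm; omega) hi y)
  | [], m, m', l, i, i', j, b, hb, hm, hm', hi, hj, h, y => by
    obtain rfl : i = i' := by simpa using hi
    subst hj
    obtain rfl : m = m' := by simp at hm; omega
    exact (fills_cons A x c [] (m' := l) b hb hm rfl rfl h y).trans rfl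
  | k :: L, m, m', l, i, i', j, b, hb, hm, hm', hi, hj, h, y => by
    have h0 : i + k • e + L.sum • e = i' := by
      rw [← hi, List.sum_cons, add_nsmul, add_assoc]
    have hs : m' + L.sum = l + (L ++ [c]).sum := by simp; omega
    refine (fills_cons A x k (L ++ [c]) (m' := m' + L.sum) b hb hm hs rfl h y).trans ?_
    refine (fills_append c L (m' := m') (i' := i') (b + 1) _ hs hm' h0 hj _ _).trans ?_
    rw [fills_cons A x k L (m' := m' + L.sum) b _ _ rfl rfl hi]
    congr 2
    rw [List.length_cons]
    omega

end Fills

section TaylorSeq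

variable {R : Type v} [CommRing R] {S : Prop} {A : ZOp.{v, w'} R S} {P : ZOp.{v, w} R S}
  {N : ShiftMap A A 0} {f : Op.Hom A P} {r : ℕ → R} {u : ∀ n, A.X n (-1)}

theorem taylorCoeff_seq_zero (hu : ∀ n, N 0 (add_zero (-1)) (u n) = u (n + 1)) (k : ℕ) :
    ∀ {n t : ℕ} (ht : t = n + k), taylorCoeff N f r k 0 (u n) = (∏ j ∈ Finset.range k, r j) •
      (withT P).fill (alpha P) k 0 (Nat.zero_le n) ht (idx_nsmul (-1) k)
        (inOld P tDeg rfl (f.f t (-1) (u t))) := by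
  induction k with
  | zero =>
    intro n t ht
    obtain rfl : t = n := ht
    rw [Finset.prod_range_zero, one_smul]
    rfl
  | succ k ih =>
    intro n t ht
    rw [taylorCoeff_succ_zero, hu, ih (t := t) (by omega), map_smul, smul_smul,
      Finset.prod_range_succ, mul_comm]
    exact congrArg (_ • ·) (fill_succ_last (withT P) (alpha P) k 0 _ ht (idx_nsmul (-1) k)
      (idx_alpha (-1) k) _ _).symm

/-- `Op.fills` for the operation `α`. -/
def alphaFills (P : ZOp.{v, w} R S) {n k t : ℕ} (ht : t = n + k) (L : List ℕ)
    (hL : L.length ≤ n + 1) (hk : L.sum = k) (y : (withT P).X t (-1, 0, 0)) :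
    (withT P).X n (-1, ((0 : ℕ) : ℤ), (k : ℤ)) :=
  (withT P).fills (alpha P) L 0 (by omega) (by rw [hk]; exact ht)
    (by rw [hk]; exact idx_nsmul (-1) k) y

theorem alphaFills_append_zero {n k t : ℕ} (ht : t = n + k) (L : List ℕ) (hL) (hL') (hk) (hk')
    (y : (withT P).X t (-1, 0, 0)) :
    alphaFills P ht (L ++ [0]) hL hk y = alphaFills P ht L hL' hk' y :=
  (fills_append (withT P) (alpha P) 0 L (m' := n) (i' := (-1, ((0 : ℕ) : ℤ), (k : ℤ)))
    (j := (-1, ((0 : ℕ) : ℤ), (k : ℤ))) 0 _ _ rfl (by rw [hk']; exact idx_nsmul (-1) k)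
    (by simp) _ y).trans rfl

theorem alphaFills_append_succ {n k t : ℕ} (ht : t = n + (k + 1)) (ht' : t = n + 1 + k) (c : ℕ)
    (L : List ℕ) (hL) (hL') (hk) (hk') {b : ℕ} (hb' : L.length = b) (hb : b ≤ n) (y : (withT P).X t (-1, 0, 0)) :
    alphaFills P ht (L ++ [c + 1]) hL hk y =
      plug (alpha P) (idx_alpha (-1) k) b hb (alphaFills P ht' (L ++ [c]) hL' hk' y) := by
  subst hb'
  have hs : L.sum + c = k := by simpa using hk'
  have h1 : ((-1, 0, 0) : Tri) + L.sum • ((0, 0, 1) : Tri) = (-1, ((0 : ℕ) : ℤ), (L.sum : ℤ)) :=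
    idx_nsmul (-1) _
  have h2 : ((-1, ((0 : ℕ) : ℤ), (L.sum : ℤ)) : Tri) + c • ((0, 0, 1) : Tri) =
      (-1, ((0 : ℕ) : ℤ), (k : ℤ)) := by
    rw [← hs]
    simp
  have h3 : ((-1, ((0 : ℕ) : ℤ), (L.sum : ℤ)) : Tri) + (c + 1) • ((0, 0, 1) : Tri) =
      (-1, ((0 : ℕ) : ℤ), ((k + 1 : ℕ) : ℤ)) := by
    rw [← hs]
    simp [add_assoc]
  have e1 : ∀ b (hb : b ≤ n), b = L.length → ∀ z,
      (withT P).fill (alpha P) (c + 1) b hb (rfl : n + (c + 1) = n + (c + 1)) h3 z =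
        plug (alpha P) (idx_alpha (-1) k) L.length (by omega)
          ((withT P).fill (alpha P) c (l := n + 1) b (by omega) (by omega) h2 z) := by
    rintro _ hb rfl z
    exact fill_succ_last (withT P) (alpha P) c _ hb rfl h2 (idx_alpha (-1) k) h3 z
  refine (fills_append (withT P) (alpha P) (c + 1) L (m' := n + (c + 1)) 0 _ _ rfl h1 h3 _ y).trans
    ((e1 _ _ (zero_add _) _).trans (congrArg _ ?_))
  exact (fills_append (withT P) (alpha P) c L (m' := n + (c + 1)) 0 _ _ (by omega) h1 h2 _ y).symm

theorem alphaFills_congr {n k t : ℕ} (ht : t = n + k) {L L' : List ℕ} (h : L = L') (hL) (hL') (hk)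
    (hk') (y : (withT P).X t (-1, 0, 0)) :
    alphaFills P ht L hL hk y = alphaFills P ht L' hL' hk' y := by
  subst h
  rfl

/-- The sum of all ways to plug `k` copies of `α`, in order, into the places after at most `b`
inputs. -/
def alphaSum (P : ZOp.{v, w} R S) {n t : ℕ} (b k : ℕ) (hb : b ≤ n) (ht : t = n + k)
    (y : (withT P).X t (-1, 0, 0)) : (withT P).X n (-1, ((0 : ℕ) : ℤ), (k : ℤ)) :=
  ∑ s : {s : Fin (b + 1) → ℕ // s ∈ Finset.Nat.antidiagonalTuple (b + 1) k},
    alphaFills P ht (List.ofFn s.1) (by simpa using hb)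
      (by rw [List.sum_ofFn]; exact Finset.Nat.mem_antidiagonalTuple.1 s.2) y

theorem alphaSum_zero {n t : ℕ} (k : ℕ) (ht : t = n + k) (y : (withT P).X t (-1, 0, 0)) :
    alphaSum P 0 k (Nat.zero_le n) ht y =
      (withT P).fill (alpha P) k 0 (Nat.zero_le n) ht (idx_nsmul (-1) k) y := by
  refine (Fintype.sum_eq_single ⟨![k], by simp [Finset.Nat.mem_antidiagonalTuple]⟩
    fun s hs => (hs (Subtype.ext ?_)).elim).trans ?_
  · exact Finset.mem_singleton.1 ((Finset.Nat.antidiagonalTuple_one k).subset s.2)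
  · exact (alphaFills_congr ht (L' := [k]) (by simp) _ (by simp) _ (by simp) y).trans
      ((fills_cons (withT P) (alpha P) k [] (m' := n) (i' := (-1, ((0 : ℕ) : ℤ), (k : ℤ)))
        (j := (-1, ((0 : ℕ) : ℤ), (k : ℤ))) 0 _ _ rfl (idx_nsmul (-1) k) _ y).trans rfl)

theorem alphaSum_succ_zero {n t b : ℕ} (hb : b + 1 ≤ n) (ht : t = n + 0)
    (y : (withT P).X t (-1, 0, 0)) :
    alphaSum P (b + 1) 0 hb ht y = alphaSum P b 0 (by omega) ht y := by
  refine (Fintype.sum_eq_single ⟨0, by simp [Finset.Nat.mem_antidiagonalTuple]⟩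
    fun s hs => (hs (Subtype.ext ?_)).elim).trans (Eq.trans ?_ (Fintype.sum_eq_single
    ⟨0, by simp [Finset.Nat.mem_antidiagonalTuple]⟩ fun s hs => (hs (Subtype.ext ?_)).elim).symm)
  · exact Finset.mem_singleton.1 ((Finset.Nat.antidiagonalTuple_zero_right _).subset s.2)
  · have hL : List.ofFn (0 : Fin (b + 1 + 1) → ℕ) = List.ofFn (0 : Fin (b + 1) → ℕ) ++ [0] := by
      rw [List.ofFn_succ', List.concat_eq_append]
      rfl
    exact (alphaFills_congr ht hL _ (by simp; omega) _ (by simp) y).trans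
      (alphaFills_append_zero ht _ _ _ _ _ y)
  · exact Finset.mem_singleton.1 ((Finset.Nat.antidiagonalTuple_zero_right _).subset s.2)

theorem ofFn_snoc {b : ℕ} (s : Fin b → ℕ) (c : ℕ) :
    List.ofFn (Fin.snoc s c : Fin (b + 1) → ℕ) = List.ofFn s ++ [c] := by
  rw [List.ofFn_succ', List.concat_eq_append]
  simp

theorem snoc_inj_nat {b : ℕ} {s t : Fin b → ℕ} {c d : ℕ}
    (h : (Fin.snoc s c : Fin (b + 1) → ℕ) = Fin.snoc t d) : s = t ∧ c = d := Fin.snoc_inj.1 h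

theorem alphaSum_succ_succ {n t b k : ℕ} (hb : b + 1 ≤ n) (ht : t = n + (k + 1))
    (ht' : t = n + 1 + k) (y : (withT P).X t (-1, 0, 0)) :
    alphaSum P (b + 1) (k + 1) hb ht y = alphaSum P b (k + 1) (by omega) ht y +
      plug (alpha P) (idx_alpha (-1) k) (b + 1) hb (alphaSum P (b + 1) k (by omega) ht' y) := by
  let e : {s : Fin (b + 1) → ℕ // s ∈ Finset.Nat.antidiagonalTuple (b + 1) (k + 1)} ⊕
      {s : Fin (b + 2) → ℕ // s ∈ Finset.Nat.antidiagonalTuple (b + 2) k} →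
      {s : Fin (b + 2) → ℕ // s ∈ Finset.Nat.antidiagonalTuple (b + 2) (k + 1)} := Sum.elim
    (fun s => ⟨Fin.snoc s.1 0, by
      have := Finset.Nat.mem_antidiagonalTuple.1 s.2
      rw [Finset.Nat.mem_antidiagonalTuple, Fin.sum_snoc, this, add_zero]⟩)
    (fun s => ⟨Fin.snoc (Fin.init s.1) (s.1 (Fin.last _) + 1), by
      have := Finset.Nat.mem_antidiagonalTuple.1 s.2
      rw [Fin.sum_univ_castSucc] at this
      rw [Finset.Nat.mem_antidiagonalTuple, Fin.sum_snoc, ← add_assoc]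
      exact congrArg (· + 1) this⟩)
  have he : Function.Bijective e := by
    constructor
    · rintro (⟨s, hs⟩ | ⟨s, hs⟩) (⟨t, ht⟩ | ⟨t, ht⟩) h
      · obtain rfl : s = t := (snoc_inj_nat (congrArg Subtype.val h)).1
        rfl
      · have := (snoc_inj_nat (congrArg Subtype.val h)).2
        omega
      · have := (snoc_inj_nat (congrArg Subtype.val h)).2
        omega
      · have h1 := snoc_inj_nat (congrArg Subtype.val h)
        have h2 : s (Fin.last _) = t (Fin.last _) := Nat.succ_injective h1.2
        have h3 : (Fin.init s : Fin (b + 1) → ℕ) = Fin.init t := h1.1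
        obtain rfl : s = t := by
          rw [← Fin.snoc_init_self s, ← Fin.snoc_init_self t, h2, h3]
        rfl
    · rintro ⟨s, hs⟩
      have hs' := Finset.Nat.mem_antidiagonalTuple.1 hs
      rw [Fin.sum_univ_castSucc] at hs'
      rcases h : s (Fin.last _) with _ | c
      · refine ⟨.inl ⟨Fin.init s, ?_⟩, Subtype.ext ?_⟩
        · rw [Finset.Nat.mem_antidiagonalTuple, ← hs', h]
          rfl
        · change Fin.snoc (Fin.init s) 0 = s
          rw [← h, Fin.snoc_init_self]
      · refine ⟨.inr ⟨Fin.snoc (Fin.init s) c, ?_⟩, Subtype.ext ?_⟩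
        · rw [Finset.Nat.mem_antidiagonalTuple, Fin.sum_snoc]
          rw [h] at hs'
          exact Nat.succ_injective hs'
        · change Fin.snoc (Fin.init (Fin.snoc (Fin.init s) c : Fin (b + 2) → ℕ))
            ((Fin.snoc (Fin.init s) c : Fin (b + 2) → ℕ) (Fin.last _) + 1) = s
          rw [Fin.init_snoc, Fin.snoc_last, ← h, Fin.snoc_init_self]
  rw [alphaSum, alphaSum, alphaSum, map_sum]
  refine (Fintype.sum_bijective e he _ _ fun s => rfl).symm.trans ((Fintype.sum_sum_type _).trans
    (congrArg₂ (· + ·) (Finset.sum_congr rfl fun s _ => ?_) (Finset.sum_congr rfl fun s _ => ?_)))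
  · have hsum : (List.ofFn s.1).sum = k + 1 := by
      rw [List.sum_ofFn]
      exact Finset.Nat.mem_antidiagonalTuple.1 s.2
    exact (alphaFills_congr ht (ofFn_snoc _ _) _ (by simp; omega) _
      (by rw [List.sum_append, hsum]; rfl) y).trans
      (alphaFills_append_zero ht _ _ _ _ _ y)
  · have hs : List.ofFn s.1 = List.ofFn (Fin.init s.1 : Fin (b + 1) → ℕ) ++ [s.1 (Fin.last _)] := by
      rw [← ofFn_snoc, Fin.snoc_init_self]
    have hsum : (List.ofFn s.1).sum = k := by
      rw [List.sum_ofFn]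
      exact Finset.Nat.mem_antidiagonalTuple.1 s.2
    rw [hs] at hsum
    refine (alphaFills_congr ht (ofFn_snoc _ _) _ (by simp; omega) _ ?_ y).trans
      ((alphaFills_append_succ ht ht' _ _ _ (by simp; omega) _ hsum (by simp) hb y).trans
        (congrArg _ (alphaFills_congr ht' hs.symm _ _ _ _ y)))
    rw [List.sum_append, List.sum_singleton] at hsum ⊢
    omega

theorem taylorCoeff_seq_ns (hr : ¬S → ∀ k : ℕ, r k = 1) (hS : ¬S)
    (hu : ∀ {s n}, Slot S s n → N s (add_zero (-1)) (u n) = u (n + 1)) (k : ℕ) :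
    ∀ {b n t : ℕ} (hb : b ≤ n) (ht : t = n + k), taylorCoeff N f r k b (u n) =
      alphaSum P b k hb ht (inOld P tDeg rfl (f.f t (-1) (u t))) := by
  have h0 : ∀ {n t : ℕ} (k : ℕ) (ht : t = n + k), taylorCoeff N f r k 0 (u n) =
      alphaSum P 0 k (Nat.zero_le n) ht (inOld P tDeg rfl (f.f t (-1) (u t))) := by
    intro n t k ht
    rw [alphaSum_zero, taylorCoeff_seq_zero (fun n => hu (slot_zero S n)) k ht,
      Finset.prod_eq_one fun j _ => hr hS j, one_smul]
  induction k with
  | zero =>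
    intro b
    induction b with
    | zero => exact fun _ ht => h0 0 ht
    | succ b ih =>
      intro n t hb ht
      rw [alphaSum_succ_zero, ← ih]
      rfl
  | succ k ih =>
    intro b
    induction b with
    | zero => exact fun _ ht => h0 _ ht
    | succ b ihb =>
      intro n t hb ht
      rw [alphaSum_succ_succ hb ht (by omega), ← ihb, ← ih,
        ← hu (s := b + 1) (n := n) ⟨hb, fun h => (hS h).elim⟩]
      rw [taylorCoeff_succ, taylorCoeff_succ, hr hS, one_smul, one_smul]
      rw [← Finset.sum_filter, ← Finset.sum_filter, show
        (Finset.univ.filter fun j : Fin (n + 1) => (j : ℕ) ≤ b + 1) =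
          insert ⟨b + 1, by omega⟩ (Finset.univ.filter fun j : Fin (n + 1) => (j : ℕ) ≤ b) by
            ext j
            simp only [Finset.mem_filter, Finset.mem_univ, true_and, Finset.mem_insert, Fin.ext_iff]
            omega, Finset.sum_insert (by simp)]
      exact add_comm _ _

end TaylorSeq
end
end TwistOperad

namespace TwistOperad

noncomputable section

section Adjunction

variable {R : Type v} [CommRing R] {S : Prop}

theorem epsilon_twistMap {P P' : PreDG.{v, w} R S} (hP : IsDG P) (hP' : IsDG P') (F : P ⟶ P')
    {n : ℕ} {i : ℤ} (x : (compl (withT P.op)).X n i) :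
    epsilon P'.op ((PreDG.Hom.toHom (twistMap hP hP' F)).f n i x) =
      (PreDG.Hom.toHom F).f n i (epsilon P.op x) := by
  obtain ⟨p, hp⟩ := isWeight_tDeg_total.inOld_surjective total_tDeg_pos
    (rfl : ((i, 0, 0) : Tri) = (i, ((0 : ℕ) : ℤ), ((0 : ℕ) : ℤ))) ((x : complX _ n i).1 (0, 0))
  have h1 : epsilon P.op x = p := (congrArg (adjEval (Op.Hom.id P.op) tDeg fun _ => 0) hp).trans
    (adjEval_old (Op.Hom.id P.op) tDeg (fun _ => 0) rfl p)
  rw [h1]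
  refine (congrArg (fun y => adjEval (Op.Hom.id P'.op) tDeg (fun _ => 0)
    ((adjMap (PreDG.Hom.toHom F) tDeg).f n _ y)) hp).trans ?_
  refine (congrArg (adjEval (Op.Hom.id P'.op) tDeg fun _ => 0) (adjMap_old _ _ _ _)).trans ?_
  exact adjEval_old (Op.Hom.id P'.op) tDeg (fun _ => 0) rfl _

variable {D : ∀ n : ℕ, (muOp.{v, w} R S).X n (-1 + -1)}
  {hD : ∀ (hS : S) (n : ℕ) (σ : Equiv.Perm (Fin n)), (muOp R S).act hS σ (D n) = D n}
  (hA : IsCurv (muQuad D hD)) (hRS : S → ∀ n : ℕ, IsUnit ((n + 1 : ℕ) : R)) (c : ℕ → R)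

/-- The dg operad that underlies a `muQuad`. -/
abbrev muBase : DGOp.{v, max v w} R S := (Curv.forget R S).obj ⟨muQuad D hD, hA⟩

/-- The twisted operations of a dg operad with a morphism from a `muQuad`. -/
def twistedOps {P : PreDG.{v, max v w} R S} (f : Op.Hom (muOp.{v, w} R S) P.op) :
    ∀ n : ℕ, (compl (withT P.op)).X n (-1)
  | 0 => series P.op fun k => c k • (withT P.op).fill (alpha P.op) k 0 le_rfl (zero_add k).symm
      (idx_nsmul (-1) k) (inOld P.op tDeg rfl (f.f k (-1) (mu R S k)))
  | n + 1 => (hA.taylor hRS (P := P) f).f (n + 1) (-1) (mu R S (n + 1))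

variable (hst : ∀ n, D n = stash (muOp.{v, w} R S) (mu R S) n)
  {c} (hc : ∀ k, c k = ∏ j ∈ Finset.range k, taylorFactor R S j)
include hst hc

omit hc in
theorem nabla_mu_slot {s n : ℕ} (hs : Slot S s n) :
    nabla hA.shift s (add_zero (-1)) (mu R S n) = mu R S (n + 1) := by
  have h := hA.nabla_seq hs (add_zero (-1))
  rw [seq_muQuad hA hst, seq_muQuad hA hst] at h
  exact h

theorem twistedOps_eq {P : PreDG.{v, max v w} R S} (f : Op.Hom (muOp.{v, w} R S) P.op) (n : ℕ) :
    twistedOps hA hRS c f n = (hA.taylor hRS (P := P) f).f n (-1) (mu R S n) := by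
  cases n with
  | zero =>
    refine mem_kappaFree_ext (series_mem _) (hA.taylor_mem hRS _ _) fun k => ?_
    refine Eq.trans ?_ (Eq.trans (taylorCoeff_seq_zero (r := taylorFactor R S) (u := mu R S) (f := f)
      (fun n => nabla_mu_slot hA hst (slot_zero S n)) k (zero_add k).symm).symm ?_)
    · exact congrArg (· • _) (hc k)
    · change _ = taylorCoeff _ _ _ k _ _
      rw [ite_self]
      rfl
  | succ n => rfl

theorem twistSeq_twistedOps {P : PreDG.{v, max v w} R S} (f : Op.Hom (muOp.{v, w} R S) P.op) :
    TwistSeq (fun n => f.f n (-1) (mu R S n)) (twistedOps hA hRS c f) where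
  alpha n := by
    rw [twistedOps_eq hA hRS hst hc, twistedOps_eq hA hRS hst hc,
      ← nabla_mu_slot hA hst (slot_zero S n)]
    exact hA.alpShift_taylor hRS (P := P) f (add_zero (-1)) (mu R S n) (slot_zero S n)
  free n := by
    rw [twistedOps_eq hA hRS hst hc]
    exact hA.taylor_mem hRS (P := P) f _
  eps n := by
    rw [twistedOps_eq hA hRS hst hc]
    exact hA.epsilon_taylor hRS (P := P) f _

omit hc in
theorem d_under (Y : Under (muBase hA)) (n : ℕ) :
    Y.right.obj.d rfl ((PreDG.Hom.toHom Y.hom.hom).f n (-1) (mu R S n)) =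
      stash Y.right.obj.op (fun n => (PreDG.Hom.toHom Y.hom.hom).f n (-1) (mu R S n)) n := by
  refine ((PreDG.Hom.map_d Y.hom.hom rfl (mu R S n)).symm.trans ?_)
  exact (congrArg _ (hst n)).trans (stash_map _ _ _)

include hRS in
theorem isCurv_twistFunctor (Y : Under (muBase hA)) :
    IsCurv ((twistFunctor c (muBase hA) (mu R S)).obj Y) :=
  (twistSeq_twistedOps hA hRS hst hc (P := Y.right.obj) (PreDG.Hom.toHom Y.hom.hom)).isCurv
    Y.right.property hRS (d_under hA hst Y)

variable (hI : Limits.IsInitial (⟨muQuad D hD, hA⟩ : Curv.{v, max v w} R S))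
  (hR : ∀ Y, IsCurv ((twistFunctor c (muBase hA) (mu R S)).obj Y))

variable (c) in
omit hst hc in
/-- The functor from the dg operads under a `muQuad` to curved operads. -/
abbrev rightFunctor (hR : ∀ Y, IsCurv ((twistFunctor c (muBase hA) (mu R S)).obj Y)) :
    Under (muBase hA) ⥤ Curv.{v, max v w} R S :=
  ObjectProperty.lift _ (twistFunctor c (muBase hA) (mu R S)) hR

omit hc in
theorem initial_mu (X : Curv.{v, max v w} R S) (n : ℕ) :
    (PreDG.Hom.toHom (Quad.Hom.toDG (hI.to X).hom)).f n (-1) (mu R S n) = X.property.seq n :=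
  (congrArg _ (seq_muQuad hA hst n).symm).trans (hA.hom_seq X.property (hI.to X).hom n)

include hRS in
theorem epsilon_under_seq (Y : Under (muBase hA)) (n : ℕ) :
    epsilon Y.right.obj.op ((hR Y).seq n) =
      (PreDG.Hom.toHom Y.hom.hom).f n (-1) (mu R S n) :=
  (twistSeq_twistedOps hA hRS hst hc (P := Y.right.obj) (PreDG.Hom.toHom Y.hom.hom)).epsilon_seq
    (hR Y) n

/-- The counit of the adjunction. -/
def twistCounit (Y : Under (muBase hA)) :
    (leftFunctor hI).obj ((rightFunctor hA c hR).obj Y) ⟶ Y :=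
  Under.homMk (ObjectProperty.homMk (⟨epsilonHom Y.right.obj.op, fun h x =>
      epsilon_d Y.right.property h x⟩ : PreDG.Hom (twistDG Y.right.property) Y.right.obj)) (by
    refine ObjectProperty.hom_ext _ (PreDG.Hom.ext' fun n i x => ?_)
    refine pres_hom_ext _ _ (fun n i g => ?_) x
    cases g with
    | mu =>
      exact (congrArg (epsilon Y.right.obj.op) (initial_mu hA hst hI _ n)).trans
        (epsilon_under_seq hA hRS hst hc hR Y n))

theorem twistCounit_naturality {Y Y' : Under (muBase hA)} (F : Y ⟶ Y') :
    (leftFunctor hI).map ((rightFunctor hA c hR).map F) ≫ twistCounit hA hRS hst hc hI hR Y' =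
      twistCounit hA hRS hst hc hI hR Y ≫ F := by
  refine Under.UnderMorphism.ext (ObjectProperty.hom_ext _ (PreDG.Hom.ext' fun n i x => ?_))
  exact epsilon_twistMap Y.right.property Y'.right.property F.right.hom x

/-- The transpose of a morphism of curved operads. -/
def twistTranspose (X : Curv.{v, max v w} R S) (Y : Under (muBase hA))
    (g : X ⟶ (rightFunctor hA c hR).obj Y) : (leftFunctor hI).obj X ⟶ Y :=
  (leftFunctor hI).map g ≫ twistCounit hA hRS hst hc hI hR Y

theorem twistTranspose_injective (X : Curv.{v, max v w} R S) (Y : Under (muBase hA)) :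
    Function.Injective (twistTranspose hA hRS hst hc hI hR X Y) := fun g g' h =>
  ObjectProperty.hom_ext _ (twistedQuad_hom_ext X.property hRS
    (twistSeq_twistedOps hA hRS hst hc (P := Y.right.obj) (PreDG.Hom.toHom Y.hom.hom)) (hR Y)
    fun {n i} x => congrArg (fun F : (leftFunctor hI).obj X ⟶ Y =>
      (PreDG.Hom.toHom F.right.hom).f n i x) h)

theorem twistTranspose_surjective (X : Curv.{v, max v w} R S) (Y : Under (muBase hA)) :
    Function.Surjective (twistTranspose hA hRS hst hc hI hR X Y) := fun F => by
  have ht := twistSeq_twistedOps hA hRS hst hc (P := Y.right.obj) (PreDG.Hom.toHom Y.hom.hom)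
  have hfm : ∀ n, (PreDG.Hom.toHom F.right.hom).f n (-1) (X.property.seq n) =
      (PreDG.Hom.toHom Y.hom.hom).f n (-1) (mu R S n) := fun n => by
    have h := congrArg (fun G : muBase hA ⟶ Y.right => (PreDG.Hom.toHom G.hom).f n (-1) (mu R S n))
      (Under.w F)
    refine Eq.trans ?_ h
    exact congrArg ((PreDG.Hom.toHom F.right.hom).f n (-1)) (initial_mu hA hst hI X n).symm
  refine ⟨ObjectProperty.homMk (X.property.twistQuadHom hRS (P := Y.right.obj)
    (PreDG.Hom.toHom F.right.hom) ht hfm Y.right.property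
    (fun h x => PreDG.Hom.map_d F.right.hom h x) (d_under hA hst Y)), ?_⟩
  refine Under.UnderMorphism.ext (ObjectProperty.hom_ext _ (PreDG.Hom.ext' fun n i x => ?_))
  exact X.property.epsilon_twist hRS (PreDG.Hom.toHom F.right.hom) ht hfm x

/-- The functor to the dg operads under a `muQuad` is left adjoint to the twist. -/
def twistAdjunction : leftFunctor hI ⊣ rightFunctor hA c hR :=
  Adjunction.mkOfHomEquiv
    { homEquiv := fun X Y => (Equiv.ofBijective _
        ⟨twistTranspose_injective hA hRS hst hc hI hR X Y,
          twistTranspose_surjective hA hRS hst hc hI hR X Y⟩).symm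
      homEquiv_naturality_left_symm := fun f g => by
        change twistTranspose hA hRS hst hc hI hR _ _ _ =
          _ ≫ twistTranspose hA hRS hst hc hI hR _ _ _
        rw [twistTranspose, twistTranspose, Functor.map_comp, Category.assoc]
      homEquiv_naturality_right := fun {X Y Y'} f g => by
        rw [Equiv.symm_apply_eq]
        change _ = twistTranspose hA hRS hst hc hI hR _ _ _
        rw [twistTranspose, Functor.map_comp, Category.assoc, twistCounit_naturality,
          ← Category.assoc]
        exact congrArg (· ≫ g) ((Equiv.ofBijective _
          ⟨twistTranspose_injective hA hRS hst hc hI hR X Y,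
            twistTranspose_surjective hA hRS hst hc hI hR X Y⟩).apply_symm_apply f).symm }

theorem twistAdjunction_counit (Y : Under (muBase hA)) :
    (twistAdjunction hA hRS hst hc hI hR).counit.app Y = twistCounit hA hRS hst hc hI hR Y := by
  rw [twistAdjunction, Adjunction.mkOfHomEquiv_counit_app]
  change twistTranspose hA hRS hst hc hI hR _ _ (𝟙 _) = _
  rw [twistTranspose, CategoryTheory.Functor.map_id, Category.id_comp]

theorem seq_twistFunctor (Y : Under (muBase hA)) (n : ℕ) : (hR Y).seq (n + 1) =
    (hA.taylor hRS (P := Y.right.obj) (PreDG.Hom.toHom Y.hom.hom)).f (n + 1) (-1)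
      (mu R S (n + 1)) :=
  (twistSeq_twistedOps hA hRS hst hc (P := Y.right.obj) (PreDG.Hom.toHom Y.hom.hom)).seq_succ
    (hR Y) n

omit hst hc in
theorem initial_apply (n : ℕ) : (PreDG.Hom.toHom (Quad.Hom.toDG
    (hI.to (⟨muQuad D hD, hA⟩ : Curv.{v, max v w} R S)).hom)).f n (-1) (mu R S n) = mu R S n := by
  rw [hI.hom_ext (hI.to _) (𝟙 _)]
  rfl

theorem twistAdjunction_unit_zero :
    DGOp.ev ((Curv.forget R S).map ((twistAdjunction hA hRS hst hc hI hR).unit.app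
      ⟨muQuad D hD, hA⟩)) (mu R S 0) = twistedKappa c (muOp R S) (mu R S) := by
  refine (Quad.Hom.map_κ
    ((twistAdjunction hA hRS hst hc hI hR).unit.app ⟨muQuad D hD, hA⟩).hom).trans ?_
  exact congrArg (twistedKappa c (muOp R S)) (funext fun n => initial_apply hA hI n)

theorem twistAdjunction_unit_succ (n : ℕ) :
    DGOp.ev ((Curv.forget R S).map ((twistAdjunction hA hRS hst hc hI hR).unit.app
      ⟨muQuad D hD, hA⟩)) (mu R S (n + 1)) =
      (hA.taylor hRS (P := muDG D hD) (PreDG.Hom.toHom (Quad.Hom.toDG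
        (hI.to (⟨muQuad D hD, hA⟩ : Curv.{v, max v w} R S)).hom))).f (n + 1) (-1)
        (mu R S (n + 1)) := by
  refine (congrArg _ (seq_muQuad hA hst (n + 1)).symm).trans ((hA.hom_seq (hR _)
    ((twistAdjunction hA hRS hst hc hI hR).unit.app ⟨muQuad D hD, hA⟩).hom (n + 1)).trans ?_)
  exact seq_twistFunctor hA hRS hst hc hR _ n

end Adjunction
end
end TwistOperad

namespace TwistOperad

noncomputable section

section TwistedOperations

theorem prod_taylorFactor_ns {R : Type v} [CommRing R] {S : Prop} (hS : ¬S) (k : ℕ) :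
    1 = ∏ j ∈ Finset.range k, taylorFactor R S j :=
  (Finset.prod_eq_one fun j _ => taylorFactor_ns hS j).symm

theorem isUnit_cast_succ (K : Type v) [Field K] [CharZero K] (n : ℕ) :
    IsUnit ((n + 1 : ℕ) : K) := (Nat.cast_ne_zero.2 n.succ_ne_zero).isUnit

theorem prod_taylorFactor_sym (K : Type v) [Field K] [CharZero K] (k : ℕ) :
    1 / (k.factorial : K) = ∏ j ∈ Finset.range k, taylorFactor K True j := by
  induction k with
  | zero => simp
  | succ k ih =>
    rw [Finset.prod_range_succ, ← ih, taylorFactor, if_pos trivial, Ring.inverse_eq_inv,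
      Nat.factorial_succ, Nat.cast_mul, one_div, one_div, mul_inv, mul_comm]

theorem taylor_mu_ns {R : Type v} [CommRing R]
    {D : ∀ n : ℕ, (muOp.{v, w} R False).X n (-1 + -1)}
    {hD : ∀ (hS : False) (n : ℕ) (σ : Equiv.Perm (Fin n)), (muOp R False).act hS σ (D n) = D n}
    (hA : IsCurv (muQuad D hD)) (hRS : False → ∀ n : ℕ, IsUnit ((n + 1 : ℕ) : R))
    (hst : ∀ n, D n = stash (muOp.{v, w} R False) (mu R False) n)
    {P : PreDG.{v, max v w} R False} (f : Op.Hom (muOp.{v, w} R False) P.op) (n : ℕ) :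
    (hA.taylor hRS (P := P) f).f n (-1) (mu R False n) =
      twistedMu P.op (fun n => f.f n (-1) (mu R False n)) n := by
  refine mem_kappaFree_ext (hA.taylor_mem hRS _ _) (series_mem _) fun k => ?_
  change taylorCoeff _ _ _ k _ _ = _
  rw [if_neg not_false]
  exact taylorCoeff_seq_ns (r := taylorFactor R False) (u := mu R False) (f := f)
    (fun hS _ => taylorFactor_ns hS _) not_false (fun hs => nabla_mu_slot hA hst hs) k le_rfl rfl

theorem taylor_mu_sym {K : Type v} [Field K] [CharZero K]
    {D : ∀ n : ℕ, (muOp.{v, w} K True).X n (-1 + -1)}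
    {hD : ∀ (hS : True) (n : ℕ) (σ : Equiv.Perm (Fin n)), (muOp K True).act hS σ (D n) = D n}
    (hA : IsCurv (muQuad D hD)) (hRS : True → ∀ n : ℕ, IsUnit ((n + 1 : ℕ) : K))
    (hst : ∀ n, D n = stash (muOp.{v, w} K True) (mu K True) n)
    {P : PreDG.{v, max v w} K True} (f : Op.Hom (muOp.{v, w} K True) P.op) (n : ℕ) :
    (hA.taylor hRS (P := P) f).f n (-1) (mu K True n) =
      twistedEll P.op (fun n => f.f n (-1) (mu K True n)) n := by
  refine mem_kappaFree_ext (hA.taylor_mem hRS _ _) (series_mem _) fun k => ?_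
  change taylorCoeff _ _ _ k _ _ = _
  rw [if_pos trivial]
  refine (taylorCoeff_seq_zero (r := taylorFactor K True) (u := mu K True) (f := f)
    (fun n => nabla_mu_slot hA hst (slot_zero True n)) k rfl).trans ?_
  exact congrArg (· • _) (prod_taylorFactor_sym K k).symm

theorem twistAdjunction_counit_apply {R : Type v} [CommRing R] {S : Prop} {c : ℕ → R}
    {D : ∀ n : ℕ, (muOp.{v, w} R S).X n (-1 + -1)}
    {hD : ∀ (hS : S) (n : ℕ) (σ : Equiv.Perm (Fin n)), (muOp R S).act hS σ (D n) = D n}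
    (hA : IsCurv (muQuad D hD)) (hRS : S → ∀ n : ℕ, IsUnit ((n + 1 : ℕ) : R))
    (hst : ∀ n, D n = stash (muOp.{v, w} R S) (mu R S) n)
    (hc : ∀ k, c k = ∏ j ∈ Finset.range k, taylorFactor R S j)
    (hI : Limits.IsInitial (⟨muQuad D hD, hA⟩ : Curv.{v, max v w} R S))
    (hR : ∀ Y, IsCurv ((twistFunctor c (muBase hA) (mu R S)).obj Y)) (Y : Under (muBase hA))
    {n : ℕ} {i : ℤ} (x : (compl (withT Y.right.obj.op)).X n i) :
    DGOp.ev ((twistAdjunction hA hRS hst hc hI hR).counit.app Y).right x =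
      epsilon Y.right.obj.op x := by
  rw [twistAdjunction_counit]
  rfl

end TwistedOperations
end
end TwistOperad

theorem corollary1p7 :
    (∃ (h : IsCurv (cAinf.{0, w} ℤ))
      (hI : Limits.IsInitial
        (⟨cAinf.{0, w} ℤ, h⟩ : Curv.{0, w} ℤ False))
      (hR : ∀ P, IsCurv ((twistFunctor (fun _ => 1)
        ((Curv.forget ℤ False).obj ⟨cAinf.{0, w} ℤ, h⟩)
        (mu ℤ False)).obj P))
      (adj : leftFunctor hI ⊣ ObjectProperty.lift _ (twistFunctor
        (fun _ => 1) ((Curv.forget ℤ False).obj ⟨cAinf.{0, w} ℤ, h⟩)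
        (mu ℤ False)) hR),
      (∀ (P : Under ((Curv.forget ℤ False).obj ⟨cAinf.{0, w} ℤ, h⟩))
        (n : ℕ) (i : ℤ) (x : (compl (withT P.right.obj.op)).X n i),
        DGOp.ev (adj.counit.app P).right x =
          epsilon P.right.obj.op x) ∧
      DGOp.ev ((Curv.forget ℤ False).map
          (adj.unit.app ⟨cAinf.{0, w} ℤ, h⟩)) (mu ℤ False 0) =
        twistedKappa (fun _ => 1) (muOp ℤ False)
          (mu ℤ False) ∧
      ∀ n : ℕ, 1 ≤ n →
        DGOp.ev ((Curv.forget ℤ False).map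
            (adj.unit.app ⟨cAinf.{0, w} ℤ, h⟩)) (mu ℤ False n) =
          twistedMu (muOp ℤ False) (mu ℤ False) n) ∧
    ∀ (K : Type v) [Field K] [CharZero K],
      ∃ (h : IsCurv (cLinf.{v, w} K))
        (hI : Limits.IsInitial
          (⟨cLinf.{v, w} K, h⟩ : Curv.{v, max v w} K True))
        (hR : ∀ P, IsCurv ((twistFunctor
          (fun k => 1 / (k.factorial : K))
          ((Curv.forget K True).obj ⟨cLinf.{v, w} K, h⟩)
          (mu K True)).obj P))
        (adj : leftFunctor hI ⊣ ObjectProperty.lift _ (twistFunctor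
          (fun k => 1 / (k.factorial : K))
          ((Curv.forget K True).obj ⟨cLinf.{v, w} K, h⟩)
          (mu K True)) hR),
        (∀ (P : Under ((Curv.forget K True).obj ⟨cLinf.{v, w} K, h⟩))
          (n : ℕ) (i : ℤ) (x : (compl (withT P.right.obj.op)).X n i),
          DGOp.ev (adj.counit.app P).right x =
            epsilon P.right.obj.op x) ∧
        DGOp.ev ((Curv.forget K True).map
            (adj.unit.app ⟨cLinf.{v, w} K, h⟩)) (mu K True 0) =
          twistedKappa (fun k => 1 / (k.factorial : K)) (muOp K True)
            (mu K True) ∧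
        ∀ n : ℕ, 1 ≤ n →
          DGOp.ev ((Curv.forget K True).map
              (adj.unit.app ⟨cLinf.{v, w} K, h⟩)) (mu K True n) =
            twistedEll (muOp K True) (mu K True) n := by
  refine ⟨?_, fun K _ _ => ?_⟩
  · have hA : IsCurv (cAinf.{0, w} ℤ) := isCurv_muQuad dMu_eq_stash False.elim
    have hI := muQuadIsInitial hA dMu_eq_stash
    have hR := isCurv_twistFunctor hA False.elim dMu_eq_stash (c := fun _ => 1)
      (prod_taylorFactor_ns not_false)
    refine ⟨hA, hI, hR, twistAdjunction hA False.elim dMu_eq_stash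
      (prod_taylorFactor_ns not_false) hI hR, fun P n i x => ?_, ?_, fun n hn => ?_⟩
    · exact twistAdjunction_counit_apply hA _ _ _ hI hR P x
    · exact twistAdjunction_unit_zero hA _ _ _ hI hR
    · obtain ⟨n, rfl⟩ := Nat.exists_eq_add_of_le' hn
      refine (twistAdjunction_unit_succ hA _ _ _ hI hR n).trans
        ((taylor_mu_ns hA False.elim dMu_eq_stash _ _).trans ?_)
      exact congrArg (fun m => twistedMu (muOp ℤ False) m (n + 1))
        (funext fun n => initial_apply hA hI n)
  · have hA : IsCurv (cLinf.{v, w} K) := isCurv_muQuad dEll_eq_stash fun _ => isUnit_cast_succ K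
    have hI := muQuadIsInitial hA dEll_eq_stash
    have hR := isCurv_twistFunctor hA (fun _ => isUnit_cast_succ K) dEll_eq_stash
      (prod_taylorFactor_sym K)
    refine ⟨hA, hI, hR, twistAdjunction hA (fun _ => isUnit_cast_succ K) dEll_eq_stash
      (prod_taylorFactor_sym K) hI hR, fun P n i x => ?_, ?_, fun n hn => ?_⟩
    · exact twistAdjunction_counit_apply hA _ _ _ hI hR P x
    · exact twistAdjunction_unit_zero hA _ _ _ hI hR
    · obtain ⟨n, rfl⟩ := Nat.exists_eq_add_of_le' hn
      refine (twistAdjunction_unit_succ hA _ _ _ hI hR n).trans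
        ((taylor_mu_sym hA (fun _ => isUnit_cast_succ K) dEll_eq_stash _ _).trans ?_)
      exact congrArg (fun m => twistedEll (muOp K True) m (n + 1))
        (funext fun n => initial_apply hA hI n)
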